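/- **Setting.** Let $X$ be a (Hausdorff, second countable) smooth manifold, $\mathbb TX=TX\oplus T^*X$ with pairing $\langle(\xi,a),(\eta,b)\rangle=\tfrac12(b(\xi)+a(\eta))$, Dorfman bracket $[\![(\xi,a),(\eta,b)]\!]=([\xi,\eta],L_\xi b-\iota_\eta da)$ and projection $\pi:\mathbb TX\to TX$. Let $\mathbb J$ be a generalized complex structure on $X$, i.e. a smooth orthogonal endomorphism of $\mathbb TX$ with $\mathbb J^2=-1$ whose $+i$-eigenbundle $L\subset\mathbb TX\otimes\mathbb C$ is involutive. For $U\subset X$ open let $\mathcal T(U)$ be the space of $x\in C^\infty(\mathbb TU)$ with $\delta_L\mu(x)=0$, where $\mu(x)=2\langle x,\cdot\rangle|_L$ and $\delta_L\alpha(s,t)=\pi(s)\alpha(t)-\pi(t)\alpha(s)-\alpha([\![s,t]\!])$, and let $\mathcal H(X)\subset\mathcal T(X)$ be the space of elements $\mathbb J(0,df_R)+(0,df_I)$ with $f_R,f_I\in C^\infty(X)$. A *brane* $\mathcal B$ on $(X,\mathbb J)$ is a closed embedded submanifold $i:Z\hookrightarrow X$ together with a Hermitian line bundle with unitary connection on $Z$,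 given by an open cover $\{W_I\}$ of $Z$, functions $c_{IJ}\in C^\infty(W_{IJ})$ with $c_{JK}-c_{IK}+c_{IJ}\in\mathbb Z$, and 1-forms $a_I\in\Omega^1(W_I)$ with $a_J-a_I=dc_{IJ}$, such that $\mathbb J$ preserves $\mathbb T(Z,F)=\{(i_*v,\alpha): i^*\alpha=\iota_vF\}\subset\mathbb TX|_Z$, where $F|_{W_I}=da_I$. Let $l\subset\mathbb T(Z,F)\otimes\mathbb C$ be the $+i$-eigenbundle of $\mathbb J$, a complex Lie algebroid over $Z$ with the bracket induced from $L$, with differential $\delta_l$ on $C^\infty(\Lambda^\bullet l^\vee)$ and cohomology $H^\bullet(\mathcal B)$. Let $q:\mathbb TX|_Z\to\mathcal N=\mathbb TX|_Z/\mathbb T(Z,F)$ be the generalized normal bundle, $r$ the restriction of sections of $\mathbb TX$ to $Z$, and $\mu:\mathcal N\to l^\vee$, $\mu(q(x))(v)=\langle x,v\rangle$. **Deformations.** Let $U\subset X$ be open and $A$ a local Artinian $\mathbb R$-algebra with maximal ideal $\mathfrak m$ and residue field $\mathbb R$; let $\rho$ be the pullback of forms from $U$ to $Z\cap U$. An *$A$-deformation*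 of $\mathcal B|_U$ consists of a map $\hat\rho=\rho e^\xi$ with $\xi\in\mathfrak m\otimes C^\infty(TU)$ and of $\hat c_{IJ}=c_{IJ}+f_{IJ}$, $\hat a_I=a_I+u_I$, where $f_{IJ}$ and $u_I$ are functions on $U\cap W_{IJ}$ and 1-forms on $U\cap W_I$ with coefficients in $\mathfrak m$, $u_J-u_I=df_{IJ}$ and $f_{JK}-f_{IK}+f_{IJ}=0$. It is *compatible* with $\mathbb J$ if, for each $I$, on some open $\tilde W\subset U$ with $Z\cap\tilde W=U\cap W_I$ and for some $\tilde u\in\mathfrak m\otimes\Omega^1(\tilde W)$ with $\rho\tilde u=u_I$, the element $g=e^{(0,\tilde u)}e^{(\xi,0)}$ satisfies $\langle g\mathbb Jg^{-1}x,y\rangle|_Z=0$ for all $x,y\in A\otimes K(\tilde W)$, where $K(\tilde W)$ is the space of sections of $\mathbb T\tilde W$ whose restriction to $Z$ lies in $\mathbb T(Z,F)$. Deformations $(\hat\rho,\hat c,\hat a)$ and $(\hat\rho',\hat c',\hat a')$ are *isomorphic* if there are $\tau\in\mathfrak m\otimes C^\infty(T(Z\cap U))$ and $g_I\in\mathfrak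 m\otimes C^\infty(U\cap W_I)$ with $\hat\rho'=e^\tau\hat\rho$, $e^\tau\hat a_I=\hat a'_I+dg_I$ and $e^\tau\hat c_{IJ}=\hat c'_{IJ}+g_J-g_I$. For $x\in\mathfrak m\otimes\mathcal T(U)$ with $e^x=e^{(0,w)}e^{(\xi,0)}$ let $\mathcal B\cdot e^x=(\rho e^\xi,c_{IJ},a_I+\rho w)$. We say that $\mathcal B|_U$ has *trivializable deformations* if, for every $A$, each compatible $A$-deformation of $\mathcal B|_U$ is isomorphic to $\mathcal B\cdot e^x$ for some $x\in\mathfrak m\otimes\mathcal T(U)$, and that $\mathcal B$ has *locally trivializable deformations* if each $z\in Z$ has an open neighbourhood $U\subset X$ such that $\mathcal B|_U$ has trivializable deformations. **The complex.** For $U\subset X$ open let $\mathcal K(U)$ be the space of pairs $(x,(\tau,f))$ with $x=(\xi,w)\in\mathcal T(U)$, $\tau\in C^\infty(T(Z\cap U))$, $f\in C^\infty(Z\cap U)$, $\xi|_Z=i_*\tau$ and $i^*w=\iota_\tau F-df$, and put $\chi(x,(\tau,f))=x$. For an open cover $\mathcal U=\{U_\alpha\}$ of $X$ let $C$ be the total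 complex of $V_{\mathcal B,\mathcal U}$, whose row $0$ is $\mathcal H(X)\oplus\prod\mathcal K(U_{\alpha_0\cdots\alpha_p})$ (identity maps on $\mathcal H(X)$, Čech coface maps on $\mathcal K$), whose row $1$ is $\prod\mathcal T(U_{\alpha_0\cdots\alpha_p})$ (Čech coface maps), whose other rows vanish, and whose vertical coface maps are $(z,y)\mapsto z|_{U_{\alpha_0\cdots\alpha_p}}$ and $(z,y)\mapsto\chi(y)$. Thus $C^n=\prod\mathcal T(U_{\alpha_0\cdots\alpha_{n-1}})\oplus\prod\mathcal K(U_{\alpha_0\cdots\alpha_n})\oplus\mathcal H(X)$ for $n\ge1$. **Theorem.** Let $\mathcal B$ be a brane with locally trivializable deformations. Then $X$ has an open cover $\mathcal U=\{U_\alpha\}$ such that each $\mathcal B|_{U_\alpha}$ has trivializable deformations, and for every such cover there is an injective ($\mathbb R$-)linear map $$\Phi: H^2(C)\hookrightarrow H^2(\mathcal B),$$ given as follows. Every class in $H^2(C)$ is represented by a cocycle $c=(\{x_{\alpha\beta}\},\{y_{\alpha\beta\gamma}\},z)$ with $z=0$ and $y_{\alpha\beta\gamma}$ having vanishing component in $C^\infty(Z\cap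 U_{\alpha\beta\gamma})$, for which there are sections $\sigma_\alpha$ of $\mathcal N$ over $Z\cap U_\alpha$ with $\sigma_\beta-\sigma_\alpha=q(r(x_{\alpha\beta}))$ on $Z\cap U_{\alpha\beta}$ and a closed $\zeta\in C^\infty(\Lambda^2l^\vee)$ with $\zeta|_{Z\cap U_\alpha}=\delta_l\mu(\sigma_\alpha)$; and $\Phi([c])=[\zeta]$ for all such $c$, $\sigma_\alpha$, $\zeta$. -/

import Mathlib

open scoped Manifold ContDiff Topology TensorProduct
open TopologicalSpace Bundle

set_option linter.unusedSectionVars false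
set_option maxSynthPendingDepth 3

noncomputable section

namespace GCB

section Fields
variable (E' E : Type*) [NormedAddCommGroup E] [NormedSpace ℝ E] [FiniteDimensional ℝ E]
  {M : Type*} [TopologicalSpace M] [ChartedSpace E M] [IsManifold 𝓘(ℝ, E) ∞ M]
  [NormedAddCommGroup E'] [NormedSpace ℝ E'] [FiniteDimensional ℝ E']
  {N : Type*} [TopologicalSpace N] [ChartedSpace E' N] [IsManifold 𝓘(ℝ, E') ∞ N]

/-- The vector field `ξ` along the map `f` is smooth on `s`. -/
def SmoothVec (f : N → M) (ξ : ∀ y, TangentSpace 𝓘(ℝ, E) (f y)) (s : Set N) : Prop :=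
  ContMDiffOn 𝓘(ℝ, E') 𝓘(ℝ, E).tangent ∞ (fun y => (⟨f y, ξ y⟩ : TangentBundle 𝓘(ℝ, E) M)) s

/-- The 1-form `a` along the map `f` is smooth on `s`. -/
def SmoothForm (f : N → M) (a : ∀ y, TangentSpace 𝓘(ℝ, E) (f y) →L[ℝ] ℝ) (s : Set N) : Prop :=
  ContMDiffOn 𝓘(ℝ, E') (𝓘(ℝ, E).prod 𝓘(ℝ, E →L[ℝ] ℝ)) ∞
    (fun y => TotalSpace.mk' (E →L[ℝ] ℝ)
      (E := fun x : M => TangentSpace 𝓘(ℝ, E) x →L[ℝ] Trivial M ℝ x) (f y) (a y)) s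

variable {E' E}

theorem SmoothForm.apply {f : N → M} {a : ∀ y, TangentSpace 𝓘(ℝ, E) (f y) →L[ℝ] ℝ}
    {ξ : ∀ y, TangentSpace 𝓘(ℝ, E) (f y)} {s : Set N}
    (ha : SmoothForm E' E f a s) (hξ : SmoothVec E' E f ξ s) :
    ContMDiffOn 𝓘(ℝ, E') 𝓘(ℝ) ∞ (fun y => a y (ξ y)) s := by
  intro y hy
  have h := ContMDiffWithinAt.clm_bundle_apply (E₁ := (TangentSpace 𝓘(ℝ, E) : M → Type _))
    (E₂ := Trivial M ℝ) (b := f) (ϕ := a) (v := ξ) (ha y hy) (hξ y hy)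
  exact (contMDiffWithinAt_totalSpace.1 h).2

theorem smoothForm_of_apply {f : N → M} {a : ∀ y, TangentSpace 𝓘(ℝ, E) (f y) →L[ℝ] ℝ} {s : Set N}
    (hf : ContMDiffOn 𝓘(ℝ, E') 𝓘(ℝ, E) ∞ f s)
    (H : ∀ V : Set M, IsOpen V → ∀ ξ : ∀ x : M, TangentSpace 𝓘(ℝ, E) x,
      SmoothVec E E (fun x => x) ξ V →
      ContMDiffOn 𝓘(ℝ, E') 𝓘(ℝ) ∞ (fun y => a y (ξ (f y))) (s ∩ f ⁻¹' V)) :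
    SmoothForm E' E f a s := by
  intro y hy
  rw [contMDiffWithinAt_hom_bundle]
  refine ⟨hf y hy, ?_⟩
  set t := trivializationAt E (TangentSpace 𝓘(ℝ, E) : M → Type _) (f y) with ht
  have hy' := FiberBundle.mem_baseSet_trivializationAt' (F := E)
    (E := (TangentSpace 𝓘(ℝ, E) : M → Type _)) (f y)
  have hnh : f ⁻¹' t.baseSet ∈ 𝓝[s] y :=
    (hf y hy).continuousWithinAt.preimage_mem_nhdsWithin (t.open_baseSet.mem_nhds hy')
  have key : ∀ e : E, ContMDiffWithinAt 𝓘(ℝ, E') 𝓘(ℝ) ∞ (fun z => a z (t.symm (f z) e)) s y := by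
    intro e
    have h1 := H t.baseSet t.open_baseSet (fun x => t.symm x e) ?_ y ⟨hy, hy'⟩
    · exact h1.mono_of_mem_nhdsWithin (Filter.inter_mem self_mem_nhdsWithin hnh)
    · intro x hx
      rw [(t.contMDiffWithinAt_section _ hx)]
      refine (contMDiffWithinAt_const (c := e)).congr_of_mem (fun z hz => ?_) hx
      rw [t.apply_mk_symm hz]
  have h2 : ContMDiffWithinAt 𝓘(ℝ, E') 𝓘(ℝ, E →L[ℝ] ℝ) ∞ (fun z => ∑ i,
      a z (t.symm (f z) (Module.finBasis ℝ E i)) •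
        LinearMap.toContinuousLinearMap ((Module.finBasis ℝ E).coord i)) s y :=
    ContMDiffWithinAt.sum (fun i _ => (key _).smul contMDiffWithinAt_const)
  refine h2.congr_of_eventuallyEq_of_mem ?_ hy
  filter_upwards [hnh] with z hz
  ext e
  have e1 : ContinuousLinearMap.inCoordinates E (TangentSpace 𝓘(ℝ, E) : M → Type _) ℝ (Trivial M ℝ)
      (f y) (f z) (f y) (f z) (a z) e = a z (t.symm (f z) e) := by
    rw [ContinuousLinearMap.inCoordinates_eq hz (by simp)]
    simp [ht]
  rw [e1]
  have e3 : ∀ e', a z (t.symm (f z) e') = ((a z).comp (t.symmL ℝ (f z))) e' := fun e' => by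
    rw [ContinuousLinearMap.comp_apply, t.symmL_apply hz]
  rw [e3 e]
  have e4 := congrArg ((a z).comp (t.symmL ℝ (f z))) ((Module.finBasis ℝ E).sum_repr e).symm
  rw [map_sum] at e4
  rw [e4]
  simp [e3, mul_comm]

theorem SmoothVec.base {f : N → M} {ξ : ∀ y, TangentSpace 𝓘(ℝ, E) (f y)} {s : Set N}
    (h : SmoothVec E' E f ξ s) : ContMDiffOn 𝓘(ℝ, E') 𝓘(ℝ, E) ∞ f s :=
  fun y hy => (contMDiffWithinAt_totalSpace.1 (h y hy)).1

theorem SmoothVec.add {f : N → M} {ξ η : ∀ y, TangentSpace 𝓘(ℝ, E) (f y)} {s : Set N}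
    (h : SmoothVec E' E f ξ s) (h' : SmoothVec E' E f η s) :
    SmoothVec E' E f (fun y => ξ y + η y) s := by
  intro y hy
  have h1 := contMDiffWithinAt_totalSpace.1 (h y hy)
  have h2 := contMDiffWithinAt_totalSpace.1 (h' y hy)
  refine contMDiffWithinAt_totalSpace.2 ⟨h1.1, (h1.2.add h2.2).congr_of_eventuallyEq_of_mem ?_ hy⟩
  filter_upwards [h1.1.continuousWithinAt.preimage_mem_nhdsWithin
    ((trivializationAt E (TangentSpace 𝓘(ℝ, E) : M → Type _) (f y)).open_baseSet.mem_nhds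
      (FiberBundle.mem_baseSet_trivializationAt' (f y)))] with z hz
  exact ((trivializationAt E (TangentSpace 𝓘(ℝ, E) : M → Type _) (f y)).linear ℝ hz).map_add _ _

theorem SmoothVec.smul {f : N → M} {g : N → ℝ} {ξ : ∀ y, TangentSpace 𝓘(ℝ, E) (f y)} {s : Set N}
    (hg : ContMDiffOn 𝓘(ℝ, E') 𝓘(ℝ) ∞ g s) (h : SmoothVec E' E f ξ s) :
    SmoothVec E' E f (fun y => g y • ξ y) s := by
  intro y hy
  have h1 := contMDiffWithinAt_totalSpace.1 (h y hy)
  refine contMDiffWithinAt_totalSpace.2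
    ⟨h1.1, ((hg y hy).smul h1.2).congr_of_eventuallyEq_of_mem ?_ hy⟩
  filter_upwards [h1.1.continuousWithinAt.preimage_mem_nhdsWithin
    ((trivializationAt E (TangentSpace 𝓘(ℝ, E) : M → Type _) (f y)).open_baseSet.mem_nhds
      (FiberBundle.mem_baseSet_trivializationAt' (f y)))] with z hz
  exact ((trivializationAt E (TangentSpace 𝓘(ℝ, E) : M → Type _) (f y)).linear ℝ hz).map_smul _ _

theorem smoothVec_zero {f : N → M} {s : Set N} (hf : ContMDiffOn 𝓘(ℝ, E') 𝓘(ℝ, E) ∞ f s) :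
    SmoothVec E' E f (fun y => (0 : TangentSpace 𝓘(ℝ, E) (f y))) s := by
  intro y hy
  refine contMDiffWithinAt_totalSpace.2
    ⟨hf y hy, (contMDiffWithinAt_const (c := (0 : E))).congr_of_eventuallyEq_of_mem ?_ hy⟩
  filter_upwards [(hf y hy).continuousWithinAt.preimage_mem_nhdsWithin
    ((trivializationAt E (TangentSpace 𝓘(ℝ, E) : M → Type _) (f y)).open_baseSet.mem_nhds
      (FiberBundle.mem_baseSet_trivializationAt' (f y)))] with z hz
  exact ((trivializationAt E (TangentSpace 𝓘(ℝ, E) : M → Type _) (f y)).linear ℝ hz).map_zero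

theorem SmoothForm.base {f : N → M} {a : ∀ y, TangentSpace 𝓘(ℝ, E) (f y) →L[ℝ] ℝ} {s : Set N}
    (h : SmoothForm E' E f a s) : ContMDiffOn 𝓘(ℝ, E') 𝓘(ℝ, E) ∞ f s :=
  fun y hy => (contMDiffWithinAt_totalSpace.1 (h y hy)).1

/-- A smooth field on `M` composed with a smooth map is smooth along the map. -/
theorem SmoothVec.comp {f : N → M} {ξ : ∀ x : M, TangentSpace 𝓘(ℝ, E) x} {s : Set N} {V : Set M}
    (hξ : SmoothVec E E (fun x => x) ξ V) (hf : ContMDiffOn 𝓘(ℝ, E') 𝓘(ℝ, E) ∞ f s)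
    (hs : Set.MapsTo f s V) : SmoothVec E' E f (fun y => ξ (f y)) s :=
  ContMDiffOn.comp (g := fun x => (⟨x, ξ x⟩ : TangentBundle 𝓘(ℝ, E) M)) hξ hf hs

theorem SmoothForm.comp {f : N → M} {a : ∀ x : M, TangentSpace 𝓘(ℝ, E) x →L[ℝ] ℝ} {s : Set N}
    {V : Set M} (ha : SmoothForm E E (fun x => x) a V) (hf : ContMDiffOn 𝓘(ℝ, E') 𝓘(ℝ, E) ∞ f s)
    (hs : Set.MapsTo f s V) : SmoothForm E' E f (fun y => a (f y)) s :=
  ContMDiffOn.comp (g := fun x => TotalSpace.mk' (E →L[ℝ] ℝ)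
      (E := fun x : M => TangentSpace 𝓘(ℝ, E) x →L[ℝ] Trivial M ℝ x) x (a x)) ha hf hs

theorem smoothForm_zero {f : N → M} {s : Set N} (hf : ContMDiffOn 𝓘(ℝ, E') 𝓘(ℝ, E) ∞ f s) :
    SmoothForm E' E f (fun y => (0 : TangentSpace 𝓘(ℝ, E) (f y) →L[ℝ] ℝ)) s :=
  smoothForm_of_apply hf fun _ _ _ _ => contMDiffOn_const

theorem SmoothForm.add {f : N → M} {a b : ∀ y, TangentSpace 𝓘(ℝ, E) (f y) →L[ℝ] ℝ} {s : Set N}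
    (h : SmoothForm E' E f a s) (h' : SmoothForm E' E f b s) :
    SmoothForm E' E f (fun y => a y + b y) s := by
  refine smoothForm_of_apply h.base fun V hV ξ hξ => ?_
  have hc := hξ.comp (h.base.mono (Set.inter_subset_left (t := f ⁻¹' V))) (fun y hy => hy.2)
  have h1 := SmoothForm.apply (ContMDiffOn.mono h (Set.inter_subset_left (t := f ⁻¹' V))) hc
  have h2 := SmoothForm.apply (ContMDiffOn.mono h' (Set.inter_subset_left (t := f ⁻¹' V))) hc
  exact h1.add h2

theorem SmoothForm.smul {f : N → M} {g : N → ℝ} {a : ∀ y, TangentSpace 𝓘(ℝ, E) (f y) →L[ℝ] ℝ}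
    {s : Set N} (hg : ContMDiffOn 𝓘(ℝ, E') 𝓘(ℝ) ∞ g s) (h : SmoothForm E' E f a s) :
    SmoothForm E' E f (fun y => g y • a y) s := by
  refine smoothForm_of_apply h.base fun V hV ξ hξ => ?_
  have hc := hξ.comp (h.base.mono (Set.inter_subset_left (t := f ⁻¹' V))) (fun y hy => hy.2)
  have h1 := SmoothForm.apply (ContMDiffOn.mono h (Set.inter_subset_left (t := f ⁻¹' V))) hc
  exact (hg.mono Set.inter_subset_left).smul h1

end Fields

section ExtDeriv
variable {E : Type*} [NormedAddCommGroup E] [NormedSpace ℝ E] [FiniteDimensional ℝ E]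
  {M : Type*} [TopologicalSpace M] [ChartedSpace E M] [IsManifold 𝓘(ℝ, E) ∞ M]

/-- A shortcut instance: the cotangent spaces are additive groups. -/
instance cotGroup (x : M) : AddCommGroup (TangentSpace 𝓘(ℝ, E) x →L[ℝ] ℝ) := inferInstance

/-- `σ(a(τ)) - τ(a(σ)) - a([σ, τ])` at `x`. -/
def preExt (a : ∀ x : M, TangentSpace 𝓘(ℝ, E) x →L[ℝ] ℝ) (σ τ : ∀ x : M, TangentSpace 𝓘(ℝ, E) x)
    (x : M) : ℝ :=
  mvfderiv 𝓘(ℝ, E) (fun y => a y (τ y)) x (σ x) - mvfderiv 𝓘(ℝ, E) (fun y => a y (σ y)) x (τ x)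
    - a x (VectorField.mlieBracket 𝓘(ℝ, E) σ τ x)

theorem preExt_swap (a : ∀ x : M, TangentSpace 𝓘(ℝ, E) x →L[ℝ] ℝ)
    (σ τ : ∀ x : M, TangentSpace 𝓘(ℝ, E) x) (x : M) : preExt a σ τ x = - preExt a τ σ x := by
  unfold preExt
  rw [VectorField.mlieBracket_swap_apply, map_neg]
  ring

theorem SmoothForm.mdiff {a : ∀ x : M, TangentSpace 𝓘(ℝ, E) x →L[ℝ] ℝ} {U : Set M} (hU : IsOpen U)
    (ha : SmoothForm E E (fun x => x) a U) {x : M} (hx : x ∈ U)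
    {σ : ∀ x : M, TangentSpace 𝓘(ℝ, E) x}
    (hσ : MDifferentiableAt 𝓘(ℝ, E) 𝓘(ℝ, E).tangent
      (fun y => (⟨y, σ y⟩ : TangentBundle 𝓘(ℝ, E) M)) x) :
    MDifferentiableAt 𝓘(ℝ, E) 𝓘(ℝ) (fun y => a y (σ y)) x := by
  have h1 := (ContMDiffOn.contMDiffAt ha (hU.mem_nhds hx)).mdifferentiableAt (by simp)
  have h := MDifferentiableAt.clm_bundle_apply (E₁ := (TangentSpace 𝓘(ℝ, E) : M → Type _))
    (E₂ := Trivial M ℝ) (b := fun y => y) (ϕ := a) (v := σ) h1 hσ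
  exact (mdifferentiableAt_totalSpace 𝓘(ℝ, E) _ |>.1 h).2

theorem tensorialAt_preExt {a : ∀ x : M, TangentSpace 𝓘(ℝ, E) x →L[ℝ] ℝ} {U : Set M} (hU : IsOpen U)
    (ha : SmoothForm E E (fun x => x) a U) {x : M} (hx : x ∈ U)
    {τ : ∀ x : M, TangentSpace 𝓘(ℝ, E) x}
    (_ : MDifferentiableAt 𝓘(ℝ, E) 𝓘(ℝ, E).tangent
      (fun y => (⟨y, τ y⟩ : TangentBundle 𝓘(ℝ, E) M)) x) :
    TensorialAt 𝓘(ℝ, E) E (fun σ => preExt a σ τ x) x := by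
  constructor
  · intro f σ hf hσ
    unfold preExt
    rw [VectorField.mlieBracket_smul_left hf hσ]
    have h1 : mvfderiv 𝓘(ℝ, E) (fun y => a y ((f • σ) y)) x
       = (a x (σ x)) • mvfderiv 𝓘(ℝ, E) f x + f x • mvfderiv 𝓘(ℝ, E) (fun y => a y (σ y)) x := by
      have h2 : (fun y => a y ((f • σ) y)) = fun y => f y * a y (σ y) := by
        ext y; simp
      rw [h2, mvfderiv_fun_mul hf (ha.mdiff hU hx hσ)]
      ext v; simp; ring
    rw [h1]
    simp
    ring
  · intro σ σ' hσ hσ'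
    unfold preExt
    rw [VectorField.mlieBracket_add_left hσ hσ']
    have h1 : mvfderiv 𝓘(ℝ, E) (fun y => a y ((σ + σ') y)) x
       = mvfderiv 𝓘(ℝ, E) (fun y => a y (σ y)) x + mvfderiv 𝓘(ℝ, E) (fun y => a y (σ' y)) x := by
      have h2 : (fun y => a y ((σ + σ') y)) = fun y => a y (σ y) + a y (σ' y) := by
        ext y; simp
      rw [h2, mvfderiv_fun_add (ha.mdiff hU hx hσ) (ha.mdiff hU hx hσ')]
    rw [h1]
    simp
    ring

theorem tensorialAt_preExt' {a : ∀ x : M, TangentSpace 𝓘(ℝ, E) x →L[ℝ] ℝ} {U : Set M}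
    (hU : IsOpen U) (ha : SmoothForm E E (fun x => x) a U) {x : M} (hx : x ∈ U)
    {σ : ∀ x : M, TangentSpace 𝓘(ℝ, E) x}
    (hσ : MDifferentiableAt 𝓘(ℝ, E) 𝓘(ℝ, E).tangent
      (fun y => (⟨y, σ y⟩ : TangentBundle 𝓘(ℝ, E) M)) x) :
    TensorialAt 𝓘(ℝ, E) E (fun τ => preExt a σ τ x) x := by
  have h := tensorialAt_preExt hU ha hx hσ
  constructor
  · intro f τ hf hτ
    rw [preExt_swap, h.smul hf hτ, preExt_swap a σ]
    simp
  · intro τ τ' hτ hτ'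
    rw [preExt_swap, h.add hτ hτ', preExt_swap a σ τ, preExt_swap a σ τ']
    ring

variable (E) in
/-- Smooth functions on the open set `U`, stored as functions on `M` vanishing off `U`. -/
def Fn (U : Opens M) : Submodule ℝ (M → ℝ) where
  carrier := {f | (∀ x ∉ U, f x = 0) ∧ ContMDiffOn 𝓘(ℝ, E) 𝓘(ℝ) ∞ f U}
  zero_mem' := ⟨fun _ _ => rfl, contMDiffOn_const⟩
  add_mem' h h' := ⟨fun x hx => by simp [h.1 x hx, h'.1 x hx], h.2.add h'.2⟩
  smul_mem' c f h := ⟨fun x hx => by simp [h.1 x hx], by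
    have h2 : ContMDiffOn 𝓘(ℝ, E) 𝓘(ℝ) ∞ f U := h.2
    exact (contMDiffOn_const :
      ContMDiffOn 𝓘(ℝ, E) 𝓘(ℝ) ∞ (fun _ : M => c) (U : Set M)).smul h2⟩

variable (E) in
/-- Smooth vector fields on the open set `U`, stored as vector fields on `M` vanishing off `U`. -/
def Vec (U : Opens M) : Submodule ℝ (∀ x : M, TangentSpace 𝓘(ℝ, E) x) where
  carrier := {ξ | (∀ x ∉ U, ξ x = 0) ∧ SmoothVec E E (fun x => x) ξ U}
  zero_mem' := ⟨fun _ _ => rfl, smoothVec_zero contMDiffOn_id⟩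
  add_mem' h h' := ⟨fun x hx => by simp [h.1 x hx, h'.1 x hx], h.2.add h'.2⟩
  smul_mem' c f h := ⟨fun x hx => by simp [h.1 x hx], SmoothVec.smul (g := fun _ => c) contMDiffOn_const h.2⟩

variable (E) in
/-- Smooth 1-forms on the open set `U`, stored as 1-forms on `M` vanishing off `U`. -/
def Form (U : Opens M) : Submodule ℝ (∀ x : M, TangentSpace 𝓘(ℝ, E) x →L[ℝ] ℝ) where
  carrier := {a | (∀ x ∉ U, a x = 0) ∧ SmoothForm E E (fun x => x) a U}
  zero_mem' := ⟨fun _ _ => rfl, smoothForm_zero contMDiffOn_id⟩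
  add_mem' h h' := ⟨fun x hx => by simp [h.1 x hx, h'.1 x hx], h.2.add h'.2⟩
  smul_mem' c f h := ⟨fun x hx => by simp [h.1 x hx], SmoothForm.smul (g := fun _ => c) contMDiffOn_const h.2⟩

variable {U V W : Opens M}

theorem SmoothVec.push {E' : Type*} [NormedAddCommGroup E'] [NormedSpace ℝ E']
    [FiniteDimensional ℝ E'] {N : Type*} [TopologicalSpace N] [ChartedSpace E' N]
    [IsManifold 𝓘(ℝ, E') ∞ N] {f : N → M} {ξ : ∀ y : N, TangentSpace 𝓘(ℝ, E') y} {s : Set N}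
    (hs : IsOpen s) (hf : ContMDiffOn 𝓘(ℝ, E') 𝓘(ℝ, E) ∞ f s)
    (hξ : SmoothVec E' E' (fun y => y) ξ s) :
    SmoothVec E' E f (fun y => mfderiv 𝓘(ℝ, E') 𝓘(ℝ, E) f y (ξ y)) s := by
  have h1 := ContMDiffOn.contMDiffOn_tangentMapWithin (m := ∞) hf (by simp) hs.uniqueMDiffOn
  have h2 := h1.comp hξ (fun y hy => hy)
  refine ContMDiffOn.congr h2 fun y hy => ?_
  simp [tangentMapWithin, mfderivWithin_of_isOpen hs hy]

theorem SmoothVec.deriv {f : M → ℝ} {ξ : ∀ y : M, TangentSpace 𝓘(ℝ, E) y} {s : Set M}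
    (hs : IsOpen s) (hf : ContMDiffOn 𝓘(ℝ, E) 𝓘(ℝ) ∞ f s)
    (hξ : SmoothVec E E (fun y => y) ξ s) :
    ContMDiffOn 𝓘(ℝ, E) 𝓘(ℝ) ∞ (fun y => mvfderiv 𝓘(ℝ, E) f y (ξ y)) s :=
  (contMDiff_snd_tangentBundle_modelSpace ℝ 𝓘(ℝ)).comp_contMDiffOn
    (SmoothVec.push (E := ℝ) hs hf hξ)

theorem mvfderiv_const_smul' {f : M → ℝ} {x : M} (hf : MDifferentiableAt 𝓘(ℝ, E) 𝓘(ℝ) f x) (c : ℝ) :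
    mvfderiv 𝓘(ℝ, E) (c • f) x = c • mvfderiv 𝓘(ℝ, E) f x := by
  have := mvfderiv_mul (f := fun _ => c) (g := f) (x := x) (I := 𝓘(ℝ, E)) mdifferentiableAt_const hf
  rw [show c • f = (fun _ => c) * f from rfl, this]
  simp [mvfderiv_const]

theorem fn_smoothAt (f : Fn E U) {x : M} (hx : x ∈ U) :
    ContMDiffAt 𝓘(ℝ, E) 𝓘(ℝ) ∞ f.1 x := f.2.2.contMDiffAt (U.2.mem_nhds hx)

theorem fn_mdiffAt (f : Fn E U) {x : M} (hx : x ∈ U) :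
    MDifferentiableAt 𝓘(ℝ, E) 𝓘(ℝ) f.1 x := (fn_smoothAt f hx).mdifferentiableAt (by simp)

theorem vec_smoothAt (ξ : Vec E U) {x : M} (hx : x ∈ U) :
    ContMDiffAt 𝓘(ℝ, E) 𝓘(ℝ, E).tangent ∞ (fun y => (⟨y, ξ.1 y⟩ : TangentBundle 𝓘(ℝ, E) M)) x :=
  ContMDiffOn.contMDiffAt ξ.2.2 (U.2.mem_nhds hx)

theorem vec_mdiffAt (ξ : Vec E U) {x : M} (hx : x ∈ U) :
    MDifferentiableAt 𝓘(ℝ, E) 𝓘(ℝ, E).tangent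
      (fun y => (⟨y, ξ.1 y⟩ : TangentBundle 𝓘(ℝ, E) M)) x :=
  (vec_smoothAt ξ hx).mdifferentiableAt (by simp)

/-- The derivative `ξ(f)`. -/
def der : Vec E U →ₗ[ℝ] Fn E U →ₗ[ℝ] Fn E U :=
  LinearMap.mk₂ ℝ (fun ξ f => ⟨fun x => mvfderiv 𝓘(ℝ, E) f.1 x (ξ.1 x),
      fun x hx => by simp [ξ.2.1 x hx], ξ.2.2.deriv U.2 f.2.2⟩)
    (by
      intro ξ η f; ext x; simp)
    (by
      intro c ξ f; ext x; simp)
    (by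
      intro ξ f g; ext x
      by_cases hx : x ∈ U
      · simp [mvfderiv_add (fn_mdiffAt f hx) (fn_mdiffAt g hx)]
      · simp [ξ.2.1 x hx])
    (by
      intro c ξ f; ext x
      by_cases hx : x ∈ U
      · simp [mvfderiv_const_smul' (fn_mdiffAt f hx)]
      · simp [ξ.2.1 x hx])

theorem mlieBracket_eq_zero {ξ η : ∀ x : M, TangentSpace 𝓘(ℝ, E) x} {x : M} (h : ξ x = 0)
    (h' : η x = 0) : VectorField.mlieBracket 𝓘(ℝ, E) ξ η x = 0 := by
  rw [← VectorField.mlieBracketWithin_univ]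
  exact VectorField.mlieBracketWithin_eq_zero_of_eq_zero h h'

theorem SmoothVec.bracket {ξ η : ∀ x : M, TangentSpace 𝓘(ℝ, E) x} {s : Set M} (hs : IsOpen s)
    (hξ : SmoothVec E E (fun x => x) ξ s) (hη : SmoothVec E E (fun x => x) η s) :
    SmoothVec E E (fun x => x) (VectorField.mlieBracket 𝓘(ℝ, E) ξ η) s := by
  intro x hx
  have : IsManifold 𝓘(ℝ, E) ((((⊤ : ℕ∞) : WithTop ℕ∞)) + 1) M := by
    simpa using (inferInstance : IsManifold 𝓘(ℝ, E) ∞ M)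
  have : IsManifold 𝓘(ℝ, E) (minSmoothness ℝ 2) M := by
    simp only [minSmoothness_of_isRCLikeNormedField]
    exact IsManifold.of_le (n := ∞) (by norm_cast)
  exact (ContMDiffAt.mlieBracket_vectorField (m := ⊤) (n := ⊤)
    (ContMDiffOn.contMDiffAt hξ (hs.mem_nhds hx)) (ContMDiffOn.contMDiffAt hη (hs.mem_nhds hx))
    (by simp)).contMDiffWithinAt

/-- The Lie bracket of vector fields. -/
def lieVec : Vec E U →ₗ[ℝ] Vec E U →ₗ[ℝ] Vec E U :=
  LinearMap.mk₂ ℝ (fun ξ η => ⟨fun x => VectorField.mlieBracket 𝓘(ℝ, E) ξ.1 η.1 x,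
      fun x hx => mlieBracket_eq_zero (ξ.2.1 x hx) (η.2.1 x hx), ξ.2.2.bracket U.2 η.2.2⟩)
    (by
      intro ξ ξ' η; ext x
      by_cases hx : x ∈ U
      · exact VectorField.mlieBracket_add_left (vec_mdiffAt ξ hx) (vec_mdiffAt ξ' hx)
      · simp [mlieBracket_eq_zero, ξ.2.1 x hx, ξ'.2.1 x hx, η.2.1 x hx])
    (by
      intro c ξ η; ext x
      by_cases hx : x ∈ U
      · exact VectorField.mlieBracket_const_smul_left (vec_mdiffAt ξ hx)
      · simp [mlieBracket_eq_zero, ξ.2.1 x hx, η.2.1 x hx])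
    (by
      intro ξ η η'; ext x
      by_cases hx : x ∈ U
      · exact VectorField.mlieBracket_add_right (vec_mdiffAt η hx) (vec_mdiffAt η' hx)
      · simp [mlieBracket_eq_zero, ξ.2.1 x hx, η'.2.1 x hx, η.2.1 x hx])
    (by
      intro c ξ η; ext x
      by_cases hx : x ∈ U
      · exact VectorField.mlieBracket_const_smul_right (vec_mdiffAt η hx)
      · simp [mlieBracket_eq_zero, ξ.2.1 x hx, η.2.1 x hx])

/-- The contraction `a(ξ)`. -/
def contr : Form E U →ₗ[ℝ] Vec E U →ₗ[ℝ] Fn E U :=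
  LinearMap.mk₂ ℝ (fun a ξ => ⟨fun x => a.1 x (ξ.1 x),
      fun x hx => by simp [ξ.2.1 x hx], a.2.2.apply ξ.2.2⟩)
    (by intro a b ξ; ext x; simp)
    (by intro c a ξ; ext x; simp)
    (by intro a ξ η; ext x; simp)
    (by intro c a ξ; ext x; simp)

open Classical in
/-- The differential of a function. -/
def d0 : Fn E U →ₗ[ℝ] Form E U where
  toFun f := ⟨fun x => if x ∈ U then mvfderiv 𝓘(ℝ, E) f.1 x else 0, fun x hx => by simp [hx],
    smoothForm_of_apply contMDiffOn_id fun V hV ξ hξ => by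
      refine (SmoothVec.deriv (U.2.inter hV) (f.2.2.mono Set.inter_subset_left)
        (ContMDiffOn.mono hξ Set.inter_subset_right)).congr fun x hx => ?_
      simp [show x ∈ U from hx.1]⟩
  map_add' f g := by
    ext x : 2
    by_cases hx : x ∈ U
    · simp [hx, mvfderiv_add (fn_mdiffAt f hx) (fn_mdiffAt g hx)]
    · simp [hx]
  map_smul' c f := by
    ext x : 2
    by_cases hx : x ∈ U
    · simp [hx, mvfderiv_const_smul' (fn_mdiffAt f hx)]
    · simp [hx]

open Classical in
/-- The exterior derivative of a 1-form on `U`, as a bilinear form at every point; it satisfies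
`da(ξ, η) = ξ(a(η)) - η(a(ξ)) - a([ξ, η])`. -/
def extDer (a : Form E U) (x : M) :
    TangentSpace 𝓘(ℝ, E) x →L[ℝ] TangentSpace 𝓘(ℝ, E) x →L[ℝ] ℝ :=
  if hx : x ∈ U then
    TensorialAt.mkHom₂ (I := 𝓘(ℝ, E)) (F := E) (F' := E) (fun σ τ => preExt a.1 σ τ x) x
      (fun _ hτ => tensorialAt_preExt U.2 a.2.2 hx hτ)
      (fun _ hσ => tensorialAt_preExt' U.2 a.2.2 hx hσ)
  else 0

theorem extDer_apply (a : Form E U) {x : M} (hx : x ∈ U) {σ τ : ∀ x : M, TangentSpace 𝓘(ℝ, E) x}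
    (hσ : MDifferentiableAt 𝓘(ℝ, E) 𝓘(ℝ, E).tangent
      (fun y => (⟨y, σ y⟩ : TangentBundle 𝓘(ℝ, E) M)) x)
    (hτ : MDifferentiableAt 𝓘(ℝ, E) 𝓘(ℝ, E).tangent
      (fun y => (⟨y, τ y⟩ : TangentBundle 𝓘(ℝ, E) M)) x) :
    extDer a x (σ x) (τ x) = preExt a.1 σ τ x := by
  rw [extDer, dif_pos hx]
  exact TensorialAt.mkHom₂_apply _ _ hσ hτ

theorem extDer_of_notMem (a : Form E U) {x : M} (hx : x ∉ U) : extDer a x = 0 := dif_neg hx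

end ExtDeriv

section Dorfman
variable {E : Type*} [NormedAddCommGroup E] [NormedSpace ℝ E] [FiniteDimensional ℝ E]
  {M : Type*} [TopologicalSpace M] [ChartedSpace E M] [IsManifold 𝓘(ℝ, E) ∞ M]
  {U V W : Opens M}

theorem extDer_add (a b : Form E U) (x : M) (v w : TangentSpace 𝓘(ℝ, E) x) :
    extDer (a + b) x v w = extDer a x v w + extDer b x v w := by
  by_cases hx : x ∈ U
  · have hv := FiberBundle.mdifferentiableAt_extend 𝓘(ℝ, E) E
      (V := (TangentSpace 𝓘(ℝ, E) : M → Type _)) v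
    have hw := FiberBundle.mdifferentiableAt_extend 𝓘(ℝ, E) E
      (V := (TangentSpace 𝓘(ℝ, E) : M → Type _)) w
    have e := fun c : Form E U => extDer_apply c hx hv hw
    simp only [FiberBundle.extend_apply_self] at e
    simp only [e, preExt]
    have h1 := mvfderiv_fun_add (a.2.2.mdiff U.2 hx hv) (b.2.2.mdiff U.2 hx hv)
    have h2 := mvfderiv_fun_add (a.2.2.mdiff U.2 hx hw) (b.2.2.mdiff U.2 hx hw)
    simp only [Submodule.coe_add, Pi.add_apply, add_apply, h1, h2]
    ring
  · rw [extDer_of_notMem _ hx, extDer_of_notMem _ hx, extDer_of_notMem _ hx]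
    exact (add_zero (0 : ℝ)).symm

theorem extDer_smul (c : ℝ) (a : Form E U) (x : M) (v w : TangentSpace 𝓘(ℝ, E) x) :
    extDer (c • a) x v w = c * extDer a x v w := by
  by_cases hx : x ∈ U
  · have hv := FiberBundle.mdifferentiableAt_extend 𝓘(ℝ, E) E
      (V := (TangentSpace 𝓘(ℝ, E) : M → Type _)) v
    have hw := FiberBundle.mdifferentiableAt_extend 𝓘(ℝ, E) E
      (V := (TangentSpace 𝓘(ℝ, E) : M → Type _)) w
    have e := fun c : Form E U => extDer_apply c hx hv hw
    simp only [FiberBundle.extend_apply_self] at e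
    simp only [e, preExt]
    have h1 := mvfderiv_const_smul' (a.2.2.mdiff U.2 hx hv) c
    have h2 := mvfderiv_const_smul' (a.2.2.mdiff U.2 hx hw) c
    simp only [Pi.smul_def, smul_eq_mul] at h1 h2
    simp only [Submodule.coe_smul, Pi.smul_apply, smul_apply, smul_eq_mul, h1, h2]
    ring
  · rw [extDer_of_notMem _ hx, extDer_of_notMem _ hx]
    exact (mul_zero c).symm

theorem extDer_apply_zero (a : Form E U) {x : M} {v : TangentSpace 𝓘(ℝ, E) x} (hv : v = 0) :
    extDer a x v = 0 := by
  rw [hv]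
  exact (extDer a x).map_zero

/-- The contraction `da(ξ, ·)`. -/
def iotaD : Vec E U →ₗ[ℝ] Form E U →ₗ[ℝ] Form E U :=
  LinearMap.mk₂ ℝ (fun ξ a => ⟨fun x => extDer a x (ξ.1 x), fun x hx => extDer_apply_zero a (ξ.2.1 x hx),
      smoothForm_of_apply contMDiffOn_id fun V hV η hη => by
        have hξ : SmoothVec E E (fun x => x) ξ.1 (U ∩ V) := ContMDiffOn.mono ξ.2.2 Set.inter_subset_left
        have hη' : SmoothVec E E (fun x => x) η (U ∩ V) := ContMDiffOn.mono hη Set.inter_subset_right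
        have ha : SmoothForm E E (fun x => x) a.1 (U ∩ V) := ContMDiffOn.mono a.2.2 Set.inter_subset_left
        have ho : IsOpen ((U : Set M) ∩ V) := U.2.inter hV
        have h1 := SmoothVec.deriv ho (ha.apply hη') hξ
        have h2 := SmoothVec.deriv ho (ha.apply hξ) hη'
        have h3 := ha.apply (hξ.bracket ho hη')
        refine ((h1.sub h2).sub h3).congr fun x hx => ?_
        exact extDer_apply a hx.1 (vec_mdiffAt ξ hx.1)
          ((ContMDiffOn.contMDiffAt hη' (ho.mem_nhds hx)).mdifferentiableAt (by simp))⟩)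
    (fun ξ η a => Subtype.ext (funext fun x => (extDer a x).map_add (ξ.1 x) (η.1 x)))
    (fun c ξ a => Subtype.ext (funext fun x => (extDer a x).map_smul c (ξ.1 x)))
    (fun ξ a b => Subtype.ext (funext fun x =>
      ContinuousLinearMap.ext fun w => extDer_add a b x (ξ.1 x) w))
    (fun c ξ a => Subtype.ext (funext fun x =>
      ContinuousLinearMap.ext fun w => extDer_smul c a x (ξ.1 x) w))

/-- The Lie derivative of 1-forms. -/
def lieForm : Vec E U →ₗ[ℝ] Form E U →ₗ[ℝ] Form E U :=
  iotaD + (contr.flip).compr₂ d0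

/-- The fibre of `TM ⊕ T*M`. -/
def GT (E : Type*) [NormedAddCommGroup E] [NormedSpace ℝ E] {M : Type*} [TopologicalSpace M]
    [ChartedSpace E M] (x : M) : Type _ :=
  TangentSpace 𝓘(ℝ, E) x × (TangentSpace 𝓘(ℝ, E) x →L[ℝ] ℝ)

instance groupGT (x : M) : AddCommGroup (GT E x) :=
  inferInstanceAs (AddCommGroup (TangentSpace 𝓘(ℝ, E) x × (TangentSpace 𝓘(ℝ, E) x →L[ℝ] ℝ)))

instance moduleGT (x : M) : Module ℝ (GT E x) :=
  inferInstanceAs (Module ℝ (TangentSpace 𝓘(ℝ, E) x × (TangentSpace 𝓘(ℝ, E) x →L[ℝ] ℝ)))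

@[simp] theorem GT.fst_zero (x : M) : (0 : GT E x).1 = 0 := rfl
@[simp] theorem GT.snd_zero (x : M) : (0 : GT E x).2 = 0 := rfl
@[simp] theorem GT.fst_add {x : M} (s t : GT E x) : (s + t).1 = s.1 + t.1 := rfl
@[simp] theorem GT.snd_add {x : M} (s t : GT E x) : (s + t).2 = s.2 + t.2 := rfl
@[simp] theorem GT.fst_smul {x : M} (c : ℝ) (s : GT E x) : (c • s).1 = c • s.1 := rfl
@[simp] theorem GT.snd_smul {x : M} (c : ℝ) (s : GT E x) : (c • s).2 = c • s.2 := rfl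

/-- The projection `TM ⊕ T*M → TM`. -/
def GT.proj (x : M) : GT E x →ₗ[ℝ] TangentSpace 𝓘(ℝ, E) x :=
  LinearMap.fst ℝ (TangentSpace 𝓘(ℝ, E) x) (TangentSpace 𝓘(ℝ, E) x →L[ℝ] ℝ)

variable (E) in
/-- The pairing `⟨(v, a), (w, b)⟩ = (b(v) + a(w)) / 2`. -/
def pairFib (x : M) : GT E x →ₗ[ℝ] GT E x →ₗ[ℝ] ℝ :=
  LinearMap.mk₂ ℝ (fun s t => 2⁻¹ * (t.2 s.1 + s.2 t.1))
    (by intro s s' t; simp; ring) (by intro c s t; simp; ring)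
    (by intro s t t'; simp; ring) (by intro c s t; simp; ring)

variable (E) in
/-- Smooth sections of `TM ⊕ T*M` on `U`, stored as sections on `M` vanishing off `U`. -/
def Sec (U : Opens M) : Submodule ℝ (∀ x : M, GT E x) where
  carrier := {s | (fun x => (s x).1) ∈ Vec E U ∧ (fun x => (s x).2) ∈ Form E U}
  zero_mem' := ⟨(Vec E U).zero_mem, (Form E U).zero_mem⟩
  add_mem' h h' := ⟨(Vec E U).add_mem h.1 h'.1, (Form E U).add_mem h.2 h'.2⟩
  smul_mem' c _ h := ⟨(Vec E U).smul_mem c h.1, (Form E U).smul_mem c h.2⟩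

/-- The anchor `(ξ, a) ↦ ξ`. -/
def anc : Sec E U →ₗ[ℝ] Vec E U where
  toFun s := ⟨fun x => (s.1 x).1, s.2.1⟩
  map_add' _ _ := rfl
  map_smul' _ _ := rfl

/-- The projection `(ξ, a) ↦ a`. -/
def cot : Sec E U →ₗ[ℝ] Form E U where
  toFun s := ⟨fun x => (s.1 x).2, s.2.2⟩
  map_add' _ _ := rfl
  map_smul' _ _ := rfl

/-- The section `(ξ, 0)`. -/
def secVec : Vec E U →ₗ[ℝ] Sec E U where
  toFun ξ := ⟨fun x => (ξ.1 x, 0), ξ.2, (Form E U).zero_mem⟩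
  map_add' _ _ := Subtype.ext (funext fun _ => Prod.ext rfl (add_zero _).symm)
  map_smul' c _ := Subtype.ext (funext fun _ => Prod.ext rfl (smul_zero c).symm)

/-- The section `(0, a)`. -/
def secForm : Form E U →ₗ[ℝ] Sec E U where
  toFun a := ⟨fun x => (0, a.1 x), (Vec E U).zero_mem, a.2⟩
  map_add' _ _ := Subtype.ext (funext fun _ => Prod.ext (add_zero _).symm rfl)
  map_smul' c _ := Subtype.ext (funext fun _ => Prod.ext (smul_zero c).symm rfl)

/-- The pairing of sections. -/
def pair : Sec E U →ₗ[ℝ] Sec E U →ₗ[ℝ] Fn E U :=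
  LinearMap.mk₂ ℝ (fun s t => (2⁻¹ : ℝ) • (contr (cot t) (anc s) + contr (cot s) (anc t)))
    (by intro s s' t; simp only [map_add, LinearMap.add_apply, ← smul_add]; congr 1; abel)
    (by intro c s t; simp only [map_smul, LinearMap.smul_apply, ← smul_add, smul_comm c])
    (by intro s t t'; simp only [map_add, LinearMap.add_apply, ← smul_add]; congr 1; abel)
    (by intro c s t; simp only [map_smul, LinearMap.smul_apply, ← smul_add, smul_comm c])

/-- The Dorfman bracket `[[(ξ, a), (η, b)]] = ([ξ, η], L_ξ b - ι_η da)`. -/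
def dorf : Sec E U →ₗ[ℝ] Sec E U →ₗ[ℝ] Sec E U :=
  LinearMap.mk₂ ℝ (fun s t => secVec (lieVec (anc s) (anc t)) +
      (secForm (lieForm (anc s) (cot t)) - secForm (iotaD (anc t) (cot s))))
    (by intro s s' t; simp only [map_add, LinearMap.add_apply]; abel)
    (by intro c s t; simp only [map_smul, LinearMap.smul_apply]; module)
    (by intro s t t'; simp only [map_add, LinearMap.add_apply]; abel)
    (by intro c s t; simp only [map_smul, LinearMap.smul_apply]; module)

theorem pair_apply (s t : Sec E U) (x : M) : (pair s t).1 x = pairFib E x (s.1 x) (t.1 x) := rfl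

end Dorfman

section BaseChange
variable (A : Type*) [CommRing A] [Algebra ℝ A] {P Q R : Type*} [AddCommGroup P] [Module ℝ P]
  [AddCommGroup Q] [Module ℝ Q] [AddCommGroup R] [Module ℝ R]

/-- The `A`-bilinear extension `(a ⊗ p, b ⊗ q) ↦ ab ⊗ B(p, q)` of a bilinear map `B`. -/
def bcBil (B : P →ₗ[ℝ] Q →ₗ[ℝ] R) : A ⊗[ℝ] P →ₗ[A] A ⊗[ℝ] Q →ₗ[A] A ⊗[ℝ] R :=
  LinearMap.liftBaseChange A (LinearMap.baseChangeHom ℝ A Q R ∘ₗ B)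

theorem bcBil_tmul (B : P →ₗ[ℝ] Q →ₗ[ℝ] R) (a b : A) (p : P) (q : Q) :
    bcBil A B (a ⊗ₜ p) (b ⊗ₜ q) = (a * b) ⊗ₜ B p q := by
  simp [bcBil, TensorProduct.smul_tmul']

end BaseChange

section GC
variable {E : Type*} [NormedAddCommGroup E] [NormedSpace ℝ E] [FiniteDimensional ℝ E]
  {M : Type*} [TopologicalSpace M] [ChartedSpace E M] [IsManifold 𝓘(ℝ, E) ∞ M]
  {U V W : Opens M}

/-- Restriction of functions to a smaller open set. -/
def resFn (h : V ≤ U) : Fn E U →ₗ[ℝ] Fn E V where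
  toFun f := ⟨(V : Set M).indicator f.1, fun _ hx => Set.indicator_of_notMem hx _,
    (f.2.2.mono h).congr fun _ hx => Set.indicator_of_mem hx _⟩
  map_add' _ _ := Subtype.ext (Set.indicator_add _ _ _)
  map_smul' c f := Subtype.ext (Set.indicator_const_smul (V : Set M) c f.1)

open Classical in
/-- Restriction of vector fields to a smaller open set. -/
def resVec (h : V ≤ U) : Vec E U →ₗ[ℝ] Vec E V where
  toFun ξ := ⟨fun x => if x ∈ V then ξ.1 x else 0, fun x hx => if_neg hx,
    (ContMDiffOn.mono ξ.2.2 h).congr fun x hx => by simp [show x ∈ V from hx]⟩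
  map_add' ξ η := by ext x; by_cases hx : x ∈ V <;> simp [hx]
  map_smul' c ξ := by ext x; by_cases hx : x ∈ V <;> simp [hx]

open Classical in
/-- Restriction of 1-forms to a smaller open set. -/
def resForm (h : V ≤ U) : Form E U →ₗ[ℝ] Form E V where
  toFun a := ⟨fun x => if x ∈ V then a.1 x else 0, fun x hx => if_neg hx,
    (ContMDiffOn.mono a.2.2 h).congr fun x hx => by simp [show x ∈ V from hx]⟩
  map_add' ξ η := by ext x : 2; by_cases hx : x ∈ V <;> simp [hx]
  map_smul' c ξ := by ext x : 2; by_cases hx : x ∈ V <;> simp [hx]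

/-- Restriction of sections of `TM ⊕ T*M` to a smaller open set. -/
def resSec (h : V ≤ U) : Sec E U →ₗ[ℝ] Sec E V :=
  secVec ∘ₗ resVec h ∘ₗ anc + secForm ∘ₗ resForm h ∘ₗ cot

theorem resSec_apply (h : V ≤ U) (s : Sec E U) {x : M} (hx : x ∈ V) : (resSec h s).1 x = s.1 x := by
  refine Prod.ext ((add_zero _).trans (if_pos hx)) ((zero_add _).trans (if_pos hx))

theorem sec_apply_of_notMem (s : Sec E U) {x : M} (hx : x ∉ U) : s.1 x = 0 :=
  Prod.ext (s.2.1.1 x hx) (s.2.2.1 x hx)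

theorem sec_ext {s t : Sec E U} (h : ∀ x ∈ U, s.1 x = t.1 x) : s = t := by
  refine Subtype.ext (funext fun x => ?_)
  by_cases hx : x ∈ U
  · exact h x hx
  · rw [sec_apply_of_notMem s hx, sec_apply_of_notMem t hx]

theorem resSec_resSec (h : V ≤ U) (h' : W ≤ V) (s : Sec E U) :
    resSec h' (resSec h s) = resSec (h'.trans h) s :=
  sec_ext fun x hx => by rw [resSec_apply _ _ hx, resSec_apply _ _ (h' hx), resSec_apply _ _ hx]

/-- The `A`-bilinear extension of the Dorfman bracket. -/
def dorfA (A : Type*) [CommRing A] [Algebra ℝ A] :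
    A ⊗[ℝ] Sec E U →ₗ[A] A ⊗[ℝ] Sec E U →ₗ[A] A ⊗[ℝ] Sec E U :=
  bcBil A (P := Sec E U) (Q := Sec E U) (R := Sec E U) dorf

/-- The `A`-bilinear extension of the pairing. -/
def pairA (A : Type*) [CommRing A] [Algebra ℝ A] :
    A ⊗[ℝ] Sec E U →ₗ[A] A ⊗[ℝ] Sec E U →ₗ[A] A ⊗[ℝ] Fn E U :=
  bcBil A (P := Sec E U) (Q := Sec E U) (R := Fn E U) pair

/-- The `A`-bilinear extension of the derivative of functions along vector fields. -/
def derA (A : Type*) [CommRing A] [Algebra ℝ A] :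
    A ⊗[ℝ] Vec E U →ₗ[A] A ⊗[ℝ] Fn E U →ₗ[A] A ⊗[ℝ] Fn E U :=
  bcBil A (P := Vec E U) (Q := Fn E U) (R := Fn E U) der

/-- The `A`-bilinear extension of the Lie derivative of 1-forms. -/
def lieFormA (A : Type*) [CommRing A] [Algebra ℝ A] :
    A ⊗[ℝ] Vec E U →ₗ[A] A ⊗[ℝ] Form E U →ₗ[A] A ⊗[ℝ] Form E U :=
  bcBil A (P := Vec E U) (Q := Form E U) (R := Form E U) lieForm

/-- The `A`-linear extension of the anchor. -/
def ancA (A : Type*) [CommRing A] [Algebra ℝ A] : A ⊗[ℝ] Sec E U →ₗ[A] A ⊗[ℝ] Vec E U :=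
  LinearMap.baseChange A (M := Sec E U) (N := Vec E U) anc

/-- The `A`-linear extension of the projection to 1-forms. -/
def cotA (A : Type*) [CommRing A] [Algebra ℝ A] : A ⊗[ℝ] Sec E U →ₗ[A] A ⊗[ℝ] Form E U :=
  LinearMap.baseChange A (M := Sec E U) (N := Form E U) cot

/-- `2(δ_L⟨x, ·⟩)(s, t) = 2 (π(s)⟨x, t⟩ - π(t)⟨x, s⟩ - ⟨x, [[s, t]]⟩)`, which is `(δ_L μ(x))(s, t)`
for `s, t ∈ Γ(L)`. -/
def deltaMu (U : Opens M) (s t : ℂ ⊗[ℝ] Sec E U) : Sec E U →ₗ[ℝ] ℂ ⊗[ℝ] Fn E U where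
  toFun x := (2 : ℂ) • (derA ℂ (ancA ℂ s) (pairA ℂ (1 ⊗ₜ x) t)
    - derA ℂ (ancA ℂ t) (pairA ℂ (1 ⊗ₜ x) s) - pairA ℂ (1 ⊗ₜ x) (dorfA ℂ s t))
  map_add' x y := by
    simp only [TensorProduct.tmul_add, map_add, LinearMap.add_apply, ← smul_add]
    congr 1; abel
  map_smul' c x := by
    simp only [TensorProduct.tmul_smul, LinearMap.map_smul_of_tower, LinearMap.smul_apply,
      RingHom.id_apply, ← smul_sub, smul_comm c (2 : ℂ)]

variable (E M) in
/-- A smooth orthogonal complex structure on `TM ⊕ T*M`. -/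
structure AlmostGC where
  J : ∀ x : M, GT E x →ₗ[ℝ] GT E x
  sq : ∀ x s, J x (J x s) = -s
  orth : ∀ x s t, pairFib E x (J x s) (J x t) = pairFib E x s t
  smooth : ∀ (U : Opens M) (s : Sec E U), (fun x => J x (s.1 x)) ∈ Sec E U

namespace AlmostGC
variable (G : AlmostGC E M)

/-- The action of the structure on sections. -/
def JSec : Sec E U →ₗ[ℝ] Sec E U where
  toFun s := ⟨fun x => G.J x (s.1 x), G.smooth U s⟩
  map_add' _ _ := Subtype.ext (funext fun x => (G.J x).map_add _ _)
  map_smul' c _ := Subtype.ext (funext fun x => (G.J x).map_smul c _)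

/-- The sections over `U` of the `i`-eigenbundle `L` in `(TM ⊕ T*M) ⊗ ℂ`. -/
def L (U : Opens M) : Submodule ℂ (ℂ ⊗[ℝ] Sec E U) :=
  Module.End.eigenspace ((G.JSec (U := U)).baseChange ℂ) Complex.I

end AlmostGC

variable (E M) in
/-- A generalized complex structure: the `i`-eigenbundle is involutive. -/
structure GCStructure extends AlmostGC E M where
  involutive : ∀ (U : Opens M), ∀ s ∈ toAlmostGC.L U, ∀ t ∈ toAlmostGC.L U,
    dorfA ℂ s t ∈ toAlmostGC.L U

namespace GCStructure
variable (G : GCStructure E M)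

/-- The sections `x` over `U` with `δ_L μ(x) = 0`, tested on all local sections of `L`. -/
def T (U : Opens M) : Submodule ℝ (Sec E U) :=
  ⨅ V : {V : Opens M // V ≤ U}, ⨅ s : G.L V.1, ⨅ t : G.L V.1,
    LinearMap.ker (deltaMu V.1 s.1 t.1 ∘ₗ resSec V.2)

theorem mem_T {U : Opens M} {x : Sec E U} : x ∈ G.T U ↔ ∀ (V : Opens M) (h : V ≤ U),
    ∀ s ∈ G.L V, ∀ t ∈ G.L V, deltaMu V s t (resSec h x) = 0 := by
  simp [T]

theorem resSec_mem_T {U V : Opens M} (h : V ≤ U) {x : Sec E U} (hx : x ∈ G.T U) :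
    resSec h x ∈ G.T V := by
  rw [mem_T] at hx ⊢
  intro W hW s hs t ht
  rw [resSec_resSec]
  exact hx W _ s hs t ht

/-- Restriction of the sections with `δ_L μ(x) = 0`. -/
def resT {U V : Opens M} (h : V ≤ U) : G.T U →ₗ[ℝ] G.T V :=
  (resSec h).restrict fun _ => G.resSec_mem_T h

/-- `(f_R, f_I) ↦ J(0, df_R) + (0, df_I)`. -/
def ham : Fn E (⊤ : Opens M) × Fn E (⊤ : Opens M) →ₗ[ℝ] Sec E (⊤ : Opens M) :=
  LinearMap.coprod (G.JSec ∘ₗ secForm ∘ₗ d0) (secForm ∘ₗ d0)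

/-- The Hamiltonian elements `J(0, df_R) + (0, df_I)` of `T(M)`. -/
def H : Submodule ℝ (Sec E (⊤ : Opens M)) := LinearMap.range G.ham ⊓ G.T ⊤

end GCStructure
end GC

section Brane
variable {E : Type*} [NormedAddCommGroup E] [NormedSpace ℝ E] [FiniteDimensional ℝ E]
  {X : Type*} [TopologicalSpace X] [ChartedSpace E X] [IsManifold 𝓘(ℝ, E) ∞ X]
  {E' : Type*} [NormedAddCommGroup E'] [NormedSpace ℝ E'] [FiniteDimensional ℝ E']
  {Z : Type*} [TopologicalSpace Z] [ChartedSpace E' Z] [IsManifold 𝓘(ℝ, E') ∞ Z]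
  (i : C^∞⟮𝓘(ℝ, E'), Z; 𝓘(ℝ, E), X⟯) {U V : Opens X} {W W' : Opens Z}

/-- The preimage `Z ∩ U`. -/
def pre (U : Opens X) : Opens Z := ⟨i ⁻¹' U, U.2.preimage i.contMDiff.continuous⟩

theorem pre_mono (h : V ≤ U) : pre i V ≤ pre i U := fun _ hz => h hz

/-- The differential of `i` at `z`. -/
def di (z : Z) : TangentSpace 𝓘(ℝ, E') z →L[ℝ] TangentSpace 𝓘(ℝ, E) (i z) :=
  mfderiv 𝓘(ℝ, E') 𝓘(ℝ, E) i z

/-- Pullback of functions to `Z`. -/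
def pullFn : Fn E U →ₗ[ℝ] Fn E' (pre i U) where
  toFun f := ⟨fun z => f.1 (i z), fun z hz => f.2.1 (i z) hz,
    f.2.2.comp i.contMDiff.contMDiffOn fun _ hz => hz⟩
  map_add' _ _ := rfl
  map_smul' _ _ := rfl

/-- Pullback of 1-forms to `Z`. -/
def pullForm : Form E U →ₗ[ℝ] Form E' (pre i U) where
  toFun a := ⟨fun z => (a.1 (i z)).comp (di i z), fun z hz => by simp [a.2.1 (i z) hz],
    smoothForm_of_apply contMDiffOn_id fun V hV ξ hξ => by
      have ho : IsOpen ((pre i U : Set Z) ∩ V) := (pre i U).2.inter hV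
      have hA : SmoothForm E' E i (fun z => a.1 (i z)) (pre i U ∩ V) :=
        SmoothForm.comp a.2.2 i.contMDiff.contMDiffOn fun z hz => hz.1
      have hB : SmoothVec E' E i (fun z => di i z (ξ z)) (pre i U ∩ V) :=
        SmoothVec.push ho i.contMDiff.contMDiffOn (ContMDiffOn.mono hξ Set.inter_subset_right)
      exact hA.apply hB⟩
  map_add' _ _ := rfl
  map_smul' _ _ := rfl

/-- Smooth sections over `W` of the restriction of `TX ⊕ T*X` to `Z`, stored as sections on `Z`
vanishing off `W`. -/
def SecAlong (W : Opens Z) : Submodule ℝ (∀ z : Z, GT E (i z)) where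
  carrier := {s | (∀ z ∉ W, s z = 0) ∧ SmoothVec E' E i (fun z => (s z).1) W ∧
    SmoothForm E' E i (fun z => (s z).2) W}
  zero_mem' := ⟨fun _ _ => rfl, smoothVec_zero i.contMDiff.contMDiffOn,
    smoothForm_zero i.contMDiff.contMDiffOn⟩
  add_mem' h h' := ⟨fun z hz => by simp [h.1 z hz, h'.1 z hz], h.2.1.add h'.2.1, h.2.2.add h'.2.2⟩
  smul_mem' c _ h := ⟨fun z hz => by simp [h.1 z hz],
    SmoothVec.smul (g := fun _ => c) contMDiffOn_const h.2.1,
    SmoothForm.smul (g := fun _ => c) contMDiffOn_const h.2.2⟩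

/-- The restriction `r` of sections of `TX ⊕ T*X` to `Z`. -/
def rSec : Sec E U →ₗ[ℝ] SecAlong i (pre i U) where
  toFun s := ⟨fun z => s.1 (i z), fun _ hz => sec_apply_of_notMem s hz,
    SmoothVec.comp (f := i) s.2.1.2 i.contMDiff.contMDiffOn fun _ hz => hz,
    SmoothForm.comp (f := i) s.2.2.2 i.contMDiff.contMDiffOn fun _ hz => hz⟩
  map_add' _ _ := rfl
  map_smul' _ _ := rfl

open Classical in
/-- Restriction of sections along `Z` to a smaller open set. -/
def resAlong (h : W' ≤ W) : SecAlong i W →ₗ[ℝ] SecAlong i W' where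
  toFun s := ⟨fun z => if z ∈ W' then s.1 z else 0, fun z hz => if_neg hz,
    (ContMDiffOn.mono s.2.2.1 h).congr fun z hz => by simp [show z ∈ W' from hz],
    (ContMDiffOn.mono s.2.2.2 h).congr fun z hz => by simp [show z ∈ W' from hz]⟩
  map_add' s t := Subtype.ext (funext fun z => by by_cases hz : z ∈ W' <;> simp [hz])
  map_smul' c s := Subtype.ext (funext fun z => by by_cases hz : z ∈ W' <;> simp [hz])

theorem resAlong_apply (h : W' ≤ W) (s : SecAlong i W) {z : Z} (hz : z ∈ W') :
    (resAlong i h s).1 z = s.1 z := if_pos hz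

theorem resAlong_apply_of_notMem (h : W' ≤ W) (s : SecAlong i W) {z : Z} (hz : z ∉ W') :
    (resAlong i h s).1 z = 0 := if_neg hz

/-- The fibre `{(i_* v, α) : i^* α = ι_v F}` of `T(Z, F)` at `z`. -/
def TFib (z : Z) (F : TangentSpace 𝓘(ℝ, E') z →L[ℝ] TangentSpace 𝓘(ℝ, E') z →L[ℝ] ℝ) :
    Submodule ℝ (GT E (i z)) where
  carrier := {s | ∃ v, s.1 = di i z v ∧ ∀ w, s.2 (di i z w) = F v w}
  zero_mem' := ⟨0, by simp, fun w => by
    rw [F.map_zero]; rfl⟩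
  add_mem' := by
    rintro s t ⟨v, h1, h2⟩ ⟨v', h1', h2'⟩
    exact ⟨v + v', by simp [h1, h1'], fun w => by
      rw [F.map_add]; exact congrArg₂ (· + ·) (h2 w) (h2' w)⟩
  smul_mem' := by
    rintro c s ⟨v, h1, h2⟩
    exact ⟨c • v, by simp [h1], fun w => by
      rw [F.map_smul]; exact congrArg (c * ·) (h2 w)⟩

end Brane

section BraneDef
universe w
variable {E : Type*} [NormedAddCommGroup E] [NormedSpace ℝ E] [FiniteDimensional ℝ E]
  {X : Type*} [TopologicalSpace X] [ChartedSpace E X] [IsManifold 𝓘(ℝ, E) ∞ X]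
  (E' : Type*) [NormedAddCommGroup E'] [NormedSpace ℝ E'] [FiniteDimensional ℝ E']
  (Z : Type*) [TopologicalSpace Z] [ChartedSpace E' Z] [IsManifold 𝓘(ℝ, E') ∞ Z]

/-- A Hermitian line bundle with unitary connection on `Z`, given by local data: a cover `W_I`,
real functions `c_IJ` on `W_I ∩ W_J` with `c_JK - c_IK + c_IJ ∈ ℤ`, and 1-forms `a_I` on `W_I` with
`a_J - a_I = dc_IJ`. -/
structure HermData where
  κ : Type w
  W : κ → Opens Z
  cover : ∀ z, ∃ I, z ∈ W I
  c : ∀ I J, Fn E' (W I ⊓ W J)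
  a : ∀ I, Form E' (W I)
  cocycle : ∀ I J K, ∀ z ∈ W I ⊓ W J ⊓ W K,
    ∃ n : ℤ, (c J K).1 z - (c I K).1 z + (c I J).1 z = n
  connection : ∀ I J, ∀ z ∈ W I ⊓ W J, (a J).1 z - (a I).1 z = (d0 (c I J)).1 z

variable {E' Z}

/-- The curvature: `F = da_I` on `W_I`. -/
def HermData.F (L : HermData E' Z) (z : Z) :
    TangentSpace 𝓘(ℝ, E') z →L[ℝ] TangentSpace 𝓘(ℝ, E') z →L[ℝ] ℝ :=
  extDer (L.a (L.cover z).choose) z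

variable (E' Z) in
/-- A generalized complex brane: a closed embedded submanifold `Z` with a Hermitian line bundle with
unitary connection whose `T(Z, F)` is preserved by the generalized complex structure. -/
structure GCBrane (G : GCStructure E X) extends HermData E' Z where
  emb : C^∞⟮𝓘(ℝ, E'), Z; 𝓘(ℝ, E), X⟯
  isEmb : Manifold.IsSmoothEmbedding 𝓘(ℝ, E') 𝓘(ℝ, E) ∞ emb
  closed : IsClosed (Set.range emb)
  compat : ∀ z, ∀ s ∈ TFib emb z (toHermData.F z), G.J (emb z) s ∈ TFib emb z (toHermData.F z)

end BraneDef

section Cohomology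
variable {E : Type*} [NormedAddCommGroup E] [NormedSpace ℝ E] [FiniteDimensional ℝ E]
  {X : Type*} [TopologicalSpace X] [ChartedSpace E X] [IsManifold 𝓘(ℝ, E) ∞ X]
  {E' : Type*} [NormedAddCommGroup E'] [NormedSpace ℝ E'] [FiniteDimensional ℝ E']
  {Z : Type*} [TopologicalSpace Z] [ChartedSpace E' Z] [IsManifold 𝓘(ℝ, E') ∞ Z]
  {G : GCStructure E X}

namespace GCBrane
variable (B : GCBrane E' Z G) {U V : Opens X} {W W' : Opens Z}

/-- The fibre of `T(Z, F)` at `z`. -/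
def TZ (z : Z) : Submodule ℝ (GT E (B.emb z)) := TFib B.emb z (B.toHermData.F z)

/-- The fibre at `z` of `l`, the `i`-eigenbundle in `T(Z, F) ⊗ ℂ`. -/
def lFib (z : Z) : Submodule ℂ (ℂ ⊗[ℝ] GT E (B.emb z)) :=
  (B.TZ z).baseChange ℂ ⊓ Module.End.eigenspace ((G.J (B.emb z)).baseChange ℂ) Complex.I

/-- Evaluation at `z` of complex sections along `Z`. -/
def ev (z : Z) : ℂ ⊗[ℝ] SecAlong B.emb W →ₗ[ℂ] ℂ ⊗[ℝ] GT E (B.emb z) :=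
  LinearMap.baseChange ℂ (M := SecAlong B.emb W)
    (LinearMap.proj (R := ℝ) (φ := fun z => GT E (B.emb z)) z ∘ₗ (SecAlong B.emb W).subtype)

/-- Smooth sections of `l` over `W`. -/
def lSec (W : Opens Z) : Submodule ℂ (ℂ ⊗[ℝ] SecAlong B.emb W) :=
  ⨅ z, (B.lFib z).comap (B.ev z)

theorem lSec_ev (s : B.lSec W) (z : Z) : B.ev z s.1 ∈ B.lFib z :=
  (Submodule.mem_iInf _).1 s.2 z

/-- The value at `z` of a section of `l`. -/
def val (z : Z) (s : B.lSec W) : B.lFib z := ⟨B.ev z s.1, B.lSec_ev s z⟩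

/-- The bracket of `Γ(l)` over `Z ∩ U`: `[s, t] = u` if `s`, `t` extend to sections of `L` over `U`
whose bracket restricts to `u`. -/
def IsBracket (U : Opens X) (s t u : B.lSec (pre B.emb U)) : Prop :=
  ∃ s' ∈ G.L U, ∃ t' ∈ G.L U, (rSec B.emb (U := U)).baseChange ℂ s' = s.1 ∧
    (rSec B.emb (U := U)).baseChange ℂ t' = t.1 ∧
    (rSec B.emb (U := U)).baseChange ℂ (dorfA ℂ s' t') = u.1

/-- `v ∈ T_z Z ⊗ ℂ` is the image of `s ∈ l_z` under the anchor `l → TZ ⊗ ℂ`. -/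
def IsAnchor (z : Z) (s : B.lFib z) (v : ℂ ⊗[ℝ] TangentSpace 𝓘(ℝ, E') z) : Prop :=
  (di B.emb z).toLinearMap.baseChange ℂ v =
    (GT.proj (E := E) (B.emb z)).baseChange ℂ s.1

end GCBrane

/-- The derivative of a complex function along a complex tangent vector. -/
def dC (g : Z → ℂ) (z : Z) : ℂ ⊗[ℝ] TangentSpace 𝓘(ℝ, E') z →ₗ[ℂ] ℂ :=
  LinearMap.liftBaseChange ℂ (mvfderiv 𝓘(ℝ, E') g z).toLinearMap

theorem dC_zero (z : Z) (v : ℂ ⊗[ℝ] TangentSpace 𝓘(ℝ, E') z) : dC (fun _ => (0 : ℂ)) z v = 0 := by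
  simp [dC, mvfderiv_const]

theorem dC_add {f g : Z → ℂ} {z : Z} (hf : MDifferentiableAt 𝓘(ℝ, E') 𝓘(ℝ, ℂ) f z)
    (hg : MDifferentiableAt 𝓘(ℝ, E') 𝓘(ℝ, ℂ) g z) (v : ℂ ⊗[ℝ] TangentSpace 𝓘(ℝ, E') z) :
    dC (fun z => f z + g z) z v = dC f z v + dC g z v := by
  rw [dC, mvfderiv_fun_add hf hg]
  simp [dC]

theorem dC_smul {f : Z → ℂ} {z : Z} (c : ℝ) (hf : MDifferentiableAt 𝓘(ℝ, E') 𝓘(ℝ, ℂ) f z)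
    (v : ℂ ⊗[ℝ] TangentSpace 𝓘(ℝ, E') z) :
    dC (fun z => (c : ℂ) * f z) z v = c * dC f z v := by
  have h : mvfderiv 𝓘(ℝ, E') (fun z => (c : ℂ) * f z) z = c • mvfderiv 𝓘(ℝ, E') f z := by
    have := mvfderiv_smul (a := fun _ : Z => c) (g := f) (x := z) (I := 𝓘(ℝ, E'))
      mdifferentiableAt_const hf
    have e : (fun z => (c : ℂ) * f z) = (fun _ : Z => c) • f := by
      ext z; simp
    rw [e, this]
    ext v; simp [mvfderiv_const]
  rw [dC, h, dC]
  induction v with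
  | zero => simp
  | add x y hx hy => rw [map_add, map_add, hx, hy, mul_add]
  | tmul a w => simp; ring

namespace GCBrane
variable (B : GCBrane E' Z G) {U V : Opens X} {W W' : Opens Z}

/-- Smooth 1-cochains of `l`, i.e. smooth sections of the dual of `l`. -/
def C1 : Submodule ℝ (∀ z, B.lFib z →ₗ[ℂ] ℂ) where
  carrier := {θ | ∀ (W : Opens Z) (s : B.lSec W),
    ContMDiffOn 𝓘(ℝ, E') 𝓘(ℝ, ℂ) ∞ (fun z => θ z (B.val z s)) W}
  zero_mem' := fun _ _ => contMDiffOn_const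
  add_mem' h h' := fun W s => (h W s).add (h' W s)
  smul_mem' c _ h := fun W s =>
    (contMDiffOn_const : ContMDiffOn 𝓘(ℝ, E') 𝓘(ℝ) ∞ (fun _ : Z => c) W).smul (h W s)

/-- Smooth 2-cochains of `l`. -/
def C2 : Submodule ℝ (∀ z, B.lFib z [⋀^Fin 2]→ₗ[ℂ] ℂ) where
  carrier := {ζ | ∀ (W : Opens Z) (s t : B.lSec W),
    ContMDiffOn 𝓘(ℝ, E') 𝓘(ℝ, ℂ) ∞ (fun z => ζ z ![B.val z s, B.val z t]) W}
  zero_mem' := fun _ _ _ => contMDiffOn_const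
  add_mem' h h' := fun W s t => (h W s t).add (h' W s t)
  smul_mem' c _ h := fun W s t =>
    (contMDiffOn_const : ContMDiffOn 𝓘(ℝ, E') 𝓘(ℝ) ∞ (fun _ : Z => c) W).smul (h W s t)

/-- `ζ = δ_l θ` over `Z ∩ U`: `ζ(s, t) = π(s)θ(t) - π(t)θ(s) - θ([s, t])`. -/
def IsDelta (U : Opens X) (θ : ∀ z, B.lFib z →ₗ[ℂ] ℂ) (ζ : ∀ z, B.lFib z [⋀^Fin 2]→ₗ[ℂ] ℂ) : Prop :=
  ∀ s t u : B.lSec (pre B.emb U), B.IsBracket U s t u → ∀ z ∈ pre B.emb U, ∀ v w,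
    B.IsAnchor z (B.val z s) v → B.IsAnchor z (B.val z t) w →
    ζ z ![B.val z s, B.val z t] =
      dC (fun z => θ z (B.val z t)) z v - dC (fun z => θ z (B.val z s)) z w - θ z (B.val z u)

/-- `(δ_l ζ)(s₀, s₁, s₂) = 0`, where `δ_l ζ` is
`Σ_i (-1)^i π(s_i)ζ(…, ŝ_i, …) + Σ_{i<j} (-1)^{i+j} ζ([s_i, s_j], …, ŝ_i, …, ŝ_j, …)`. -/
def IsClosed2 (ζ : ∀ z, B.lFib z [⋀^Fin 2]→ₗ[ℂ] ℂ) : Prop :=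
  ∀ s₀ s₁ s₂ u₀₁ u₀₂ u₁₂ : B.lSec (pre B.emb ⊤), B.IsBracket ⊤ s₀ s₁ u₀₁ →
    B.IsBracket ⊤ s₀ s₂ u₀₂ → B.IsBracket ⊤ s₁ s₂ u₁₂ → ∀ z v₀ v₁ v₂,
    B.IsAnchor z (B.val z s₀) v₀ → B.IsAnchor z (B.val z s₁) v₁ →
    B.IsAnchor z (B.val z s₂) v₂ →
    dC (fun z => ζ z ![B.val z s₁, B.val z s₂]) z v₀ -
        dC (fun z => ζ z ![B.val z s₀, B.val z s₂]) z v₁ +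
        dC (fun z => ζ z ![B.val z s₀, B.val z s₁]) z v₂ -
        ζ z ![B.val z u₀₁, B.val z s₂] + ζ z ![B.val z u₀₂, B.val z s₁] -
        ζ z ![B.val z u₁₂, B.val z s₀] = 0

variable {B} in
theorem C1.mdiffAt {θ : ∀ z, B.lFib z →ₗ[ℂ] ℂ} (h : θ ∈ B.C1) {W : Opens Z} (s : B.lSec W) {z : Z}
    (hz : z ∈ W) : MDifferentiableAt 𝓘(ℝ, E') 𝓘(ℝ, ℂ) (fun z => θ z (B.val z s)) z :=
  ((h W s).contMDiffAt (W.2.mem_nhds hz)).mdifferentiableAt (by simp)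

variable {B} in
theorem C2.mdiffAt {ζ : ∀ z, B.lFib z [⋀^Fin 2]→ₗ[ℂ] ℂ} (h : ζ ∈ B.C2) {W : Opens Z}
    (s t : B.lSec W) {z : Z} (hz : z ∈ W) :
    MDifferentiableAt 𝓘(ℝ, E') 𝓘(ℝ, ℂ) (fun z => ζ z ![B.val z s, B.val z t]) z :=
  ((h W s t).contMDiffAt (W.2.mem_nhds hz)).mdifferentiableAt (by simp)

set_option maxHeartbeats 1000000 in
/-- Closed 2-cochains. -/
def Z2 : Submodule ℝ (∀ z, B.lFib z [⋀^Fin 2]→ₗ[ℂ] ℂ) where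
  carrier := {ζ | ζ ∈ B.C2 ∧ B.IsClosed2 ζ}
  zero_mem' := ⟨B.C2.zero_mem, fun s₀ s₁ s₂ u₀₁ u₀₂ u₁₂ _ _ _ z v₀ v₁ v₂ _ _ _ => by
    simp [dC_zero]⟩
  add_mem' {ζ ζ'} h h' := ⟨B.C2.add_mem h.1 h'.1,
    fun s₀ s₁ s₂ u₀₁ u₀₂ u₁₂ b₀ b₁ b₂ z v₀ v₁ v₂ a₀ a₁ a₂ => by
      have e := h.2 s₀ s₁ s₂ u₀₁ u₀₂ u₁₂ b₀ b₁ b₂ z v₀ v₁ v₂ a₀ a₁ a₂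
      have e' := h'.2 s₀ s₁ s₂ u₀₁ u₀₂ u₁₂ b₀ b₁ b₂ z v₀ v₁ v₂ a₀ a₁ a₂
      have hz : z ∈ pre B.emb (⊤ : Opens X) := trivial
      simp only [Pi.add_apply, AlternatingMap.add_apply]
      rw [dC_add (C2.mdiffAt h.1 s₁ s₂ hz) (C2.mdiffAt h'.1 s₁ s₂ hz),
        dC_add (C2.mdiffAt h.1 s₀ s₂ hz) (C2.mdiffAt h'.1 s₀ s₂ hz),
        dC_add (C2.mdiffAt h.1 s₀ s₁ hz) (C2.mdiffAt h'.1 s₀ s₁ hz)]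
      linear_combination e + e'⟩
  smul_mem' := by
    rintro c ζ ⟨h, e⟩
    refine ⟨B.C2.smul_mem c h, fun s₀ s₁ s₂ u₀₁ u₀₂ u₁₂ b₀ b₁ b₂ z v₀ v₁ v₂ a₀ a₁ a₂ => ?_⟩
    have hz : z ∈ pre B.emb (⊤ : Opens X) := trivial
    simp only [Pi.smul_apply, AlternatingMap.smul_apply, Complex.real_smul]
    rw [dC_smul c (C2.mdiffAt h s₁ s₂ hz), dC_smul c (C2.mdiffAt h s₀ s₂ hz),
      dC_smul c (C2.mdiffAt h s₀ s₁ hz), ← mul_zero (c : ℂ),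
      ← e s₀ s₁ s₂ u₀₁ u₀₂ u₁₂ b₀ b₁ b₂ z v₀ v₁ v₂ a₀ a₁ a₂]
    ring

/-- Exact 2-cochains. -/
def B2 : Submodule ℝ (∀ z, B.lFib z [⋀^Fin 2]→ₗ[ℂ] ℂ) where
  carrier := {ζ | ζ ∈ B.C2 ∧ ∃ θ ∈ B.C1, B.IsDelta ⊤ θ ζ}
  zero_mem' := ⟨B.C2.zero_mem, 0, B.C1.zero_mem, fun s t u _ z _ v w _ _ => by simp [dC_zero]⟩
  add_mem' := by
    rintro ζ ζ' ⟨h, θ, hθ, e⟩ ⟨h', θ', hθ', e'⟩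
    refine ⟨B.C2.add_mem h h', θ + θ', B.C1.add_mem hθ hθ', fun s t u b z hz v w a a' => ?_⟩
    simp only [Pi.add_apply, AlternatingMap.add_apply, LinearMap.add_apply]
    rw [dC_add (C1.mdiffAt hθ s hz) (C1.mdiffAt hθ' s hz),
      dC_add (C1.mdiffAt hθ t hz) (C1.mdiffAt hθ' t hz), e s t u b z hz v w a a',
      e' s t u b z hz v w a a']
    ring
  smul_mem' := by
    rintro c ζ ⟨h, θ, hθ, e⟩
    refine ⟨B.C2.smul_mem c h, c • θ, B.C1.smul_mem c hθ, fun s t u b z hz v w a a' => ?_⟩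
    simp only [Pi.smul_apply, AlternatingMap.smul_apply, LinearMap.smul_apply, Complex.real_smul]
    rw [dC_smul c (C1.mdiffAt hθ s hz), dC_smul c (C1.mdiffAt hθ t hz), e s t u b z hz v w a a']
    ring

/-- The Lie algebroid cohomology `H²(B)` of `l`. -/
def H2 : Type _ := ↥B.Z2 ⧸ B.B2.submoduleOf B.Z2

instance groupH2 : AddCommGroup B.H2 :=
  inferInstanceAs (AddCommGroup (↥B.Z2 ⧸ B.B2.submoduleOf B.Z2))

instance moduleH2 : Module ℝ B.H2 :=
  inferInstanceAs (Module ℝ (↥B.Z2 ⧸ B.B2.submoduleOf B.Z2))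

/-- The class of a closed 2-cochain. -/
def H2mk : B.Z2 →ₗ[ℝ] B.H2 := (B.B2.submoduleOf B.Z2).mkQ

end GCBrane
end Cohomology

section Complex
variable {E : Type*} [NormedAddCommGroup E] [NormedSpace ℝ E] [FiniteDimensional ℝ E]
  {X : Type*} [TopologicalSpace X] [ChartedSpace E X] [IsManifold 𝓘(ℝ, E) ∞ X]
  {E' : Type*} [NormedAddCommGroup E'] [NormedSpace ℝ E'] [FiniteDimensional ℝ E']
  {Z : Type*} [TopologicalSpace Z] [ChartedSpace E' Z] [IsManifold 𝓘(ℝ, E') ∞ Z]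
  {G : GCStructure E X}

namespace GCBrane
variable (B : GCBrane E' Z G) {U V : Opens X} {W W' : Opens Z}

/-- Smooth sections of `T(Z, F)` over `W`. -/
def TT (W : Opens Z) : Submodule ℝ (SecAlong B.emb W) where
  carrier := {s | ∀ z, s.1 z ∈ B.TZ z}
  zero_mem' := fun z => (B.TZ z).zero_mem
  add_mem' h h' := fun z => (B.TZ z).add_mem (h z) (h' z)
  smul_mem' c _ h := fun z => (B.TZ z).smul_mem c (h z)

/-- Smooth sections over `W` of the generalized normal bundle `N = (TX ⊕ T*X)|_Z / T(Z, F)`. -/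
abbrev NSec (W : Opens Z) : Type _ := SecAlong B.emb W ⧸ B.TT W

/-- Restriction of sections of `N`. -/
def resN (h : W' ≤ W) : B.NSec W →ₗ[ℝ] B.NSec W' :=
  (B.TT W).mapQ (B.TT W') (resAlong B.emb h) fun s hs z => by
    by_cases hz : z ∈ W'
    · rw [resAlong_apply _ _ _ hz]; exact hs z
    · rw [resAlong_apply_of_notMem _ _ _ hz]; exact (B.TZ z).zero_mem

/-- `x ↦ q(r(x))`. -/
def qr : Sec E U →ₗ[ℝ] B.NSec (pre B.emb U) := (B.TT _).mkQ ∘ₗ rSec B.emb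

theorem extDer_antisymm (a : Form E' W) (z : Z) (v w : TangentSpace 𝓘(ℝ, E') z) :
    extDer a z v w = - extDer a z w v := by
  by_cases hz : z ∈ W
  · have hv := FiberBundle.mdifferentiableAt_extend 𝓘(ℝ, E') E'
      (V := (TangentSpace 𝓘(ℝ, E') : Z → Type _)) v
    have hw := FiberBundle.mdifferentiableAt_extend 𝓘(ℝ, E') E'
      (V := (TangentSpace 𝓘(ℝ, E') : Z → Type _)) w
    have e := extDer_apply a hz hv hw
    have e' := extDer_apply a hz hw hv
    simp only [FiberBundle.extend_apply_self] at e e'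
    rw [e, e', preExt_swap]
  · rw [extDer_of_notMem _ hz]
    exact neg_zero.symm

theorem pairFib_TZ {z : Z} {s t : GT E (B.emb z)} (hs : s ∈ B.TZ z) (ht : t ∈ B.TZ z) :
    pairFib E (B.emb z) s t = 0 := by
  obtain ⟨v, h1, h2⟩ := hs
  obtain ⟨w, h1', h2'⟩ := ht
  have h3 : t.2 s.1 + s.2 t.1 = 0 := by
    rw [h1, h1', h2, h2']
    have := extDer_antisymm (B.a (B.cover z).choose) z v w
    exact add_eq_zero_iff_neg_eq.2 (by rw [HermData.F, this])
  simp [pairFib, h3]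

/-- `v ↦ ⟨x, v⟩` on `l_z`. -/
def muFib (z : Z) : GT E (B.emb z) →ₗ[ℝ] B.lFib z →ₗ[ℂ] ℂ where
  toFun x := (LinearMap.liftBaseChange ℂ
    (Algebra.linearMap ℝ ℂ ∘ₗ pairFib E (B.emb z) x)) ∘ₗ (B.lFib z).subtype
  map_add' x y := by
    ext v
    generalize hw : (v : ℂ ⊗[ℝ] GT E (B.emb z)) = w
    simp only [LinearMap.comp_apply, LinearMap.add_apply, Submodule.subtype_apply, hw]
    clear hw
    induction w with
    | zero => simp
    | add a b ha hb => rw [map_add, ha, hb, map_add, map_add]; ring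
    | tmul a t => simp; ring
  map_smul' c x := by
    ext v
    generalize hw : (v : ℂ ⊗[ℝ] GT E (B.emb z)) = w
    simp only [LinearMap.comp_apply, LinearMap.smul_apply, Submodule.subtype_apply, hw]
    clear hw
    induction w with
    | zero => simp
    | add a b ha hb => simp only [map_add, ha, hb, smul_add]
    | tmul a t => simp; ring

theorem muFib_eq_zero {z : Z} {x : GT E (B.emb z)} (hx : x ∈ B.TZ z) : B.muFib z x = 0 := by
  have h : ∀ v ∈ (B.TZ z).baseChange ℂ, LinearMap.liftBaseChange ℂ
      (Algebra.linearMap ℝ ℂ ∘ₗ pairFib E (B.emb z) x) v = 0 := by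
    intro v hv
    rw [Submodule.baseChange_eq_span] at hv
    refine (Submodule.span_le (p := LinearMap.ker (LinearMap.liftBaseChange ℂ
      (Algebra.linearMap ℝ ℂ ∘ₗ pairFib E (B.emb z) x)))).2 ?_ hv
    rintro _ ⟨t, ht, rfl⟩
    simp [B.pairFib_TZ hx ht]
  exact LinearMap.ext fun v => h v.1 v.2.1

/-- The map `μ` from sections of `N` to 1-cochains of `l`: `μ(q(x))(v) = ⟨x, v⟩`. -/
def mu (W : Opens Z) : B.NSec W →ₗ[ℝ] ∀ z, B.lFib z →ₗ[ℂ] ℂ :=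
  (B.TT W).liftQ (LinearMap.pi fun z => B.muFib z ∘ₗ
      LinearMap.proj (R := ℝ) (φ := fun z => GT E (B.emb z)) z ∘ₗ (SecAlong B.emb W).subtype)
    (fun _ hs => funext fun z => B.muFib_eq_zero (hs z))

/-- The pairs `(x, (τ, f))` with `x = (ξ, w)` in `T(U)`, `ξ|_Z = i_* τ` and
`i^* w = ι_τ F - df`. -/
def KK (U : Opens X) :
    Submodule ℝ (Sec E U × Vec E' (pre B.emb U) × Fn E' (pre B.emb U)) where
  carrier := {p | p.1 ∈ G.T U ∧ ∀ z ∈ pre B.emb U,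
    (p.1.1 (B.emb z)).1 = di B.emb z (p.2.1.1 z) ∧
    ∀ v, (p.1.1 (B.emb z)).2 (di B.emb z v) = B.F z (p.2.1.1 z) v - (d0 p.2.2).1 z v}
  zero_mem' := by
    refine ⟨(G.T U).zero_mem, fun z _ => ⟨((di B.emb z).map_zero).symm, fun v => ?_⟩⟩
    have h : B.F z 0 v = 0 := by rw [(B.F z).map_zero]; rfl
    have h3 : (d0 (0 : Fn E' (pre B.emb U))).1 z v = 0 := by rw [map_zero]; rfl
    change (0 : ℝ) = B.F z 0 v - (d0 (0 : Fn E' (pre B.emb U))).1 z v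
    rw [h, h3, sub_zero]
  add_mem' := by
    rintro p p' ⟨h, e⟩ ⟨h', e'⟩
    refine ⟨(G.T U).add_mem h h', fun z hz => ⟨?_, fun v => ?_⟩⟩
    · exact (congrArg₂ (· + ·) (e z hz).1 (e' z hz).1).trans ((di B.emb z).map_add _ _).symm
    · have h : B.F z (p.2.1.1 z + p'.2.1.1 z) v = B.F z (p.2.1.1 z) v + B.F z (p'.2.1.1 z) v := by
        rw [(B.F z).map_add]; rfl
      have h3 : (d0 (p.2.2 + p'.2.2)).1 z v = (d0 p.2.2).1 z v + (d0 p'.2.2).1 z v := by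
        rw [map_add]; rfl
      refine (congrArg₂ (· + ·) ((e z hz).2 v) ((e' z hz).2 v)).trans ?_
      change _ = B.F z (p.2.1.1 z + p'.2.1.1 z) v - (d0 (p.2.2 + p'.2.2)).1 z v
      rw [h, h3]
      ring
  smul_mem' := by
    rintro c p ⟨h, e⟩
    refine ⟨(G.T U).smul_mem c h, fun z hz => ⟨?_, fun v => ?_⟩⟩
    · exact (congrArg (c • ·) (e z hz).1).trans ((di B.emb z).map_smul _ _).symm
    · have h : B.F z (c • p.2.1.1 z) v = c * B.F z (p.2.1.1 z) v := by
        rw [(B.F z).map_smul]; rfl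
      have h3 : (d0 (c • p.2.2)).1 z v = c * (d0 p.2.2).1 z v := by
        rw [map_smul]; rfl
      refine (congrArg (c * ·) ((e z hz).2 v)).trans ?_
      change _ = B.F z (c • p.2.1.1 z) v - (d0 (c • p.2.2)).1 z v
      rw [h, h3]
      ring

theorem KK_le (p : B.KK U) : p.1.1 ∈ G.T U := p.2.1

/-- `(x, (τ, f)) ↦ x`. -/
def chi : B.KK U →ₗ[ℝ] G.T U :=
  (LinearMap.fst ℝ _ _ ∘ₗ (B.KK U).subtype).codRestrict (G.T U) fun p => B.KK_le p

theorem d0_resFn (h : W' ≤ W) (f : Fn E' W) {z : Z} (hz : z ∈ W') :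
    (d0 (resFn h f)).1 z = (d0 f).1 z := by
  have e : (resFn h f).1 =ᶠ[𝓝 z] f.1 := by
    filter_upwards [W'.2.mem_nhds hz] with y hy
    exact Set.indicator_of_mem hy _
  simp only [d0, LinearMap.coe_mk, AddHom.coe_mk, hz, h hz, if_true, mvfderiv, e.mfderiv_eq]
  rfl

theorem resVec_apply (h : W' ≤ W) (ξ : Vec E' W) {z : Z} (hz : z ∈ W') :
    (resVec h ξ).1 z = ξ.1 z := if_pos hz

/-- Restriction in `KK`. -/
def resK (h : V ≤ U) : B.KK U →ₗ[ℝ] B.KK V :=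
  ((resSec h).prodMap ((resVec (pre_mono B.emb h)).prodMap (resFn (pre_mono B.emb h)))).restrict
    fun p hp => by
      refine ⟨G.resSec_mem_T h hp.1, fun z hz => ?_⟩
      have e := hp.2 z (h hz)
      refine ⟨?_, fun v => ?_⟩
      · refine (congrArg Prod.fst (resSec_apply h p.1 hz)).trans (e.1.trans ?_)
        exact congrArg (di B.emb z) (resVec_apply (pre_mono B.emb h) p.2.1 hz).symm
      · refine (congrArg (fun t : GT E (B.emb z) => t.2 (di B.emb z v)) (resSec_apply h p.1 hz)).trans
          ((e.2 v).trans ?_)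
        exact congrArg₂ (fun a b => B.F z a v - b v)
          (resVec_apply (pre_mono B.emb h) p.2.1 hz).symm
          (d0_resFn (pre_mono B.emb h) p.2.2 hz).symm

/-- The space `H(X)` of global Hamiltonian elements. -/
def HType (G : GCStructure E X) : Type _ := ↥G.H

instance groupHType : AddCommGroup (HType G) := inferInstanceAs (AddCommGroup ↥G.H)

instance moduleHType : Module ℝ (HType G) := inferInstanceAs (Module ℝ ↥G.H)

/-- The space `T(U)`. -/
def TType (G : GCStructure E X) (U : Opens X) : Type _ := ↥(G.T U)

instance groupTType : AddCommGroup (TType G U) := inferInstanceAs (AddCommGroup ↥(G.T U))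

instance moduleTType : Module ℝ (TType G U) := inferInstanceAs (Module ℝ ↥(G.T U))

/-- The space of pairs `(x, (τ, f))` over `U`. -/
def KKType (U : Opens X) : Type _ := ↥(B.KK U)

instance groupKKType : AddCommGroup (B.KKType U) := inferInstanceAs (AddCommGroup ↥(B.KK U))

instance moduleKKType : Module ℝ (B.KKType U) := inferInstanceAs (Module ℝ ↥(B.KK U))

variable (G) in
/-- Restriction of the elements of `T(U)`. -/
def resTT (h : V ≤ U) : TType G U →ₗ[ℝ] TType G V := G.resT h

variable (G) in
/-- Restriction of the elements of `H(X)` to elements of `T(U)`. -/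
def resH (U : Opens X) : HType G →ₗ[ℝ] TType G U :=
  (G.resT (le_top : U ≤ ⊤) ∘ₗ Submodule.inclusion (inf_le_right : G.H ≤ G.T ⊤) : G.H →ₗ[ℝ] G.T U)

/-- Restriction of the pairs `(x, (τ, f))`. -/
def resKK (h : V ≤ U) : B.KKType U →ₗ[ℝ] B.KKType V := B.resK h

/-- `(x, (τ, f)) ↦ x`. -/
def chiT : B.KKType U →ₗ[ℝ] TType G U := B.chi

section Tot
variable {ι : Type*} (U : ι → Opens X)

/-- The intersection `U_{α_0} ∩ … ∩ U_{α_p}`. -/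
def cap {p : ℕ} (α : Fin (p + 1) → ι) : Opens X := Finset.univ.inf fun j => U (α j)

theorem cap_le {p : ℕ} (α : Fin (p + 1) → ι) (j : Fin (p + 1)) : cap U α ≤ U (α j) :=
  Finset.inf_le (f := fun j => U (α j)) (Finset.mem_univ j)

theorem cap_le_face {p : ℕ} (α : Fin (p + 2) → ι) (k : Fin (p + 2)) :
    cap U α ≤ cap U (α ∘ k.succAbove) :=
  Finset.le_inf fun j _ => cap_le U α (k.succAbove j)

/-- Row `0` of the bisemicosimplicial vector space: `H(X) × ∏ KK(U_{α_0} ∩ … ∩ U_{α_p})`. -/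
abbrev V0 (p : ℕ) : Type _ := HType G × ∀ α : Fin (p + 1) → ι, B.KKType (cap U α)

variable (G) in
/-- Row `1` of the bisemicosimplicial vector space: `∏ T(U_{α_0} ∩ … ∩ U_{α_p})`. -/
abbrev V1 (p : ℕ) : Type _ := ∀ α : Fin (p + 1) → ι, TType G (cap U α)

/-- The horizontal coface maps in row `0`. -/
def face0 (p : ℕ) (k : Fin (p + 2)) : B.V0 U p →ₗ[ℝ] B.V0 U (p + 1) :=
  LinearMap.prodMap LinearMap.id
    (LinearMap.pi fun α => B.resKK (cap_le_face U α k) ∘ₗ LinearMap.proj (α ∘ k.succAbove))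

variable (G) in
/-- The horizontal coface maps in row `1`. -/
def face1 (p : ℕ) (k : Fin (p + 2)) : V1 G U p →ₗ[ℝ] V1 G U (p + 1) :=
  LinearMap.pi fun α => resTT G (cap_le_face U α k) ∘ₗ LinearMap.proj (α ∘ k.succAbove)

/-- The horizontal differential in row `0`. -/
def hor0 (p : ℕ) : B.V0 U p →ₗ[ℝ] B.V0 U (p + 1) :=
  ∑ k : Fin (p + 2), (-1 : ℝ) ^ (k : ℕ) • B.face0 U p k

variable (G) in
/-- The horizontal differential in row `1`. -/
def hor1 (p : ℕ) : V1 G U p →ₗ[ℝ] V1 G U (p + 1) :=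
  ∑ k : Fin (p + 2), (-1 : ℝ) ^ (k : ℕ) • face1 G U p k

/-- The first vertical coface map: restriction of the elements of `H(X)`. -/
def vert0 (p : ℕ) : B.V0 U p →ₗ[ℝ] V1 G U p :=
  LinearMap.pi fun α => resH G (cap U α) ∘ₗ
    LinearMap.fst ℝ (HType G) (∀ α : Fin (p + 1) → ι, B.KKType (cap U α))

/-- The second vertical coface map: `χ`. -/
def vert1 (p : ℕ) : B.V0 U p →ₗ[ℝ] V1 G U p :=
  LinearMap.pi fun α => B.chiT ∘ₗ LinearMap.proj α ∘ₗ LinearMap.snd ℝ _ _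

/-- The vertical differential. -/
def vert (p : ℕ) : B.V0 U p →ₗ[ℝ] V1 G U p := B.vert0 U p - B.vert1 U p

/-- The total complex in degrees `p + 1`; the rows above row `1` vanish. -/
abbrev Tot (p : ℕ) : Type _ := B.V0 U (p + 1) × V1 G U p

/-- The differential of the total complex in degrees `p + 1`. -/
def totD (p : ℕ) : B.Tot U p →ₗ[ℝ] B.Tot U (p + 1) :=
  LinearMap.prod (B.hor0 U (p + 1) ∘ₗ LinearMap.fst ℝ _ _)
    (B.vert U (p + 1) ∘ₗ LinearMap.fst ℝ _ _ - hor1 G U p ∘ₗ LinearMap.snd ℝ _ _)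

/-- The 2-cocycles of the total complex. -/
abbrev Cocycle : Submodule ℝ (B.Tot U 1) := LinearMap.ker (B.totD U 1)

/-- The second cohomology of the total complex. -/
def H2Tot : Type _ :=
  ↥(B.Cocycle U) ⧸ (LinearMap.range (B.totD U 0)).submoduleOf (B.Cocycle U)

instance groupH2Tot : AddCommGroup (B.H2Tot U) := inferInstanceAs (AddCommGroup
  (↥(B.Cocycle U) ⧸ (LinearMap.range (B.totD U 0)).submoduleOf (B.Cocycle U)))

instance moduleH2Tot : Module ℝ (B.H2Tot U) := inferInstanceAs (Module ℝ
  (↥(B.Cocycle U) ⧸ (LinearMap.range (B.totD U 0)).submoduleOf (B.Cocycle U)))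

/-- The class of a 2-cocycle. -/
def H2TotMk : B.Cocycle U →ₗ[ℝ] B.H2Tot U :=
  ((LinearMap.range (B.totD U 0)).submoduleOf (B.Cocycle U)).mkQ

/-- The data from which the comparison map is computed: a 2-cocycle `(x_ab, y_abc)` whose components
in `H(X)` and in `∏ C^∞(Z ∩ U_abc)` vanish, sections `σ_a` of the generalized normal bundle over
`Z ∩ U_a` with `σ_b - σ_a = q(r(x_ab))`, and a closed 2-cochain `ζ` of `l` that restricts to
`δ_l μ(σ_a)` on `Z ∩ U_a`. -/
structure Lifts (c : B.Cocycle U) (σ : ∀ a, B.NSec (pre B.emb (U a))) (ζ : B.Z2) : Prop where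
  ham : c.1.1.1 = 0
  fn : ∀ α, (c.1.1.2 α).1.2.2 = 0
  glue : ∀ a b, B.resN (pre_mono B.emb (cap_le U ![a, b] 1)) (σ b) -
    B.resN (pre_mono B.emb (cap_le U ![a, b] 0)) (σ a) = B.qr (c.1.2 ![a, b]).1
  delta : ∀ a, B.IsDelta (U a) (B.mu _ (σ a)) ζ.1

end Tot

end GCBrane
end Complex

section Artin

/-- A local Artinian real algebra with residue field `ℝ`. -/
class IsArt (A : Type) [CommRing A] [Algebra ℝ A] : Prop extends
    IsLocalRing A, IsArtinianRing A where
  residue : Function.Bijective (algebraMap ℝ (IsLocalRing.ResidueField A))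

variable (A : Type) [CommRing A] [Algebra ℝ A] [IsArt A] (P : Type*) [AddCommGroup P] [Module ℝ P]

/-- `𝔪 ⊗ P` inside `A ⊗ P`. -/
def mTen : Submodule A (A ⊗[ℝ] P) := IsLocalRing.maximalIdeal A • ⊤

variable {A} {P' : Type*} [AddCommGroup P'] [Module A P']

/-- The exponential of a nilpotent endomorphism. -/
def expNil (φ : Module.End A P') : Module.End A P' :=
  ∑ k ∈ Finset.range (nilpotencyClass φ), algebraMap ℝ A ((k.factorial : ℝ)⁻¹) • φ ^ k

/-- `∫₀¹ exp(tφ) dt = ∑ φ^k / (k + 1)!` for a nilpotent endomorphism `φ`. -/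
def intExp (φ : Module.End A P') : Module.End A P' :=
  ∑ k ∈ Finset.range (nilpotencyClass φ), algebraMap ℝ A (((k + 1).factorial : ℝ)⁻¹) • φ ^ k

end Artin

section Deformations
variable {E : Type*} [NormedAddCommGroup E] [NormedSpace ℝ E] [FiniteDimensional ℝ E]
  {X : Type*} [TopologicalSpace X] [ChartedSpace E X] [IsManifold 𝓘(ℝ, E) ∞ X]
  {E' : Type*} [NormedAddCommGroup E'] [NormedSpace ℝ E'] [FiniteDimensional ℝ E']
  {Z : Type*} [TopologicalSpace Z] [ChartedSpace E' Z] [IsManifold 𝓘(ℝ, E') ∞ Z]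
  {G : GCStructure E X}

/-- The `A`-linear restriction of vector fields. -/
def resVecA (A : Type) [CommRing A] [Algebra ℝ A] {U V : Opens X} (h : V ≤ U) :
    A ⊗[ℝ] Vec E U →ₗ[A] A ⊗[ℝ] Vec E V :=
  LinearMap.baseChange A (M := Vec E U) (N := Vec E V) (resVec h)

/-- The `A`-linear restriction of functions. -/
def resFnA (A : Type) [CommRing A] [Algebra ℝ A] {U V : Opens X} (h : V ≤ U) :
    A ⊗[ℝ] Fn E U →ₗ[A] A ⊗[ℝ] Fn E V :=
  LinearMap.baseChange A (M := Fn E U) (N := Fn E V) (resFn h)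

/-- The `A`-linear restriction of 1-forms. -/
def resFormA (A : Type) [CommRing A] [Algebra ℝ A] {U V : Opens X} (h : V ≤ U) :
    A ⊗[ℝ] Form E U →ₗ[A] A ⊗[ℝ] Form E V :=
  LinearMap.baseChange A (M := Form E U) (N := Form E V) (resForm h)

/-- The `A`-linear differential of functions. -/
def d0A (A : Type) [CommRing A] [Algebra ℝ A] {U : Opens X} :
    A ⊗[ℝ] Fn E U →ₗ[A] A ⊗[ℝ] Form E U :=
  LinearMap.baseChange A (M := Fn E U) (N := Form E U) d0

/-- The `A`-linear map `ξ ↦ (ξ, 0)`. -/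
def secVecA (A : Type) [CommRing A] [Algebra ℝ A] {U : Opens X} :
    A ⊗[ℝ] Vec E U →ₗ[A] A ⊗[ℝ] Sec E U :=
  LinearMap.baseChange A (M := Vec E U) (N := Sec E U) secVec

/-- The `A`-linear map `a ↦ (0, a)`. -/
def secFormA (A : Type) [CommRing A] [Algebra ℝ A] {U : Opens X} :
    A ⊗[ℝ] Form E U →ₗ[A] A ⊗[ℝ] Sec E U :=
  LinearMap.baseChange A (M := Form E U) (N := Sec E U) secForm

namespace GCBrane
variable (B : GCBrane E' Z G) (U : Opens X)

/-- `Z ∩ U ∩ W_I`. -/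
abbrev WU (I : B.κ) : Opens Z := pre B.emb U ⊓ B.W I

/-- `Z ∩ U ∩ W_I ∩ W_J`. -/
abbrev WU2 (I J : B.κ) : Opens Z := pre B.emb U ⊓ (B.W I ⊓ B.W J)

variable (A : Type) [CommRing A] [Algebra ℝ A]

/-- The `A`-linear pullback of functions to `Z`. -/
def rho0 : A ⊗[ℝ] Fn E U →ₗ[A] A ⊗[ℝ] Fn E' (pre B.emb U) :=
  LinearMap.baseChange A (M := Fn E U) (N := Fn E' (pre B.emb U)) (pullFn B.emb)

/-- The `A`-linear pullback of 1-forms to `Z`. -/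
def rho1 : A ⊗[ℝ] Form E U →ₗ[A] A ⊗[ℝ] Form E' (pre B.emb U) :=
  LinearMap.baseChange A (M := Form E U) (N := Form E' (pre B.emb U)) (pullForm B.emb)

/-- The data of an `A`-deformation of the restriction of a brane to `U`: maps from functions and
1-forms on `U` to functions and 1-forms on `Z ∩ U`, functions `f_IJ` and 1-forms `u_I`. The deformed
line bundle is given by `c_IJ + f_IJ` and `a_I + u_I`. -/
structure DefData where
  rhoFn : A ⊗[ℝ] Fn E U →ₗ[A] A ⊗[ℝ] Fn E' (pre B.emb U)
  rhoForm : A ⊗[ℝ] Form E U →ₗ[A] A ⊗[ℝ] Form E' (pre B.emb U)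
  f : ∀ I J, A ⊗[ℝ] Fn E' (B.WU2 U I J)
  u : ∀ I, A ⊗[ℝ] Form E' (B.WU U I)

variable {A} {B U}

/-- `c_IJ + f_IJ`. -/
def DefData.cHat (D : B.DefData U A) (I J : B.κ) : A ⊗[ℝ] Fn E' (B.WU2 U I J) :=
  1 ⊗ₜ resFn inf_le_right (B.c I J) + D.f I J

/-- `a_I + u_I`. -/
def DefData.aHat (D : B.DefData U A) (I : B.κ) : A ⊗[ℝ] Form E' (B.WU U I) :=
  1 ⊗ₜ resForm inf_le_right (B.a I) + D.u I

variable [IsArt A]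

/-- The deformed pullback maps are `ρ e^ξ`. -/
def DefData.IsFlow (D : B.DefData U A) (ξ : A ⊗[ℝ] Vec E U) : Prop :=
  ξ ∈ mTen A (Vec E U) ∧ D.rhoFn = B.rho0 U A ∘ₗ expNil (derA A ξ) ∧
    D.rhoForm = B.rho1 U A ∘ₗ expNil (lieFormA A ξ)

/-- The conditions for an `A`-deformation of the restriction of a brane to `U`. -/
structure DefData.IsDef (D : B.DefData U A) : Prop where
  flow : ∃ ξ, D.IsFlow ξ
  f_mem : ∀ I J, D.f I J ∈ mTen A (Fn E' (B.WU2 U I J))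
  u_mem : ∀ I, D.u I ∈ mTen A (Form E' (B.WU U I))
  connection : ∀ I J, resFormA A (V := B.WU2 U I J) (inf_le_inf_left _ inf_le_right) (D.u J) -
    resFormA A (inf_le_inf_left _ inf_le_left) (D.u I) = d0A A (D.f I J)
  cocycle : ∀ I J K,
    resFnA A (V := pre B.emb U ⊓ (B.W I ⊓ B.W J ⊓ B.W K))
        (inf_le_inf_left _ (le_inf (inf_le_left.trans inf_le_right) inf_le_right)) (D.f J K) -
      resFnA A (inf_le_inf_left _ (le_inf (inf_le_left.trans inf_le_left) inf_le_right)) (D.f I K) +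
      resFnA A (inf_le_inf_left _ inf_le_left) (D.f I J) = 0

variable (B) in
/-- The sections of `TX ⊕ T*X` over `V` whose restriction to `Z` is a section of `T(Z, F)`. -/
def KB (V : Opens X) : Submodule ℝ (Sec E V) := (B.TT (pre B.emb V)).comap (rSec B.emb)

/-- The action of `e^{(0, u)} e^{(ξ, 0)}` on sections of `TX ⊕ T*X`. -/
def gAct {V : Opens X} (ξ : A ⊗[ℝ] Vec E V) (u : A ⊗[ℝ] Form E V) :
    A ⊗[ℝ] Sec E V →ₗ[A] A ⊗[ℝ] Sec E V :=
  expNil (dorfA A (secFormA A u)) ∘ₗ expNil (dorfA A (secVecA A ξ))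

/-- The action of the inverse `e^{(-ξ, 0)} e^{(0, -u)}` on sections of `TX ⊕ T*X`. -/
def gInv {V : Opens X} (ξ : A ⊗[ℝ] Vec E V) (u : A ⊗[ℝ] Form E V) :
    A ⊗[ℝ] Sec E V →ₗ[A] A ⊗[ℝ] Sec E V :=
  expNil (dorfA A (secVecA A (-ξ))) ∘ₗ expNil (dorfA A (secFormA A (-u)))

variable (B) in
/-- `g = e^{(0, u)} e^{(ξ, 0)}` is compatible with the generalized complex structure: the pairing
`⟨g J g⁻¹ x, y⟩` vanishes on `Z` for all `x, y` in `A ⊗ KB`. -/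
def CompatElt (V : Opens X) (ξ : A ⊗[ℝ] Vec E V) (u : A ⊗[ℝ] Form E V) : Prop :=
  ∀ x ∈ (B.KB V).baseChange A, ∀ y ∈ (B.KB V).baseChange A,
    B.rho0 V A (pairA A (gAct ξ u
      (LinearMap.baseChange A (M := Sec E V) (N := Sec E V) G.JSec (gInv ξ u x))) y) = 0

/-- Compatibility of an `A`-deformation with the generalized complex structure. -/
def DefData.Compatible (D : B.DefData U A) : Prop :=
  ∃ ξ, D.IsFlow ξ ∧ ∀ I, ∃ (V : Opens X) (hV : V ≤ U) (h : pre B.emb V = B.WU U I),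
    ∃ u ∈ mTen A (Form E V), resFormA A h.ge (B.rho1 V A u) = D.u I ∧
      B.CompatElt V (resVecA A hV ξ) u

/-- Two `A`-deformations are isomorphic: for some `τ` and `g_I` the map `e^τ` carries the first
deformed pullback to the second, and `g_I` is an isomorphism from the second deformed line bundle to
the image of the first under `e^τ`. -/
def DefData.Iso (D D' : B.DefData U A) : Prop :=
  ∃ τ ∈ mTen A (Vec E' (pre B.emb U)), ∃ g : ∀ I, A ⊗[ℝ] Fn E' (B.WU U I),
    (∀ I, g I ∈ mTen A (Fn E' (B.WU U I))) ∧
    D'.rhoFn = expNil (derA A τ) ∘ₗ D.rhoFn ∧ D'.rhoForm = expNil (lieFormA A τ) ∘ₗ D.rhoForm ∧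
    (∀ I, expNil (lieFormA A (resVecA A (V := B.WU U I) inf_le_left τ)) (D.aHat I) =
      D'.aHat I + d0A A (g I)) ∧
    ∀ I J, expNil (derA A (resVecA A (V := B.WU2 U I J) inf_le_left τ)) (D.cHat I J) =
      D'.cHat I J + (resFnA A (inf_le_inf_left _ inf_le_right) (g J) -
        resFnA A (inf_le_inf_left _ inf_le_left) (g I))

variable (B) in
/-- The deformation `B · e^x` for `x = (ξ, v)`: since `e^x = e^{(0, w)} e^{(ξ, 0)}` with
`w = ∫₀¹ e^{tξ} v dt`, it is given by `ρ e^ξ`, `c_IJ` and `a_I + ρ(w)`. -/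
def act (x : A ⊗[ℝ] Sec E U) : B.DefData U A where
  rhoFn := B.rho0 U A ∘ₗ expNil (derA A (ancA A x))
  rhoForm := B.rho1 U A ∘ₗ expNil (lieFormA A (ancA A x))
  f _ _ := 0
  u _ := resFormA A inf_le_left (B.rho1 U A (intExp (lieFormA A (ancA A x)) (cotA A x)))

variable (B U) in
/-- The restriction of the brane to `U` has trivializable deformations. -/
def Trivializable : Prop :=
  ∀ (A : Type) [CommRing A] [Algebra ℝ A] [IsArt A] (D : B.DefData U A), D.IsDef → D.Compatible →
    ∃ x ∈ IsLocalRing.maximalIdeal A • (G.T U).baseChange A, D.Iso (B.act x)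

variable (B) in
/-- The brane has locally trivializable deformations. -/
def LocallyTrivializable : Prop := ∀ z, ∃ U : Opens X, B.emb z ∈ U ∧ B.Trivializable U

variable (B) in
/-- An open cover of `X` by sets on which the brane has trivializable deformations. -/
structure AdaptedCover {ι : Type*} (U : ι → Opens X) : Prop where
  cover : ⨆ a, U a = ⊤
  triv : ∀ a, B.Trivializable (U a)

end GCBrane
end Deformations

end GCB

end

/-!
The cohomology of the total complex and the cohomology of the Lie algebroid `l` are compared by a
Čech argument on `Z`: the generalized normal bundle has partitions of unity, so the only
obstruction to trivializing a cocycle is the one measured by `δ_l`, and this obstruction disappears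
locally because the brane has trivializable deformations.

*The real form of `δ_l μ`.* All complex computations are carried out on real sections. Sections of
`L` have the form `a - iJa` (`holo`), and for a section `x` of `TX ⊕ T*X` the cochain `δ_L μ(x)` is,
up to a constant, the complexification of the tensor `ω_x(a, b) = ⟨(L_x J) a, b⟩`
(`AlmostGC.omega`). Hence `x` lies in `T(U)` exactly if `ω_x = 0` (`GCStructure.mem_T_iff`), and
exact forms lie in `T(U)` (`GCStructure.exact_mem_T`). Because the curvature `F` is closed, sections
whose restrictions lie in `T(Z, F)` are closed under the Dorfman bracket
(`GCBrane.dorf_mem_TT`); this gives `GCBrane.isDelta_iff`, by which `δ_l μ(q(x))` is the restriction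
`zetaFib x` of `ω_x` to `l`. A cochain that is locally of this form is smooth and closed
(`GCBrane.IsLocallyDelta.mem_Z2`, which rests on `δ² = 0` for `L`, `GCStructure.deltaHalf_closed`).
Every smooth section of the dual of `l` is `μ(q(x))` for a global section `x`
(`GCBrane.exists_mu_eq`).

*Trivializable deformations.* A section `x` over `U` with `δ_l μ(q(x)) = 0` is an infinitesimal
deformation of the brane. Trivializing the corresponding deformation over the dual numbers gives an
element `x'` of `T(U)` that differs from `x` along `Z` by an infinitesimal automorphism `(τ, f)` of
the line bundle (`GCBrane.Trivializable.exists_correction`).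

*The comparison map.* The components of a cocycle in the functions on `Z` form a Čech 2-cocycle, so
after subtracting a coboundary these components and the component in `H(X)` vanish
(`GCBrane.exists_reduced_cocycle`). Then the `q(r(x_ab))` form a Čech 1-cocycle with values in the
generalized normal bundle, hence `q(r(x_ab)) = σ_b - σ_a`, and since `x_ab` lies in `T` the
`δ_l μ(σ_a)` agree on overlaps (`GCBrane.exists_lifts`). If the cocycle is a coboundary, then the
`σ_a` can be changed by elements of `T(U_a)` so as to glue to a global section, and the class of `ζ`
vanishes (`GCBrane.Lifts.mem_B2`); so the class of `ζ` depends only on the class of the cocycle, and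
the map is linear. Conversely, if `ζ = δ_l μ(q(x))` for a global `x`, then the sections `σ_a - q(x)`
are infinitesimal deformations; their trivializations over the `U_a` exhibit the cocycle as a
coboundary (`GCBrane.Lifts.mem_range`), which is injectivity.
-/

noncomputable section

namespace GCB

/-! ### Partitions of unity on open sets -/

section Partition
variable {E : Type*} [NormedAddCommGroup E] [NormedSpace ℝ E] [FiniteDimensional ℝ E]
  {M : Type*} [TopologicalSpace M] [ChartedSpace E M] [IsManifold 𝓘(ℝ, E) ∞ M]

variable (E) in
/-- A partition of unity on the open set `V`, subordinate to the sets `O j`. Every point of `V` has a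
neighbourhood `N` on which only finitely many of the functions are nonzero, each of these belonging
to a set `O j` that contains `N`. -/
structure IsPartition {J : Type*} (V : Opens M) (O : J → Opens M) (φ : J → M → ℝ) : Prop where
  smooth : ∀ j, ContMDiffOn 𝓘(ℝ, E) 𝓘(ℝ) ∞ (φ j) V
  finite : ∀ x ∈ V, ∃ (N : Opens M) (T : Finset J), x ∈ N ∧ N ≤ V ∧ (∀ j ∈ T, N ≤ O j) ∧
    ∀ y ∈ N, ∀ j ∉ T, φ j y = 0
  sum_eq : ∀ x ∈ V, ∑ᶠ j, φ j x = 1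

open Classical in
theorem exists_isPartition [T2Space M] [SecondCountableTopology M] {J : Type*} (V : Opens M)
    (O : J → Opens M) (hc : ∀ x ∈ V, ∃ j, x ∈ O j) : ∃ φ : J → M → ℝ, IsPartition E V O φ := by
  have : LocallyCompactSpace M := ChartedSpace.locallyCompactSpace E M
  have : LocallyCompactSpace V := V.2.locallyCompactSpace
  obtain ⟨ρ, hρ⟩ := SmoothPartitionOfUnity.exists_isSubordinate 𝓘(ℝ, E) (M := V) isClosed_univ
    (fun j => ((↑) : V → M) ⁻¹' (O j)) (fun j => (O j).2.preimage continuous_subtype_val)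
    (fun x _ => by
      obtain ⟨j, hj⟩ := hc x x.2
      exact Set.mem_iUnion.2 ⟨j, hj⟩)
  let φ : J → M → ℝ := fun j x => if h : x ∈ V then ρ j ⟨x, h⟩ else 0
  have hφ : ∀ j (x : V), φ j x = ρ j x := fun j x => dif_pos x.2
  refine ⟨φ, fun j x hx => ?_, fun x hx => ?_, fun x hx => ?_⟩
  · refine ContMDiffAt.contMDiffWithinAt ?_
    refine (contMDiffAt_subtype_iff (U := V) (x := ⟨x, hx⟩)).1 ?_
    exact ((ρ j).contMDiff _).congr_of_eventuallyEq (Filter.Eventually.of_forall (hφ j))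
  · have h1 := ρ.eventually_finsupport_subset (x₀ := ⟨x, hx⟩)
    have h2 : ∀ᶠ y : V in 𝓝 ⟨x, hx⟩, ∀ j ∈ ρ.fintsupport ⟨x, hx⟩, (y : M) ∈ O j := by
      rw [Filter.eventually_all_finset]
      intro j hj
      have : (⟨x, hx⟩ : V) ∈ ((↑) : V → M) ⁻¹' (O j) := hρ j ((ρ.mem_fintsupport_iff _ j).1 hj)
      exact ((O j).2.preimage continuous_subtype_val).mem_nhds this
    obtain ⟨N, hN, hNo, hxN⟩ := eventually_nhds_iff.1 (h1.and h2)
    refine ⟨⟨(↑) '' N, V.2.isOpenMap_subtype_val _ hNo⟩, ρ.fintsupport ⟨x, hx⟩, ⟨_, hxN, rfl⟩,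
      ?_, ?_, ?_⟩
    · rintro _ ⟨y, _, rfl⟩
      exact y.2
    · rintro j hj _ ⟨y, hy, rfl⟩
      exact (hN y hy).2 j hj
    · rintro _ ⟨y, hy, rfl⟩ j hj
      rw [hφ]
      by_contra h
      exact hj ((hN y hy).1 ((ρ.mem_finsupport _).2 h))
  · have := ρ.sum_eq_one (x := ⟨x, hx⟩) trivial
    simpa [φ, hx] using this

theorem IsPartition.finsum_eq {J : Type*} {V : Opens M} {O : J → Opens M} {φ : J → M → ℝ}
    (h : IsPartition E V O φ) {x : M} (hx : x ∈ V) {P : Type*} [AddCommGroup P] [Module ℝ P]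
    (v : J → P) :
    ∃ T : Finset J, (∀ j ∈ T, x ∈ O j) ∧ ∑ᶠ j, φ j x • v j = ∑ j ∈ T, φ j x • v j ∧
      ∑ j ∈ T, φ j x = 1 := by
  obtain ⟨N, T, hxN, -, hT, h0⟩ := h.finite x hx
  refine ⟨T, fun j hj => hT j hj hxN, ?_, ?_⟩
  · refine finsum_eq_sum_of_support_subset _ fun j hj => ?_
    by_contra hj'
    exact hj (by simp [h0 x hxN j hj'])
  · rw [← h.sum_eq x hx]
    refine (finsum_eq_sum_of_support_subset _ fun j hj => ?_).symm
    by_contra hj'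
    exact hj (h0 x hxN j hj')

/-- An affine condition that holds for the members `v j` with `x ∈ O j` holds for their average. -/
theorem IsPartition.map_finsum {J : Type*} {V : Opens M} {O : J → Opens M} {φ : J → M → ℝ}
    (h : IsPartition E V O φ) {x : M} (hx : x ∈ V) {P Q : Type*} [AddCommGroup P] [Module ℝ P]
    [AddCommGroup Q] [Module ℝ Q] (v : J → P) (L : P →ₗ[ℝ] Q) (q : Q)
    (hq : ∀ j, x ∈ O j → L (v j) = q) : L (∑ᶠ j, φ j x • v j) = q := by
  obtain ⟨T, hT, e, e1⟩ := h.finsum_eq hx v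
  rw [e, map_sum, Finset.sum_congr rfl (fun j hj => by rw [map_smul, hq j (hT j hj)]),
    ← Finset.sum_smul, e1, one_smul]

/-- A class of sections of a family of vector spaces which, like the smooth sections of a bundle, is
local and closed under linear combinations with smooth coefficients. -/
structure IsModuleSheaf {F : M → Type*} [∀ x, AddCommGroup (F x)] [∀ x, Module ℝ (F x)]
    (S : (∀ x, F x) → Set M → Prop) : Prop where
  congr_loc : ∀ (s : ∀ x, F x) (V : Set M), (∀ x ∈ V, ∃ O : Opens M, x ∈ O ∧ ∃ t, S t O ∧
    ∀ y ∈ O, s y = t y) → S s V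
  mono : ∀ (s : ∀ x, F x) (V W : Set M), W ⊆ V → S s V → S s W
  zero : ∀ V : Set M, S (fun _ => 0) V
  add : ∀ (s t : ∀ x, F x) (V : Set M), S s V → S t V → S (fun x => s x + t x) V
  smul : ∀ (g : M → ℝ) (s : ∀ x, F x) (V : Set M), ContMDiffOn 𝓘(ℝ, E) 𝓘(ℝ) ∞ g V → S s V →
    S (fun x => g x • s x) V

variable {F : M → Type*} [∀ x, AddCommGroup (F x)] [∀ x, Module ℝ (F x)]
  {S : (∀ x, F x) → Set M → Prop}

theorem IsModuleSheaf.sum (hS : IsModuleSheaf (E := E) S) {J : Type*} (T : Finset J)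
    (s : J → ∀ x, F x) (V : Set M) (h : ∀ j ∈ T, S (s j) V) : S (fun x => ∑ j ∈ T, s j x) V := by
  classical
  induction T using Finset.induction_on with
  | empty => simpa using hS.zero V
  | insert a T ha ih =>
    simp only [Finset.sum_insert ha]
    exact hS.add _ _ _ (h a (by simp)) (ih fun j hj => h j (by simp [hj]))

theorem IsModuleSheaf.glue (hS : IsModuleSheaf (E := E) S) {J : Type*} {V : Opens M}
    {O : J → Opens M} {φ : J → M → ℝ} (h : IsPartition E V O φ) (s : J → ∀ x, F x)
    (hs : ∀ j, S (s j) (O j)) : S (fun x => ∑ᶠ j, φ j x • s j x) V := by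
  refine hS.congr_loc _ _ fun x hx => ?_
  obtain ⟨N, T, hxN, hNV, hT, h0⟩ := h.finite x hx
  refine ⟨N, hxN, fun x => ∑ j ∈ T, φ j x • s j x, hS.sum T _ _ fun j hj => ?_, fun y hy => ?_⟩
  · exact hS.smul _ _ _ ((h.smooth j).mono hNV) (hS.mono _ _ _ (hT j hj) (hs j))
  · refine finsum_eq_sum_of_support_subset _ fun j hj => ?_
    by_contra hj'
    exact hj (by simp [h0 y hy j hj'])

variable (E) in
/-- A cutoff function around `y` inside `U`: it is `1` near `y`, and multiplying by it turns
sections over `U` into global sections. -/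
structure IsCutoff (U : Opens M) (y : M) (χ : M → ℝ) : Prop where
  eq_one : ∀ᶠ x in 𝓝 y, χ x = 1
  smooth : ContMDiff 𝓘(ℝ, E) 𝓘(ℝ) ∞ χ
  eq_zero : ∀ x ∉ U, ∃ N : Opens M, x ∈ N ∧ ∀ x' ∈ N, χ x' = 0

theorem exists_isCutoff [T2Space M] [SecondCountableTopology M] (U : Opens M) {y : M}
    (hy : y ∈ U) : ∃ χ : M → ℝ, IsCutoff E U y χ := by
  obtain ⟨φ, hφ⟩ := exists_isPartition (E := E) (⊤ : Opens M)
    (fun b : Bool => if b then U else ⟨{y}ᶜ, isOpen_compl_singleton⟩) (fun x _ => by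
      by_cases hx : x = y
      · exact ⟨true, by simpa [hx] using hy⟩
      · exact ⟨false, by simpa using! hx⟩)
  refine ⟨φ true, ?_, contMDiffOn_univ.1 (hφ.smooth true), fun x hx => ?_⟩
  · obtain ⟨N, T, hN, -, hT, h0⟩ := hφ.finite y trivial
    have hf : false ∉ T := fun h => by
      have := hT false h hN
      exact this rfl
    filter_upwards [N.2.mem_nhds hN] with x hx
    have h1 := hφ.sum_eq x trivial
    rw [finsum_eq_sum_of_fintype] at h1
    simpa [h0 x hx false hf] using h1
  · obtain ⟨N, T, hN, -, hT, h0⟩ := hφ.finite x trivial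
    exact ⟨N, hN, fun x' hx' => h0 x' hx' true fun h => hx (by simpa using hT true h hN)⟩

theorem IsCutoff.apply_self {U : Opens M} {y : M} {χ : M → ℝ} (h : IsCutoff E U y χ) : χ y = 1 :=
  h.eq_one.self_of_nhds

theorem IsModuleSheaf.cutoff (hS : IsModuleSheaf (E := E) S) {U : Opens M} {y : M} {χ : M → ℝ}
    (h : IsCutoff E U y χ) {s : ∀ x, F x} (hs : S s U) (V : Set M) : S (fun x => χ x • s x) V := by
  refine hS.congr_loc _ _ fun x _ => ?_
  by_cases hx : x ∈ U
  · exact ⟨U, hx, _, hS.smul _ _ _ h.smooth.contMDiffOn hs, fun _ _ => rfl⟩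
  · obtain ⟨N, hN, h0⟩ := h.eq_zero x hx
    exact ⟨N, hN, _, hS.zero _, fun x' hx' => by simp [h0 x' hx']⟩

theorem isModuleSheaf_fun {P : Type*} [NormedAddCommGroup P] [NormedSpace ℝ P] :
    IsModuleSheaf (E := E) (M := M) (F := fun _ => P)
      (fun s V => ContMDiffOn 𝓘(ℝ, E) 𝓘(ℝ, P) ∞ s V) where
  congr_loc s V h x hx := by
    obtain ⟨O, hxO, t, ht, hst⟩ := h x hx
    refine ContMDiffAt.contMDiffWithinAt ?_
    exact (ht.contMDiffAt (O.2.mem_nhds hxO)).congr_of_eventuallyEq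
      (Filter.mem_of_superset (O.2.mem_nhds hxO) hst)
  mono _ _ _ h hs := hs.mono h
  zero _ := contMDiffOn_const
  add _ _ _ hs ht := hs.add ht
  smul _ _ _ hg hs := hg.smul hs

end Partition

section Along
variable {E : Type*} [NormedAddCommGroup E] [NormedSpace ℝ E] [FiniteDimensional ℝ E]
  {M : Type*} [TopologicalSpace M] [ChartedSpace E M] [IsManifold 𝓘(ℝ, E) ∞ M]
  {E' : Type*} [NormedAddCommGroup E'] [NormedSpace ℝ E'] [FiniteDimensional ℝ E']
  {N : Type*} [TopologicalSpace N] [ChartedSpace E' N] [IsManifold 𝓘(ℝ, E') ∞ N]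
  {f : N → M}

theorem isModuleSheaf_vec (hf : ContMDiff 𝓘(ℝ, E') 𝓘(ℝ, E) ∞ f) :
    IsModuleSheaf (E := E') (M := N) (F := fun y => TangentSpace 𝓘(ℝ, E) (f y))
      (SmoothVec E' E f) where
  congr_loc s V h x hx := by
    obtain ⟨O, hxO, t, ht, hst⟩ := h x hx
    refine ContMDiffAt.contMDiffWithinAt ?_
    exact (ContMDiffOn.contMDiffAt ht (O.2.mem_nhds hxO)).congr_of_eventuallyEq
      (Filter.mem_of_superset (O.2.mem_nhds hxO) fun y hy => by simp [hst y hy])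
  mono _ _ _ h hs := ContMDiffOn.mono hs h
  zero _ := smoothVec_zero hf.contMDiffOn
  add _ _ _ hs ht := hs.add ht
  smul _ _ _ hg hs := hs.smul hg

theorem isModuleSheaf_form (hf : ContMDiff 𝓘(ℝ, E') 𝓘(ℝ, E) ∞ f) :
    IsModuleSheaf (E := E') (M := N) (F := fun y => TangentSpace 𝓘(ℝ, E) (f y) →L[ℝ] ℝ)
      (SmoothForm E' E f) where
  congr_loc s V h x hx := by
    obtain ⟨O, hxO, t, ht, hst⟩ := h x hx
    refine ContMDiffAt.contMDiffWithinAt ?_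
    exact (ContMDiffOn.contMDiffAt ht (O.2.mem_nhds hxO)).congr_of_eventuallyEq
      (Filter.mem_of_superset (O.2.mem_nhds hxO) fun y hy => by simp [hst y hy])
  mono _ _ _ h hs := ContMDiffOn.mono hs h
  zero _ := smoothForm_zero hf.contMDiffOn
  add _ _ _ hs ht := hs.add ht
  smul _ _ _ hg hs := hs.smul hg

/-- Sections of the pullback of `TM ⊕ T*M` along `f`. -/
theorem isModuleSheaf_sec (hf : ContMDiff 𝓘(ℝ, E') 𝓘(ℝ, E) ∞ f) :
    IsModuleSheaf (E := E') (M := N) (F := fun y => GT E (f y))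
      (fun s V => SmoothVec E' E f (fun y => (s y).1) V ∧ SmoothForm E' E f (fun y => (s y).2) V)
      where
  congr_loc s V h := by
    refine ⟨(isModuleSheaf_vec hf).congr_loc _ _ fun x hx => ?_,
      (isModuleSheaf_form hf).congr_loc _ _ fun x hx => ?_⟩
    · obtain ⟨O, hxO, t, ht, hst⟩ := h x hx
      exact ⟨O, hxO, _, ht.1, fun y hy => by rw [hst y hy]⟩
    · obtain ⟨O, hxO, t, ht, hst⟩ := h x hx
      exact ⟨O, hxO, _, ht.2, fun y hy => by rw [hst y hy]⟩
  mono _ _ _ h hs := ⟨ContMDiffOn.mono hs.1 h, ContMDiffOn.mono hs.2 h⟩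
  zero _ := ⟨smoothVec_zero hf.contMDiffOn, smoothForm_zero hf.contMDiffOn⟩
  add _ _ _ hs ht := ⟨hs.1.add ht.1, hs.2.add ht.2⟩
  smul _ _ _ hg hs := ⟨hs.1.smul hg, hs.2.smul hg⟩

end Along

/-! ### Local frames, extension of vectors, and derivations -/

section Frames
variable {E : Type*} [NormedAddCommGroup E] [NormedSpace ℝ E] [FiniteDimensional ℝ E]
  {M : Type*} [TopologicalSpace M] [ChartedSpace E M] [IsManifold 𝓘(ℝ, E) ∞ M]

variable (E) in
/-- A smooth frame `e` of the tangent bundle over `O` with its dual coframe `ε`. -/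
structure IsFrame (O : Opens M) {κ : Type} [Fintype κ] (e : κ → ∀ x : M, TangentSpace 𝓘(ℝ, E) x)
    (ε : κ → ∀ x : M, TangentSpace 𝓘(ℝ, E) x →L[ℝ] ℝ) : Prop where
  vec : ∀ i, SmoothVec E E (fun x => x) (e i) O
  form : ∀ i, SmoothForm E E (fun x => x) (ε i) O
  sum_eq : ∀ x ∈ O, ∀ v, ∑ i, ε i x v • e i x = v

theorem exists_isFrame (x₀ : M) : ∃ O : Opens M, x₀ ∈ O ∧
    ∃ (e : Fin (Module.finrank ℝ E) → ∀ x : M, TangentSpace 𝓘(ℝ, E) x)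
      (ε : Fin (Module.finrank ℝ E) → ∀ x : M, TangentSpace 𝓘(ℝ, E) x →L[ℝ] ℝ),
      IsFrame E O e ε := by
  set t := trivializationAt E (TangentSpace 𝓘(ℝ, E) : M → Type _) x₀ with ht
  let b := Module.finBasis ℝ E
  refine ⟨⟨t.baseSet, t.open_baseSet⟩, FiberBundle.mem_baseSet_trivializationAt' x₀,
    fun i x => t.symm x (b i),
    fun i x => (LinearMap.toContinuousLinearMap (b.coord i)).comp (t.continuousLinearMapAt ℝ x),
    fun i x hx => ?_, fun i => smoothForm_of_apply contMDiffOn_id fun V hV ξ hξ x hx => ?_,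
    fun x hx v => ?_⟩
  · rw [(t.contMDiffWithinAt_section _ hx)]
    refine (contMDiffWithinAt_const (c := b i)).congr_of_mem (fun z hz => ?_) hx
    rw [t.apply_mk_symm hz]
  · have h1 := ((t.contMDiffWithinAt_section _ hx.1).1 (hξ x hx.2)).mono
      (Set.inter_subset_right (s := t.baseSet))
    have h2 : ContMDiff 𝓘(ℝ, E) 𝓘(ℝ) ∞ (LinearMap.toContinuousLinearMap (b.coord i)) :=
      (LinearMap.toContinuousLinearMap (b.coord i)).contMDiff
    refine ContMDiffWithinAt.congr_of_mem (h2.contMDiffAt.comp_contMDiffWithinAt x h1)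
      (fun z hz => ?_) hx
    have hz1 : z ∈ t.baseSet := hz.1
    simp [t.coe_linearMapAt_of_mem (R := ℝ) hz1]
  · have hx' : x ∈ t.baseSet := hx
    have h1 := congrArg (t.symmL ℝ x) (b.sum_repr (t.continuousLinearMapAt ℝ x v))
    rw [t.symmL_continuousLinearMapAt hx', map_sum] at h1
    refine Eq.trans (Finset.sum_congr rfl fun i _ => ?_) h1
    rw [map_smul, t.symmL_apply hx']
    rfl

theorem mvfderiv_congr {P : Type*} [NormedAddCommGroup P] [NormedSpace ℝ P] {f g : M → P} {x : M}
    (h : f =ᶠ[𝓝 x] g) : mvfderiv 𝓘(ℝ, E) f x = mvfderiv 𝓘(ℝ, E) g x := by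
  unfold mvfderiv
  rw [h.mfderiv_eq, h.eq_of_nhds]

theorem mvfderiv_comp_apply {E' : Type*} [NormedAddCommGroup E'] [NormedSpace ℝ E']
    {N : Type*} [TopologicalSpace N] [ChartedSpace E' N] {P : Type*} [NormedAddCommGroup P]
    [NormedSpace ℝ P] {g : M → P} {f : N → M} {y : N}
    (hg : MDifferentiableAt 𝓘(ℝ, E) 𝓘(ℝ, P) g (f y))
    (hf : MDifferentiableAt 𝓘(ℝ, E') 𝓘(ℝ, E) f y) (v : TangentSpace 𝓘(ℝ, E') y) :
    mvfderiv 𝓘(ℝ, E') (fun y => g (f y)) y v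
      = mvfderiv 𝓘(ℝ, E) g (f y) (mfderiv 𝓘(ℝ, E') 𝓘(ℝ, E) f y v) := by
  have h := mfderiv_comp_apply (I := 𝓘(ℝ, E')) (I' := 𝓘(ℝ, E)) (I'' := 𝓘(ℝ, P)) y hg hf v
  exact h

variable [T2Space M] [SecondCountableTopology M]

theorem exists_fn_eq_near {U : Opens M} {x : M} (hx : x ∈ U) {f : M → ℝ}
    (hf : ContMDiffOn 𝓘(ℝ, E) 𝓘(ℝ) ∞ f U) : ∃ g : Fn E (⊤ : Opens M), ∀ᶠ y in 𝓝 x, g.1 y = f y := by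
  obtain ⟨χ, hχ⟩ := exists_isCutoff (E := E) U hx
  refine ⟨⟨fun y => χ y • f y, fun _ h => absurd trivial h,
    isModuleSheaf_fun.cutoff hχ hf _⟩, ?_⟩
  filter_upwards [hχ.eq_one] with y hy
  rw [hy, one_smul]

/-- A tangent vector that annihilates all smooth functions is zero. -/
theorem tangent_eq_zero {x : M} {v : TangentSpace 𝓘(ℝ, E) x}
    (h : ∀ f : Fn E (⊤ : Opens M), mvfderiv 𝓘(ℝ, E) f.1 x v = 0) : v = 0 := by
  have hinv := isInvertible_mfderiv_extChartAt (I := 𝓘(ℝ, E)) (mem_extChartAt_source (I := 𝓘(ℝ, E)) x)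
  have hs : ContMDiffOn 𝓘(ℝ, E) 𝓘(ℝ, E) ∞ (extChartAt 𝓘(ℝ, E) x) (extChartAt 𝓘(ℝ, E) x).source := by
    rw [extChartAt_source]
    exact contMDiffOn_extChartAt
  let O : Opens M := ⟨(extChartAt 𝓘(ℝ, E) x).source, isOpen_extChartAt_source x⟩
  have hx : x ∈ O := mem_extChartAt_source x
  refine hinv.injective ?_
  rw [map_zero]
  refine (Module.forall_dual_apply_eq_zero_iff ℝ (V := E) _).1 fun φ => ?_
  have hφ : ContMDiff 𝓘(ℝ, E) 𝓘(ℝ) ∞ (LinearMap.toContinuousLinearMap φ) :=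
    (LinearMap.toContinuousLinearMap φ).contMDiff
  obtain ⟨g, hg⟩ := exists_fn_eq_near hx (hφ.comp_contMDiffOn hs)
  have e1 := h g
  rw [mvfderiv_congr hg] at e1
  have e2 := mvfderiv_comp_apply (g := LinearMap.toContinuousLinearMap φ)
    (f := extChartAt 𝓘(ℝ, E) x) (y := x) (hφ.mdifferentiable (by simp) _)
    ((hs.contMDiffAt (O.2.mem_nhds hx)).mdifferentiableAt (by simp)) v
  rw [show (LinearMap.toContinuousLinearMap φ ∘ (extChartAt 𝓘(ℝ, E) x))
    = fun y => LinearMap.toContinuousLinearMap φ (extChartAt 𝓘(ℝ, E) x y) from rfl, e2] at e1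
  rw [mvfderiv, mfderiv_eq_fderiv, ContinuousLinearMap.fderiv] at e1
  exact e1

/-- Every element of the fibre of `TM ⊕ T*M` extends to a global section. -/
theorem exists_sec {x : M} (v : GT E x) (U : Opens M) (hx : x ∈ U) : ∃ s : Sec E U, s.1 x = v := by
  obtain ⟨O, hxO, e, ε, h⟩ := exists_isFrame (E := E) x
  obtain ⟨χ, hχ⟩ := exists_isCutoff (E := E) O hxO
  have h1 : SmoothVec E E (fun x => x) (fun y => ∑ i, ε i x v.1 • e i y) O :=
    (isModuleSheaf_vec contMDiff_id).sum Finset.univ (fun i y => ε i x v.1 • e i y) _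
      fun i _ => SmoothVec.smul (g := fun _ => ε i x v.1) contMDiffOn_const (h.vec i)
  have h2 : SmoothForm E E (fun x => x) (fun y => ∑ i, v.2 (e i x) • ε i y) O :=
    (isModuleSheaf_form contMDiff_id).sum Finset.univ (fun i y => v.2 (e i x) • ε i y) _
      fun i _ => SmoothForm.smul (g := fun _ => v.2 (e i x)) contMDiffOn_const (h.form i)
  let s : Sec E (⊤ : Opens M) := ⟨fun y => (χ y • ∑ i, ε i x v.1 • e i y,
    χ y • ∑ i, v.2 (e i x) • ε i y),
    ⟨fun _ h => absurd trivial h, (isModuleSheaf_vec contMDiff_id).cutoff hχ h1 _⟩,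
    ⟨fun _ h => absurd trivial h, (isModuleSheaf_form contMDiff_id).cutoff hχ h2 _⟩⟩
  refine ⟨resSec le_top s, ?_⟩
  rw [resSec_apply _ _ hx]
  refine Prod.ext ?_ ?_
  · change χ x • ∑ i, ε i x v.1 • e i x = v.1
    rw [hχ.apply_self, one_smul, h.sum_eq x hxO]
  · change χ x • ∑ i, v.2 (e i x) • ε i x = v.2
    rw [hχ.apply_self, one_smul]
    ext w
    conv_rhs => rw [← h.sum_eq x hxO w, map_sum]
    simp [mul_comm]

theorem exists_vec {x : M} (v : TangentSpace 𝓘(ℝ, E) x) {U : Opens M} (hx : x ∈ U) :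
    ∃ ξ : Vec E U, ξ.1 x = v := by
  obtain ⟨s, hs⟩ := exists_sec (x := x) (v, 0) U hx
  exact ⟨anc s, congrArg Prod.fst hs⟩

end Frames

section Algebra
variable {E : Type*} [NormedAddCommGroup E] [NormedSpace ℝ E] [FiniteDimensional ℝ E]
  {M : Type*} [TopologicalSpace M] [ChartedSpace E M] [IsManifold 𝓘(ℝ, E) ∞ M]
  {U V : Opens M}

theorem fn_ext {f g : Fn E U} (h : ∀ x ∈ U, f.1 x = g.1 x) : f = g :=
  Subtype.ext (funext fun x => by
    by_cases hx : x ∈ U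
    · exact h x hx
    · rw [f.2.1 x hx, g.2.1 x hx])

theorem vec_ext {f g : Vec E U} (h : ∀ x ∈ U, f.1 x = g.1 x) : f = g :=
  Subtype.ext (funext fun x => by
    by_cases hx : x ∈ U
    · exact h x hx
    · rw [f.2.1 x hx, g.2.1 x hx])

theorem der_apply (ξ : Vec E U) (f : Fn E U) (x : M) :
    (der ξ f).1 x = mvfderiv 𝓘(ℝ, E) f.1 x (ξ.1 x) := rfl

theorem contr_apply (a : Form E U) (ξ : Vec E U) (x : M) : (contr a ξ).1 x = a.1 x (ξ.1 x) := rfl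

theorem lieVec_apply (ξ η : Vec E U) (x : M) :
    (lieVec ξ η).1 x = VectorField.mlieBracket 𝓘(ℝ, E) ξ.1 η.1 x := rfl

theorem d0_apply (f : Fn E U) {x : M} (hx : x ∈ U) : (d0 f).1 x = mvfderiv 𝓘(ℝ, E) f.1 x :=
  if_pos hx

/-- The product of a vector field with a function. -/
def smulVec (f : Fn E U) (ξ : Vec E U) : Vec E U :=
  ⟨fun x => f.1 x • ξ.1 x, fun x hx => by simp [ξ.2.1 x hx], SmoothVec.smul f.2.2 ξ.2.2⟩

theorem lieVec_swap (ξ η : Vec E U) : lieVec ξ η = - lieVec η ξ :=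
  Subtype.ext (funext fun _ => VectorField.mlieBracket_swap_apply)

theorem vec_minSmoothness (ξ : Vec E U) {x : M} (hx : x ∈ U) :
    ContMDiffAt 𝓘(ℝ, E) 𝓘(ℝ, E).tangent (minSmoothness ℝ 2)
      (fun y => (⟨y, ξ.1 y⟩ : TangentBundle 𝓘(ℝ, E) M)) x :=
  (vec_smoothAt ξ hx).of_le (by
    simp only [minSmoothness_of_isRCLikeNormedField]
    norm_cast)

theorem isManifold_minSmoothness : IsManifold 𝓘(ℝ, E) (minSmoothness ℝ 3) M := by
  simp only [minSmoothness_of_isRCLikeNormedField]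
  exact IsManifold.of_le (n := ∞) (by norm_cast)

theorem lieVec_jacobi (ξ η ζ : Vec E U) :
    lieVec ξ (lieVec η ζ) = lieVec (lieVec ξ η) ζ + lieVec η (lieVec ξ ζ) := by
  have := isManifold_minSmoothness (E := E) (M := M)
  exact vec_ext fun x hx => VectorField.leibniz_identity_mlieBracket_apply
    (vec_minSmoothness ξ hx) (vec_minSmoothness η hx) (vec_minSmoothness ζ hx)

theorem lieVec_smulVec (ξ η : Vec E U) (f : Fn E U) :
    lieVec ξ (smulVec f η) = smulVec (der ξ f) η + smulVec f (lieVec ξ η) :=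
  vec_ext fun _ hx => VectorField.mlieBracket_smul_right (fn_mdiffAt f hx) (vec_mdiffAt η hx)

theorem contr_d0 (f : Fn E U) (η : Vec E U) : contr (d0 f) η = der η f :=
  fn_ext fun x hx => by rw [contr_apply, d0_apply f hx, der_apply]

theorem contr_iotaD (ξ η : Vec E U) (a : Form E U) : contr (iotaD ξ a) η =
    der ξ (contr a η) - der η (contr a ξ) - contr a (lieVec ξ η) :=
  fn_ext fun _ hx => extDer_apply a hx (vec_mdiffAt ξ hx) (vec_mdiffAt η hx)

theorem contr_lieForm (ξ η : Vec E U) (a : Form E U) : contr (lieForm ξ a) η =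
    der ξ (contr a η) - contr a (lieVec ξ η) := by
  have h : lieForm ξ a = iotaD ξ a + d0 (contr a ξ) := rfl
  rw [h, map_add, LinearMap.add_apply, contr_iotaD, contr_d0]
  abel

variable [T2Space M] [SecondCountableTopology M]

/-- The bracket of vector fields acts on functions as the commutator. It follows from the Jacobi
identity for `ξ`, `η` and `fζ`, by comparing the coefficients of a field `ζ` that does not vanish at
the given point. -/
theorem der_lieVec (ξ η : Vec E U) (f : Fn E U) :
    der (lieVec ξ η) f = der ξ (der η f) - der η (der ξ f) := by
  refine fn_ext fun x hx => ?_
  by_cases h0 : ∃ v : TangentSpace 𝓘(ℝ, E) x, v ≠ 0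
  · obtain ⟨v, hv⟩ := h0
    obtain ⟨ζ, hζ⟩ := exists_vec v hx
    have e := lieVec_jacobi ξ η (smulVec f ζ)
    simp only [lieVec_smulVec, map_add] at e
    have e1 := lieVec_jacobi ξ η ζ
    have e2 : smulVec (der (lieVec ξ η) f) ζ =
        smulVec (der ξ (der η f)) ζ - smulVec (der η (der ξ f)) ζ := by
      have e3 : smulVec f (lieVec ξ (lieVec η ζ)) = smulVec f (lieVec (lieVec ξ η) ζ) +
          smulVec f (lieVec η (lieVec ξ ζ)) := by
        rw [e1]
        exact Subtype.ext (funext fun y => smul_add _ _ _)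
      rw [e3] at e
      linear_combination (norm := abel) -e
    have e4 := congrFun (congrArg Subtype.val e2) x
    have e5 : ((der (lieVec ξ η) f).1 x) • ζ.1 x =
        ((der ξ (der η f)).1 x) • ζ.1 x - ((der η (der ξ f)).1 x) • ζ.1 x := e4
    rw [← sub_smul, hζ] at e5
    exact smul_left_injective ℝ hv e5
  · have h0' : ∀ v : TangentSpace 𝓘(ℝ, E) x, v = 0 := by
      intro v
      by_contra hv
      exact h0 ⟨v, hv⟩
    have e : ∀ (ζ : Vec E U) (g : Fn E U), (der ζ g).1 x = 0 := fun ζ g => by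
      rw [der_apply, h0' (ζ.1 x), map_zero]
    change _ = (der ξ (der η f)).1 x - (der η (der ξ f)).1 x
    rw [e, e, e, sub_zero]

theorem form_ext {a b : Form E U} (h : ∀ η : Vec E U, contr a η = contr b η) : a = b := by
  refine Subtype.ext (funext fun x => ?_)
  by_cases hx : x ∈ U
  · ext v
    obtain ⟨η, hη⟩ := exists_vec v hx
    have := congrFun (congrArg Subtype.val (h η)) x
    simpa only [contr_apply, hη] using this
  · rw [a.2.1 x hx, b.2.1 x hx]

theorem iotaD_d0 (η : Vec E U) (f : Fn E U) : iotaD η (d0 f) = 0 :=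
  form_ext fun ζ => by
    rw [contr_iotaD, contr_d0, contr_d0, contr_d0, der_lieVec, map_zero, LinearMap.zero_apply]
    abel

end Algebra

/-! ### The Dorfman bracket -/

section DorfmanAlgebra
variable {E : Type*} [NormedAddCommGroup E] [NormedSpace ℝ E] [FiniteDimensional ℝ E]
  {M : Type*} [TopologicalSpace M] [ChartedSpace E M] [IsManifold 𝓘(ℝ, E) ∞ M]
  {U V : Opens M}

theorem sec_ext_parts {s t : Sec E U} (h : anc s = anc t) (h' : cot s = cot t) : s = t :=
  Subtype.ext (funext fun x => Prod.ext (congrFun (congrArg Subtype.val h) x)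
    (congrFun (congrArg Subtype.val h') x))

theorem anc_secVec (ξ : Vec E U) : anc (secVec ξ) = ξ := rfl

theorem cot_secVec (ξ : Vec E U) : cot (secVec ξ) = 0 := rfl

theorem anc_secForm (a : Form E U) : anc (secForm a) = 0 := rfl

theorem cot_secForm (a : Form E U) : cot (secForm a) = a := rfl

theorem dorf_def (s t : Sec E U) : dorf s t = secVec (lieVec (anc s) (anc t)) +
    (secForm (lieForm (anc s) (cot t)) - secForm (iotaD (anc t) (cot s))) := rfl

theorem anc_dorf (s t : Sec E U) : anc (dorf s t) = lieVec (anc s) (anc t) := by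
  rw [dorf_def, map_add, map_sub, anc_secVec, anc_secForm, anc_secForm, sub_zero, add_zero]

theorem cot_dorf (s t : Sec E U) :
    cot (dorf s t) = lieForm (anc s) (cot t) - iotaD (anc t) (cot s) := by
  rw [dorf_def, map_add, map_sub, cot_secVec, cot_secForm, cot_secForm, zero_add]

theorem pair_def (s t : Sec E U) :
    pair s t = (2⁻¹ : ℝ) • (contr (cot t) (anc s) + contr (cot s) (anc t)) := rfl

theorem pair_comm (s t : Sec E U) : pair s t = pair t s := by
  rw [pair_def, pair_def, add_comm]

theorem contr_cot_dorf (s t : Sec E U) (η : Vec E U) : contr (cot (dorf s t)) η =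
    der (anc s) (contr (cot t) η) - contr (cot t) (lieVec (anc s) η) -
    (der (anc t) (contr (cot s) η) - der η (contr (cot s) (anc t)) -
      contr (cot s) (lieVec (anc t) η)) := by
  rw [cot_dorf, map_sub, LinearMap.sub_apply, contr_lieForm, contr_iotaD]

/-- The pairing is invariant under the Dorfman bracket. -/
theorem der_pair (x s t : Sec E U) :
    der (anc x) (pair s t) = pair (dorf x s) t + pair s (dorf x t) := by
  simp only [pair_def, map_smul, map_add, contr_cot_dorf, anc_dorf]
  rw [lieVec_swap (anc s) (anc t), map_neg]
  module

theorem dorf_add_swap [T2Space M] [SecondCountableTopology M] (s t : Sec E U) :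
    dorf s t + dorf t s = (2 : ℝ) • secForm (d0 (pair s t)) := by
  refine sec_ext_parts ?_ (form_ext fun η => ?_)
  · rw [map_add, anc_dorf, anc_dorf, lieVec_swap, map_smul, anc_secForm]
    simp
  · rw [map_add, map_smul, cot_secForm, map_smul, LinearMap.smul_apply, contr_d0, map_add,
      LinearMap.add_apply, contr_cot_dorf, contr_cot_dorf, pair_def]
    simp only [map_smul, map_add]
    module

theorem dorf_jacobi [T2Space M] [SecondCountableTopology M] (s t u : Sec E U) :
    dorf s (dorf t u) = dorf (dorf s t) u + dorf t (dorf s u) := by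
  refine sec_ext_parts ?_ (form_ext fun η => ?_)
  · simp only [map_add, anc_dorf]
    exact lieVec_jacobi _ _ _
  · simp only [map_add, LinearMap.add_apply, contr_cot_dorf, anc_dorf, map_sub, der_lieVec]
    rw [lieVec_jacobi (anc s) (anc t) η, lieVec_jacobi (anc s) (anc u) η,
      lieVec_jacobi (anc t) (anc u) η]
    simp only [map_add]
    abel

/-- Exact sections act trivially. -/
theorem dorf_exact [T2Space M] [SecondCountableTopology M] (f : Fn E U) (t : Sec E U) :
    dorf (secForm (d0 f)) t = 0 := by
  refine sec_ext_parts ?_ ?_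
  · rw [anc_dorf, anc_secForm, map_zero, LinearMap.zero_apply, map_zero]
  · rw [cot_dorf, anc_secForm, map_zero, LinearMap.zero_apply, cot_secForm, iotaD_d0, map_zero,
      sub_zero]

theorem pair_exact (f : Fn E U) (t : Sec E U) :
    pair (secForm (d0 f)) t = (2⁻¹ : ℝ) • der (anc t) f := by
  rw [pair_def, anc_secForm, cot_secForm, map_zero, contr_d0, zero_add]

theorem extDer_congr {a : Form E U} {b : Form E V} {x : M} (hx : x ∈ U) (hx' : x ∈ V)
    (h : ∀ᶠ y in 𝓝 x, a.1 y = b.1 y) : extDer a x = extDer b x := by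
  ext v w
  have hv := FiberBundle.mdifferentiableAt_extend 𝓘(ℝ, E) E
    (V := (TangentSpace 𝓘(ℝ, E) : M → Type _)) v
  have hw := FiberBundle.mdifferentiableAt_extend 𝓘(ℝ, E) E
    (V := (TangentSpace 𝓘(ℝ, E) : M → Type _)) w
  have e := extDer_apply a hx hv hw
  have e' := extDer_apply b hx' hv hw
  simp only [FiberBundle.extend_apply_self] at e e'
  rw [e, e', preExt, preExt, h.self_of_nhds]
  have h1 : ∀ σ : ∀ y : M, TangentSpace 𝓘(ℝ, E) y, mvfderiv 𝓘(ℝ, E) (fun y => a.1 y (σ y)) x =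
      mvfderiv 𝓘(ℝ, E) (fun y => b.1 y (σ y)) x := fun σ =>
    mvfderiv_congr (h.mono fun y hy => congrArg (fun c => c (σ y)) hy)
  rw [h1, h1]

/-- The Dorfman bracket is local. -/
theorem dorf_congr {s t : Sec E U} {s' t' : Sec E V} {x : M} (hx : x ∈ U) (hx' : x ∈ V)
    (hs : ∀ᶠ y in 𝓝 x, s.1 y = s'.1 y) (ht : ∀ᶠ y in 𝓝 x, t.1 y = t'.1 y) :
    (dorf s t).1 x = (dorf s' t').1 x := by
  have f1 : ∀ᶠ y in 𝓝 x, (s.1 y).1 = (s'.1 y).1 := hs.mono fun y hy => congrArg Prod.fst hy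
  have f2 : ∀ᶠ y in 𝓝 x, (s.1 y).2 = (s'.1 y).2 := hs.mono fun y hy => congrArg Prod.snd hy
  have g1 : ∀ᶠ y in 𝓝 x, (t.1 y).1 = (t'.1 y).1 := ht.mono fun y hy => congrArg Prod.fst hy
  have g2 : ∀ᶠ y in 𝓝 x, (t.1 y).2 = (t'.1 y).2 := ht.mono fun y hy => congrArg Prod.snd hy
  have e1 : (anc (dorf s t)).1 x = (anc (dorf s' t')).1 x := by
    rw [anc_dorf, anc_dorf, lieVec_apply, lieVec_apply]
    exact Filter.EventuallyEq.mlieBracket_vectorField_eq f1 g1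
  have e2 : (cot (dorf s t)).1 x = (cot (dorf s' t')).1 x := by
    have e : ∀ {W : Opens M} (p q : Sec E W), x ∈ W → (cot (dorf p q)).1 x =
        extDer (cot q) x (p.1 x).1 + mvfderiv 𝓘(ℝ, E) (fun y => (q.1 y).2 (p.1 y).1) x -
          extDer (cot p) x (q.1 x).1 := fun p q hW => by
      rw [cot_dorf]
      change _ + (d0 (contr (cot q) (anc p))).1 x - _ = _
      rw [d0_apply _ hW]
      rfl
    rw [e _ _ hx, e _ _ hx', extDer_congr (a := cot t) (b := cot t') hx hx' g2,
      extDer_congr (a := cot s) (b := cot s') hx hx' f2, hs.self_of_nhds, ht.self_of_nhds]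
    congr 2
    exact mvfderiv_congr ((hs.and ht).mono fun y hy =>
      congrArg₂ (fun (p q : GT E y) => q.2 p.1) hy.1 hy.2)
  exact Prod.ext e1 e2

theorem resSec_eventuallyEq (h : V ≤ U) (s : Sec E U) {x : M} (hx : x ∈ V) :
    ∀ᶠ y in 𝓝 x, (resSec h s).1 y = s.1 y := by
  filter_upwards [V.2.mem_nhds hx] with y hy
  exact resSec_apply h s hy

theorem dorf_resSec (h : V ≤ U) (s t : Sec E U) :
    dorf (resSec h s) (resSec h t) = resSec h (dorf s t) :=
  sec_ext fun x hx => by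
    rw [resSec_apply h _ hx]
    exact dorf_congr hx (h hx) (resSec_eventuallyEq h s hx) (resSec_eventuallyEq h t hx)

theorem pairFib_nondegenerate {x : M} {v : GT E x} (h : ∀ w, pairFib E x v w = 0) : v = 0 := by
  have e : ∀ w : GT E x, (2⁻¹ : ℝ) * (w.2 v.1 + v.2 w.1) = 0 := h
  refine Prod.ext ?_ ?_
  · refine (Module.forall_dual_apply_eq_zero_iff ℝ (V := E) _).1 fun φ => ?_
    have := e (0, (LinearMap.toContinuousLinearMap (E := E) φ : E →L[ℝ] ℝ))
    have e0 : v.2 0 = 0 := map_zero _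
    rw [e0, add_zero] at this
    exact (mul_eq_zero.1 this).resolve_left (by norm_num)
  · ext w
    have := e (w, 0)
    simpa using this

end DorfmanAlgebra

/-! ### The Lie derivative of the complex structure -/

section LieJ
variable {E : Type*} [NormedAddCommGroup E] [NormedSpace ℝ E] [FiniteDimensional ℝ E]
  {M : Type*} [TopologicalSpace M] [ChartedSpace E M] [IsManifold 𝓘(ℝ, E) ∞ M]
  {U V : Opens M}

/-- Evaluation of sections at a point. -/
def evSec (U : Opens M) (y : M) : Sec E U →ₗ[ℝ] GT E y :=
  LinearMap.proj (R := ℝ) (φ := fun y => GT E y) y ∘ₗ (Sec E U).subtype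

/-- Evaluation of functions at a point. -/
def evFn (U : Opens M) (y : M) : Fn E U →ₗ[ℝ] ℝ :=
  LinearMap.proj (R := ℝ) (φ := fun _ => ℝ) y ∘ₗ (Fn E U).subtype

open Classical in
/-- A linear choice of sections over `U` with given value at `y`; it is `0` if `y ∉ U`. -/
def secExt (U : Opens M) (y : M) : GT E y →ₗ[ℝ] Sec E U :=
  if h : Function.Surjective (evSec (E := E) U y) then
    ((evSec U y).exists_rightInverse_of_surjective (LinearMap.range_eq_top.2 h)).choose
  else 0

theorem secExt_apply [T2Space M] [SecondCountableTopology M] {y : M} (hy : y ∈ U) (v : GT E y) :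
    (secExt U y v).1 y = v := by
  have h : Function.Surjective (evSec (E := E) U y) := fun v => exists_sec v U hy
  rw [secExt, dif_pos h]
  exact LinearMap.congr_fun ((evSec U y).exists_rightInverse_of_surjective
    (LinearMap.range_eq_top.2 h)).choose_spec v

namespace AlmostGC
variable (G : AlmostGC E M)

theorem JSec_JSec (s : Sec E U) : G.JSec (G.JSec s) = -s :=
  Subtype.ext (funext fun x => G.sq x _)

theorem JSec_resSec (h : V ≤ U) (s : Sec E U) : G.JSec (resSec h s) = resSec h (G.JSec s) :=
  sec_ext fun x hx => by
    rw [resSec_apply h _ hx]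
    exact congrArg (G.J x) (resSec_apply h _ hx)

theorem pairFib_J_left (x : M) (s t : GT E x) :
    pairFib E x (G.J x s) t = - pairFib E x s (G.J x t) := by
  rw [← G.orth x s (G.J x t), G.sq, map_neg, neg_neg]

theorem pair_JSec_JSec (s t : Sec E U) : pair (G.JSec s) (G.JSec t) = pair s t :=
  Subtype.ext (funext fun x => G.orth x _ _)

theorem pair_JSec_left (s t : Sec E U) : pair (G.JSec s) t = - pair s (G.JSec t) :=
  Subtype.ext (funext fun x => G.pairFib_J_left x _ _)

/-- The Lie derivative of `J` along the section `x`: `a ↦ [[x, Ja]] - J[[x, a]]`. -/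
def lieJ (x : Sec E U) : Sec E U →ₗ[ℝ] Sec E U := dorf x ∘ₗ G.JSec - G.JSec ∘ₗ dorf x

/-- The 2-form `ω_x(a, b) = ⟨(L_x J) a, b⟩`. It is of type `(2,0) + (0,2)`, and its component on `L`
is `δ_L μ(x)` up to a constant factor, so it vanishes exactly when `x` preserves `J`. -/
def omega (x : Sec E U) : Sec E U →ₗ[ℝ] Sec E U →ₗ[ℝ] Fn E U := pair ∘ₗ G.lieJ x

theorem omega_apply (x a b : Sec E U) :
    G.omega x a b = pair (dorf x (G.JSec a)) b - pair (G.JSec (dorf x a)) b := by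
  change pair (dorf x (G.JSec a) - G.JSec (dorf x a)) b = _
  rw [map_sub, LinearMap.sub_apply]

theorem omega_eq (x a b : Sec E U) :
    G.omega x a b = pair (dorf x (G.JSec a)) b + pair (dorf x a) (G.JSec b) := by
  rw [omega_apply, pair_JSec_left, sub_neg_eq_add]

theorem omega_add (x x' a b : Sec E U) :
    G.omega (x + x') a b = G.omega x a b + G.omega x' a b := by
  simp only [omega_apply, map_add, LinearMap.add_apply]
  abel

theorem omega_swap (x a b : Sec E U) : G.omega x a b = - G.omega x b a := by
  have h1 := der_pair x (G.JSec a) b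
  have h2 := der_pair x a (G.JSec b)
  rw [pair_JSec_left, map_neg, h2] at h1
  rw [omega_eq, omega_eq, pair_comm (dorf x (G.JSec b)), pair_comm (dorf x b)]
  linear_combination (norm := abel) -h1

theorem omega_JSec_right (x a b : Sec E U) : G.omega x (G.JSec a) b = G.omega x a (G.JSec b) := by
  simp only [omega_eq, JSec_JSec, map_neg, LinearMap.neg_apply]
  abel

theorem omega_exact [T2Space M] [SecondCountableTopology M] (f : Fn E U) (a b : Sec E U) :
    G.omega (secForm (d0 f)) a b = 0 := by
  rw [omega_apply, dorf_exact, dorf_exact, map_zero, map_zero, map_zero, sub_self]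

theorem omega_congr_right (x a : Sec E U) {b b' : Sec E U} {y : M} (h : b.1 y = b'.1 y) :
    (G.omega x a b).1 y = (G.omega x a b').1 y := by
  change pairFib E y _ (b.1 y) = pairFib E y _ (b'.1 y)
  rw [h]

theorem omega_congr (x : Sec E U) {a a' b b' : Sec E U} {y : M} (ha : a.1 y = a'.1 y)
    (hb : b.1 y = b'.1 y) : (G.omega x a b).1 y = (G.omega x a' b').1 y := by
  rw [G.omega_congr_right x a hb, G.omega_swap x a, G.omega_swap x a']
  exact congrArg Neg.neg (G.omega_congr_right x b' ha)

/-- The value of the 2-form `ω_x` at a point; it is `0` off `U`. -/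
def omegaAt (x : Sec E U) (y : M) : GT E y →ₗ[ℝ] GT E y →ₗ[ℝ] ℝ :=
  ((G.omega x).compl₁₂ (secExt U y) (secExt U y)).compr₂ (evFn U y)

variable [T2Space M] [SecondCountableTopology M]

theorem omega_val (x a b : Sec E U) {y : M} (hy : y ∈ U) :
    (G.omega x a b).1 y = G.omegaAt x y (a.1 y) (b.1 y) :=
  G.omega_congr x (secExt_apply hy _).symm (secExt_apply hy _).symm

theorem omegaAt_J (x : Sec E U) {y : M} (hy : y ∈ U) (v w : GT E y) :
    G.omegaAt x y (G.J y v) w = G.omegaAt x y v (G.J y w) := by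
  obtain ⟨a, rfl⟩ := exists_sec v U hy
  obtain ⟨b, rfl⟩ := exists_sec w U hy
  have := congrFun (congrArg Subtype.val (G.omega_JSec_right x a b)) y
  rwa [omega_val _ _ _ _ hy, omega_val _ _ _ _ hy] at this

theorem omegaAt_add (x x' : Sec E U) {y : M} (hy : y ∈ U) :
    G.omegaAt (x + x') y = G.omegaAt x y + G.omegaAt x' y := by
  refine LinearMap.ext₂ fun v w => ?_
  obtain ⟨a, rfl⟩ := exists_sec v U hy
  obtain ⟨b, rfl⟩ := exists_sec w U hy
  rw [LinearMap.add_apply, LinearMap.add_apply, ← omega_val _ _ _ _ hy, ← omega_val _ _ _ _ hy,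
    ← omega_val _ _ _ _ hy, omega_add]
  rfl

theorem omegaAt_exact (f : Fn E U) {y : M} (hy : y ∈ U) : G.omegaAt (secForm (d0 f)) y = 0 := by
  refine LinearMap.ext₂ fun v w => ?_
  obtain ⟨a, rfl⟩ := exists_sec v U hy
  obtain ⟨b, rfl⟩ := exists_sec w U hy
  rw [← omega_val _ _ _ _ hy, omega_exact]
  rfl

theorem omegaAt_congr {x : Sec E U} {x' : Sec E V} {y : M} (hy : y ∈ U) (hy' : y ∈ V)
    (h : ∀ᶠ z in 𝓝 y, x.1 z = x'.1 z) : G.omegaAt x y = G.omegaAt x' y := by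
  refine LinearMap.ext₂ fun v w => ?_
  obtain ⟨a, rfl⟩ := exists_sec v ⊤ trivial
  obtain ⟨b, rfl⟩ := exists_sec w ⊤ trivial
  have ea : ∀ {W : Opens M} (s : Sec E (⊤ : Opens M)), y ∈ W → (resSec (le_top : W ≤ ⊤) s).1 y = s.1 y :=
    fun s hW => resSec_apply _ _ hW
  have e : ∀ s : Sec E (⊤ : Opens M), ∀ᶠ z in 𝓝 y, (resSec (le_top : U ≤ ⊤) s).1 z =
      (resSec (le_top : V ≤ ⊤) s).1 z := fun s => by
    filter_upwards [resSec_eventuallyEq (le_top : U ≤ ⊤) s hy,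
      resSec_eventuallyEq (le_top : V ≤ ⊤) s hy'] with z h1 h2
    rw [h1, h2]
  have e1 := G.omega_val x (resSec le_top a) (resSec le_top b) hy
  have e2 := G.omega_val x' (resSec le_top a) (resSec le_top b) hy'
  rw [ea a hy, ea b hy] at e1
  rw [ea a hy', ea b hy'] at e2
  rw [← e1, ← e2, omega_apply, omega_apply]
  change pairFib E y _ _ - pairFib E y _ _ = pairFib E y _ _ - pairFib E y _ _
  rw [ea b hy, ea b hy', JSec_resSec, JSec_resSec, dorf_congr hy hy' h (e _)]
  congr 3
  exact congrArg (G.J y) (dorf_congr hy hy' h (e _))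

end AlmostGC
end LieJ

/-! ### Extension of scalars -/

section Scalars
variable {A : Type*} [CommRing A] [Algebra ℝ A] {P Q R : Type*} [AddCommGroup P] [Module ℝ P]
  [AddCommGroup Q] [Module ℝ Q] [AddCommGroup R] [Module ℝ R]

/-- The coefficient of an element of `A ⊗ P` along a linear form on `A`. -/
def coef (l : A →ₗ[ℝ] ℝ) : A ⊗[ℝ] P →ₗ[ℝ] P := (TensorProduct.lid ℝ P).toLinearMap ∘ₗ l.rTensor P

@[simp] theorem coef_tmul (l : A →ₗ[ℝ] ℝ) (a : A) (p : P) : coef l (a ⊗ₜ[ℝ] p) = l a • p := by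
  simp [coef]

theorem coef_baseChange (l : A →ₗ[ℝ] ℝ) (f : P →ₗ[ℝ] Q) (s : A ⊗[ℝ] P) :
    coef l (f.baseChange A s) = f (coef l s) := by
  induction s with
  | zero => simp
  | add s t hs ht => simp only [map_add, hs, ht]
  | tmul a p => simp

/-- The real part of an element of `ℂ ⊗ P`. -/
def reT : ℂ ⊗[ℝ] P →ₗ[ℝ] P := coef Complex.reLm

/-- The imaginary part of an element of `ℂ ⊗ P`. -/
def imT : ℂ ⊗[ℝ] P →ₗ[ℝ] P := coef Complex.imLm

@[simp] theorem reT_tmul (a : ℂ) (p : P) : reT (a ⊗ₜ[ℝ] p) = a.re • p := coef_tmul _ _ _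

@[simp] theorem imT_tmul (a : ℂ) (p : P) : imT (a ⊗ₜ[ℝ] p) = a.im • p := coef_tmul _ _ _

theorem eq_re_add_im (s : ℂ ⊗[ℝ] P) : s = 1 ⊗ₜ reT s + Complex.I ⊗ₜ imT s := by
  induction s with
  | zero => simp
  | add s t hs ht =>
    rw [map_add, map_add, TensorProduct.tmul_add, TensorProduct.tmul_add]
    nth_rewrite 1 [hs, ht]
    abel
  | tmul a p =>
    rw [reT_tmul, imT_tmul, ← TensorProduct.smul_tmul, ← TensorProduct.smul_tmul,
      ← TensorProduct.add_tmul]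
    congr 1
    apply Complex.ext <;> simp

theorem tensor_ext {s t : ℂ ⊗[ℝ] P} (h : reT s = reT t) (h' : imT s = imT t) : s = t := by
  rw [eq_re_add_im s, eq_re_add_im t, h, h']

theorem reT_baseChange (f : P →ₗ[ℝ] Q) (s : ℂ ⊗[ℝ] P) : reT (f.baseChange ℂ s) = f (reT s) :=
  coef_baseChange _ _ _

theorem imT_baseChange (f : P →ₗ[ℝ] Q) (s : ℂ ⊗[ℝ] P) : imT (f.baseChange ℂ s) = f (imT s) :=
  coef_baseChange _ _ _

theorem reT_smul (c : ℂ) (s : ℂ ⊗[ℝ] P) : reT (c • s) = c.re • reT s - c.im • imT s := by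
  induction s with
  | zero => simp
  | add s t hs ht =>
    rw [smul_add, map_add, hs, ht, map_add, map_add]
    module
  | tmul a p =>
    rw [TensorProduct.smul_tmul', reT_tmul, reT_tmul, imT_tmul, smul_eq_mul, Complex.mul_re]
    module

theorem imT_smul (c : ℂ) (s : ℂ ⊗[ℝ] P) : imT (c • s) = c.re • imT s + c.im • reT s := by
  induction s with
  | zero => simp
  | add s t hs ht =>
    rw [smul_add, map_add, hs, ht, map_add, map_add]
    module
  | tmul a p =>
    rw [TensorProduct.smul_tmul', imT_tmul, reT_tmul, imT_tmul, smul_eq_mul, Complex.mul_im]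
    module

theorem reT_I_smul (s : ℂ ⊗[ℝ] P) : reT (Complex.I • s) = - imT s := by simp [reT_smul]

theorem imT_I_smul (s : ℂ ⊗[ℝ] P) : imT (Complex.I • s) = reT s := by simp [imT_smul]

theorem mem_baseChange_complex {S : Submodule ℝ P} {s : ℂ ⊗[ℝ] P} :
    s ∈ S.baseChange ℂ ↔ reT s ∈ S ∧ imT s ∈ S := by
  constructor
  · intro h
    rw [Submodule.baseChange_eq_span] at h
    induction h using Submodule.span_induction with
    | mem x hx =>
      obtain ⟨p, hp, rfl⟩ := hx
      simpa using hp
    | zero => simp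
    | add x y _ _ hx hy =>
      rw [map_add, map_add]
      exact ⟨S.add_mem hx.1 hy.1, S.add_mem hx.2 hy.2⟩
    | smul c x _ hx =>
      rw [reT_smul, imT_smul]
      exact ⟨S.sub_mem (S.smul_mem _ hx.1) (S.smul_mem _ hx.2),
        S.add_mem (S.smul_mem _ hx.2) (S.smul_mem _ hx.1)⟩
  · rintro ⟨h, h'⟩
    rw [eq_re_add_im s]
    exact Submodule.add_mem _ (Submodule.tmul_mem_baseChange_of_mem _ h)
      (Submodule.tmul_mem_baseChange_of_mem _ h')

/-- The `i`-eigenvector `a - iJa` of an operator `J` with `J² = -1`. -/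
def holo (J : P →ₗ[ℝ] P) (a : P) : ℂ ⊗[ℝ] P := 1 ⊗ₜ a - Complex.I ⊗ₜ J a

@[simp] theorem reT_holo (J : P →ₗ[ℝ] P) (a : P) : reT (holo J a) = a := by simp [holo]

@[simp] theorem imT_holo (J : P →ₗ[ℝ] P) (a : P) : imT (holo J a) = - J a := by simp [holo]

theorem mem_eigenspace_I {J : P →ₗ[ℝ] P} (hJ : ∀ a, J (J a) = -a) {s : ℂ ⊗[ℝ] P} :
    s ∈ Module.End.eigenspace (J.baseChange ℂ) Complex.I ↔ s = holo J (reT s) := by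
  rw [Module.End.mem_eigenspace_iff]
  constructor
  · intro h
    refine tensor_ext (by simp) ?_
    have := congrArg reT h
    rw [reT_baseChange, reT_I_smul] at this
    rw [imT_holo, this, neg_neg]
  · intro h
    have h2 : imT s = - J (reT s) := by
      conv_lhs => rw [h]
      exact imT_holo _ _
    refine tensor_ext ?_ ?_
    · rw [reT_baseChange, reT_I_smul, h2, neg_neg]
    · rw [imT_baseChange, imT_I_smul, h2, map_neg, hJ, neg_neg]

theorem holo_mem_eigenspace {J : P →ₗ[ℝ] P} (hJ : ∀ a, J (J a) = -a) (a : P) :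
    holo J a ∈ Module.End.eigenspace (J.baseChange ℂ) Complex.I := by
  rw [mem_eigenspace_I hJ, reT_holo]

theorem baseChange_holo {J : P →ₗ[ℝ] P} {K : Q →ₗ[ℝ] Q} (f : P →ₗ[ℝ] Q) (h : ∀ a, f (J a) = K (f a))
    (a : P) : f.baseChange ℂ (holo J a) = holo K (f a) := by
  simp [holo, h]

/-- The complex bilinear extension of a real bilinear form. -/
def cBil (B : P →ₗ[ℝ] Q →ₗ[ℝ] ℝ) : ℂ ⊗[ℝ] P →ₗ[ℂ] ℂ ⊗[ℝ] Q →ₗ[ℂ] ℂ :=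
  LinearMap.liftBaseChange ℂ
    ((LinearMap.liftBaseChangeEquiv ℂ).toLinearMap.restrictScalars ℝ ∘ₗ
      B.compr₂ (Algebra.linearMap ℝ ℂ))

@[simp] theorem cBil_tmul (B : P →ₗ[ℝ] Q →ₗ[ℝ] ℝ) (a b : ℂ) (p : P) (q : Q) :
    cBil B (a ⊗ₜ p) (b ⊗ₜ q) = a * b * B p q := by
  simp [cBil, mul_assoc]

theorem cBil_holo {B : P →ₗ[ℝ] P →ₗ[ℝ] ℝ} {J : P →ₗ[ℝ] P} (hJ : ∀ a, J (J a) = -a)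
    (hB : ∀ a b, B (J a) b = B a (J b)) (a b : P) :
    cBil B (holo J a) (holo J b) = 2 * B a b - 2 * Complex.I * B a (J b) := by
  simp only [holo, map_sub, LinearMap.sub_apply, cBil_tmul, hB, hJ, map_neg]
  push_cast
  linear_combination (-(B a b : ℂ)) * Complex.I_mul_I

end Scalars

/-! ### The `i`-eigenbundle -/

section EigenBundle
variable {E : Type*} [NormedAddCommGroup E] [NormedSpace ℝ E] [FiniteDimensional ℝ E]
  {M : Type*} [TopologicalSpace M] [ChartedSpace E M] [IsManifold 𝓘(ℝ, E) ∞ M]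
  {U V : Opens M}

theorem derA_tmul {A : Type*} [CommRing A] [Algebra ℝ A] (a b : A) (ξ : Vec E U) (f : Fn E U) :
    derA A (a ⊗ₜ ξ) (b ⊗ₜ f) = (a * b) ⊗ₜ der ξ f := bcBil_tmul _ _ _ _ _ _

theorem pairA_tmul {A : Type*} [CommRing A] [Algebra ℝ A] (a b : A) (s t : Sec E U) :
    pairA A (a ⊗ₜ s) (b ⊗ₜ t) = (a * b) ⊗ₜ pair s t := bcBil_tmul _ _ _ _ _ _

theorem dorfA_tmul {A : Type*} [CommRing A] [Algebra ℝ A] (a b : A) (s t : Sec E U) :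
    dorfA A (a ⊗ₜ s) (b ⊗ₜ t) = (a * b) ⊗ₜ dorf s t := bcBil_tmul _ _ _ _ _ _

theorem ancA_tmul {A : Type*} [CommRing A] [Algebra ℝ A] (a : A) (s : Sec E U) :
    ancA A (a ⊗ₜ s) = a ⊗ₜ anc s := LinearMap.baseChange_tmul _ _ _

/-- `x(s, t) ↦ π(s)⟨x, t⟩ - π(t)⟨x, s⟩ - ⟨x, [[s, t]]⟩`, half of `deltaMu`. -/
def deltaHalf (x : Sec E U) (s t : ℂ ⊗[ℝ] Sec E U) : ℂ ⊗[ℝ] Fn E U :=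
  derA ℂ (ancA ℂ s) (pairA ℂ (1 ⊗ₜ x) t) - derA ℂ (ancA ℂ t) (pairA ℂ (1 ⊗ₜ x) s) -
    pairA ℂ (1 ⊗ₜ x) (dorfA ℂ s t)

theorem deltaMu_eq (x : Sec E U) (s t : ℂ ⊗[ℝ] Sec E U) :
    deltaMu U s t x = (2 : ℂ) • deltaHalf x s t := rfl

theorem deltaHalf_eq [T2Space M] [SecondCountableTopology M] (x : Sec E U)
    (s t : ℂ ⊗[ℝ] Sec E U) : deltaHalf x s t = - pairA ℂ (dorfA ℂ (1 ⊗ₜ x) s) t := by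
  induction s with
  | zero => simp [deltaHalf]
  | add s s' h h' =>
    simp only [deltaHalf, map_add, LinearMap.add_apply] at h h' ⊢
    linear_combination (norm := abel) h + h'
  | tmul a s =>
    induction t with
    | zero => simp [deltaHalf]
    | add t t' h h' =>
      simp only [deltaHalf, map_add, LinearMap.add_apply] at h h' ⊢
      linear_combination (norm := abel) h + h'
    | tmul b t =>
      have h1 := der_pair s x t
      have h2 := dorf_add_swap x s
      have h3 : pair (dorf x s) t + pair (dorf s x) t = der (anc t) (pair x s) := by
        rw [← LinearMap.add_apply, ← map_add, h2, map_smul, LinearMap.smul_apply, pair_exact,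
          smul_smul]
        norm_num
      have h4 : der (anc s) (pair x t) - der (anc t) (pair x s) - pair x (dorf s t) =
          - pair (dorf x s) t := by
        rw [h1, ← h3]
        abel
      simp only [deltaHalf, derA_tmul, pairA_tmul, dorfA_tmul, ancA_tmul, one_mul]
      rw [mul_comm b a, ← TensorProduct.tmul_sub, ← TensorProduct.tmul_sub, h4,
        TensorProduct.tmul_neg]

namespace AlmostGC
variable (G : AlmostGC E M)

theorem mem_L {s : ℂ ⊗[ℝ] Sec E U} : s ∈ G.L U ↔ s = holo G.JSec (reT s) :=
  mem_eigenspace_I G.JSec_JSec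

theorem holo_mem_L (a : Sec E U) : holo G.JSec a ∈ G.L U := holo_mem_eigenspace G.JSec_JSec a

/-- The complex bilinear extension of `ω_x`. -/
def omegaC (x : Sec E U) : ℂ ⊗[ℝ] Sec E U →ₗ[ℂ] ℂ ⊗[ℝ] Sec E U →ₗ[ℂ] ℂ ⊗[ℝ] Fn E U :=
  bcBil ℂ (P := Sec E U) (Q := Sec E U) (R := Fn E U) (G.omega x)

theorem omegaC_tmul (x : Sec E U) (a b : ℂ) (s t : Sec E U) :
    G.omegaC x (a ⊗ₜ s) (b ⊗ₜ t) = (a * b) ⊗ₜ G.omega x s t := bcBil_tmul _ _ _ _ _ _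

theorem omegaC_eq (x : Sec E U) (s t : ℂ ⊗[ℝ] Sec E U) : G.omegaC x s t =
    pairA ℂ (dorfA ℂ (1 ⊗ₜ x) (G.JSec.baseChange ℂ s)) t +
      pairA ℂ (dorfA ℂ (1 ⊗ₜ x) s) (G.JSec.baseChange ℂ t) := by
  induction s with
  | zero => simp
  | add s s' h h' =>
    simp only [map_add, LinearMap.add_apply, h, h']
    abel
  | tmul a s =>
    induction t with
    | zero => simp
    | add t t' h h' =>
      simp only [map_add, h, h']
      abel
    | tmul b t =>
      rw [omegaC_tmul, LinearMap.baseChange_tmul, LinearMap.baseChange_tmul, dorfA_tmul, dorfA_tmul,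
        pairA_tmul, pairA_tmul, omega_eq, one_mul, TensorProduct.tmul_add]

variable [T2Space M] [SecondCountableTopology M]

theorem deltaHalf_of_mem_L (x : Sec E U) {s t : ℂ ⊗[ℝ] Sec E U} (hs : s ∈ G.L U)
    (ht : t ∈ G.L U) : deltaHalf x s t = (Complex.I / 2) • G.omegaC x s t := by
  have h1 : G.JSec.baseChange ℂ s = Complex.I • s := Module.End.mem_eigenspace_iff.1 hs
  have h2 : G.JSec.baseChange ℂ t = Complex.I • t := Module.End.mem_eigenspace_iff.1 ht
  rw [deltaHalf_eq, omegaC_eq, h1, h2, map_smul, map_smul, map_smul, LinearMap.smul_apply,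
    ← add_smul, smul_smul, show Complex.I / 2 * (Complex.I + Complex.I) = -1 by
      linear_combination Complex.I_mul_I, neg_smul, one_smul]

theorem omegaC_holo (x : Sec E U) (a b : Sec E U) :
    reT (G.omegaC x (holo G.JSec a) (holo G.JSec b)) = (2 : ℝ) • G.omega x a b := by
  simp only [holo, map_sub, LinearMap.sub_apply, omegaC_tmul, omega_JSec_right, JSec_JSec, map_neg,
    TensorProduct.tmul_neg, reT_tmul]
  simp [two_smul]

end AlmostGC

variable [T2Space M] [SecondCountableTopology M]

/-- `T(U)` consists of the sections `x` with `ω_x = 0`. -/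
theorem GCStructure.mem_T_iff (G : GCStructure E M) {x : Sec E U} :
    x ∈ G.T U ↔ ∀ y ∈ U, G.omegaAt x y = 0 := by
  rw [mem_T]
  constructor
  · intro h y hy
    refine LinearMap.ext₂ fun v w => ?_
    obtain ⟨a, rfl⟩ := exists_sec v U hy
    obtain ⟨b, rfl⟩ := exists_sec w U hy
    have e := h U le_rfl _ (G.holo_mem_L a) _ (G.holo_mem_L b)
    have hx : resSec le_rfl x = x := sec_ext fun z hz => resSec_apply _ _ hz
    rw [hx, deltaMu_eq, G.deltaHalf_of_mem_L x (G.holo_mem_L a) (G.holo_mem_L b), smul_smul] at e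
    have e2 := (smul_eq_zero.1 e).resolve_left (by simp)
    have e3 := congrArg reT e2
    rw [G.omegaC_holo, map_zero, smul_eq_zero] at e3
    rw [← G.omega_val x a b hy, e3.resolve_left two_ne_zero]
    rfl
  · intro h V hV s hs t ht
    have h0 : G.omega (resSec hV x) = 0 := by
      refine LinearMap.ext₂ fun a b => fn_ext fun y hy => ?_
      rw [G.omega_val _ _ _ hy, G.omegaAt_congr hy (hV hy) (resSec_eventuallyEq hV x hy),
        h y (hV hy)]
      rfl
    have h1 : G.omegaC (resSec hV x) = 0 := by
      rw [AlmostGC.omegaC, h0]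
      simp [bcBil]
    rw [deltaMu_eq, G.deltaHalf_of_mem_L _ hs ht, h1]
    simp

theorem GCStructure.exact_mem_T (G : GCStructure E M) (f : Fn E U) : secForm (d0 f) ∈ G.T U :=
  G.mem_T_iff.2 fun _ hy => G.omegaAt_exact f hy

end EigenBundle

/-! ### Local retractions and extension from a closed submanifold -/

section Sections
variable {E : Type*} [NormedAddCommGroup E] [NormedSpace ℝ E] [FiniteDimensional ℝ E]
  {X : Type*} [TopologicalSpace X] [ChartedSpace E X] [IsManifold 𝓘(ℝ, E) ∞ X]
  {E' : Type*} [NormedAddCommGroup E'] [NormedSpace ℝ E'] [FiniteDimensional ℝ E']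
  {Z : Type*} [TopologicalSpace Z] [ChartedSpace E' Z] [IsManifold 𝓘(ℝ, E') ∞ Z]
  {i : C^∞⟮𝓘(ℝ, E'), Z; 𝓘(ℝ, E), X⟯}

open Classical in
theorem IsModuleSheaf.exists_supported {F : X → Type*} [∀ x, AddCommGroup (F x)]
    [∀ x, Module ℝ (F x)] {S : (∀ x, F x) → Set X → Prop} (hS : IsModuleSheaf (E := E) S)
    {V : Opens X} {t : ∀ x, F x} (ht : S t V) :
    ∃ s : ∀ x, F x, S s V ∧ (∀ x ∉ V, s x = 0) ∧ ∀ x ∈ V, s x = t x :=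
  ⟨fun x => if x ∈ V then t x else 0,
    hS.congr_loc _ _ fun _ hx => ⟨V, hx, t, ht, fun _ hy => if_pos hy⟩,
    fun _ hx => if_neg hx, fun _ hx => if_pos hx⟩

theorem exists_fn_of_smooth {V : Opens X} {f : X → ℝ} (hf : ContMDiffOn 𝓘(ℝ, E) 𝓘(ℝ) ∞ f V) :
    ∃ g : Fn E V, ∀ x ∈ V, g.1 x = f x := by
  obtain ⟨s, hs, h0, h⟩ := isModuleSheaf_fun.exists_supported hf
  exact ⟨⟨s, h0, hs⟩, h⟩

theorem exists_vec_of_smooth {V : Opens X} {t : ∀ x : X, TangentSpace 𝓘(ℝ, E) x}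
    (ht : SmoothVec E E (fun x => x) t V) : ∃ s : Vec E V, ∀ x ∈ V, s.1 x = t x := by
  obtain ⟨s, hs, h0, h⟩ := (isModuleSheaf_vec contMDiff_id).exists_supported ht
  exact ⟨⟨s, h0, hs⟩, h⟩

theorem exists_sec_of_smooth {V : Opens X} {t : ∀ x : X, GT E x}
    (ht : SmoothVec E E (fun x => x) (fun x => (t x).1) V)
    (ht' : SmoothForm E E (fun x => x) (fun x => (t x).2) V) :
    ∃ s : Sec E V, ∀ x ∈ V, s.1 x = t x := by
  obtain ⟨s, hs, h0, h⟩ := (isModuleSheaf_sec (f := fun x : X => x) contMDiff_id).exists_supported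
    (V := V) (t := t) ⟨ht, ht'⟩
  exact ⟨⟨s, ⟨fun x hx => congrArg Prod.fst (h0 x hx), hs.1⟩,
    ⟨fun x hx => congrArg Prod.snd (h0 x hx), hs.2⟩⟩, h⟩

theorem exists_secAlong_of_smooth {W : Opens Z} {t : ∀ z : Z, GT E (i z)}
    (ht : SmoothVec E' E i (fun x => (t x).1) W)
    (ht' : SmoothForm E' E i (fun x => (t x).2) W) :
    ∃ s : SecAlong i W, ∀ x ∈ W, s.1 x = t x := by
  obtain ⟨s, hs, h0, h⟩ := (isModuleSheaf_sec (f := i) i.contMDiff).exists_supported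
    (V := W) (t := t) ⟨ht, ht'⟩
  exact ⟨⟨s, h0, hs⟩, h⟩

theorem secAlong_ext {W : Opens Z} {s t : SecAlong i W} (h : ∀ z ∈ W, s.1 z = t.1 z) : s = t :=
  Subtype.ext (funext fun z => by
    by_cases hz : z ∈ W
    · exact h z hz
    · rw [s.2.1 z hz, t.2.1 z hz])

end Sections

section Retraction
variable {E : Type*} [NormedAddCommGroup E] [NormedSpace ℝ E] [FiniteDimensional ℝ E]
  {X : Type*} [TopologicalSpace X] [ChartedSpace E X] [IsManifold 𝓘(ℝ, E) ∞ X]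
  {E' : Type*} [NormedAddCommGroup E'] [NormedSpace ℝ E'] [FiniteDimensional ℝ E']
  {Z : Type*} [TopologicalSpace Z] [ChartedSpace E' Z] [IsManifold 𝓘(ℝ, E') ∞ Z]
  {i : C^∞⟮𝓘(ℝ, E'), Z; 𝓘(ℝ, E), X⟯}

variable (i) in
/-- A smooth retraction `p` of the open set `O` onto `Z ∩ O`, and the projection `P` of `TX` onto
`TZ` along `Z ∩ O` that is the differential of `p`. -/
structure IsRetraction (O : Opens X) (p : X → Z)
    (P : ∀ z : Z, TangentSpace 𝓘(ℝ, E) (i z) →L[ℝ] TangentSpace 𝓘(ℝ, E') z) : Prop where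
  smooth : ContMDiffOn 𝓘(ℝ, E) 𝓘(ℝ, E') ∞ p O
  mapsTo : ∀ x ∈ O, p x ∈ pre i O
  apply_emb : ∀ z ∈ pre i O, p (i z) = z
  proj_di : ∀ z ∈ pre i O, ∀ v, P z (di i z v) = v
  proj_smooth : ∀ (W : Set Z) (ξ : ∀ z : Z, TangentSpace 𝓘(ℝ, E) (i z)), W ⊆ pre i O →
    SmoothVec E' E i ξ W → SmoothVec E' E' (fun z => z) (fun z => P z (ξ z)) W

theorem exists_local_inverse (hi : Manifold.IsSmoothEmbedding 𝓘(ℝ, E') 𝓘(ℝ, E) ∞ i) (z₀ : Z) :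
    ∃ (O : Opens X) (p : X → Z), i z₀ ∈ O ∧ ContMDiffOn 𝓘(ℝ, E) 𝓘(ℝ, E') ∞ p O ∧
      ∀ z ∈ pre i O, p (i z) = z := by
  have h := hi.isImmersion.isImmersionAt z₀
  obtain ⟨O₁, hO₁, e₁⟩ := hi.isEmbedding.isInducing.isOpen_iff.1 h.domChart.open_source
  have hψ := contMDiffOn_of_mem_maximalAtlas h.codChart_mem_maximalAtlas
  have hφ := contMDiffOn_symm_of_mem_maximalAtlas h.domChart_mem_maximalAtlas
  have hq : ContMDiffOn 𝓘(ℝ, E) 𝓘(ℝ, E') ∞ (fun x => (h.equiv.symm (h.codChart x)).1)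
      h.codChart.source := by
    have : ContMDiff 𝓘(ℝ, E) 𝓘(ℝ, E') ∞ (fun e : E => (h.equiv.symm e).1) :=
      ((ContinuousLinearMap.fst ℝ E' h.complement).comp
        (h.equiv.symm : E →L[ℝ] E' × h.complement)).contMDiff
    exact this.comp_contMDiffOn hψ
  have key : ∀ z ∈ h.domChart.source,
      (h.equiv.symm (h.codChart (i z))).1 = h.domChart z := by
    intro z hz
    have e := h.writtenInCharts (show h.domChart z ∈ (h.domChart.extend 𝓘(ℝ, E')).target by
      simpa using h.domChart.map_source hz)
    simp only [Function.comp_apply] at e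
    have e2 : h.codChart (i z) = h.equiv (h.domChart z, 0) := by
      simpa [h.domChart.left_inv hz] using e
    rw [e2, h.equiv.symm_apply_apply]
  have ho : IsOpen (h.codChart.source ∩
      (fun x => (h.equiv.symm (h.codChart x)).1) ⁻¹' h.domChart.target) :=
    hq.continuousOn.isOpen_inter_preimage h.codChart.open_source h.domChart.open_target
  have hmem : ∀ z, i z ∈ O₁ → z ∈ h.domChart.source := fun z hz => by
    rw [← e₁]; exact hz
  have hz₀ := h.mem_domChart_source
  refine ⟨⟨_, ho.inter hO₁⟩, fun x => h.domChart.symm (h.equiv.symm (h.codChart x)).1,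
    ⟨⟨h.mem_codChart_source, ?_⟩, ?_⟩, ?_, ?_⟩
  · change (h.equiv.symm (h.codChart (i z₀))).1 ∈ h.domChart.target
    rw [key _ hz₀]
    exact h.domChart.map_source hz₀
  · have : z₀ ∈ i ⁻¹' O₁ := by rw [e₁]; exact hz₀
    exact this
  · exact hφ.comp (hq.mono fun x hx => hx.1.1) fun x hx => hx.1.2
  · rintro z ⟨-, hz⟩
    have := hmem z hz
    change h.domChart.symm (h.equiv.symm (h.codChart (i z))).1 = z
    rw [key z this, h.domChart.left_inv this]

theorem exists_isRetraction (hi : Manifold.IsSmoothEmbedding 𝓘(ℝ, E') 𝓘(ℝ, E) ∞ i) (z₀ : Z)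
    (V : Opens X) (hV : i z₀ ∈ V) :
    ∃ (O : Opens X) (p : X → Z)
      (P : ∀ z : Z, TangentSpace 𝓘(ℝ, E) (i z) →L[ℝ] TangentSpace 𝓘(ℝ, E') z),
      i z₀ ∈ O ∧ O ≤ V ∧ IsRetraction i O p P := by
  obtain ⟨O₀, p, hz₀, hp, hpi⟩ := exists_local_inverse hi z₀
  let O₁ : Opens X := O₀ ⊓ V
  have hp₁ := hp.mono (show (O₁ : Set X) ⊆ O₀ from inf_le_left)
  let O : Opens X := ⟨O₁ ∩ p ⁻¹' (pre i O₁), hp₁.continuousOn.isOpen_inter_preimage O₁.2 (pre i O₁).2⟩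
  have hO : ∀ z, z ∈ pre i O₁ → i z ∈ O := fun z hz =>
    ⟨hz, by change p (i z) ∈ pre i O₁; rw [hpi z hz.1]; exact hz⟩
  have hle : ∀ z, z ∈ pre i O → z ∈ pre i O₁ := fun z hz => hz.1
  have hpO : ContMDiffOn 𝓘(ℝ, E) 𝓘(ℝ, E') ∞ p O := hp₁.mono Set.inter_subset_left
  have hpd : ∀ z ∈ pre i O, MDifferentiableAt 𝓘(ℝ, E) 𝓘(ℝ, E') p (i z) := fun z hz =>
    (hpO.contMDiffAt (O.2.mem_nhds hz)).mdifferentiableAt (by simp)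
  let P : ∀ z : Z, TangentSpace 𝓘(ℝ, E) (i z) →L[ℝ] TangentSpace 𝓘(ℝ, E') z :=
    fun z => (mfderiv 𝓘(ℝ, E) 𝓘(ℝ, E') p (i z) : E →L[ℝ] E')
  refine ⟨O, p, P, hO _ ⟨hz₀, hV⟩, fun x hx => hx.1.2, hpO, fun x hx => ?_, fun z hz => ?_,
    fun z hz v => ?_, fun W ξ hW hξ => ?_⟩
  · exact hO _ hx.2
  · exact hpi z (hle z hz).1
  · have h1 := ((hpd z hz).hasMFDerivAt.comp z
      (i.contMDiff.mdifferentiable (by simp) z).hasMFDerivAt).congr_of_eventuallyEq (f₁ := id) (by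
        filter_upwards [(pre i O).2.mem_nhds hz] with y hy
        exact (hpi y (hle y hy).1).symm)
    have h2 := hasMFDerivAt_unique h1 (hasMFDerivAt_id z)
    exact congrArg (fun L : E' →L[ℝ] E' => L v) h2
  · have hm : ContMDiffOn 𝓘(ℝ, E).tangent 𝓘(ℝ, E').tangent ∞
        (tangentMapWithin 𝓘(ℝ, E) 𝓘(ℝ, E') p O) _ :=
      ContMDiffOn.contMDiffOn_tangentMapWithin (m := ∞) hpO (by simp) O.2.uniqueMDiffOn
    have h1 := hm.comp hξ (fun z hz => hW hz)
    refine ContMDiffOn.congr h1 fun z hz => ?_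
    have e : ∀ (y : Z) (_ : y = z) (w : E'), (⟨z, w⟩ : TangentBundle 𝓘(ℝ, E') Z) = ⟨y, w⟩ := by
      rintro y rfl w
      rfl
    have e2 := e (p (i z)) (hpi z (hle z (hW hz)).1) (P z (ξ z))
    refine e2.trans ?_
    have e3 := mfderivWithin_of_isOpen (I := 𝓘(ℝ, E)) (I' := 𝓘(ℝ, E')) (f := p) O.2 (hW hz)
    simp only [Function.comp, tangentMapWithin]
    exact congrArg (TotalSpace.mk (p (i z))) (congrArg (fun L => L (ξ z)) e3.symm)

variable {O : Opens X} {p : X → Z}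
  {P : ∀ z : Z, TangentSpace 𝓘(ℝ, E) (i z) →L[ℝ] TangentSpace 𝓘(ℝ, E') z}

theorem IsRetraction.extend_fn (h : IsRetraction i O p P) {F : Type*} [NormedAddCommGroup F]
    [NormedSpace ℝ F] {f : Z → F} (hf : ContMDiffOn 𝓘(ℝ, E') 𝓘(ℝ, F) ∞ f (pre i O)) :
    ContMDiffOn 𝓘(ℝ, E) 𝓘(ℝ, F) ∞ (fun x => f (p x)) O ∧ ∀ z ∈ pre i O, f (p (i z)) = f z :=
  ⟨hf.comp h.smooth h.mapsTo, fun z hz => by rw [h.apply_emb z hz]⟩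

theorem di_injective (hi : Manifold.IsSmoothEmbedding 𝓘(ℝ, E') 𝓘(ℝ, E) ∞ i) (z : Z) :
    Function.Injective (di i z) := by
  obtain ⟨O, p, P, hz, -, h⟩ := exists_isRetraction hi z ⊤ trivial
  exact Function.LeftInverse.injective (h.proj_di z hz)

/-- A vector field along `Z` that is tangent to `Z` is smooth as a vector field on `Z`. -/
theorem exists_tangent_vec (hi : Manifold.IsSmoothEmbedding 𝓘(ℝ, E') 𝓘(ℝ, E) ∞ i) {W : Opens Z}
    {ξ : ∀ z : Z, TangentSpace 𝓘(ℝ, E) (i z)} (hξ : SmoothVec E' E i ξ W)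
    (ht : ∀ z ∈ W, ∃ v, ξ z = di i z v) : ∃ τ : Vec E' W, ∀ z ∈ W, ξ z = di i z (τ.1 z) := by
  have h0 : ∀ z, ∃ v, z ∈ W → ξ z = di i z v := fun z => by
    by_cases hz : z ∈ W
    · obtain ⟨v, hv⟩ := ht z hz
      exact ⟨v, fun _ => hv⟩
    · exact ⟨0, fun h => absurd h hz⟩
  choose t ht using h0
  have hs : SmoothVec E' E' (fun z => z) t W := by
    refine (isModuleSheaf_vec contMDiff_id).congr_loc _ _ fun z hz => ?_
    obtain ⟨O, p, P, hzO, -, h⟩ := exists_isRetraction hi z ⊤ trivial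
    refine ⟨pre i O ⊓ W, ⟨hzO, hz⟩, fun y => P y (ξ y), h.proj_smooth _ _ (fun y hy => hy.1)
      (ContMDiffOn.mono hξ fun y hy => hy.2), fun y hy => ?_⟩
    change t y = P y (ξ y)
    rw [ht y hy.2, h.proj_di y hy.1]
  obtain ⟨τ, hτ⟩ := exists_vec_of_smooth hs
  exact ⟨τ, fun z hz => by rw [hτ z hz, ht z hz]⟩

/-- Sections along `Z` extend locally: their coefficients in a local frame are composed with a
retraction. -/
theorem exists_sec_ext_local (hi : Manifold.IsSmoothEmbedding 𝓘(ℝ, E') 𝓘(ℝ, E) ∞ i) {V : Opens X}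
    (s : SecAlong i (pre i V)) {z₀ : Z} (hz₀ : i z₀ ∈ V) : ∃ O : Opens X, i z₀ ∈ O ∧
      ∃ t : ∀ x : X, GT E x, (SmoothVec E E (fun x => x) (fun x => (t x).1) O ∧
        SmoothForm E E (fun x => x) (fun x => (t x).2) O) ∧ ∀ z ∈ pre i O, t (i z) = s.1 z := by
  obtain ⟨O₁, hO₁, e, ε, hf⟩ := exists_isFrame (E := E) (i z₀)
  obtain ⟨O, p, P, hzO, hO, h⟩ := exists_isRetraction hi z₀ (O₁ ⊓ V) ⟨hO₁, hz₀⟩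
  have hO₁' : (O : Set X) ⊆ O₁ := fun x hx => (hO hx).1
  have s1 : SmoothVec E' E i (fun z => (s.1 z).1) (pre i O) :=
    ContMDiffOn.mono s.2.2.1 fun z hz => (hO hz).2
  have s2 : SmoothForm E' E i (fun z => (s.1 z).2) (pre i O) :=
    ContMDiffOn.mono s.2.2.2 fun z hz => (hO hz).2
  obtain ⟨c, hcd⟩ : ∃ c : Fin (Module.finrank ℝ E) → Z → ℝ, ∀ j z, c j z = ε j (i z) (s.1 z).1 :=
    ⟨_, fun _ _ => rfl⟩
  obtain ⟨d, hdd⟩ : ∃ d : Fin (Module.finrank ℝ E) → Z → ℝ, ∀ j z, d j z = (s.1 z).2 (e j (i z)) :=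
    ⟨_, fun _ _ => rfl⟩
  have hc : ∀ j, ContMDiffOn 𝓘(ℝ, E') 𝓘(ℝ) ∞ (c j) (pre i O) := fun j =>
    ((SmoothForm.comp (hf.form j) (i.contMDiff.contMDiffOn (s := pre i O))
      fun z hz => hO₁' hz).apply s1).congr fun z _ => hcd j z
  have hd : ∀ j, ContMDiffOn 𝓘(ℝ, E') 𝓘(ℝ) ∞ (d j) (pre i O) := fun j =>
    (s2.apply (SmoothVec.comp (hf.vec j) (i.contMDiff.contMDiffOn (s := pre i O))
      fun z hz => hO₁' hz)).congr fun z _ => hdd j z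
  refine ⟨O, hzO, fun x => (∑ j, c j (p x) • e j x, ∑ j, d j (p x) • ε j x), ⟨?_, ?_⟩,
    fun z hz => Prod.ext ?_ ?_⟩
  · exact (isModuleSheaf_vec contMDiff_id).sum Finset.univ (fun j x => c j (p x) • e j x) _
      fun j _ => SmoothVec.smul (h.extend_fn (hc j)).1 (ContMDiffOn.mono (hf.vec j) hO₁')
  · exact (isModuleSheaf_form contMDiff_id).sum Finset.univ (fun j x => d j (p x) • ε j x) _
      fun j _ => SmoothForm.smul (h.extend_fn (hd j)).1 (ContMDiffOn.mono (hf.form j) hO₁')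
  · change ∑ j, c j (p (i z)) • e j (i z) = _
    simp only [h.apply_emb z hz, hcd]
    exact hf.sum_eq (i z) (hO₁' hz) (s.1 z).1
  · change ∑ j, d j (p (i z)) • ε j (i z) = _
    simp only [h.apply_emb z hz, hdd]
    ext w
    conv_rhs => rw [← hf.sum_eq (i z) (hO₁' hz) w, map_sum]
    simp [mul_comm]

variable [T2Space X] [SecondCountableTopology X]

/-- Every section of `TX ⊕ T*X` along `Z ∩ V` extends to a section over `V`. -/
theorem rSec_surjective (hi : Manifold.IsSmoothEmbedding 𝓘(ℝ, E') 𝓘(ℝ, E) ∞ i)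
    (hc : IsClosed (Set.range i)) (V : Opens X) :
    Function.Surjective (rSec i : Sec E V →ₗ[ℝ] SecAlong i (pre i V)) := by
  intro s
  have hloc : ∀ x : V, ∃ O : Opens X, x.1 ∈ O ∧ ∃ t : ∀ x : X, GT E x,
      (SmoothVec E E (fun x => x) (fun x => (t x).1) O ∧
        SmoothForm E E (fun x => x) (fun x => (t x).2) O) ∧ ∀ z ∈ pre i O, t (i z) = s.1 z := by
    rintro ⟨x, hx⟩
    by_cases hxi : x ∈ Set.range i
    · obtain ⟨z, rfl⟩ := hxi
      exact exists_sec_ext_local hi s hx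
    · exact ⟨⟨(Set.range i)ᶜ, hc.isOpen_compl⟩, hxi, fun _ => 0,
        ⟨smoothVec_zero contMDiffOn_id, smoothForm_zero contMDiffOn_id⟩,
        fun z hz => absurd ⟨z, rfl⟩ hz⟩
  choose O hxO t ht hs using hloc
  obtain ⟨φ, hφ⟩ := exists_isPartition (E := E) V O fun x hx => ⟨⟨x, hx⟩, hxO _⟩
  have hg := (isModuleSheaf_sec (f := fun x : X => x) contMDiff_id).glue hφ t ht
  obtain ⟨s', hs'⟩ := exists_sec_of_smooth hg.1 hg.2
  refine ⟨s', secAlong_ext fun z hz => ?_⟩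
  refine (hs' (i z) hz).trans ?_
  exact hφ.map_finsum hz (fun j => t j (i z)) LinearMap.id (s.1 z) fun j hj => hs j z hj

/-- Every function on `Z ∩ V` extends to `V`. -/
theorem pullFn_surjective (hi : Manifold.IsSmoothEmbedding 𝓘(ℝ, E') 𝓘(ℝ, E) ∞ i)
    (hc : IsClosed (Set.range i)) (V : Opens X) :
    Function.Surjective (pullFn i : Fn E V →ₗ[ℝ] Fn E' (pre i V)) := by
  intro f
  have hloc : ∀ x : V, ∃ O : Opens X, x.1 ∈ O ∧ ∃ t : X → ℝ,
      ContMDiffOn 𝓘(ℝ, E) 𝓘(ℝ) ∞ t O ∧ ∀ z ∈ pre i O, t (i z) = f.1 z := by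
    rintro ⟨x, hx⟩
    by_cases hxi : x ∈ Set.range i
    · obtain ⟨z, rfl⟩ := hxi
      obtain ⟨O, p, P, hzO, hO, h⟩ := exists_isRetraction hi z V hx
      have h1 := h.extend_fn (f.2.2.mono fun y hy => hO hy)
      exact ⟨O, hzO, _, h1.1, h1.2⟩
    · exact ⟨⟨(Set.range i)ᶜ, hc.isOpen_compl⟩, hxi, fun _ => 0, contMDiffOn_const,
        fun z hz => absurd ⟨z, rfl⟩ hz⟩
  choose O hxO t ht hs using hloc
  obtain ⟨φ, hφ⟩ := exists_isPartition (E := E) V O fun x hx => ⟨⟨x, hx⟩, hxO _⟩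
  obtain ⟨g, hg⟩ := exists_fn_of_smooth (isModuleSheaf_fun.glue hφ t ht)
  refine ⟨g, fn_ext fun z hz => ?_⟩
  refine (hg (i z) hz).trans ?_
  exact hφ.map_finsum hz (fun j => t j (i z)) LinearMap.id (f.1 z) fun j hj => hs j z hj

end Retraction

/-! ### The generalized tangent bundle of a brane -/

section Related
variable {E : Type*} [NormedAddCommGroup E] [NormedSpace ℝ E] [FiniteDimensional ℝ E]
  {X : Type*} [TopologicalSpace X] [ChartedSpace E X] [IsManifold 𝓘(ℝ, E) ∞ X]
  {E' : Type*} [NormedAddCommGroup E'] [NormedSpace ℝ E'] [FiniteDimensional ℝ E']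
  {Z : Type*} [TopologicalSpace Z] [ChartedSpace E' Z] [IsManifold 𝓘(ℝ, E') ∞ Z]
  {i : C^∞⟮𝓘(ℝ, E'), Z; 𝓘(ℝ, E), X⟯} {U V : Opens X}

theorem exists_pre_eq (hi : Manifold.IsSmoothEmbedding 𝓘(ℝ, E') 𝓘(ℝ, E) ∞ i) (W : Opens Z) :
    ∃ O : Opens X, pre i O = W := by
  obtain ⟨O, hO, e⟩ := hi.isEmbedding.isInducing.isOpen_iff.1 W.2
  exact ⟨⟨O, hO⟩, Opens.ext e⟩

theorem mvfderiv_di {F : Type*} [NormedAddCommGroup F] [NormedSpace ℝ F] {g : X → F} {z : Z}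
    (hg : MDifferentiableAt 𝓘(ℝ, E) 𝓘(ℝ, F) g (i z)) (v : TangentSpace 𝓘(ℝ, E') z) :
    mvfderiv 𝓘(ℝ, E) g (i z) (di i z v) = mvfderiv 𝓘(ℝ, E') (fun z => g (i z)) z v :=
  (mvfderiv_comp_apply hg (i.contMDiff.mdifferentiable (by simp) z) v).symm

variable (i) in
/-- The vector field `ξ` on `X` restricts to the vector field `τ` on `Z`. -/
def Related (ξ : Vec E U) (τ : Vec E' (pre i U)) : Prop :=
  ∀ z ∈ pre i U, ξ.1 (i z) = di i z (τ.1 z)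

theorem Related.pullFn_der {ξ : Vec E U} {τ : Vec E' (pre i U)} (h : Related i ξ τ) (g : Fn E U) :
    pullFn i (der ξ g) = der τ (pullFn i g) :=
  fn_ext fun z hz => by
    change mvfderiv 𝓘(ℝ, E) g.1 (i z) (ξ.1 (i z)) = _
    rw [h z hz, mvfderiv_di (fn_mdiffAt g hz)]
    rfl

theorem Related.lieVec [T2Space X] [SecondCountableTopology X] [T2Space Z]
    [SecondCountableTopology Z] {ξ η : Vec E U} {τ υ : Vec E' (pre i U)} (h : Related i ξ τ)
    (h' : Related i η υ) : Related i (lieVec ξ η) (lieVec τ υ) := by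
  intro z hz
  rw [← sub_eq_zero]
  refine tangent_eq_zero fun f => ?_
  let f' : Fn E U := resFn le_top f
  have hf : f.1 =ᶠ[𝓝 (i z)] f'.1 := by
    filter_upwards [U.2.mem_nhds hz] with y hy
    exact (Set.indicator_of_mem hy f.1).symm
  rw [mvfderiv_congr hf, map_sub, sub_eq_zero, mvfderiv_di (fn_mdiffAt f' hz)]
  have e1 := congrFun (congrArg Subtype.val (congrArg (pullFn i) (der_lieVec ξ η f'))) z
  have e2 := congrFun (congrArg Subtype.val (der_lieVec τ υ (pullFn i f'))) z
  rw [map_sub, h.pullFn_der, h'.pullFn_der, h'.pullFn_der, h.pullFn_der] at e1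
  exact e1.trans e2.symm

/-- `d(da) = 0`, evaluated on three vector fields. -/
theorem extDer_closed [T2Space X] [SecondCountableTopology X] (a : Form E U) (ξ η ζ : Vec E U) :
    contr (iotaD (GCB.lieVec ξ η) a) ζ = der ξ (contr (iotaD η a) ζ) -
      contr (iotaD η a) (GCB.lieVec ξ ζ) - (der η (contr (iotaD ξ a) ζ) -
      der ζ (contr (iotaD ξ a) η) - contr (iotaD ξ a) (GCB.lieVec η ζ)) := by
  simp only [contr_iotaD, map_sub, der_lieVec]
  rw [lieVec_jacobi ξ η ζ]
  simp only [map_add]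
  abel

end Related

section Curvature
variable {E' : Type*} [NormedAddCommGroup E'] [NormedSpace ℝ E'] [FiniteDimensional ℝ E']
  {Z : Type*} [TopologicalSpace Z] [ChartedSpace E' Z] [IsManifold 𝓘(ℝ, E') ∞ Z]
  [T2Space Z] [SecondCountableTopology Z]

theorem extDer_d0 {W : Opens Z} (f : Fn E' W) {z : Z} (hz : z ∈ W) : extDer (d0 f) z = 0 := by
  ext v w
  obtain ⟨ξ, rfl⟩ := exists_vec v hz
  exact congrArg (fun L => L w) (congrFun (congrArg Subtype.val (iotaD_d0 ξ f)) z)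

theorem resForm_eventuallyEq {W W' : Opens Z} (h : W' ≤ W) (a : Form E' W) {z : Z} (hz : z ∈ W') :
    ∀ᶠ y in 𝓝 z, (resForm h a).1 y = a.1 y := by
  filter_upwards [W'.2.mem_nhds hz] with y hy
  exact if_pos hy

theorem HermData.F_eq (L : HermData E' Z) (I : L.κ) {z : Z} (hz : z ∈ L.W I) :
    L.F z = extDer (L.a I) z := by
  set J := (L.cover z).choose with hJ
  have hzJ : z ∈ L.W J := (L.cover z).choose_spec
  have hz2 : z ∈ L.W I ⊓ L.W J := ⟨hz, hzJ⟩
  have e : ∀ᶠ y in 𝓝 z, (L.a J).1 y = (resForm inf_le_left (L.a I) + d0 (L.c I J)).1 y := by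
    filter_upwards [(L.W I ⊓ L.W J).2.mem_nhds hz2,
      resForm_eventuallyEq (inf_le_left : L.W I ⊓ L.W J ≤ L.W I) (L.a I) hz2] with y hy hy2
    have := L.connection I J y hy
    rw [sub_eq_iff_eq_add'] at this
    rw [this, ← hy2]
    rfl
  have h1 : L.F z = extDer (L.a J) z := rfl
  rw [h1, extDer_congr hzJ hz2 e]
  ext v w
  rw [extDer_add, extDer_d0 _ hz2, extDer_congr hz2 hz (resForm_eventuallyEq _ _ hz2)]
  exact add_zero _

theorem HermData.smooth_F (L : HermData E' Z) {W : Opens Z} {τ : ∀ z : Z, TangentSpace 𝓘(ℝ, E') z}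
    (hτ : SmoothVec E' E' (fun z => z) τ W) : SmoothForm E' E' (fun z => z) (fun z => L.F z (τ z)) W := by
  refine (isModuleSheaf_form contMDiff_id).congr_loc _ _ fun z hz => ?_
  obtain ⟨I, hI⟩ := L.cover z
  obtain ⟨τ', hτ'⟩ := exists_vec_of_smooth (V := W ⊓ L.W I)
    (ContMDiffOn.mono hτ fun y hy => hy.1)
  refine ⟨W ⊓ L.W I, ⟨hz, hI⟩, _, (iotaD τ' (resForm inf_le_right (L.a I))).2.2, fun y hy => ?_⟩
  change _ = extDer (resForm inf_le_right (L.a I)) y (τ'.1 y)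
  rw [L.F_eq I hy.2, hτ' y hy, extDer_congr hy hy.2 (resForm_eventuallyEq _ _ hy)]

end Curvature

namespace GCBrane
variable {E : Type*} [NormedAddCommGroup E] [NormedSpace ℝ E] [FiniteDimensional ℝ E]
  {X : Type*} [TopologicalSpace X] [ChartedSpace E X] [IsManifold 𝓘(ℝ, E) ∞ X]
  {E' : Type*} [NormedAddCommGroup E'] [NormedSpace ℝ E'] [FiniteDimensional ℝ E']
  {Z : Type*} [TopologicalSpace Z] [ChartedSpace E' Z] [IsManifold 𝓘(ℝ, E') ∞ Z]
  {G : GCStructure E X} (B : GCBrane E' Z G) {U V : Opens X} {W W' : Opens Z}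
  [T2Space X] [SecondCountableTopology X] [T2Space Z] [SecondCountableTopology Z]

theorem exists_rSec (s : SecAlong B.emb (pre B.emb U)) : ∃ x : Sec E U, rSec B.emb x = s :=
  rSec_surjective B.isEmb B.closed U s

theorem exists_related (τ : Vec E' (pre B.emb U)) : ∃ ξ : Vec E U, Related B.emb ξ τ := by
  have h : SmoothVec E' E B.emb (fun z => di B.emb z (τ.1 z)) (pre B.emb U) :=
    SmoothVec.push (pre B.emb U).2 B.emb.contMDiff.contMDiffOn τ.2.2
  obtain ⟨s, hs⟩ := exists_secAlong_of_smooth (i := B.emb)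
    (t := fun z => ((di B.emb z (τ.1 z), 0) : GT E (B.emb z))) h
    (smoothForm_zero B.emb.contMDiff.contMDiffOn)
  obtain ⟨x, rfl⟩ := B.exists_rSec s
  exact ⟨anc x, fun z hz => congrArg Prod.fst (hs z hz)⟩

theorem exists_related_of_mem_TT {x : Sec E U} (hx : rSec B.emb x ∈ B.TT (pre B.emb U)) :
    ∃ τ : Vec E' (pre B.emb U), Related B.emb (anc x) τ ∧
      ∀ z ∈ pre B.emb U, ∀ w, (x.1 (B.emb z)).2 (di B.emb z w) = B.F z (τ.1 z) w := by
  obtain ⟨τ, hτ⟩ := exists_tangent_vec B.isEmb (W := pre B.emb U)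
    (ξ := fun z => (x.1 (B.emb z)).1) (rSec B.emb x).2.2.1 fun z _ => by
      obtain ⟨v, hv, -⟩ := hx z
      exact ⟨v, hv⟩
  refine ⟨τ, hτ, fun z hz w => ?_⟩
  obtain ⟨v, hv, hw⟩ := hx z
  have hv' : (x.1 (B.emb z)).1 = di B.emb z v := hv
  have : v = τ.1 z := di_injective B.isEmb z (hv'.symm.trans (hτ z hz))
  exact this ▸ hw w

theorem rSec_mem_TT {x : Sec E U} (h : ∀ z ∈ pre B.emb U, x.1 (B.emb z) ∈ B.TZ z) :
    rSec B.emb x ∈ B.TT (pre B.emb U) := fun z => by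
  by_cases hz : z ∈ pre B.emb U
  · exact h z hz
  · have e : (rSec B.emb x).1 z = 0 := (rSec B.emb x).2.1 z hz
    rw [e]
    exact (B.TZ z).zero_mem

theorem rSec_resSec_mem_TT (h : V ≤ U) {x : Sec E U} (hx : rSec B.emb x ∈ B.TT (pre B.emb U)) :
    rSec B.emb (resSec h x) ∈ B.TT (pre B.emb V) :=
  B.rSec_mem_TT fun z hz => by
    rw [resSec_apply h x hz]
    exact hx z

/-- Sections whose restriction to `Z` lies in `T(Z, F)` are closed under the Dorfman bracket, because
the curvature `F` is closed. -/
theorem dorf_mem_TT {x y : Sec E U} (hx : rSec B.emb x ∈ B.TT (pre B.emb U))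
    (hy : rSec B.emb y ∈ B.TT (pre B.emb U)) : rSec B.emb (dorf x y) ∈ B.TT (pre B.emb U) := by
  refine B.rSec_mem_TT fun z hz => ?_
  obtain ⟨I, hI⟩ := B.cover z
  obtain ⟨O, hO⟩ := exists_pre_eq B.isEmb (B.W I)
  have hzO : z ∈ pre B.emb O := hO.symm ▸ hI
  let V : Opens X := U ⊓ O
  have hzV : z ∈ pre B.emb V := ⟨hz, hzO⟩
  have hVI : pre B.emb V ≤ B.W I := fun y hy => hO ▸ (show y ∈ pre B.emb O from hy.2)
  have e0 : (dorf x y).1 (B.emb z) = (dorf (resSec (inf_le_left : V ≤ U) x)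
      (resSec (inf_le_left : V ≤ U) y)).1 (B.emb z) := by
    rw [dorf_resSec, resSec_apply _ _ (show B.emb z ∈ V from hzV)]
  rw [e0]
  generalize hx' : resSec (inf_le_left : V ≤ U) x = x'
  generalize hy' : resSec (inf_le_left : V ≤ U) y = y'
  have hxV : rSec B.emb x' ∈ B.TT (pre B.emb V) := by
    rw [← hx']; exact B.rSec_resSec_mem_TT _ hx
  have hyV : rSec B.emb y' ∈ B.TT (pre B.emb V) := by
    rw [← hy']; exact B.rSec_resSec_mem_TT _ hy
  obtain ⟨τ, hτ, hτF⟩ := B.exists_related_of_mem_TT hxV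
  obtain ⟨υ, hυ, hυF⟩ := B.exists_related_of_mem_TT hyV
  obtain ⟨a, ha⟩ : ∃ a : Form E' (pre B.emb V), ∀ z ∈ pre B.emb V, B.F z = extDer a z :=
    ⟨resForm hVI (B.a I), fun z hz => by
      rw [B.toHermData.F_eq I (hVI hz), extDer_congr hz (hVI hz) (resForm_eventuallyEq _ _ hz)]⟩
  have key : ∀ (p : Sec E V) (σ : Vec E' (pre B.emb V)) (ζ : Vec E V) (κ : Vec E' (pre B.emb V)),
      (∀ z ∈ pre B.emb V, ∀ w, (p.1 (B.emb z)).2 (di B.emb z w) = B.F z (σ.1 z) w) →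
      Related B.emb ζ κ → pullFn B.emb (contr (cot p) ζ) = contr (iotaD σ a) κ :=
    fun p σ ζ κ hp hζ => fn_ext fun z hz => by
      change (p.1 (B.emb z)).2 (ζ.1 (B.emb z)) = extDer a z (σ.1 z) (κ.1 z)
      rw [hζ z hz, hp z hz, ha z hz]
  refine ⟨(lieVec τ υ).1 z, ?_, fun w => ?_⟩
  · have := hτ.lieVec hυ z hzV
    rw [← anc_dorf] at this
    exact this
  · obtain ⟨κ, rfl⟩ := exists_vec w hzV
    obtain ⟨ζ, hζ⟩ := B.exists_related κ
    have h1 := contr_cot_dorf x' y' ζ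
    have h2 := congrArg (pullFn B.emb) h1
    simp only [map_sub] at h2
    rw [hτ.pullFn_der, hυ.pullFn_der, hζ.pullFn_der, key y' υ ζ κ hυF hζ,
      key y' υ _ _ hυF (hτ.lieVec hζ), key x' τ ζ κ hτF hζ, key x' τ _ _ hτF hυ,
      key x' τ _ _ hτF (hυ.lieVec hζ), ← extDer_closed] at h2
    have h3 := congrFun (congrArg Subtype.val h2) z
    change ((dorf x' y').1 (B.emb z)).2 (ζ.1 (B.emb z)) =
      extDer a z ((lieVec τ υ).1 z) (κ.1 z) at h3
    rw [hζ z hzV] at h3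
    rw [h3, ha z hzV]

/-- Every element of `T(Z, F)` extends to a smooth section. -/
theorem exists_TT_ext {z₀ : Z} {s₀ : GT E (B.emb z₀)} (hs : s₀ ∈ B.TZ z₀) :
    ∃ s ∈ B.TT (⊤ : Opens Z), s.1 z₀ = s₀ := by
  obtain ⟨v, hv, hw⟩ := hs
  obtain ⟨O, p, P, hzO, -, h⟩ := exists_isRetraction B.isEmb z₀ ⊤ trivial
  obtain ⟨γ, hγ⟩ := exists_sec (E := E) (x := B.emb z₀) ((0, s₀.2) : GT E (B.emb z₀)) ⊤ trivial
  have hγ2 : (γ.1 (B.emb z₀)).2 = s₀.2 := by rw [hγ]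
  obtain ⟨τ, hτ⟩ := exists_vec (E := E') v (U := (⊤ : Opens Z)) trivial
  -- The form part is `γ - p^* i^* γ + p^* (ι_τ F)`, where `γ` extends the form part of `s₀`.
  let α : ∀ z : Z, TangentSpace 𝓘(ℝ, E) (B.emb z) →L[ℝ] ℝ := fun z =>
    (γ.1 (B.emb z)).2 - ((γ.1 (B.emb z)).2.comp (di B.emb z)).comp (P z) + (B.F z (τ.1 z)).comp (P z)
  have hF : SmoothForm E' E' (fun z => z) (fun z => B.F z (τ.1 z)) (pre B.emb O) :=
    B.toHermData.smooth_F (ContMDiffOn.mono τ.2.2 (Set.subset_univ _))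
  have hα : SmoothForm E' E B.emb α (pre B.emb O) := by
    refine smoothForm_of_apply B.emb.contMDiff.contMDiffOn fun V hV ξ hξ => ?_
    have hξ' : SmoothVec E' E B.emb (fun z => ξ (B.emb z)) (pre B.emb O ∩ B.emb ⁻¹' V) :=
      SmoothVec.comp hξ B.emb.contMDiff.contMDiffOn fun z hz => hz.2
    have hP := h.proj_smooth _ _ (Set.inter_subset_left) hξ'
    have hdP : SmoothVec E' E B.emb (fun z => di B.emb z (P z (ξ (B.emb z))))
        (pre B.emb O ∩ B.emb ⁻¹' V) :=
      SmoothVec.push ((pre B.emb O).2.inter (hV.preimage B.emb.contMDiff.continuous))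
        B.emb.contMDiff.contMDiffOn hP
    have hγ' : SmoothForm E' E B.emb (fun z => (γ.1 (B.emb z)).2) (pre B.emb O ∩ B.emb ⁻¹' V) :=
      SmoothForm.comp γ.2.2.2 B.emb.contMDiff.contMDiffOn fun _ _ => trivial
    have hF' : SmoothForm E' E' (fun z => z) (fun z => B.F z (τ.1 z)) (pre B.emb O ∩ B.emb ⁻¹' V) :=
      ContMDiffOn.mono hF Set.inter_subset_left
    exact ((hγ'.apply hξ').sub (hγ'.apply hdP)).add (hF'.apply hP)
  have hd : SmoothVec E' E B.emb (fun z => di B.emb z (τ.1 z)) (pre B.emb O) :=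
    SmoothVec.push (pre B.emb O).2 B.emb.contMDiff.contMDiffOn
      (ContMDiffOn.mono τ.2.2 (Set.subset_univ _))
  obtain ⟨χ, hχ⟩ := exists_isCutoff (E := E') (pre B.emb O) (y := z₀) hzO
  let t : ∀ z, GT E (B.emb z) := fun z => (di B.emb z (τ.1 z), α z)
  have hcut := (isModuleSheaf_sec (f := B.emb) B.emb.contMDiff).cutoff hχ
    (s := t) ⟨hd, hα⟩ (⊤ : Opens Z)
  refine ⟨⟨fun z => χ z • t z,
    fun _ h => absurd trivial h, hcut.1, hcut.2⟩, fun z => ?_, ?_⟩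
  · by_cases hz : z ∈ pre B.emb O
    · refine (B.TZ z).smul_mem _ ⟨τ.1 z, rfl, fun w => ?_⟩
      change (γ.1 (B.emb z)).2 (di B.emb z w) - (γ.1 (B.emb z)).2 (di B.emb z (P z (di B.emb z w))) +
        B.F z (τ.1 z) (P z (di B.emb z w)) = _
      rw [h.proj_di z hz, sub_self, zero_add]
    · obtain ⟨N, hN, h0⟩ := hχ.eq_zero z hz
      change χ z • t z ∈ _
      rw [h0 z hN, zero_smul]
      exact (B.TZ z).zero_mem
  · change χ z₀ • t z₀ = _
    rw [hχ.apply_self, one_smul]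
    refine Prod.ext ?_ ?_
    · change di B.emb z₀ (τ.1 z₀) = s₀.1
      rw [hτ, hv]
    · ext w
      change (γ.1 (B.emb z₀)).2 w - (γ.1 (B.emb z₀)).2 (di B.emb z₀ (P z₀ w)) +
        B.F z₀ (τ.1 z₀) (P z₀ w) = _
      rw [hτ, hγ2, hw, sub_add_cancel]

/-- Every element of `T(Z, F)` is the value of a section over `U` that restricts to `T(Z, F)`. -/
theorem exists_sec_ext {z₀ : Z} (hz₀ : z₀ ∈ pre B.emb U) {s₀ : GT E (B.emb z₀)}
    (hs : s₀ ∈ B.TZ z₀) :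
    ∃ s : Sec E U, rSec B.emb s ∈ B.TT (pre B.emb U) ∧ s.1 (B.emb z₀) = s₀ := by
  obtain ⟨t, ht, e⟩ := B.exists_TT_ext hs
  obtain ⟨s, rfl⟩ := B.exists_rSec (U := ⊤) t
  refine ⟨resSec le_top s, B.rSec_resSec_mem_TT le_top ht, ?_⟩
  exact (resSec_apply le_top s (show B.emb z₀ ∈ U from hz₀)).trans e

/-- Tangential derivatives of sections vanishing on `Z` vanish on `Z`. -/
theorem dorf_eq_zero {b a : Sec E U} (hb : rSec B.emb b ∈ B.TT (pre B.emb U))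
    (ha : rSec B.emb a = 0) {z : Z} (hz : z ∈ pre B.emb U) : (dorf b a).1 (B.emb z) = 0 := by
  have ha' : ∀ z, a.1 (B.emb z) = 0 := fun z => congrFun (congrArg Subtype.val ha) z
  refine pairFib_nondegenerate fun w => ?_
  obtain ⟨y, rfl⟩ := exists_sec w U hz
  have h1 := congrFun (congrArg Subtype.val (der_pair b a y)) (B.emb z)
  have h2 : (der (anc b) (pair a y)).1 (B.emb z) = 0 := by
    obtain ⟨v, hv, -⟩ := hb z
    rw [der_apply, show (anc b).1 (B.emb z) = di B.emb z v from hv,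
      mvfderiv_di (fn_mdiffAt (pair a y) hz)]
    have : (fun z => (pair a y).1 (B.emb z)) = fun _ => (0 : ℝ) := funext fun z' => by
      rw [pair_apply, ha', map_zero, LinearMap.zero_apply]
    rw [this, mvfderiv_const]
    rfl
  rw [h2] at h1
  have h3 : (pair a (dorf b y)).1 (B.emb z) = 0 := by
    rw [pair_apply, ha', map_zero, LinearMap.zero_apply]
  have h4 : (0 : ℝ) = (pair (dorf b a) y).1 (B.emb z) + (pair a (dorf b y)).1 (B.emb z) := h1
  rw [h3, add_zero] at h4
  exact h4.symm

theorem J_along_mem (s : SecAlong B.emb W) : (fun z => G.J (B.emb z) (s.1 z)) ∈ SecAlong B.emb W := by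
  obtain ⟨O, rfl⟩ := exists_pre_eq B.isEmb W
  obtain ⟨x, rfl⟩ := B.exists_rSec s
  exact (rSec B.emb (G.JSec x)).2

/-- The action of `J` on sections along `Z`. -/
def JAlong : SecAlong B.emb W →ₗ[ℝ] SecAlong B.emb W where
  toFun s := ⟨fun z => G.J (B.emb z) (s.1 z), B.J_along_mem s⟩
  map_add' _ _ := Subtype.ext (funext fun z => (G.J (B.emb z)).map_add _ _)
  map_smul' c _ := Subtype.ext (funext fun z => (G.J (B.emb z)).map_smul c _)

end GCBrane

/-! ### Complex calculus on sections of the eigenbundle -/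

section ComplexCalculus
variable {E : Type*} [NormedAddCommGroup E] [NormedSpace ℝ E] [FiniteDimensional ℝ E]
  {M : Type*} [TopologicalSpace M] [ChartedSpace E M] [IsManifold 𝓘(ℝ, E) ∞ M]
  {U V : Opens M}

/-- Evaluation of complex functions at a point. -/
def evC (U : Opens M) (y : M) : ℂ ⊗[ℝ] Fn E U →ₗ[ℂ] ℂ :=
  LinearMap.liftBaseChange ℂ (Algebra.linearMap ℝ ℂ ∘ₗ evFn U y)

@[simp] theorem evC_tmul (y : M) (a : ℂ) (f : Fn E U) : evC U y (a ⊗ₜ f) = a * f.1 y := by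
  simp [evC, evFn]

theorem contMDiffOn_evC (g : ℂ ⊗[ℝ] Fn E U) :
    ContMDiffOn 𝓘(ℝ, E) 𝓘(ℝ, ℂ) ∞ (fun y => evC U y g) U := by
  induction g with
  | zero => simpa using contMDiffOn_const
  | add f g hf hg => exact (hf.add hg).congr fun y _ => map_add _ _ _
  | tmul a f =>
    have h : ContMDiffOn 𝓘(ℝ, E) 𝓘(ℝ) ∞ f.1 U := f.2.2
    refine (h.smul (contMDiffOn_const (c := a))).congr fun y _ => ?_
    simp [mul_comm]

theorem mdiffAt_evC (g : ℂ ⊗[ℝ] Fn E U) {y : M} (hy : y ∈ U) :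
    MDifferentiableAt 𝓘(ℝ, E) 𝓘(ℝ, ℂ) (fun y => evC U y g) y :=
  ((contMDiffOn_evC g).contMDiffAt (U.2.mem_nhds hy)).mdifferentiableAt (by simp)

theorem dC_evC (ξ : ℂ ⊗[ℝ] Vec E U) (g : ℂ ⊗[ℝ] Fn E U) {y : M} (hy : y ∈ U) :
    dC (fun y => evC U y g) y (LinearMap.baseChange ℂ (M := Vec E U)
      (LinearMap.proj (R := ℝ) (φ := fun y => TangentSpace 𝓘(ℝ, E) y) y ∘ₗ (Vec E U).subtype) ξ) =
    evC U y (derA ℂ ξ g) := by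
  induction g with
  | zero => simp [dC_zero]
  | add f g hf hg =>
    simp only [map_add]
    rw [dC_add (mdiffAt_evC f hy) (mdiffAt_evC g hy), hf, hg]
  | tmul a f =>
    have h : mvfderiv 𝓘(ℝ, E) (fun y => evC U y (a ⊗ₜ[ℝ] f)) y =
        (mvfderiv 𝓘(ℝ, E) f.1 y).smulRight a := by
      have := mvfderiv_smul (a := f.1) (g := fun _ : M => a) (x := y) (I := 𝓘(ℝ, E))
        (fn_mdiffAt f hy) mdifferentiableAt_const
      have e : (fun y => evC U y (a ⊗ₜ[ℝ] f)) = f.1 • (fun _ : M => a) := by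
        ext y; simp [mul_comm]
      rw [e, this]
      ext v; simp [mvfderiv_const]
    induction ξ with
    | zero => simp
    | add ξ η hξ hη => simp only [map_add, LinearMap.add_apply, hξ, hη]
    | tmul b ξ =>
      rw [derA_tmul, evC_tmul, dC, h]
      simp [der_apply]
      ring

variable [T2Space M] [SecondCountableTopology M]

theorem derA_dorfA (s t : ℂ ⊗[ℝ] Sec E U) (f : ℂ ⊗[ℝ] Fn E U) :
    derA ℂ (ancA ℂ (dorfA ℂ s t)) f =
      derA ℂ (ancA ℂ s) (derA ℂ (ancA ℂ t) f) - derA ℂ (ancA ℂ t) (derA ℂ (ancA ℂ s) f) := by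
  induction f with
  | zero => simp
  | add f g hf hg => simp only [map_add, hf, hg]; abel
  | tmul c f =>
    induction s with
    | zero => simp
    | add s s' h h' => simp only [map_add, LinearMap.add_apply, h, h']; abel
    | tmul a s =>
      induction t with
      | zero => simp
      | add t t' h h' => simp only [map_add, LinearMap.add_apply, h, h']; abel
      | tmul b t =>
        simp only [dorfA_tmul, ancA_tmul, derA_tmul, anc_dorf, der_lieVec, TensorProduct.tmul_sub]
        rw [mul_assoc, mul_left_comm b a c]

theorem dorfA_jacobi (s t u : ℂ ⊗[ℝ] Sec E U) :
    dorfA ℂ s (dorfA ℂ t u) = dorfA ℂ (dorfA ℂ s t) u + dorfA ℂ t (dorfA ℂ s u) := by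
  induction u with
  | zero => simp
  | add f g hf hg => simp only [map_add, hf, hg]; abel
  | tmul c u =>
    induction s with
    | zero => simp
    | add s s' h h' => simp only [map_add, LinearMap.add_apply, h, h']; abel
    | tmul a s =>
      induction t with
      | zero => simp
      | add t t' h h' => simp only [map_add, LinearMap.add_apply, h, h']; abel
      | tmul b t =>
        simp only [dorfA_tmul]
        rw [mul_left_comm b a c, mul_assoc, ← TensorProduct.tmul_add, ← dorf_jacobi]

namespace AlmostGC
variable (G : AlmostGC E M)

theorem dorfA_holo (a b : Sec E U) : dorfA ℂ (holo G.JSec a) (holo G.JSec b) =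
    1 ⊗ₜ (dorf a b - dorf (G.JSec a) (G.JSec b)) -
      Complex.I ⊗ₜ (dorf a (G.JSec b) + dorf (G.JSec a) b) := by
  simp only [holo, map_sub, LinearMap.sub_apply, dorfA_tmul, TensorProduct.tmul_sub,
    TensorProduct.tmul_add, one_mul, mul_one, Complex.I_mul_I, TensorProduct.neg_tmul]
  abel

/-- On sections of `L`, which is isotropic, the Dorfman bracket is skew. -/
theorem dorfA_swap {s t : ℂ ⊗[ℝ] Sec E U} (hs : s ∈ G.L U) (ht : t ∈ G.L U) :
    dorfA ℂ s t = - dorfA ℂ t s := by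
  rw [G.mem_L.1 hs, G.mem_L.1 ht]
  generalize reT s = a
  generalize reT t = b
  have h1 := dorf_add_swap a b
  have h2 := dorf_add_swap (G.JSec a) (G.JSec b)
  have h3 := dorf_add_swap a (G.JSec b)
  have h4 := dorf_add_swap (G.JSec a) b
  rw [G.pair_JSec_JSec] at h2
  rw [G.pair_JSec_left, map_neg, map_neg, smul_neg, ← h3] at h4
  rw [eq_neg_iff_add_eq_zero, dorfA_holo, dorfA_holo]
  have e1 : dorf a b - dorf (G.JSec a) (G.JSec b) + (dorf b a - dorf (G.JSec b) (G.JSec a)) = 0 := by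
    rw [← sub_eq_zero_of_eq (h1.trans h2.symm)]
    abel
  have e2 : dorf a (G.JSec b) + dorf (G.JSec a) b + (dorf b (G.JSec a) + dorf (G.JSec b) a) = 0 := by
    rw [← sub_eq_zero_of_eq h4]
    abel
  rw [sub_add_sub_comm, ← TensorProduct.tmul_add, ← TensorProduct.tmul_add, e1, e2]
  simp

end AlmostGC

/-- `δ_L(δ_L μ(x)) = 0`. -/
theorem GCStructure.deltaHalf_closed (G : GCStructure E M) (x : Sec E U)
    {s₀ s₁ s₂ : ℂ ⊗[ℝ] Sec E U} (h₀ : s₀ ∈ G.L U) (h₁ : s₁ ∈ G.L U) (h₂ : s₂ ∈ G.L U) :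
    derA ℂ (ancA ℂ s₀) (deltaHalf x s₁ s₂) - derA ℂ (ancA ℂ s₁) (deltaHalf x s₀ s₂) +
      derA ℂ (ancA ℂ s₂) (deltaHalf x s₀ s₁) - deltaHalf x (dorfA ℂ s₀ s₁) s₂ +
      deltaHalf x (dorfA ℂ s₀ s₂) s₁ - deltaHalf x (dorfA ℂ s₁ s₂) s₀ = 0 := by
  have h := dorfA_jacobi s₀ s₁ s₂
  rw [G.dorfA_swap h₀ (G.involutive U _ h₁ _ h₂), G.dorfA_swap h₁ (G.involutive U _ h₀ _ h₂)] at h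
  have h' := congrArg (pairA ℂ (1 ⊗ₜ x)) h
  simp only [map_add, map_neg] at h'
  simp only [deltaHalf, derA_dorfA, map_sub]
  linear_combination (norm := abel) -h'

end ComplexCalculus

/-! ### The Lie algebroid of a brane -/

/-- The alternating map given by a bilinear map that vanishes on the diagonal. -/
def altOfBilin {R P Q : Type*} [CommRing R] [AddCommGroup P] [Module R P] [AddCommGroup Q]
    [Module R Q] (b : P →ₗ[R] P →ₗ[R] Q) (h : ∀ v, b v v = 0) : P [⋀^Fin 2]→ₗ[R] Q where
  toFun m := b (m 0) (m 1)
  map_update_add' m i x y := by fin_cases i <;> simp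
  map_update_smul' m i c x := by fin_cases i <;> simp
  map_eq_zero_of_eq' m i j e hij := by
    have h' : m 0 = m 1 := by fin_cases i <;> fin_cases j <;> simp_all
    change b (m 0) (m 1) = 0
    rw [h', h]

theorem alt_ext {R P Q : Type*} [CommRing R] [AddCommGroup P] [Module R P] [AddCommGroup Q]
    [Module R Q] {f g : P [⋀^Fin 2]→ₗ[R] Q} (h : ∀ v w, f ![v, w] = g ![v, w]) : f = g :=
  AlternatingMap.ext fun m => by
    have e : m = ![m 0, m 1] := by
      ext i
      fin_cases i <;> rfl
    rw [e, h]

section Algebroid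
variable {E : Type*} [NormedAddCommGroup E] [NormedSpace ℝ E] [FiniteDimensional ℝ E]
  {X : Type*} [TopologicalSpace X] [ChartedSpace E X] [IsManifold 𝓘(ℝ, E) ∞ X]
  {E' : Type*} [NormedAddCommGroup E'] [NormedSpace ℝ E'] [FiniteDimensional ℝ E']
  {Z : Type*} [TopologicalSpace Z] [ChartedSpace E' Z] [IsManifold 𝓘(ℝ, E') ∞ Z]
  {G : GCStructure E X}

theorem AlmostGC.omegaAt_self {U : Opens X} (G : AlmostGC E X) (x : Sec E U) (y : X)
    (v : GT E y) : G.omegaAt x y v v = 0 := by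
  have h := congrFun (congrArg Subtype.val (G.omega_swap x (secExt U y v) (secExt U y v))) y
  exact self_eq_neg.1 h

theorem cBil_self {P : Type*} [AddCommGroup P] [Module ℝ P] {b : P →ₗ[ℝ] P →ₗ[ℝ] ℝ}
    (h : ∀ v, b v v = 0) (v : ℂ ⊗[ℝ] P) : cBil b v v = 0 := by
  have h' : b (imT v) (reT v) = - b (reT v) (imT v) := by
    have := h (reT v + imT v)
    simp only [map_add, LinearMap.add_apply, h, zero_add, add_zero] at this
    linarith
  rw [eq_re_add_im v]
  simp only [map_add, LinearMap.add_apply, cBil_tmul, h, h']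
  push_cast
  ring

namespace GCBrane
variable (B : GCBrane E' Z G) {U V : Opens X} {W W' : Opens Z}

theorem mem_lFib {z : Z} {v : ℂ ⊗[ℝ] GT E (B.emb z)} :
    v ∈ B.lFib z ↔ reT v ∈ B.TZ z ∧ v = holo (G.J (B.emb z)) (reT v) := by
  change v ∈ (B.TZ z).baseChange ℂ ∧
    v ∈ Module.End.eigenspace ((G.J (B.emb z)).baseChange ℂ) Complex.I ↔ _
  rw [mem_eigenspace_I (G.sq (B.emb z)), mem_baseChange_complex]
  refine ⟨fun h => ⟨h.1.1, h.2⟩, fun h => ⟨⟨h.1, ?_⟩, h.2⟩⟩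
  rw [h.2, imT_holo]
  exact (B.TZ z).neg_mem (B.compat z _ h.1)

/-- The isomorphism `a ↦ a - iJa` from `T(Z, F)` to `l`. -/
def jl (z : Z) : B.TZ z →ₗ[ℝ] B.lFib z where
  toFun a := ⟨holo (G.J (B.emb z)) a.1, B.mem_lFib.2 (by simp)⟩
  map_add' a b := Subtype.ext (by
    simp only [holo, Submodule.coe_add, map_add, TensorProduct.tmul_add]
    abel)
  map_smul' c a := Subtype.ext (by
    simp only [holo, map_smul, TensorProduct.tmul_smul, RingHom.id_apply,
      smul_sub, SetLike.val_smul_of_tower])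

theorem exists_jl {z : Z} (v : B.lFib z) : ∃ a, B.jl z a = v :=
  ⟨⟨reT v.1, (B.mem_lFib.1 v.2).1⟩, Subtype.ext (B.mem_lFib.1 v.2).2.symm⟩

theorem jl_J {z : Z} (a : B.TZ z) (h : G.J (B.emb z) a.1 ∈ B.TZ z) :
    B.jl z ⟨G.J (B.emb z) a.1, h⟩ = Complex.I • B.jl z a :=
  Subtype.ext (tensor_ext (by
    change reT (holo _ _) = reT (Complex.I • holo _ _)
    rw [reT_I_smul, reT_holo, imT_holo, neg_neg]) (by
    change imT (holo _ _) = imT (Complex.I • holo _ _)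
    rw [imT_I_smul, reT_holo, imT_holo, G.sq, neg_neg]))

/-- The value at `z` of `δ_l μ(q(x))`, expressed through the Lie derivative of `J` along `x`. -/
def zetaFib (x : Sec E U) (z : Z) : B.lFib z [⋀^Fin 2]→ₗ[ℂ] ℂ :=
  altOfBilin ((Complex.I / 2) • (cBil (G.omegaAt x (B.emb z))).compl₁₂ (B.lFib z).subtype
    (B.lFib z).subtype) fun v => by
      change Complex.I / 2 * cBil (G.omegaAt x (B.emb z)) v.1 v.1 = 0
      rw [cBil_self (G.omegaAt_self x (B.emb z)), mul_zero]

theorem zetaFib_apply (x : Sec E U) (z : Z) (v w : B.lFib z) : B.zetaFib x z ![v, w] =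
    Complex.I / 2 * cBil (G.omegaAt x (B.emb z)) v.1 w.1 := rfl

theorem ev_rSec (s : ℂ ⊗[ℝ] Sec E U) (z : Z) :
    B.ev z ((rSec B.emb (U := U)).baseChange ℂ s) = (evSec U (B.emb z)).baseChange ℂ s := by
  induction s with
  | zero => simp
  | add s t hs ht => simp only [map_add, hs, ht]
  | tmul a s => rfl

theorem muFib_eq (x : Sec E U) {z : Z} (v : B.lFib z) (s : ℂ ⊗[ℝ] Sec E U)
    (hs : v.1 = (evSec U (B.emb z)).baseChange ℂ s) :
    B.mu _ (B.qr x) z v = evC U (B.emb z) (pairA ℂ (1 ⊗ₜ x) s) := by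
  change LinearMap.liftBaseChange ℂ
    (Algebra.linearMap ℝ ℂ ∘ₗ pairFib E (B.emb z) (x.1 (B.emb z))) v.1 = _
  rw [hs]
  clear hs
  induction s with
  | zero => simp
  | add s t hs ht => simp only [map_add, hs, ht]
  | tmul a s =>
    rw [pairA_tmul, evC_tmul, one_mul]
    rfl

theorem di_baseChange_dC (g : X → ℂ) {z : Z}
    (hg : MDifferentiableAt 𝓘(ℝ, E) 𝓘(ℝ, ℂ) g (B.emb z))
    (v : ℂ ⊗[ℝ] TangentSpace 𝓘(ℝ, E') z) :
    dC (fun z => g (B.emb z)) z v = dC g (B.emb z) ((di B.emb z).toLinearMap.baseChange ℂ v) := by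
  induction v with
  | zero => simp
  | add v w hv hw => simp only [map_add, hv, hw]
  | tmul a v =>
    simp only [dC, LinearMap.baseChange_tmul, LinearMap.liftBaseChange_tmul]
    congr 1
    exact (mvfderiv_di hg v).symm

/-- The derivative on `Z` along the anchor of a section of `l` is computed by an extension to `X`. -/
theorem dC_anchor (g : ℂ ⊗[ℝ] Fn E U) {z : Z} (hz : z ∈ pre B.emb U) {v : B.lFib z}
    {s : ℂ ⊗[ℝ] Sec E U} (hs : v.1 = (evSec U (B.emb z)).baseChange ℂ s)
    {τ : ℂ ⊗[ℝ] TangentSpace 𝓘(ℝ, E') z} (hτ : B.IsAnchor z v τ) :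
    dC (fun z => evC U (B.emb z) g) z τ = evC U (B.emb z) (derA ℂ (ancA ℂ s) g) := by
  rw [B.di_baseChange_dC (fun y => evC U y g) (mdiffAt_evC g hz), ← dC_evC (y := B.emb z) _ _ hz]
  congr 1
  refine Eq.trans hτ ?_
  rw [hs]
  clear hs
  induction s with
  | zero => simp
  | add s t hs ht => simp only [map_add, hs, ht]
  | tmul a s => rfl

theorem exists_isAnchor {z : Z} (v : B.lFib z) : ∃ τ, B.IsAnchor z v τ := by
  obtain ⟨a, rfl⟩ := B.exists_jl v
  obtain ⟨v, hv, -⟩ := a.2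
  obtain ⟨w, hw, -⟩ := B.compat z _ a.2
  refine ⟨1 ⊗ₜ v - Complex.I ⊗ₜ w, ?_⟩
  change (di B.emb z).toLinearMap.baseChange ℂ _ = (GT.proj (B.emb z)).baseChange ℂ (holo _ _)
  rw [holo, map_sub, map_sub]
  simp only [LinearMap.baseChange_tmul]
  exact congrArg₂ (fun p q => (1 : ℂ) ⊗ₜ[ℝ] p - Complex.I ⊗ₜ[ℝ] q) hv.symm hw.symm

theorem contMDiffOn_evC_emb (g : ℂ ⊗[ℝ] Fn E U) :
    ContMDiffOn 𝓘(ℝ, E') 𝓘(ℝ, ℂ) ∞ (fun z => evC U (B.emb z) g) (pre B.emb U) :=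
  (contMDiffOn_evC g).comp B.emb.contMDiff.contMDiffOn fun _ h => h

section
variable [T2Space X] [SecondCountableTopology X]

theorem zetaFib_jl (x : Sec E U) {z : Z} (hz : z ∈ pre B.emb U) (a b : B.TZ z) :
    B.zetaFib x z ![B.jl z a, B.jl z b] = G.omegaAt x (B.emb z) a (G.J (B.emb z) b) +
      Complex.I * G.omegaAt x (B.emb z) a b := by
  rw [zetaFib_apply]
  change Complex.I / 2 * cBil _ (holo _ _) (holo _ _) = _
  rw [cBil_holo (G.sq _) (fun a b => G.omegaAt_J x hz a b)]
  linear_combination (-(G.omegaAt x (B.emb z) a (G.J (B.emb z) b) : ℂ)) * Complex.I_mul_I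

theorem zetaFib_eq_zero_iff (x : Sec E U) {z : Z} (hz : z ∈ pre B.emb U) :
    B.zetaFib x z = 0 ↔ ∀ a ∈ B.TZ z, ∀ b ∈ B.TZ z, G.omegaAt x (B.emb z) a b = 0 := by
  constructor
  · intro h a ha b hb
    have e := B.zetaFib_jl x hz ⟨a, ha⟩ ⟨b, hb⟩
    rw [h] at e
    have := congrArg Complex.im e
    simpa using this.symm
  · intro h
    refine alt_ext fun v w => ?_
    obtain ⟨a, rfl⟩ := B.exists_jl v
    obtain ⟨b, rfl⟩ := B.exists_jl w
    rw [B.zetaFib_jl x hz, h _ a.2 _ b.2, h _ a.2 _ (B.compat z _ b.2)]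
    simp

theorem zetaFib_add (x x' : Sec E U) {z : Z} (hz : z ∈ pre B.emb U) :
    B.zetaFib (x + x') z = B.zetaFib x z + B.zetaFib x' z := by
  refine alt_ext fun v w => ?_
  obtain ⟨a, rfl⟩ := B.exists_jl v
  obtain ⟨b, rfl⟩ := B.exists_jl w
  rw [AlternatingMap.add_apply, B.zetaFib_jl _ hz, B.zetaFib_jl _ hz, B.zetaFib_jl _ hz,
    G.omegaAt_add _ _ (show B.emb z ∈ U from hz)]
  simp only [LinearMap.add_apply]
  push_cast
  ring

theorem zetaFib_sub (x x' : Sec E U) {z : Z} (hz : z ∈ pre B.emb U) :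
    B.zetaFib (x - x') z = B.zetaFib x z - B.zetaFib x' z := by
  rw [eq_sub_iff_add_eq, ← B.zetaFib_add _ _ hz, sub_add_cancel]

theorem zetaFib_congr {x : Sec E U} {x' : Sec E V} {z : Z} (hz : z ∈ pre B.emb U)
    (hz' : z ∈ pre B.emb V) (h : ∀ᶠ y in 𝓝 (B.emb z), x.1 y = x'.1 y) :
    B.zetaFib x z = B.zetaFib x' z := by
  refine alt_ext fun v w => ?_
  rw [zetaFib_apply, zetaFib_apply, G.omegaAt_congr hz hz' h]

theorem zetaFib_resSec (h : V ≤ U) (x : Sec E U) {z : Z} (hz : z ∈ pre B.emb V) :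
    B.zetaFib (resSec h x) z = B.zetaFib x z :=
  B.zetaFib_congr hz (h hz) (resSec_eventuallyEq h x hz)

theorem zetaFib_of_mem_T {x : Sec E U} (hx : x ∈ G.T U) {z : Z} (hz : z ∈ pre B.emb U) :
    B.zetaFib x z = 0 :=
  (B.zetaFib_eq_zero_iff x hz).2 fun _ _ _ _ => by
    rw [G.mem_T_iff.1 hx _ hz]
    rfl

theorem evC_omegaC (x : Sec E U) (s t : ℂ ⊗[ℝ] Sec E U) {y : X} (hy : y ∈ U) :
    evC U y (G.omegaC x s t) = cBil (G.omegaAt x y) ((evSec U y).baseChange ℂ s)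
      ((evSec U y).baseChange ℂ t) := by
  induction s with
  | zero => simp
  | add s s' h h' => simp only [map_add, LinearMap.add_apply, h, h']
  | tmul a s =>
    induction t with
    | zero => simp
    | add t t' h h' => simp only [map_add, h, h']
    | tmul b t =>
      rw [G.omegaC_tmul, evC_tmul, LinearMap.baseChange_tmul, LinearMap.baseChange_tmul, cBil_tmul,
        G.omega_val _ _ _ hy]
      rfl

theorem evC_deltaHalf (x : Sec E U) {s t : ℂ ⊗[ℝ] Sec E U} (hs : s ∈ G.L U) (ht : t ∈ G.L U)
    {z : Z} (hz : z ∈ pre B.emb U) {v w : B.lFib z}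
    (hv : v.1 = (evSec U (B.emb z)).baseChange ℂ s)
    (hw : w.1 = (evSec U (B.emb z)).baseChange ℂ t) :
    evC U (B.emb z) (deltaHalf x s t) = B.zetaFib x z ![v, w] := by
  rw [G.deltaHalf_of_mem_L x hs ht, map_smul, evC_omegaC x s t hz, zetaFib_apply, hv, hw, smul_eq_mul]

variable [T2Space Z] [SecondCountableTopology Z]

/-- Every element of `l` extends to a section of `L` over `U` that restricts to a section of `l`. -/
theorem exists_holo_ext {z : Z} (hz : z ∈ pre B.emb U) (v : B.lFib z) :
    ∃ a : Sec E U, rSec B.emb a ∈ B.TT (pre B.emb U) ∧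
      v.1 = (evSec U (B.emb z)).baseChange ℂ (holo G.JSec a) := by
  obtain ⟨a₀, rfl⟩ := B.exists_jl v
  obtain ⟨a, ha, e⟩ := B.exists_sec_ext hz a₀.2
  refine ⟨a, ha, ?_⟩
  rw [baseChange_holo (K := G.J (B.emb z)) (evSec U (B.emb z)) (fun _ => rfl)]
  exact congrArg (holo (G.J (B.emb z))) e.symm

theorem rSec_mem_lSec {s : ℂ ⊗[ℝ] Sec E U} (hs : s ∈ G.L U)
    (h : rSec B.emb (reT s) ∈ B.TT (pre B.emb U)) :
    (rSec B.emb (U := U)).baseChange ℂ s ∈ B.lSec (pre B.emb U) := by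
  refine (Submodule.mem_iInf _).2 fun z => ?_
  change B.ev z _ ∈ B.lFib z
  have e := G.mem_L.1 hs
  rw [ev_rSec, mem_lFib, reT_baseChange]
  refine ⟨h z, ?_⟩
  conv_lhs => rw [e]
  exact baseChange_holo (K := G.J (B.emb z)) (evSec U (B.emb z)) (fun _ => rfl) _

theorem JSec_mem_TT {a : Sec E U} (ha : rSec B.emb a ∈ B.TT (pre B.emb U)) :
    rSec B.emb (G.JSec a) ∈ B.TT (pre B.emb U) := fun z => B.compat z _ (ha z)

theorem reT_dorfA_holo_mem_TT {a b : Sec E U} (ha : rSec B.emb a ∈ B.TT (pre B.emb U))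
    (hb : rSec B.emb b ∈ B.TT (pre B.emb U)) :
    rSec B.emb (reT (dorfA ℂ (holo G.JSec a) (holo G.JSec b))) ∈ B.TT (pre B.emb U) := by
  rw [G.dorfA_holo, map_sub, reT_tmul, reT_tmul]
  simp only [Complex.one_re, one_smul, Complex.I_re, zero_smul, sub_zero, map_sub]
  exact (B.TT _).sub_mem (B.dorf_mem_TT ha hb)
    (B.dorf_mem_TT (B.JSec_mem_TT ha) (B.JSec_mem_TT hb))

/-- `δ_l μ(q(x))` is the restriction to `l` of the Lie derivative of `J` along `x`. -/
theorem isDelta_iff (x : Sec E U) (ζ : ∀ z, B.lFib z [⋀^Fin 2]→ₗ[ℂ] ℂ) :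
    B.IsDelta U (B.mu _ (B.qr x)) ζ ↔ ∀ z ∈ pre B.emb U, ζ z = B.zetaFib x z := by
  have key : ∀ (s t u : B.lSec (pre B.emb U)), ∀ s' ∈ G.L U, ∀ t' ∈ G.L U,
      (rSec B.emb (U := U)).baseChange ℂ s' = s.1 →
      (rSec B.emb (U := U)).baseChange ℂ t' = t.1 →
      (rSec B.emb (U := U)).baseChange ℂ (dorfA ℂ s' t') = u.1 → ∀ z ∈ pre B.emb U, ∀ v w,
      B.IsAnchor z (B.val z s) v → B.IsAnchor z (B.val z t) w →
      B.zetaFib x z ![B.val z s, B.val z t] =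
      dC (fun z => B.mu _ (B.qr x) z (B.val z t)) z v -
        dC (fun z => B.mu _ (B.qr x) z (B.val z s)) z w - B.mu _ (B.qr x) z (B.val z u) := by
    intro s t u s' hs' t' ht' es et eu z hz v w hv hw
    have hval : ∀ (p : B.lSec (pre B.emb U)) (p' : ℂ ⊗[ℝ] Sec E U),
        (rSec B.emb (U := U)).baseChange ℂ p' = p.1 → ∀ z,
        (B.val z p).1 = (evSec U (B.emb z)).baseChange ℂ p' := fun p p' e z => by
      rw [← B.ev_rSec, e]
      rfl
    have h1 : ∀ (p : B.lSec (pre B.emb U)) (p' : ℂ ⊗[ℝ] Sec E U),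
        (rSec B.emb (U := U)).baseChange ℂ p' = p.1 →
        (fun z => B.mu _ (B.qr x) z (B.val z p)) =
          fun z => evC U (B.emb z) (pairA ℂ (1 ⊗ₜ x) p') := fun p p' e =>
      funext fun z => B.muFib_eq x _ _ (hval p p' e z)
    rw [h1 t t' et, h1 s s' es, B.muFib_eq x _ _ (hval u _ eu z),
      B.dC_anchor _ hz (hval s s' es z) hv, B.dC_anchor _ hz (hval t t' et z) hw,
      ← map_sub, ← map_sub, ← B.evC_deltaHalf x hs' ht' hz (hval s s' es z) (hval t t' et z)]
    rfl
  constructor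
  · intro h z hz
    refine alt_ext fun p q => ?_
    obtain ⟨a, ha, ea⟩ := B.exists_holo_ext hz p
    obtain ⟨b, hb, eb⟩ := B.exists_holo_ext hz q
    have hla := G.holo_mem_L a
    have hlb := G.holo_mem_L b
    let s : B.lSec (pre B.emb U) := ⟨_, B.rSec_mem_lSec hla (by rwa [reT_holo])⟩
    let t : B.lSec (pre B.emb U) := ⟨_, B.rSec_mem_lSec hlb (by rwa [reT_holo])⟩
    let u : B.lSec (pre B.emb U) := ⟨_, B.rSec_mem_lSec (G.involutive U _ hla _ hlb)
      (B.reT_dorfA_holo_mem_TT ha hb)⟩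
    have es : p = B.val z s := Subtype.ext (ea.trans (B.ev_rSec _ z).symm)
    have et : q = B.val z t := Subtype.ext (eb.trans (B.ev_rSec _ z).symm)
    obtain ⟨v, hv⟩ := B.exists_isAnchor (B.val z s)
    obtain ⟨w, hw⟩ := B.exists_isAnchor (B.val z t)
    rw [es, et, h s t u ⟨_, hla, _, hlb, rfl, rfl, rfl⟩ z hz v w hv hw,
      key s t u _ hla _ hlb rfl rfl rfl z hz v w hv hw]
  · rintro h s t u ⟨s', hs', t', ht', es, et, eu⟩ z hz v w hv hw
    rw [h z hz]
    exact key s t u s' hs' t' ht' es et eu z hz v w hv hw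

end
end GCBrane
end Algebroid

/-! ### Cochains of the Lie algebroid -/

section Cochains
variable {E : Type*} [NormedAddCommGroup E] [NormedSpace ℝ E] [FiniteDimensional ℝ E]
  {X : Type*} [TopologicalSpace X] [ChartedSpace E X] [IsManifold 𝓘(ℝ, E) ∞ X]
  {E' : Type*} [NormedAddCommGroup E'] [NormedSpace ℝ E'] [FiniteDimensional ℝ E']
  {Z : Type*} [TopologicalSpace Z] [ChartedSpace E' Z] [IsManifold 𝓘(ℝ, E') ∞ Z]
  {G : GCStructure E X}
  [T2Space X] [SecondCountableTopology X] [T2Space Z] [SecondCountableTopology Z]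

theorem exists_global_near {U : Opens X} (x : Sec E U) {y : X} (hy : y ∈ U) :
    ∃ x' : Sec E (⊤ : Opens X), ∀ᶠ z in 𝓝 y, x'.1 z = x.1 z := by
  obtain ⟨χ, hχ⟩ := exists_isCutoff (E := E) U hy
  have h := (isModuleSheaf_sec (f := fun x : X => x) contMDiff_id).cutoff hχ (s := x.1)
    ⟨x.2.1.2, x.2.2.2⟩ (⊤ : Opens X)
  obtain ⟨x', hx'⟩ := exists_sec_of_smooth h.1 h.2
  refine ⟨x', hχ.eq_one.mono fun z hz => ?_⟩
  rw [hx' z trivial, hz, one_smul]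

/-- A linear form on a tangent space as an element of the cotangent space: tangent spaces are
finite-dimensional, so it is continuous. -/
def cotOfLinear {x : X} (l : TangentSpace 𝓘(ℝ, E) x →ₗ[ℝ] ℝ) : TangentSpace 𝓘(ℝ, E) x →L[ℝ] ℝ :=
  LinearMap.toContinuousLinearMap (𝕜 := ℝ) (E := E) (F' := ℝ) l

theorem dC_congr {g g' : Z → ℂ} {z : Z} (h : g =ᶠ[𝓝 z] g')
    (v : ℂ ⊗[ℝ] TangentSpace 𝓘(ℝ, E') z) : dC g z v = dC g' z v := by
  rw [dC, mvfderiv_congr h, dC]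

namespace GCBrane
variable (B : GCBrane E' Z G) {U V : Opens X} {W W' : Opens Z}

theorem reT_mem_TT {s : ℂ ⊗[ℝ] Sec E U} {u : B.lSec (pre B.emb U)}
    (h : (rSec B.emb (U := U)).baseChange ℂ s = u.1) :
    rSec B.emb (reT s) ∈ B.TT (pre B.emb U) := fun z => by
  have e := (B.mem_lFib.1 (B.lSec_ev u z)).1
  rw [← h, ev_rSec, reT_baseChange] at e
  exact e

theorem dorfA_rSec_eq_zero {s d : ℂ ⊗[ℝ] Sec E U} (hs : s ∈ G.L U) (hd : d ∈ G.L U)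
    (hs' : rSec B.emb (reT s) ∈ B.TT (pre B.emb U))
    (hd' : (rSec B.emb (U := U)).baseChange ℂ d = 0) :
    (rSec B.emb (U := U)).baseChange ℂ (dorfA ℂ s d) = 0 := by
  have h0 : rSec B.emb (reT d) = 0 := by rw [← reT_baseChange, hd', map_zero]
  rw [G.mem_L.1 hs, G.mem_L.1 hd, G.dorfA_holo]
  generalize reT s = a at hs'
  generalize reT d = b at h0
  have h0' : rSec B.emb (G.JSec b) = 0 := secAlong_ext fun z _ => by
    have : b.1 (B.emb z) = 0 := congrFun (congrArg Subtype.val h0) z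
    change G.J _ (b.1 (B.emb z)) = 0
    rw [this, map_zero]
  have key : ∀ p q : Sec E U, rSec B.emb p ∈ B.TT (pre B.emb U) → rSec B.emb q = 0 →
      rSec B.emb (dorf p q) = 0 := fun p q hp hq =>
    secAlong_ext fun z hz => B.dorf_eq_zero hp hq hz
  simp only [map_sub, LinearMap.baseChange_tmul, map_add, key _ _ hs' h0, key _ _ hs' h0',
    key _ _ (B.JSec_mem_TT hs') h0, key _ _ (B.JSec_mem_TT hs') h0']
  simp

variable {B} in
/-- The bracket of `l` may be computed from any extensions to sections of `L`. -/
theorem IsBracket.eq_of_ext {s t u : B.lSec (pre B.emb U)} (h : B.IsBracket U s t u)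
    {s' t' : ℂ ⊗[ℝ] Sec E U} (hs' : s' ∈ G.L U) (ht' : t' ∈ G.L U)
    (es : (rSec B.emb (U := U)).baseChange ℂ s' = s.1)
    (et : (rSec B.emb (U := U)).baseChange ℂ t' = t.1) :
    (rSec B.emb (U := U)).baseChange ℂ (dorfA ℂ s' t') = u.1 := by
  obtain ⟨s₁, hs₁, t₁, ht₁, es₁, et₁, eu⟩ := h
  rw [← eu, ← sub_eq_zero, ← map_sub]
  have e : dorfA ℂ s' t' - dorfA ℂ s₁ t₁ =
      dorfA ℂ s' (t' - t₁) - dorfA ℂ t₁ (s' - s₁) := by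
    rw [← neg_eq_iff_eq_neg.2 (G.dorfA_swap ((G.L U).sub_mem hs' hs₁) ht₁)]
    simp only [map_sub, LinearMap.sub_apply]
    abel
  rw [e, map_sub, B.dorfA_rSec_eq_zero hs' ((G.L U).sub_mem ht' ht₁) (B.reT_mem_TT es)
    (by rw [map_sub, et, et₁, sub_self]), B.dorfA_rSec_eq_zero ht₁ ((G.L U).sub_mem hs' hs₁)
    (B.reT_mem_TT et₁) (by rw [map_sub, es, es₁, sub_self]), sub_zero]

/-- The 2-cochain `ζ` is locally of the form `δ_l μ(q(x))`. -/
def IsLocallyDelta (ζ : ∀ z, B.lFib z [⋀^Fin 2]→ₗ[ℂ] ℂ) : Prop :=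
  ∀ z, ∃ (U : Opens X) (x : Sec E U), z ∈ pre B.emb U ∧ ∀ z' ∈ pre B.emb U, ζ z' = B.zetaFib x z'

variable {B} in
theorem IsLocallyDelta.exists_global {ζ : ∀ z, B.lFib z [⋀^Fin 2]→ₗ[ℂ] ℂ}
    (h : B.IsLocallyDelta ζ) (z : Z) :
    ∃ x : Sec E (⊤ : Opens X), ∀ᶠ z' in 𝓝 z, ζ z' = B.zetaFib x z' := by
  obtain ⟨U, x, hz, hx⟩ := h z
  obtain ⟨x', hx'⟩ := exists_global_near x hz
  refine ⟨x', ?_⟩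
  filter_upwards [B.emb.contMDiff.continuous.continuousAt.eventually hx'.eventually_nhds,
    (pre B.emb U).2.mem_nhds hz] with z' h1 h2
  rw [hx z' h2]
  exact (B.zetaFib_congr (U := ⊤) trivial h2 h1).symm

variable {B} in
theorem IsLocallyDelta.isClosed2 {ζ : ∀ z, B.lFib z [⋀^Fin 2]→ₗ[ℂ] ℂ} (h : B.IsLocallyDelta ζ) :
    B.IsClosed2 ζ := by
  intro s₀ s₁ s₂ u₀₁ u₀₂ u₁₂ b₀₁ b₀₂ b₁₂ z v₀ v₁ v₂ a₀ a₁ a₂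
  obtain ⟨x, hx⟩ := h.exists_global z
  obtain ⟨t₀, h₀, t₁, h₁, e₀, e₁, -⟩ := id b₀₁
  obtain ⟨-, -, t₂, h₂, -, e₂, -⟩ := id b₀₂
  have hz : z ∈ pre B.emb (⊤ : Opens X) := trivial
  have hval : ∀ (p : B.lSec (pre B.emb ⊤)) (p' : ℂ ⊗[ℝ] Sec E (⊤ : Opens X)),
      (rSec B.emb (U := ⊤)).baseChange ℂ p' = p.1 → ∀ z,
      (B.val z p).1 = (evSec ⊤ (B.emb z)).baseChange ℂ p' := fun p p' e z => by
    rw [← B.ev_rSec, e]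
    rfl
  have key : ∀ (p q : B.lSec (pre B.emb ⊤)) (p' q' : ℂ ⊗[ℝ] Sec E (⊤ : Opens X)),
      (rSec B.emb (U := ⊤)).baseChange ℂ p' = p.1 → (rSec B.emb (U := ⊤)).baseChange ℂ q' = q.1 →
      p' ∈ G.L ⊤ → q' ∈ G.L ⊤ → (fun z => ζ z ![B.val z p, B.val z q]) =ᶠ[𝓝 z]
        fun z => evC ⊤ (B.emb z) (deltaHalf x p' q') := by
    intro p q p' q' ep eq hp hq
    filter_upwards [hx] with z' hz'
    rw [hz', B.evC_deltaHalf x hp hq (z := z') trivial (hval p p' ep z') (hval q q' eq z')]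
  have e := congrArg (evC ⊤ (B.emb z)) (G.deltaHalf_closed x h₀ h₁ h₂)
  simp only [map_sub, map_add, map_zero] at e
  have k₀₁ : ζ z ![B.val z u₀₁, B.val z s₂] = _ := (key u₀₁ s₂ _ t₂ (b₀₁.eq_of_ext h₀ h₁ e₀ e₁) e₂
    (G.involutive _ _ h₀ _ h₁) h₂).self_of_nhds
  have k₀₂ : ζ z ![B.val z u₀₂, B.val z s₁] = _ := (key u₀₂ s₁ _ t₁ (b₀₂.eq_of_ext h₀ h₂ e₀ e₂) e₁
    (G.involutive _ _ h₀ _ h₂) h₁).self_of_nhds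
  have k₁₂ : ζ z ![B.val z u₁₂, B.val z s₀] = _ := (key u₁₂ s₀ _ t₀ (b₁₂.eq_of_ext h₁ h₂ e₁ e₂) e₀
    (G.involutive _ _ h₁ _ h₂) h₀).self_of_nhds
  rw [dC_congr (key s₁ s₂ t₁ t₂ e₁ e₂ h₁ h₂), dC_congr (key s₀ s₂ t₀ t₂ e₀ e₂ h₀ h₂),
    dC_congr (key s₀ s₁ t₀ t₁ e₀ e₁ h₀ h₁),
    B.dC_anchor _ hz (hval s₀ t₀ e₀ z) a₀, B.dC_anchor _ hz (hval s₁ t₁ e₁ z) a₁,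
    B.dC_anchor _ hz (hval s₂ t₂ e₂ z) a₂,
    k₀₁, k₀₂, k₁₂]
  exact e

/-- Sections of `l` over `W` extend to sections of `L` over an open subset of `X`. -/
theorem exists_L_ext (s : B.lSec (pre B.emb U)) : ∃ s' ∈ G.L U,
    (rSec B.emb (U := U)).baseChange ℂ s' = s.1 := by
  obtain ⟨a, ha⟩ := B.exists_rSec (reT s.1)
  refine ⟨_, G.holo_mem_L a, ?_⟩
  have hz : ∀ z, B.ev z s.1 = holo (G.J (B.emb z)) (B.ev z s.1 |> reT) := fun z =>
    (B.mem_lFib.1 (B.lSec_ev s z)).2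
  have him : imT s.1 = - B.JAlong (reT s.1) := secAlong_ext fun z _ => by
    have e := congrArg imT (hz z)
    rw [imT_holo, ev, imT_baseChange, reT_baseChange] at e
    exact e
  refine tensor_ext ?_ ?_
  · rw [reT_baseChange, reT_holo, ha]
  · rw [imT_baseChange, imT_holo, him, ← ha]
    rfl

variable {B} in
theorem IsLocallyDelta.mem_C2 {ζ : ∀ z, B.lFib z [⋀^Fin 2]→ₗ[ℂ] ℂ} (h : B.IsLocallyDelta ζ) :
    ζ ∈ B.C2 := by
  intro W s t
  obtain ⟨O, rfl⟩ := exists_pre_eq B.isEmb W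
  obtain ⟨s', hs', es⟩ := B.exists_L_ext s
  obtain ⟨t', ht', et⟩ := B.exists_L_ext t
  intro z hz
  obtain ⟨x, hx⟩ := h.exists_global z
  refine (((B.contMDiffOn_evC_emb (deltaHalf (resSec le_top x) s' t')).contMDiffAt
    ((pre B.emb O).2.mem_nhds hz)).congr_of_eventuallyEq ?_).contMDiffWithinAt
  filter_upwards [hx, (pre B.emb O).2.mem_nhds hz] with z' h1 h2
  rw [h1, ← B.zetaFib_resSec (le_top : O ≤ ⊤) x h2, B.evC_deltaHalf _ hs' ht' h2]
  · rw [← B.ev_rSec, es]; rfl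
  · rw [← B.ev_rSec, et]; rfl

variable {B} in
theorem IsLocallyDelta.mem_Z2 {ζ : ∀ z, B.lFib z [⋀^Fin 2]→ₗ[ℂ] ℂ} (h : B.IsLocallyDelta ζ) :
    ζ ∈ B.Z2 := ⟨h.mem_C2, h.isClosed2⟩

theorem mu_mem_C1 (x : Sec E (⊤ : Opens X)) : B.mu _ (B.qr x) ∈ B.C1 := by
  intro W s
  obtain ⟨O, rfl⟩ := exists_pre_eq B.isEmb W
  obtain ⟨s', hs', es⟩ := B.exists_L_ext s
  refine (B.contMDiffOn_evC_emb (pairA ℂ (1 ⊗ₜ resSec le_top x) s')).congr fun z hz => ?_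
  have e : B.mu _ (B.qr x) z = B.mu _ (B.qr (resSec (le_top : O ≤ ⊤) x)) z := by
    change B.muFib z (x.1 (B.emb z)) = B.muFib z ((resSec (le_top : O ≤ ⊤) x).1 (B.emb z))
    rw [resSec_apply _ _ (show B.emb z ∈ O from hz)]
  rw [e]
  refine B.muFib_eq _ _ _ ?_
  rw [← B.ev_rSec, es]
  rfl

/-- Linear forms on `T(Z, F)` that extend the real part of a 1-cochain of `l` are smooth. -/
theorem contMDiffOn_re {θ : ∀ z, B.lFib z →ₗ[ℂ] ℂ} (hθ : θ ∈ B.C1)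
    {ψ : ∀ z, GT E (B.emb z) →ₗ[ℝ] ℝ}
    (hψ : ∀ z (a : B.TZ z), ψ z a = (θ z (B.jl z a)).re) {t : ∀ z, GT E (B.emb z)}
    (h1 : SmoothVec E' E B.emb (fun z => (t z).1) W)
    (h2 : SmoothForm E' E B.emb (fun z => (t z).2) W) (ht : ∀ z ∈ W, t z ∈ B.TZ z) :
    ContMDiffOn 𝓘(ℝ, E') 𝓘(ℝ) ∞ (fun z => ψ z (t z)) W := by
  obtain ⟨s, hs⟩ := exists_secAlong_of_smooth h1 h2
  have hsT : ∀ z, s.1 z ∈ B.TZ z := fun z => by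
    by_cases hz : z ∈ W
    · rw [hs z hz]; exact ht z hz
    · rw [s.2.1 z hz]; exact (B.TZ z).zero_mem
  have hev : ∀ z, B.ev z (holo B.JAlong s) = (B.jl z ⟨s.1 z, hsT z⟩).1 := fun z =>
    baseChange_holo
    (J := B.JAlong) (K := G.J (B.emb z)) (LinearMap.proj (R := ℝ) (φ := fun z => GT E (B.emb z)) z ∘ₗ
      (SecAlong B.emb W).subtype) (fun _ => rfl) s
  let σ : B.lSec W := ⟨holo B.JAlong s, (Submodule.mem_iInf _).2 fun z => by
    change B.ev z _ ∈ B.lFib z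
    rw [hev]
    exact (B.jl z _).2⟩
  have h := (Complex.reCLM.contMDiff (n := ∞)).comp_contMDiffOn (hθ W σ)
  refine ContMDiffOn.congr h fun z hz => ?_
  rw [← hs z hz]
  exact (hψ z ⟨s.1 z, hsT z⟩).trans (congrArg (fun p => (θ z p).re) (Subtype.ext (hev z).symm))

theorem exists_local_pairing {θ : ∀ z, B.lFib z →ₗ[ℂ] ℂ} (hθ : θ ∈ B.C1)
    {ψ : ∀ z, GT E (B.emb z) →ₗ[ℝ] ℝ}
    (hψ : ∀ z (a : B.TZ z), ψ z a = (θ z (B.jl z a)).re) (z₀ : Z) :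
    ∃ (O : Opens Z), z₀ ∈ O ∧ ∃ t : ∀ z, GT E (B.emb z),
      (SmoothVec E' E B.emb (fun z => (t z).1) O ∧ SmoothForm E' E B.emb (fun z => (t z).2) O) ∧
      ∀ z ∈ O, ∀ a ∈ B.TZ z, pairFib E (B.emb z) (t z) a = ψ z a := by
  obtain ⟨O₁, hO₁, e, ε, hf⟩ := exists_isFrame (E := E) (B.emb z₀)
  obtain ⟨O, p, P, hzO, hO, h⟩ := exists_isRetraction B.isEmb z₀ O₁ hO₁
  -- `T(Z, F)` is spanned by the conormal elements `β k` and the elements `Γ w`, with `w` in `TX`.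
  let β : Fin (Module.finrank ℝ E) → ∀ z, GT E (B.emb z) := fun k z =>
    (0, ε k (B.emb z) - (ε k (B.emb z)).comp ((di B.emb z).comp (P z)))
  let Γ : ∀ z, TangentSpace 𝓘(ℝ, E) (B.emb z) →ₗ[ℝ] GT E (B.emb z) := fun z =>
    { toFun := fun w => (di B.emb z (P z w), (B.F z (P z w)).comp (P z))
      map_add' := fun v w => by
        rw [map_add, map_add, map_add]
        rfl
      map_smul' := fun c v => by
        rw [map_smul, map_smul, map_smul]
        rfl }
  have hβT : ∀ k, ∀ z ∈ pre B.emb O, β k z ∈ B.TZ z := fun k z hz => by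
    refine ⟨0, ((di B.emb z).map_zero).symm, fun w => ?_⟩
    change ε k (B.emb z) (di B.emb z w) - ε k (B.emb z) (di B.emb z (P z (di B.emb z w))) = _
    rw [h.proj_di z hz, sub_self, map_zero]
    rfl
  have hΓT : ∀ z ∈ pre B.emb O, ∀ w, Γ z w ∈ B.TZ z := fun z hz w => by
    refine ⟨P z w, rfl, fun w' => ?_⟩
    change B.F z (P z w) (P z (di B.emb z w')) = _
    rw [h.proj_di z hz]
  have hP : ∀ {S : Set Z}, IsOpen S → S ⊆ pre B.emb O → ∀ {ξ : ∀ z, TangentSpace 𝓘(ℝ, E) (B.emb z)},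
      SmoothVec E' E B.emb ξ S → SmoothVec E' E B.emb (fun z => di B.emb z (P z (ξ z))) S :=
    fun hS hSO ξ hξ => SmoothVec.push hS B.emb.contMDiff.contMDiffOn (h.proj_smooth _ _ hSO hξ)
  have hεs : ∀ k, SmoothForm E' E B.emb (fun z => ε k (B.emb z)) (pre B.emb O) := fun k =>
    SmoothForm.comp (hf.form k) B.emb.contMDiff.contMDiffOn fun z hz => hO hz
  have hξs : ∀ {V : Set X} {ξ : ∀ x : X, TangentSpace 𝓘(ℝ, E) x}, SmoothVec E E (fun x => x) ξ V →
      SmoothVec E' E B.emb (fun z => ξ (B.emb z)) (pre B.emb O ∩ B.emb ⁻¹' V) := fun hξ =>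
    SmoothVec.comp hξ B.emb.contMDiff.contMDiffOn fun z hz => hz.2
  have hopen : ∀ {V : Set X}, IsOpen V → IsOpen ((pre B.emb O : Set Z) ∩ B.emb ⁻¹' V) := fun hV =>
    (pre B.emb O).2.inter (hV.preimage B.emb.contMDiff.continuous)
  have hβs : ∀ k, SmoothForm E' E B.emb (fun z => (β k z).2) (pre B.emb O) := fun k =>
    smoothForm_of_apply B.emb.contMDiff.contMDiffOn fun V hV ξ hξ => by
      have hε : SmoothForm E' E B.emb (fun z => ε k (B.emb z)) (pre B.emb O ∩ B.emb ⁻¹' V) :=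
        ContMDiffOn.mono (hεs k) Set.inter_subset_left
      exact (hε.apply (hξs hξ)).sub (hε.apply (hP (hopen hV) Set.inter_subset_left (hξs hξ)))
  have hΓs : ∀ {V : Set X}, IsOpen V → ∀ {ξ : ∀ x : X, TangentSpace 𝓘(ℝ, E) x},
      SmoothVec E E (fun x => x) ξ V →
      SmoothForm E' E B.emb (fun z => (Γ z (ξ (B.emb z))).2) (pre B.emb O ∩ B.emb ⁻¹' V) :=
    fun {V} hV {ξ} hξ => by
      have hF : SmoothForm E' E' (fun z => z) (fun z => B.F z (P z (ξ (B.emb z))))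
          (pre B.emb O ⊓ ⟨B.emb ⁻¹' V, hV.preimage B.emb.contMDiff.continuous⟩ : Opens Z) :=
        B.toHermData.smooth_F (h.proj_smooth _ _ Set.inter_subset_left (hξs hξ))
      refine smoothForm_of_apply B.emb.contMDiff.contMDiffOn fun V' hV' η hη => ?_
      have hF' : SmoothForm E' E' (fun z => z) (fun z => B.F z (P z (ξ (B.emb z))))
          ((pre B.emb O ∩ B.emb ⁻¹' V) ∩ B.emb ⁻¹' V') := ContMDiffOn.mono hF Set.inter_subset_left
      refine hF'.apply (h.proj_smooth _ (fun z => η (B.emb z)) (fun z hz => hz.1.1)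
        (ContMDiffOn.mono (hξs hη) fun z hz => ⟨hz.1.1, hz.2⟩))
  have hψβ : ∀ k, ContMDiffOn 𝓘(ℝ, E') 𝓘(ℝ) ∞ (fun z => ψ z (β k z)) (pre B.emb O) := fun k =>
    B.contMDiffOn_re hθ hψ (smoothVec_zero B.emb.contMDiff.contMDiffOn) (hβs k) (hβT k)
  refine ⟨pre B.emb O, hzO, fun z => (∑ k, (2 * ψ z (β k z)) • e k (B.emb z),
    cotOfLinear ((2 : ℝ) • ψ z ∘ₗ Γ z)), ⟨?_, ?_⟩,
    fun z hz a ha => ?_⟩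
  · refine (isModuleSheaf_vec (f := B.emb) B.emb.contMDiff).sum Finset.univ
      (fun k z => (2 * ψ z (β k z)) • e k (B.emb z)) _ fun k _ => SmoothVec.smul
      (contMDiffOn_const.mul (hψβ k)) (SmoothVec.comp (hf.vec k) B.emb.contMDiff.contMDiffOn
        fun z hz => hO hz)
  · refine smoothForm_of_apply B.emb.contMDiff.contMDiffOn fun V hV ξ hξ => ?_
    have := B.contMDiffOn_re hθ hψ
      (W := pre B.emb O ⊓ ⟨B.emb ⁻¹' V, hV.preimage B.emb.contMDiff.continuous⟩)
      (t := fun z => Γ z (ξ (B.emb z)))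
      (hP (hopen hV) Set.inter_subset_left (hξs hξ)) (hΓs hV hξ) fun z hz => hΓT z hz.1 _
    exact (contMDiffOn_const (c := (2 : ℝ))).mul this
  · obtain ⟨v, hv, hw⟩ := id ha
    have ea : a = ∑ k, a.2 (e k (B.emb z)) • β k z + Γ z a.1 := by
      have es : (∑ k, a.2 (e k (B.emb z)) • β k z) =
          ((0, ∑ k, a.2 (e k (B.emb z)) • (β k z).2) : GT E (B.emb z)) := by
        refine Prod.ext ?_ ?_
        · refine (map_sum (GT.proj (E := E) (B.emb z)) _ _).trans (Finset.sum_eq_zero fun k _ => ?_)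
          exact smul_zero (A := TangentSpace 𝓘(ℝ, E) (B.emb z)) _
        · exact map_sum (LinearMap.snd ℝ (TangentSpace 𝓘(ℝ, E) (B.emb z))
            (TangentSpace 𝓘(ℝ, E) (B.emb z) →L[ℝ] ℝ)) _ _
      rw [es]
      refine Prod.ext ?_ ?_
      · change a.1 = 0 + di B.emb z (P z a.1)
        rw [hv, h.proj_di z hz, zero_add]
      · ext w
        change a.2 w = (∑ k, a.2 (e k (B.emb z)) • (β k z).2) w + B.F z (P z a.1) (P z w)
        have e1 := congrArg a.2 (hf.sum_eq (B.emb z) (hO hz) (w - di B.emb z (P z w)))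
        rw [map_sub, hw, map_sum] at e1
        rw [hv, h.proj_di z hz]
        have e2 : (∑ k, a.2 (e k (B.emb z)) • (β k z).2) w =
            ∑ k, a.2 ((ε k (B.emb z)) (w - di B.emb z (P z w)) • e k (B.emb z)) := by
          rw [sum_apply]
          refine Finset.sum_congr rfl fun k _ => ?_
          change a.2 (e k (B.emb z)) * (ε k (B.emb z) w - ε k (B.emb z) (di B.emb z (P z w))) = _
          rw [map_smul, map_sub, smul_eq_mul, mul_comm]
        rw [e2, e1, sub_add_cancel]
    have e3 := congrArg (ψ z) ea
    rw [map_add, map_sum] at e3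
    change 2⁻¹ * (a.2 (∑ k, (2 * ψ z (β k z)) • e k (B.emb z)) + 2 * ψ z (Γ z a.1)) = ψ z a
    rw [e3, map_sum]
    simp only [map_smul, smul_eq_mul, mul_add, Finset.mul_sum]
    congr 1
    · exact Finset.sum_congr rfl fun k _ => by ring
    · ring

/-- Every 1-cochain of `l` is of the form `μ(q(x))`. -/
theorem exists_mu_eq {θ : ∀ z, B.lFib z →ₗ[ℂ] ℂ} (hθ : θ ∈ B.C1) :
    ∃ x : Sec E (⊤ : Opens X), B.mu _ (B.qr x) = θ := by
  have h0 : ∀ z, ∃ ψ : GT E (B.emb z) →ₗ[ℝ] ℝ, ∀ a : B.TZ z, ψ a = (θ z (B.jl z a)).re := fun z => by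
    obtain ⟨ψ, hψ⟩ := LinearMap.exists_extend
      (Complex.reLm ∘ₗ (θ z).restrictScalars ℝ ∘ₗ B.jl z)
    exact ⟨ψ, fun a => LinearMap.congr_fun hψ a⟩
  choose ψ hψ using h0
  choose O hzO t ht hpair using B.exists_local_pairing hθ hψ
  obtain ⟨φ, hφ⟩ := exists_isPartition (E := E') (pre B.emb (⊤ : Opens X)) O fun z _ => ⟨z, hzO z⟩
  have hg := (isModuleSheaf_sec (f := B.emb) B.emb.contMDiff).glue hφ t ht
  obtain ⟨s, hs⟩ := exists_secAlong_of_smooth hg.1 hg.2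
  obtain ⟨x, rfl⟩ := B.exists_rSec s
  have hx : ∀ z, ∀ a ∈ B.TZ z, pairFib E (B.emb z) (x.1 (B.emb z)) a = ψ z a := fun z a ha => by
    have e : x.1 (B.emb z) = ∑ᶠ j, φ j z • t j z := hs z trivial
    rw [e]
    exact hφ.map_finsum (x := z) trivial (fun j => t j z) ((pairFib E (B.emb z)).flip a) (ψ z a)
      fun j hj => hpair j z hj a ha
  refine ⟨x, funext fun z => LinearMap.ext fun v => ?_⟩
  obtain ⟨a, rfl⟩ := B.exists_jl v
  change LinearMap.liftBaseChange ℂ (Algebra.linearMap ℝ ℂ ∘ₗ pairFib E (B.emb z) (x.1 (B.emb z)))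
    (holo (G.J (B.emb z)) a.1) = _
  rw [holo, map_sub]
  simp only [LinearMap.liftBaseChange_tmul, LinearMap.comp_apply, Algebra.linearMap_apply,
    smul_eq_mul, one_mul]
  have hJ := B.compat z _ a.2
  rw [hx z _ a.2, hx z _ hJ, hψ z a, hψ z ⟨_, hJ⟩, B.jl_J a hJ, map_smul]
  simp [Complex.ext_iff]

end GCBrane
end Cochains

/-! ### Extension of scalars to the dual numbers -/

section Dual

/-- The ring `ℝ[ε]` of dual numbers. -/
abbrev Dual : Type := DualNumber ℝ

/-- The element `ε` of `ℝ[ε]`. -/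
abbrev dε : Dual := DualNumber.eps

theorem dε_mul_self : dε * dε = 0 := DualNumber.eps_mul_eps

instance isArt_dual : IsArt Dual where
  toIsLocalRing := inferInstance
  wf :=
    have : Module.Finite ℝ Dual := inferInstanceAs (Module.Finite ℝ (ℝ × ℝ))
    (IsArtinianRing.of_finite ℝ Dual).wf
  residue := by
    refine ⟨(algebraMap ℝ (IsLocalRing.ResidueField Dual)).injective, fun r => ?_⟩
    obtain ⟨a, rfl⟩ := IsLocalRing.residue_surjective r
    refine ⟨a.fst, ?_⟩
    change IsLocalRing.residue Dual (algebraMap ℝ Dual a.fst) = _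
    rw [← sub_eq_zero, ← map_sub, IsLocalRing.residue_eq_zero_iff,
      DualNumber.maximalIdeal_eq_span_singleton_eps, Ideal.mem_span_singleton,
      ← DualNumber.fst_eq_zero_iff_eps_dvd]
    change a.fst - a.fst = 0
    exact sub_self _

variable {P Q : Type*} [AddCommGroup P] [Module ℝ P] [AddCommGroup Q] [Module ℝ Q]

/-- The constant coefficient `p` of `p + εq`. -/
def coef0 : Dual ⊗[ℝ] P →ₗ[ℝ] P := coef (TrivSqZeroExt.fstHom ℝ ℝ ℝ).toLinearMap

/-- The coefficient `q` of `p + εq`. -/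
def coef1 : Dual ⊗[ℝ] P →ₗ[ℝ] P := coef (TrivSqZeroExt.sndHom ℝ ℝ)

@[simp] theorem coef0_tmul (a : Dual) (p : P) : coef0 (a ⊗ₜ[ℝ] p) = a.fst • p := coef_tmul _ _ _

@[simp] theorem coef1_tmul (a : Dual) (p : P) : coef1 (a ⊗ₜ[ℝ] p) = a.snd • p := coef_tmul _ _ _

theorem dual_eq (s : Dual ⊗[ℝ] P) : s = 1 ⊗ₜ coef0 s + dε ⊗ₜ coef1 s := by
  induction s with
  | zero => simp
  | add s t hs ht =>
    rw [map_add, map_add, TensorProduct.tmul_add, TensorProduct.tmul_add]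
    nth_rewrite 1 [hs, ht]
    abel
  | tmul a p =>
    rw [coef0_tmul, coef1_tmul, ← TensorProduct.smul_tmul, ← TensorProduct.smul_tmul,
      ← TensorProduct.add_tmul]
    congr 1
    ext <;> simp

theorem coef_mem {A : Type*} [CommRing A] [Algebra ℝ A] (l : A →ₗ[ℝ] ℝ) {S : Submodule ℝ P}
    {s : A ⊗[ℝ] P} (h : s ∈ S.baseChange A) : coef l s ∈ S := by
  obtain ⟨t, rfl⟩ := h
  rw [coef_baseChange]
  exact (coef l t).2

theorem exists_eq_eps_tmul {S : Submodule ℝ P} {s : Dual ⊗[ℝ] P}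
    (h : s ∈ IsLocalRing.maximalIdeal Dual • S.baseChange Dual) : ∃ p ∈ S, s = dε ⊗ₜ p := by
  rw [DualNumber.maximalIdeal_eq_span_singleton_eps, Submodule.ideal_span_singleton_smul,
    Submodule.mem_smul_pointwise_iff_exists] at h
  obtain ⟨n, hn, rfl⟩ := h
  refine ⟨coef0 n, coef_mem _ hn, ?_⟩
  nth_rewrite 1 [dual_eq n]
  rw [smul_add, TensorProduct.smul_tmul', TensorProduct.smul_tmul', smul_eq_mul, smul_eq_mul,
    dε_mul_self, TensorProduct.zero_tmul, add_zero, mul_one]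

theorem exists_eq_eps_tmul' {s : Dual ⊗[ℝ] P} (h : s ∈ mTen Dual P) : ∃ p, s = dε ⊗ₜ p := by
  obtain ⟨p, -, hp⟩ := exists_eq_eps_tmul (S := (⊤ : Submodule ℝ P)) (s := s)
    (by rwa [Submodule.baseChange_top])
  exact ⟨p, hp⟩

theorem eps_tmul_mem (p : P) : dε ⊗ₜ p ∈ mTen Dual P := by
  have h : dε ∈ IsLocalRing.maximalIdeal Dual := by
    rw [DualNumber.maximalIdeal_eq_span_singleton_eps]
    exact Ideal.mem_span_singleton_self _
  have := Submodule.smul_mem_smul (N := (⊤ : Submodule Dual (Dual ⊗[ℝ] P))) (n := 1 ⊗ₜ p) h trivial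
  rwa [TensorProduct.smul_tmul', smul_eq_mul, mul_one] at this

theorem sum_nilpotencyClass {R M : Type*} [CommRing R] [AddCommGroup M] [Module R M]
    {φ : Module.End R M} (h : φ ^ 2 = 0) (c : ℕ → R) :
    ∑ k ∈ Finset.range (nilpotencyClass φ), c k • φ ^ k = c 0 • 1 + c 1 • φ := by
  have hn : IsNilpotent φ := ⟨2, h⟩
  have h0 : ∀ k, nilpotencyClass φ ≤ k → φ ^ k = 0 := fun k hk =>
    pow_eq_zero_of_le hk (pow_nilpotencyClass hn)
  have h2 : nilpotencyClass φ ≤ 2 := Nat.sInf_le h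
  rw [Finset.sum_subset (Finset.range_subset_range.2 h2) fun k _ hk => by
    rw [h0 k (by simpa using hk), smul_zero]]
  simp [Finset.sum_range_succ]

theorem bcBil_sq (b : P →ₗ[ℝ] Q →ₗ[ℝ] Q) (p : P) : (bcBil Dual b (dε ⊗ₜ p)) ^ 2 = 0 := by
  refine LinearMap.ext fun s => ?_
  rw [pow_two, Module.End.mul_apply]
  induction s with
  | zero => simp
  | add s t hs ht => rw [map_add, map_add, hs, ht]; simp
  | tmul a q => rw [bcBil_tmul, bcBil_tmul, ← mul_assoc, dε_mul_self, zero_mul]; simp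

theorem expNil_bcBil (b : P →ₗ[ℝ] Q →ₗ[ℝ] Q) (p : P) (q q' : Q) :
    expNil (bcBil Dual b (dε ⊗ₜ p)) (1 ⊗ₜ q + dε ⊗ₜ q') = 1 ⊗ₜ q + dε ⊗ₜ (b p q + q') := by
  rw [expNil, sum_nilpotencyClass (bcBil_sq b p)]
  simp [bcBil_tmul, TensorProduct.tmul_add]
  abel

theorem intExp_bcBil (b : P →ₗ[ℝ] Q →ₗ[ℝ] Q) (p : P) (q : Q) :
    intExp (bcBil Dual b (dε ⊗ₜ p)) (dε ⊗ₜ q) = dε ⊗ₜ q := by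
  rw [intExp, sum_nilpotencyClass (bcBil_sq b p)]
  simp [bcBil_tmul]

theorem expNil_bcBil_one (b : P →ₗ[ℝ] Q →ₗ[ℝ] Q) (p : P) (q : Q) :
    expNil (bcBil Dual b (dε ⊗ₜ p)) (1 ⊗ₜ q) = 1 ⊗ₜ q + dε ⊗ₜ (b p q) := by
  simpa using expNil_bcBil b p q 0

theorem coef1_add (q q' : Q) : coef1 ((1 : Dual) ⊗ₜ[ℝ] q + dε ⊗ₜ[ℝ] q') = q' := by simp

end Dual

/-! ### First order deformations -/

section FirstOrder
variable {E : Type*} [NormedAddCommGroup E] [NormedSpace ℝ E] [FiniteDimensional ℝ E]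
  {X : Type*} [TopologicalSpace X] [ChartedSpace E X] [IsManifold 𝓘(ℝ, E) ∞ X]
  {E' : Type*} [NormedAddCommGroup E'] [NormedSpace ℝ E'] [FiniteDimensional ℝ E']
  {Z : Type*} [TopologicalSpace Z] [ChartedSpace E' Z] [IsManifold 𝓘(ℝ, E') ∞ Z]
  {G : GCStructure E X}

theorem resForm_apply {U V : Opens X} (h : V ≤ U) (a : Form E U) {x : X} (hx : x ∈ V) :
    (resForm h a).1 x = a.1 x := if_pos hx

theorem form_ext_pt {U : Opens X} {a b : Form E U} (h : ∀ x ∈ U, a.1 x = b.1 x) : a = b :=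
  Subtype.ext (funext fun x => by
    by_cases hx : x ∈ U
    · exact h x hx
    · rw [a.2.1 x hx, b.2.1 x hx])

theorem resFn_apply {U V : Opens X} (h : V ≤ U) (f : Fn E U) {x : X} (hx : x ∈ V) :
    (resFn h f).1 x = f.1 x := Set.indicator_of_mem hx _

theorem sec_eq_secVec_add_secForm {U : Opens X} (x : Sec E U) :
    secVec (anc x) + secForm (cot x) = x :=
  sec_ext_parts (by rw [map_add, anc_secVec, anc_secForm, add_zero])
    (by rw [map_add, cot_secVec, cot_secForm, zero_add])

variable {U V : Opens X}

theorem GCBrane.gAct_eps (x : Sec E V) (a b : Sec E V) :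
    gAct (dε ⊗ₜ anc x) (dε ⊗ₜ cot x) ((1 : Dual) ⊗ₜ a + dε ⊗ₜ b) =
      1 ⊗ₜ a + dε ⊗ₜ (dorf x a + b) := by
  have h1 : secVecA Dual (dε ⊗ₜ[ℝ] anc x) = dε ⊗ₜ secVec (anc x) := LinearMap.baseChange_tmul _ _ _
  have h2 : secFormA Dual (dε ⊗ₜ[ℝ] cot x) = dε ⊗ₜ secForm (cot x) :=
    LinearMap.baseChange_tmul _ _ _
  have e1 := expNil_bcBil (P := Sec E V) (Q := Sec E V) dorf (secVec (anc x)) a b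
  have e2 := expNil_bcBil (P := Sec E V) (Q := Sec E V) dorf (secForm (cot x)) a
    (dorf (secVec (anc x)) a + b)
  rw [gAct, h1, h2, LinearMap.comp_apply]
  refine (congrArg _ e1).trans (e2.trans ?_)
  rw [← add_assoc, ← LinearMap.add_apply, ← map_add, add_comm (secForm _), sec_eq_secVec_add_secForm]

theorem GCBrane.gInv_eps (x : Sec E V) (a b : Sec E V) :
    gInv (dε ⊗ₜ anc x) (dε ⊗ₜ cot x) ((1 : Dual) ⊗ₜ a + dε ⊗ₜ b) =
      1 ⊗ₜ a + dε ⊗ₜ (b - dorf x a) := by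
  have h1 : secVecA Dual (-(dε ⊗ₜ[ℝ] anc x)) = dε ⊗ₜ (-secVec (anc x)) := by
    rw [secVecA, map_neg, LinearMap.baseChange_tmul, TensorProduct.tmul_neg]
  have h2 : secFormA Dual (-(dε ⊗ₜ[ℝ] cot x)) = dε ⊗ₜ (-secForm (cot x)) := by
    rw [secFormA, map_neg, LinearMap.baseChange_tmul, TensorProduct.tmul_neg]
  have e1 := expNil_bcBil (P := Sec E V) (Q := Sec E V) dorf (-secForm (cot x)) a b
  have e2 := expNil_bcBil (P := Sec E V) (Q := Sec E V) dorf (-secVec (anc x)) a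
    (dorf (-secForm (cot x)) a + b)
  rw [gInv, h1, h2, LinearMap.comp_apply]
  refine (congrArg _ e1).trans (e2.trans ?_)
  rw [← add_assoc, ← LinearMap.add_apply, ← map_add, ← neg_add, sec_eq_secVec_add_secForm, map_neg,
    LinearMap.neg_apply, neg_add_eq_sub]

namespace GCBrane
variable (B : GCBrane E' Z G)

/-- The first order deformation of the brane along a section `x`. -/
def epsDef (x : Sec E U) : B.DefData U Dual where
  rhoFn := B.rho0 U Dual ∘ₗ expNil (derA Dual (dε ⊗ₜ anc x))
  rhoForm := B.rho1 U Dual ∘ₗ expNil (lieFormA Dual (dε ⊗ₜ anc x))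
  f _ _ := 0
  u _ := dε ⊗ₜ resForm inf_le_left (pullForm B.emb (cot x))

theorem epsDef_isFlow (x : Sec E U) : (B.epsDef x).IsFlow (dε ⊗ₜ anc x) :=
  ⟨eps_tmul_mem _, rfl, rfl⟩

theorem epsDef_isDef (x : Sec E U) : (B.epsDef x).IsDef where
  flow := ⟨_, B.epsDef_isFlow x⟩
  f_mem _ _ := Submodule.zero_mem _
  u_mem _ := eps_tmul_mem _
  connection I J := by
    change resFormA Dual _ (dε ⊗ₜ _) - resFormA Dual _ (dε ⊗ₜ _) = d0A Dual 0
    rw [map_zero, sub_eq_zero]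
    refine (LinearMap.baseChange_tmul _ _ _).trans
      (Eq.trans ?_ (LinearMap.baseChange_tmul _ _ _).symm)
    congr 1
    refine form_ext_pt fun z hz => ?_
    rw [resForm_apply _ _ hz, resForm_apply _ _ hz]
    exact (resForm_apply _ _ (show z ∈ B.WU U J from ⟨hz.1, hz.2.2⟩)).trans
      (resForm_apply _ _ (show z ∈ B.WU U I from ⟨hz.1, hz.2.1⟩)).symm
  cocycle I J K := by
    change resFnA Dual _ 0 - resFnA Dual _ 0 + resFnA Dual _ 0 = 0
    simp only [map_zero, sub_zero, add_zero]

variable [T2Space X] [SecondCountableTopology X]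

theorem epsDef_compatible (x : Sec E U) (hx : ∀ z ∈ pre B.emb U, B.zetaFib x z = 0) :
    (B.epsDef x).Compatible := by
  refine ⟨_, B.epsDef_isFlow x, fun I => ?_⟩
  obtain ⟨O, hO⟩ := exists_pre_eq B.isEmb (B.W I)
  have hpre : pre B.emb (U ⊓ O) = B.WU U I := by
    change pre B.emb U ⊓ pre B.emb O = _
    rw [hO]
  refine ⟨U ⊓ O, inf_le_left, hpre, dε ⊗ₜ resForm inf_le_left (cot x), eps_tmul_mem _, ?_, ?_⟩
  · change resFormA Dual _ (rho1 B (U ⊓ O) Dual (dε ⊗ₜ _)) = dε ⊗ₜ resForm _ _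
    rw [rho1, resFormA, LinearMap.baseChange_tmul, LinearMap.baseChange_tmul]
    congr 1
    refine form_ext_pt fun z hz => ?_
    rw [resForm_apply _ _ hz, resForm_apply _ _ hz]
    change ((resForm _ (cot x)).1 (B.emb z)).comp (di B.emb z) = _
    rw [resForm_apply _ _ (show B.emb z ∈ U ⊓ O from hpre.ge hz)]
    rfl
  · intro p hp q hq
    have h1 : resVecA Dual (inf_le_left : U ⊓ O ≤ U) (dε ⊗ₜ anc x) =
        dε ⊗ₜ anc (resSec (inf_le_left : U ⊓ O ≤ U) x) := by
      rw [resVecA, LinearMap.baseChange_tmul]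
      congr 1
      exact vec_ext fun y hy => (resVec_apply _ _ hy).trans
        (congrArg Prod.fst (resSec_apply _ x hy)).symm
    have h2 : resForm (inf_le_left : U ⊓ O ≤ U) (cot x) =
        cot (resSec (inf_le_left : U ⊓ O ≤ U) x) :=
      form_ext_pt fun y hy => (resForm_apply _ _ hy).trans
        (congrArg Prod.snd (resSec_apply _ x hy)).symm
    rw [h1, h2]
    have hω : ∀ z ∈ pre B.emb (U ⊓ O), B.zetaFib (resSec (inf_le_left : U ⊓ O ≤ U) x) z = 0 :=
      fun z hz => by rw [B.zetaFib_resSec _ _ hz, hx z hz.1]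
    generalize resSec (inf_le_left : U ⊓ O ≤ U) x = x' at hω ⊢
    have hp0 : coef0 p ∈ B.KB (U ⊓ O) := coef_mem _ hp
    have hp1 : coef1 p ∈ B.KB (U ⊓ O) := coef_mem _ hp
    have hq0 : coef0 q ∈ B.KB (U ⊓ O) := coef_mem _ hq
    have hq1 : coef1 q ∈ B.KB (U ⊓ O) := coef_mem _ hq
    have hJe : ∀ a b : Sec E (U ⊓ O), (G.JSec (U := U ⊓ O)).baseChange Dual (1 ⊗ₜ a + dε ⊗ₜ b) =
        1 ⊗ₜ G.JSec a + dε ⊗ₜ G.JSec b := fun a b => by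
      rw [map_add, LinearMap.baseChange_tmul, LinearMap.baseChange_tmul]
    rw [dual_eq p, dual_eq q, gInv_eps, hJe, gAct_eps]
    generalize coef0 p = a at hp0
    generalize coef1 p = b at hp1
    generalize coef0 q = c at hq0
    generalize coef1 q = d at hq1
    simp only [map_add, LinearMap.add_apply, pairA_tmul, one_mul, mul_one, dε_mul_self,
      TensorProduct.zero_tmul, add_zero]
    rw [rho0, LinearMap.baseChange_tmul, LinearMap.baseChange_tmul, LinearMap.baseChange_tmul]
    have hpair : ∀ p' q' : Sec E (U ⊓ O), p' ∈ B.KB (U ⊓ O) → q' ∈ B.KB (U ⊓ O) →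
        pullFn B.emb (pair p' q') = 0 := fun p' q' hp' hq' =>
      fn_ext fun z _ => B.pairFib_TZ (hp' z) (hq' z)
    have hJ : ∀ p' : Sec E (U ⊓ O), p' ∈ B.KB (U ⊓ O) → G.JSec p' ∈ B.KB (U ⊓ O) :=
      fun p' hp' z => B.compat z _ (hp' z)
    have e : pullFn B.emb (pair (dorf x' (G.JSec a)) c + pair (G.JSec (b - dorf x' a)) c) = 0 := by
      have e1 : pair (dorf x' (G.JSec a)) c + pair (G.JSec (b - dorf x' a)) c =
          pair (G.JSec b) c + G.omega x' a c := by
        rw [G.omega_apply]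
        simp only [map_sub, LinearMap.sub_apply]
        abel
      rw [e1, map_add, hpair _ _ (hJ b hp1) hq0, zero_add]
      refine fn_ext fun z hz => ?_
      change (G.omega x' a c).1 (B.emb z) = 0
      rw [G.omega_val _ _ _ (show B.emb z ∈ U ⊓ O from hz)]
      exact (B.zetaFib_eq_zero_iff x' hz).1 (hω z hz) _ (hp0 z) _ (hq0 z)
    rw [hpair _ _ (hJ a hp0) hq0, hpair _ _ (hJ a hp0) hq1, e]
    simp

variable {B}
variable [T2Space Z] [SecondCountableTopology Z]

/-- If the restriction of the brane to `U` has trivializable deformations, then a section `x` over `U`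
with `δ_l μ(q(x)) = 0` agrees on `Z` with a section that preserves `J`, up to an infinitesimal
automorphism of the line bundle. -/
theorem Trivializable.exists_correction (h : B.Trivializable U) (x : Sec E U)
    (hx : ∀ z ∈ pre B.emb U, B.zetaFib x z = 0) :
    ∃ x' ∈ G.T U, ∃ (τ : Vec E' (pre B.emb U)) (f : Fn E' (pre B.emb U)), ∀ z ∈ pre B.emb U,
      (x'.1 (B.emb z)).1 - (x.1 (B.emb z)).1 = di B.emb z (τ.1 z) ∧
      ∀ v, (x'.1 (B.emb z)).2 (di B.emb z v) - (x.1 (B.emb z)).2 (di B.emb z v) =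
        B.F z (τ.1 z) v - (d0 f).1 z v := by
  obtain ⟨y, hy, t, ht, g, hg, hfn, -, ha, hc⟩ :=
    h Dual (B.epsDef x) (B.epsDef_isDef x) (B.epsDef_compatible x hx)
  obtain ⟨x', hx', rfl⟩ := exists_eq_eps_tmul hy
  obtain ⟨τ, rfl⟩ := exists_eq_eps_tmul' ht
  choose g' hg' using fun I => exists_eq_eps_tmul' (hg I)
  obtain rfl : g = fun I => dε ⊗ₜ g' I := funext hg'
  -- The coefficients of `ε` in the equations that define an isomorphism of deformations.
  have hfn' : ∀ f : Fn E U, pullFn B.emb (der (anc x') f) =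
      pullFn B.emb (der (anc x) f) + der τ (pullFn B.emb f) := fun f => by
    have e := LinearMap.congr_fun hfn (1 ⊗ₜ f)
    change B.rho0 U Dual (expNil (derA Dual (ancA Dual (dε ⊗ₜ x'))) (1 ⊗ₜ f)) =
      expNil (derA Dual (dε ⊗ₜ τ)) (B.rho0 U Dual (expNil (derA Dual (dε ⊗ₜ anc x)) (1 ⊗ₜ f))) at e
    have e1 : ∀ ξ : Vec E U, B.rho0 U Dual (expNil (derA Dual (dε ⊗ₜ ξ)) (1 ⊗ₜ f)) =
        1 ⊗ₜ pullFn B.emb f + dε ⊗ₜ pullFn B.emb (der ξ f) := fun ξ => by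
      refine (congrArg _ (expNil_bcBil_one (P := Vec E U) (Q := Fn E U) der ξ f)).trans ?_
      rw [rho0, map_add, LinearMap.baseChange_tmul, LinearMap.baseChange_tmul]
    rw [ancA_tmul, e1, e1] at e
    replace e := e.trans (expNil_bcBil (P := Vec E' (pre B.emb U)) (Q := Fn E' (pre B.emb U)) der τ
      (pullFn B.emb f) (pullFn B.emb (der (anc x) f)))
    have := congrArg coef1 e
    rwa [coef1_add, coef1_add, add_comm] at this
  have ha' : ∀ I, lieForm (resVec (inf_le_left : B.WU U I ≤ _) τ) (resForm inf_le_right (B.a I)) +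
      resForm inf_le_left (pullForm B.emb (cot x)) =
      resForm inf_le_left (pullForm B.emb (cot x')) + d0 (g' I) := fun I => by
    have e := ha I
    change expNil (lieFormA Dual (resVecA Dual _ (dε ⊗ₜ τ)))
        (1 ⊗ₜ resForm _ _ + dε ⊗ₜ resForm _ (pullForm B.emb (cot x))) =
      1 ⊗ₜ resForm _ _ + resFormA Dual _ (B.rho1 U Dual
        (intExp (lieFormA Dual (ancA Dual (dε ⊗ₜ x'))) (cotA Dual (dε ⊗ₜ x')))) +
        d0A Dual (dε ⊗ₜ g' I) at e
    have e1 : intExp (lieFormA Dual (ancA Dual (dε ⊗ₜ x'))) (cotA Dual (dε ⊗ₜ x')) =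
        dε ⊗ₜ cot x' := by
      rw [ancA_tmul, cotA, LinearMap.baseChange_tmul]
      exact intExp_bcBil (P := Vec E U) (Q := Form E U) lieForm (anc x') (cot x')
    rw [e1, resVecA, LinearMap.baseChange_tmul, rho1, LinearMap.baseChange_tmul, resFormA,
      LinearMap.baseChange_tmul, d0A, LinearMap.baseChange_tmul, add_assoc,
      ← TensorProduct.tmul_add] at e
    have := congrArg coef1 ((expNil_bcBil (P := Vec E' (B.WU U I)) (Q := Form E' (B.WU U I)) lieForm
      _ _ _).symm.trans e)
    rwa [coef1_add, coef1_add] at this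
  have hc' : ∀ I J, der (resVec (inf_le_left : B.WU2 U I J ≤ _) τ) (resFn inf_le_right (B.c I J)) =
      resFn (inf_le_inf_left _ inf_le_right) (g' J) -
        resFn (inf_le_inf_left _ inf_le_left) (g' I) := fun I J => by
    have e := hc I J
    change expNil (derA Dual (resVecA Dual _ (dε ⊗ₜ τ))) (1 ⊗ₜ resFn _ _ + 0) =
      1 ⊗ₜ resFn _ _ + 0 + (resFnA Dual _ (dε ⊗ₜ g' J) - resFnA Dual _ (dε ⊗ₜ g' I)) at e
    rw [add_zero, resVecA, LinearMap.baseChange_tmul, resFnA, resFnA,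
      LinearMap.baseChange_tmul, LinearMap.baseChange_tmul, ← TensorProduct.tmul_sub] at e
    have := congrArg coef1 ((expNil_bcBil_one (P := Vec E' (B.WU2 U I J))
      (Q := Fn E' (B.WU2 U I J)) der _ _).symm.trans e)
    rwa [coef1_add, coef1_add] at this
  -- The function `f` is `g_I - a_I(τ)` on `W_I`.
  let φ : ∀ I, Fn E' (B.WU U I) := fun I =>
    g' I - contr (resForm inf_le_right (B.a I)) (resVec inf_le_left τ)
  have hφ : ∀ I J, ∀ z ∈ B.WU2 U I J, (φ I).1 z = (φ J).1 z := fun I J z hz => by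
    have hI : z ∈ B.WU U I := ⟨hz.1, hz.2.1⟩
    have hJ : z ∈ B.WU U J := ⟨hz.1, hz.2.2⟩
    have e := congrFun (congrArg Subtype.val (hc' I J)) z
    have e1 : mvfderiv 𝓘(ℝ, E') (B.c I J).1 z (τ.1 z) = (g' J).1 z - (g' I).1 z := by
      have e2 : (der (resVec (inf_le_left : B.WU2 U I J ≤ _) τ)
          (resFn inf_le_right (B.c I J))).1 z = (resFn (inf_le_inf_left _ inf_le_right) (g' J)).1 z -
            (resFn (inf_le_inf_left _ inf_le_left) (g' I)).1 z := e
      rw [resFn_apply _ _ hz, resFn_apply _ _ hz, der_apply, resVec_apply _ _ hz] at e2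
      rw [← e2]
      congr 1
      refine mvfderiv_congr ?_
      filter_upwards [(B.WU2 U I J).2.mem_nhds hz] with z' hz'
      exact (resFn_apply _ _ hz').symm
    have e3 := congrArg (fun b => b (τ.1 z)) (B.connection I J z hz.2)
    have e4 : (B.a J).1 z (τ.1 z) - (B.a I).1 z (τ.1 z) = mvfderiv 𝓘(ℝ, E') (B.c I J).1 z (τ.1 z) := by
      rw [← d0_apply (B.c I J) hz.2]
      exact e3
    have e5 : ∀ K, z ∈ B.WU U K → (φ K).1 z = (g' K).1 z - (B.a K).1 z (τ.1 z) := fun K hK => by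
      change (g' K).1 z - (resForm _ (B.a K)).1 z ((resVec _ τ).1 z) = _
      rw [resForm_apply _ _ hK, resVec_apply _ _ hK]
    rw [e5 I hI, e5 J hJ]
    linarith
  choose I hI using B.cover
  have hf : ContMDiffOn 𝓘(ℝ, E') 𝓘(ℝ) ∞ (fun z => (φ (I z)).1 z) (pre B.emb U) :=
    isModuleSheaf_fun.congr_loc _ _ fun z hz => ⟨B.WU U (I z), ⟨hz, hI z⟩, (φ (I z)).1, (φ (I z)).2.2,
      fun z' hz' => hφ _ _ z' ⟨hz'.1, hI z', hz'.2⟩⟩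
  obtain ⟨f, hf⟩ := exists_fn_of_smooth hf
  refine ⟨x', hx', τ, f, fun z hz => ⟨?_, fun v => ?_⟩⟩
  · rw [← sub_eq_zero]
    refine tangent_eq_zero fun u => ?_
    have e := congrFun (congrArg Subtype.val (hfn' (resFn le_top u))) z
    have e1 : ∀ w : TangentSpace 𝓘(ℝ, E) (B.emb z),
        mvfderiv 𝓘(ℝ, E) (resFn (le_top : U ≤ ⊤) u).1 (B.emb z) w =
          mvfderiv 𝓘(ℝ, E) u.1 (B.emb z) w := fun w => by
      congr 1
      refine mvfderiv_congr ?_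
      filter_upwards [U.2.mem_nhds hz] with y hy
      exact resFn_apply _ _ hy
    have e2 : mvfderiv 𝓘(ℝ, E) (resFn (le_top : U ≤ ⊤) u).1 (B.emb z) (x'.1 (B.emb z)).1 =
        mvfderiv 𝓘(ℝ, E) (resFn (le_top : U ≤ ⊤) u).1 (B.emb z) (x.1 (B.emb z)).1 +
          mvfderiv 𝓘(ℝ, E') (fun z => (resFn (le_top : U ≤ ⊤) u).1 (B.emb z)) z (τ.1 z) := e
    rw [← mvfderiv_di (fn_mdiffAt _ (show B.emb z ∈ U from hz)), e1, e1, e1] at e2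
    rw [map_sub, map_sub, e2]
    ring
  · have hzI : z ∈ B.WU U (I z) := ⟨hz, hI z⟩
    have hτz : (resVec (inf_le_left : B.WU U (I z) ≤ _) τ).1 z = τ.1 z := resVec_apply _ _ hzI
    have e := congrArg (fun b => b v) (congrFun (congrArg Subtype.val (ha' (I z))) z)
    have e1 : (extDer (resForm (inf_le_right : B.WU U (I z) ≤ _) (B.a (I z))) z
        ((resVec (inf_le_left : B.WU U (I z) ≤ _) τ).1 z) v +
        (d0 (contr (resForm inf_le_right (B.a (I z))) (resVec inf_le_left τ))).1 z v) +
        (resForm (inf_le_left : B.WU U (I z) ≤ _) (pullForm B.emb (cot x))).1 z v =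
        (resForm (inf_le_left : B.WU U (I z) ≤ _) (pullForm B.emb (cot x'))).1 z v +
          (d0 (g' (I z))).1 z v := e
    rw [resForm_apply _ _ hzI, resForm_apply _ _ hzI, hτz,
      extDer_congr hzI (hI z) (resForm_eventuallyEq _ _ hzI), ← B.toHermData.F_eq (I z) (hI z)] at e1
    have e2 : (d0 f).1 z = (d0 (φ (I z))).1 z := by
      rw [d0_apply _ hz, d0_apply _ hzI]
      refine mvfderiv_congr ?_
      filter_upwards [(B.WU U (I z)).2.mem_nhds hzI] with z' hz'
      rw [hf z' hz'.1]
      exact hφ _ _ z' ⟨hz'.1, hI z', hz'.2⟩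
    have e3 : (d0 (φ (I z))).1 z v = (d0 (g' (I z))).1 z v -
        (d0 (contr (resForm inf_le_right (B.a (I z))) (resVec inf_le_left τ))).1 z v := by
      rw [map_sub]
      rfl
    rw [e2, e3]
    have e4 : ∀ s : Sec E U, (pullForm B.emb (cot s)).1 z v = (s.1 (B.emb z)).2 (di B.emb z v) :=
      fun s => rfl
    rw [e4, e4] at e1
    linarith

end GCBrane
end FirstOrder

/-! ### The total complex -/

section TotalComplex
variable {E : Type*} [NormedAddCommGroup E] [NormedSpace ℝ E] [FiniteDimensional ℝ E]
  {X : Type*} [TopologicalSpace X] [ChartedSpace E X] [IsManifold 𝓘(ℝ, E) ∞ X]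
  {E' : Type*} [NormedAddCommGroup E'] [NormedSpace ℝ E'] [FiniteDimensional ℝ E']
  {Z : Type*} [TopologicalSpace Z] [ChartedSpace E' Z] [IsManifold 𝓘(ℝ, E') ∞ Z]
  {G : GCStructure E X}

namespace GCBrane
variable (B : GCBrane E' Z G)

section Values
variable {V V' : Opens X}

variable (G V) in
/-- The value of an element of `T(V)` at a point. -/
def evT (y : X) : TType G V →ₗ[ℝ] GT E y := evSec V y ∘ₗ (G.T V).subtype

variable (V) in
/-- The value of the `T(V)`-component of a pair `(x, (τ, f))` at a point. -/
def evK (y : X) : B.KKType V →ₗ[ℝ] GT E y := evSec V y ∘ₗ (G.T V).subtype ∘ₗ B.chi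

variable (V) in
/-- The value of the function `f` of a pair `(x, (τ, f))` at a point. -/
def evKf (z : Z) : B.KKType V →ₗ[ℝ] ℝ :=
  evFn (pre B.emb V) z ∘ₗ LinearMap.snd ℝ _ _ ∘ₗ LinearMap.snd ℝ _ _ ∘ₗ (B.KK V).subtype

theorem ttype_ext {s t : TType G V} (h : ∀ y ∈ V, evT G V y s = evT G V y t) : s = t :=
  Subtype.ext (sec_ext h)

theorem kktype_ext {s t : B.KKType V} (h : ∀ y ∈ V, B.evK V y s = B.evK V y t)
    (hf : ∀ z ∈ pre B.emb V, B.evKf V z s = B.evKf V z t) : s = t := by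
  have h1 : s.1.1 = t.1.1 := sec_ext h
  refine Subtype.ext (Prod.ext h1 (Prod.ext (vec_ext fun z hz => ?_) (fn_ext hf)))
  refine di_injective B.isEmb z ?_
  rw [← (s.2.2 z hz).1, ← (t.2.2 z hz).1, h1]

theorem evT_resTT (h : V' ≤ V) (s : TType G V) {y : X} (hy : y ∈ V') :
    evT G V' y (resTT G h s) = evT G V y s := resSec_apply h s.1 hy

theorem evK_resKK (h : V' ≤ V) (s : B.KKType V) {y : X} (hy : y ∈ V') :
    B.evK V' y (B.resKK h s) = B.evK V y s := resSec_apply h s.1.1 hy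

theorem evKf_resKK (h : V' ≤ V) (s : B.KKType V) {z : Z} (hz : z ∈ pre B.emb V') :
    B.evKf V' z (B.resKK h s) = B.evKf V z s := resFn_apply (pre_mono B.emb h) s.1.2.2 hz

end Values

section Cech
variable {ι : Type*} {U : ι → Opens X} {p : ℕ}

theorem mem_cap {α : Fin (p + 1) → ι} {y : X} : y ∈ cap U α ↔ ∀ j, y ∈ U (α j) := by
  refine ⟨fun h j => cap_le U α j h, fun h => ?_⟩
  rw [cap, ← SetLike.mem_coe, Opens.coe_finset_inf]
  simpa using h

theorem mem_cap_one {a : ι} {y : X} : y ∈ cap U ![a] ↔ y ∈ U a := by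
  simp [mem_cap]

theorem mem_cap_two {a b : ι} {y : X} : y ∈ cap U ![a, b] ↔ y ∈ U a ∧ y ∈ U b := by
  simp [mem_cap, Fin.forall_fin_two]

theorem mem_cap_three {a b d : ι} {y : X} :
    y ∈ cap U ![a, b, d] ↔ y ∈ U a ∧ y ∈ U b ∧ y ∈ U d := by
  simp [mem_cap, Fin.forall_fin_succ]

theorem mem_cap_four {a b d e : ι} {y : X} :
    y ∈ cap U ![a, b, d, e] ↔ y ∈ U a ∧ y ∈ U b ∧ y ∈ U d ∧ y ∈ U e := by
  simp [mem_cap, Fin.forall_fin_succ]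

theorem evT_hor1 (x : V1 G U p) (α : Fin (p + 2) → ι) {y : X} (hy : y ∈ cap U α) :
    evT G _ y (hor1 G U p x α) =
      ∑ k : Fin (p + 2), (-1 : ℝ) ^ (k : ℕ) • evT G _ y (x (α ∘ k.succAbove)) := by
  rw [hor1, LinearMap.sum_apply, Finset.sum_apply, map_sum]
  refine Finset.sum_congr rfl fun k _ => ?_
  rw [LinearMap.smul_apply, Pi.smul_apply, map_smul]
  exact congrArg _ (evT_resTT _ _ hy)

theorem hor0_snd (v : B.V0 U p) (α : Fin (p + 2) → ι) : (B.hor0 U p v).2 α =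
    ∑ k : Fin (p + 2), (-1 : ℝ) ^ (k : ℕ) • B.resKK (cap_le_face U α k) (v.2 (α ∘ k.succAbove)) := by
  rw [hor0, LinearMap.sum_apply, Prod.snd_sum, Finset.sum_apply]
  rfl

theorem hor0_fst (v : B.V0 U p) :
    (B.hor0 U p v).1 = ∑ k : Fin (p + 2), (-1 : ℝ) ^ (k : ℕ) • v.1 := by
  rw [hor0, LinearMap.sum_apply, Prod.fst_sum]
  rfl

theorem evK_hor0 (v : B.V0 U p) (α : Fin (p + 2) → ι) {y : X} (hy : y ∈ cap U α) :
    B.evK _ y ((B.hor0 U p v).2 α) =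
      ∑ k : Fin (p + 2), (-1 : ℝ) ^ (k : ℕ) • B.evK _ y (v.2 (α ∘ k.succAbove)) := by
  rw [hor0_snd, map_sum]
  refine Finset.sum_congr rfl fun k _ => ?_
  rw [map_smul, evK_resKK _ _ _ hy]

theorem evKf_hor0 (v : B.V0 U p) (α : Fin (p + 2) → ι) {z : Z} (hz : z ∈ pre B.emb (cap U α)) :
    B.evKf _ z ((B.hor0 U p v).2 α) =
      ∑ k : Fin (p + 2), (-1 : ℝ) ^ (k : ℕ) • B.evKf _ z (v.2 (α ∘ k.succAbove)) := by
  rw [hor0_snd, map_sum]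
  refine Finset.sum_congr rfl fun k _ => ?_
  rw [map_smul, evKf_resKK _ _ _ hz]

theorem evT_vert (v : B.V0 U p) (α : Fin (p + 1) → ι) {y : X} (hy : y ∈ cap U α) :
    evT G _ y (B.vert U p v α) = v.1.1.1 y - B.evK _ y (v.2 α) := by
  change evT G _ y (resH G (cap U α) v.1 - B.chiT (v.2 α)) = _
  rw [map_sub]
  exact congrArg (· - _) (resSec_apply _ _ hy)

theorem face_two (a b : ι) : (![a, b] ∘ (0 : Fin 2).succAbove = ![b]) ∧
    ![a, b] ∘ (1 : Fin 2).succAbove = ![a] := by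
  constructor <;> · ext i; fin_cases i; rfl

theorem face_three (a b d : ι) : (![a, b, d] ∘ (0 : Fin 3).succAbove = ![b, d]) ∧
    (![a, b, d] ∘ (1 : Fin 3).succAbove = ![a, d]) ∧
    ![a, b, d] ∘ (2 : Fin 3).succAbove = ![a, b] := by
  refine ⟨?_, ?_, ?_⟩ <;> · ext i; fin_cases i <;> rfl

theorem face_four (a b d e : ι) : (![a, b, d, e] ∘ (0 : Fin 4).succAbove = ![b, d, e]) ∧
    (![a, b, d, e] ∘ (1 : Fin 4).succAbove = ![a, d, e]) ∧
    (![a, b, d, e] ∘ (2 : Fin 4).succAbove = ![a, b, e]) ∧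
    ![a, b, d, e] ∘ (3 : Fin 4).succAbove = ![a, b, d] := by
  refine ⟨?_, ?_, ?_, ?_⟩ <;> · ext i; fin_cases i <;> rfl

theorem evT_hor1_zero (x : V1 G U 0) (a b : ι) {y : X} (hy : y ∈ cap U ![a, b]) :
    evT G _ y (hor1 G U 0 x ![a, b]) = evT G _ y (x ![b]) - evT G _ y (x ![a]) := by
  rw [evT_hor1 x _ hy, Fin.sum_univ_two, (face_two a b).1, (face_two a b).2]
  simp [sub_eq_add_neg]

theorem evT_hor1_one (x : V1 G U 1) (a b d : ι) {y : X} (hy : y ∈ cap U ![a, b, d]) :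
    evT G _ y (hor1 G U 1 x ![a, b, d]) =
      evT G _ y (x ![b, d]) - evT G _ y (x ![a, d]) + evT G _ y (x ![a, b]) := by
  obtain ⟨e0, e1, e2⟩ := face_three a b d
  rw [evT_hor1 x _ hy, Fin.sum_univ_three, e0, e1, e2]
  simp [sub_eq_add_neg]

theorem evK_hor0_one (v : B.V0 U 1) (a b d : ι) {y : X} (hy : y ∈ cap U ![a, b, d]) :
    B.evK _ y ((B.hor0 U 1 v).2 ![a, b, d]) =
      B.evK _ y (v.2 ![b, d]) - B.evK _ y (v.2 ![a, d]) + B.evK _ y (v.2 ![a, b]) := by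
  obtain ⟨e0, e1, e2⟩ := face_three a b d
  rw [evK_hor0 B v _ hy, Fin.sum_univ_three, e0, e1, e2]
  simp [sub_eq_add_neg]

theorem evKf_hor0_one (v : B.V0 U 1) (a b d : ι) {z : Z} (hz : z ∈ pre B.emb (cap U ![a, b, d])) :
    B.evKf _ z ((B.hor0 U 1 v).2 ![a, b, d]) =
      B.evKf _ z (v.2 ![b, d]) - B.evKf _ z (v.2 ![a, d]) + B.evKf _ z (v.2 ![a, b]) := by
  obtain ⟨e0, e1, e2⟩ := face_three a b d
  rw [evKf_hor0 B v _ hz, Fin.sum_univ_three, e0, e1, e2]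
  simp [sub_eq_add_neg]

theorem evKf_hor0_two (v : B.V0 U 2) (a b d e : ι) {z : Z}
    (hz : z ∈ pre B.emb (cap U ![a, b, d, e])) :
    B.evKf _ z ((B.hor0 U 2 v).2 ![a, b, d, e]) =
      B.evKf _ z (v.2 ![b, d, e]) - B.evKf _ z (v.2 ![a, d, e]) + B.evKf _ z (v.2 ![a, b, e]) -
        B.evKf _ z (v.2 ![a, b, d]) := by
  obtain ⟨e0, e1, e2, e3⟩ := face_four a b d e
  rw [evKf_hor0 B v _ hz, Fin.sum_univ_four, e0, e1, e2, e3]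
  simp [sub_eq_add_neg, pow_succ]

theorem evK_hor0_two (v : B.V0 U 2) (a b d e : ι) {y : X} (hy : y ∈ cap U ![a, b, d, e]) :
    B.evK _ y ((B.hor0 U 2 v).2 ![a, b, d, e]) =
      B.evK _ y (v.2 ![b, d, e]) - B.evK _ y (v.2 ![a, d, e]) + B.evK _ y (v.2 ![a, b, e]) -
        B.evK _ y (v.2 ![a, b, d]) := by
  obtain ⟨e0, e1, e2, e3⟩ := face_four a b d e
  rw [evK_hor0 B v _ hy, Fin.sum_univ_four, e0, e1, e2, e3]
  simp [sub_eq_add_neg, pow_succ]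

theorem hor0_two_fst (v : B.V0 U 2) : (B.hor0 U 2 v).1 = 0 := by
  rw [hor0_fst, Fin.sum_univ_four]
  simp [pow_succ]

theorem hor0_one_fst (v : B.V0 U 1) : (B.hor0 U 1 v).1 = v.1 := by
  rw [hor0_fst, Fin.sum_univ_three]
  simp

variable {B}

theorem Cocycle.x_eq (c : B.Cocycle U) (a b d : ι) {y : X} (hy : y ∈ cap U ![a, b, d]) :
    evT G _ y (c.1.2 ![b, d]) - evT G _ y (c.1.2 ![a, d]) + evT G _ y (c.1.2 ![a, b]) =
      c.1.1.1.1.1 y - B.evK _ y (c.1.1.2 ![a, b, d]) := by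
  have h : B.vert U 2 c.1.1 - hor1 G U 1 c.1.2 = 0 := congrArg Prod.snd c.2
  rw [← evT_hor1_one _ _ _ _ hy, ← evT_vert B _ _ hy]
  exact congrArg (fun w => evT G _ y (w ![a, b, d])) (sub_eq_zero.1 h).symm

theorem Cocycle.f_eq (c : B.Cocycle U) (a b d e : ι) {z : Z}
    (hz : z ∈ pre B.emb (cap U ![a, b, d, e])) :
    B.evKf _ z (c.1.1.2 ![b, d, e]) - B.evKf _ z (c.1.1.2 ![a, d, e]) +
      B.evKf _ z (c.1.1.2 ![a, b, e]) - B.evKf _ z (c.1.1.2 ![a, b, d]) = 0 := by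
  have h : B.hor0 U 2 c.1.1 = 0 := congrArg Prod.fst c.2
  rw [← evKf_hor0_two B _ _ _ _ _ hz, h]
  exact map_zero _

theorem totD_fst (v : B.Tot U p) : (B.totD U p v).1 = B.hor0 U (p + 1) v.1 := rfl

theorem evT_totD (v : B.Tot U 0) (a b : ι) {y : X} (hy : y ∈ cap U ![a, b]) :
    evT G _ y ((B.totD U 0 v).2 ![a, b]) = v.1.1.1.1 y - B.evK _ y (v.1.2 ![a, b]) -
      (evT G _ y (v.2 ![b]) - evT G _ y (v.2 ![a])) := by
  rw [← evT_vert B _ _ hy, ← evT_hor1_zero _ _ _ hy]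
  rfl

/-- The square of the differential of the total complex vanishes. -/
theorem totD_totD (v : B.Tot U 0) : B.totD U 1 (B.totD U 0 v) = 0 := by
  have h1 : ∀ {P : Type _} (α : Fin 3 → P), α = ![α 0, α 1, α 2] := fun α => by
    ext i; fin_cases i <;> rfl
  have h2 : ∀ {P : Type _} (α : Fin 4 → P), α = ![α 0, α 1, α 2, α 3] := fun α => by
    ext i; fin_cases i <;> rfl
  have mem : ∀ {a b d e : ι} {y : X}, y ∈ cap U ![a, b, d, e] → y ∈ cap U ![b, d, e] ∧
      y ∈ cap U ![a, d, e] ∧ y ∈ cap U ![a, b, e] ∧ y ∈ cap U ![a, b, d] := fun h => by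
    obtain ⟨ha, hb, hd, he⟩ := mem_cap_four.1 h
    exact ⟨mem_cap_three.2 ⟨hb, hd, he⟩, mem_cap_three.2 ⟨ha, hd, he⟩,
      mem_cap_three.2 ⟨ha, hb, he⟩, mem_cap_three.2 ⟨ha, hb, hd⟩⟩
  refine Prod.ext (Prod.ext (hor0_two_fst B _) (funext fun α => ?_)) (funext fun α => ?_)
  · rw [h2 α]
    refine B.kktype_ext (fun y hy => ?_) fun z hz => ?_
    · obtain ⟨m0, m1, m2, m3⟩ := mem hy
      refine (evK_hor0_two B (B.totD U 0 v).1 _ _ _ _ hy).trans ?_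
      rw [totD_fst, evK_hor0_one B _ _ _ _ m0, evK_hor0_one B _ _ _ _ m1,
        evK_hor0_one B _ _ _ _ m2, evK_hor0_one B _ _ _ _ m3]
      refine Eq.trans ?_ (map_zero _).symm
      abel
    · obtain ⟨m0, m1, m2, m3⟩ := mem (y := B.emb z) hz
      refine (evKf_hor0_two B (B.totD U 0 v).1 _ _ _ _ hz).trans ?_
      rw [totD_fst, evKf_hor0_one B _ _ _ _ m0, evKf_hor0_one B _ _ _ _ m1,
        evKf_hor0_one B _ _ _ _ m2, evKf_hor0_one B _ _ _ _ m3]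
      refine Eq.trans ?_ (map_zero _).symm
      ring
  · rw [h1 α]
    refine ttype_ext fun y hy => ?_
    obtain ⟨ha, hb, hd⟩ := mem_cap_three.1 hy
    have m0 : y ∈ cap U ![α 1, α 2] := mem_cap_two.2 ⟨hb, hd⟩
    have m1 : y ∈ cap U ![α 0, α 2] := mem_cap_two.2 ⟨ha, hd⟩
    have m2 : y ∈ cap U ![α 0, α 1] := mem_cap_two.2 ⟨ha, hb⟩
    refine ((map_sub (evT G _ y) _ _).trans (congrArg₂ (· - ·) (evT_vert B (B.totD U 0 v).1 _ hy)
      (evT_hor1_one (B.totD U 0 v).2 _ _ _ hy))).trans ?_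
    rw [evT_totD _ _ _ m0, evT_totD _ _ _ m1, evT_totD _ _ _ m2, totD_fst, evK_hor0_one B _ _ _ _ hy, hor0_one_fst]
    refine Eq.trans ?_ (map_zero _).symm
    abel

end Cech
end GCBrane
end TotalComplex

/-! ### Čech cochains with values in a module sheaf -/

section CechSheaf
variable {E : Type*} [NormedAddCommGroup E] [NormedSpace ℝ E] [FiniteDimensional ℝ E]
  {M : Type*} [TopologicalSpace M] [ChartedSpace E M] [IsManifold 𝓘(ℝ, E) ∞ M]
  {F : M → Type*} [∀ x, AddCommGroup (F x)] [∀ x, Module ℝ (F x)]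
  {S : (∀ x, F x) → Set M → Prop} {ι : Type*} {W : ι → Opens M} {φ : ι → M → ℝ}

/-- At a given point all locally finite sums are sums over one finite set, with weights that add up
to `1`. -/
theorem IsPartition.exists_weights {V : Opens M} (h : IsPartition E V W φ) {x : M} (hx : x ∈ V)
    (P : Type*) [AddCommGroup P] [Module ℝ P] :
    ∃ T : Finset ι, (∀ c ∈ T, x ∈ W c) ∧ ∑ c ∈ T, φ c x = 1 ∧
      ∀ v : ι → P, ∑ᶠ c, φ c x • v c = ∑ c ∈ T, φ c x • v c := by
  obtain ⟨N, T, hxN, -, hT, h0⟩ := h.finite x hx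
  have hs : ∀ {Q : Type _} [Zero Q] (g : ι → Q), (∀ c, φ c x = 0 → g c = 0) →
      Function.support g ⊆ T := fun g hg c hc => by
    by_contra hc'
    exact hc (hg c (h0 x hxN c hc'))
  refine ⟨T, fun c hc => hT c hc hxN, ?_, fun v => ?_⟩
  · rw [← h.sum_eq x hx]
    refine (finsum_eq_sum_of_support_subset _ fun c hc => ?_).symm
    by_contra hc'
    exact hc (h0 x hxN c hc')
  · exact finsum_eq_sum_of_support_subset _ (hs _ fun c hc => by simp [hc])

theorem IsPartition.restrict (h : IsPartition E (⊤ : Opens M) W φ) (V : Opens M) :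
    IsPartition E V (fun c => W c ⊓ V) φ where
  smooth c := (h.smooth c).mono fun _ _ => trivial
  finite x hx := by
    obtain ⟨N, T, hxN, -, hT, h0⟩ := h.finite x trivial
    exact ⟨N ⊓ V, T, ⟨hxN, hx⟩, inf_le_right, fun c hc => inf_le_inf_right _ (hT c hc),
      fun y hy => h0 y hy.1⟩
  sum_eq x _ := h.sum_eq x trivial

/-- Sections that agree on overlaps up to a family of subspaces glue up to this family. -/
theorem IsModuleSheaf.cech_zero (hS : IsModuleSheaf (E := E) S)
    (h : IsPartition E (⊤ : Opens M) W φ) (K : ∀ x, Submodule ℝ (F x)) (s : ι → ∀ x, F x)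
    (hs : ∀ a, S (s a) (W a))
    (hK : ∀ a b, ∀ x ∈ W a ⊓ W b, s b x - s a x ∈ K x) :
    ∃ t, S t (⊤ : Opens M) ∧ ∀ a, ∀ x ∈ W a, t x - s a x ∈ K x := by
  refine ⟨fun x => ∑ᶠ c, φ c x • s c x, hS.glue h s hs, fun a x hx => ?_⟩
  obtain ⟨T, hT, h1, e⟩ := h.exists_weights (x := x) trivial (F x)
  have e1 : ∑ c ∈ T, φ c x • (s c x - s a x) = ∑ᶠ c, φ c x • s c x - s a x := by
    rw [e]
    simp only [smul_sub, Finset.sum_sub_distrib, ← Finset.sum_smul, h1, one_smul]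
  rw [← e1]
  exact (K x).sum_mem fun c hc => (K x).smul_mem _ (hK a c x ⟨hx, hT c hc⟩)

/-- Čech 1-cocycles, up to a family of subspaces, with values in a module sheaf are coboundaries. -/
theorem IsModuleSheaf.cech_one (hS : IsModuleSheaf (E := E) S)
    (h : IsPartition E (⊤ : Opens M) W φ) (K : ∀ x, Submodule ℝ (F x)) (s : ι → ι → ∀ x, F x)
    (hs : ∀ a b, S (s a b) (W a ⊓ W b : Opens M))
    (hK : ∀ a b d, ∀ x ∈ W a ⊓ W b ⊓ W d, s b d x - s a d x + s a b x ∈ K x) :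
    ∃ t : ι → ∀ x, F x, (∀ a, S (t a) (W a)) ∧
      ∀ a b, ∀ x ∈ W a ⊓ W b, t b x - t a x - s a b x ∈ K x := by
  refine ⟨fun a x => ∑ᶠ c, φ c x • s c a x, fun a => hS.glue (h.restrict (W a)) _ fun c => hs c a,
    fun a b x hx => ?_⟩
  obtain ⟨T, hT, h1, e⟩ := h.exists_weights (x := x) trivial (F x)
  have e1 : ∑ c ∈ T, φ c x • -(s a b x - s c b x + s c a x) =
      ∑ᶠ c, φ c x • s c b x - ∑ᶠ c, φ c x • s c a x - s a b x := by
    have e2 : ∑ c ∈ T, φ c x • s a b x = s a b x := by rw [← Finset.sum_smul, h1, one_smul]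
    rw [e, e, ← e2, ← Finset.sum_sub_distrib, ← Finset.sum_sub_distrib, e2]
    refine Finset.sum_congr rfl fun c _ => ?_
    rw [← smul_sub, ← smul_sub]
    congr 1
    abel
  rw [← e1]
  exact (K x).sum_mem fun c hc => (K x).smul_mem _
    ((K x).neg_mem (hK c a b x ⟨⟨hT c hc, hx.1⟩, hx.2⟩))

/-- Čech 2-cocycles with values in a module sheaf are coboundaries. -/
theorem IsModuleSheaf.cech_two (hS : IsModuleSheaf (E := E) S)
    (h : IsPartition E (⊤ : Opens M) W φ) (s : ι → ι → ι → ∀ x, F x)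
    (hs : ∀ a b d, S (s a b d) (W a ⊓ (W b ⊓ W d) : Opens M))
    (hK : ∀ a b d e, ∀ x ∈ W a ⊓ W b ⊓ W d ⊓ W e,
      s b d e x - s a d e x + s a b e x - s a b d x = 0) :
    ∃ t : ι → ι → ∀ x, F x, (∀ a b, S (t a b) (W a ⊓ W b : Opens M)) ∧
      ∀ a b d, ∀ x ∈ W a ⊓ W b ⊓ W d, t b d x - t a d x + t a b x = s a b d x := by
  refine ⟨fun a b x => ∑ᶠ c, φ c x • s c a b x,
    fun a b => hS.glue (h.restrict (W a ⊓ W b)) _ fun c => hs c a b, fun a b d x hx => ?_⟩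
  obtain ⟨T, hT, h1, e⟩ := h.exists_weights (x := x) trivial (F x)
  have e1 : ∑ c ∈ T, φ c x • s a b d x = s a b d x := by rw [← Finset.sum_smul, h1, one_smul]
  beta_reduce
  rw [e, e, e, ← e1, ← Finset.sum_sub_distrib, ← Finset.sum_add_distrib]
  refine Finset.sum_congr rfl fun c hc => ?_
  rw [← smul_sub, ← smul_add]
  congr 1
  rw [← sub_eq_zero, ← neg_eq_zero, ← hK c a b d x ⟨⟨⟨hT c hc, hx.1.1⟩, hx.1.2⟩, hx.2⟩]
  abel

end CechSheaf

/-! ### Sections with values in the generalized tangent bundle of a brane -/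

section Tangential
variable {E : Type*} [NormedAddCommGroup E] [NormedSpace ℝ E] [FiniteDimensional ℝ E]
  {X : Type*} [TopologicalSpace X] [ChartedSpace E X] [IsManifold 𝓘(ℝ, E) ∞ X]
  {E' : Type*} [NormedAddCommGroup E'] [NormedSpace ℝ E'] [FiniteDimensional ℝ E']
  {Z : Type*} [TopologicalSpace Z] [ChartedSpace E' Z] [IsManifold 𝓘(ℝ, E') ∞ Z]
  {G : GCStructure E X}

namespace GCBrane
variable (B : GCBrane E' Z G) {U V : Opens X}

/-- The affine space `{(i_* v, α) : i^* α = ι_v F - β}` over `T(Z, F)`. For `β = df` it holds the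
values of the elements of `T(U)` that, with the function `f`, belong to the row `0` of the
complex. -/
def InK (z : Z) (β : TangentSpace 𝓘(ℝ, E') z →L[ℝ] ℝ) (s : GT E (B.emb z)) : Prop :=
  ∃ v, s.1 = di B.emb z v ∧ ∀ w, s.2 (di B.emb z w) = B.F z v w - β w

theorem inK_zero {z : Z} {s : GT E (B.emb z)} : B.InK z 0 s ↔ s ∈ B.TZ z := by
  simp only [InK, zero_apply, sub_zero]
  rfl

variable {B} in
theorem InK.add {z : Z} {β β' : TangentSpace 𝓘(ℝ, E') z →L[ℝ] ℝ} {s s' : GT E (B.emb z)}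
    (h : B.InK z β s) (h' : B.InK z β' s') : B.InK z (β + β') (s + s') := by
  obtain ⟨v, h1, h2⟩ := h
  obtain ⟨v', h1', h2'⟩ := h'
  refine ⟨v + v', ?_, fun w => ?_⟩
  · exact (congrArg₂ (· + ·) h1 h1').trans ((di B.emb z).map_add _ _).symm
  · have h : B.F z (v + v') w = B.F z v w + B.F z v' w := by
      rw [(B.F z).map_add]; rfl
    refine (congrArg₂ (· + ·) (h2 w) (h2' w)).trans ?_
    rw [h, add_apply]
    ring

variable {B} in
theorem InK.neg {z : Z} {β : TangentSpace 𝓘(ℝ, E') z →L[ℝ] ℝ} {s : GT E (B.emb z)}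
    (h : B.InK z β s) : B.InK z (-β) (-s) := by
  obtain ⟨v, h1, h2⟩ := h
  refine ⟨-v, ?_, fun w => ?_⟩
  · exact (congrArg (- ·) h1).trans ((di B.emb z).map_neg _).symm
  · have h : B.F z (-v) w = - B.F z v w := by
      rw [(B.F z).map_neg]; rfl
    refine (congrArg (- ·) (h2 w)).trans ?_
    rw [h, neg_apply]
    ring

variable {B} in
theorem InK.sub {z : Z} {β β' : TangentSpace 𝓘(ℝ, E') z →L[ℝ] ℝ} {s s' : GT E (B.emb z)}
    (h : B.InK z β s) (h' : B.InK z β' s') : B.InK z (β - β') (s - s') := by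
  rw [sub_eq_add_neg, sub_eq_add_neg]
  exact h.add h'.neg

theorem evK_inK (y : B.KKType U) {z : Z} (hz : z ∈ pre B.emb U) :
    B.InK z ((d0 y.1.2.2).1 z) (B.evK U (B.emb z) y) :=
  ⟨_, y.2.2 z hz⟩

section
variable [T2Space X] [SecondCountableTopology X] [T2Space Z] [SecondCountableTopology Z]

/-- The element `(0, dH)`, where `H` extends `-f` from `Z`, lies over `df`. -/
theorem exists_exact_inK (f : Fn E' (pre B.emb U)) : ∃ H : Fn E U, ∀ z ∈ pre B.emb U,
    B.InK z ((d0 f).1 z) ((secForm (d0 H)).1 (B.emb z)) := by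
  obtain ⟨H, hH⟩ := pullFn_surjective B.isEmb B.closed U (-f)
  refine ⟨H, fun z hz => ⟨0, ((di B.emb z).map_zero).symm, fun w => ?_⟩⟩
  have hF : B.F z 0 w = 0 := by rw [(B.F z).map_zero]; rfl
  have hd : MDifferentiableAt 𝓘(ℝ, E) 𝓘(ℝ) H.1 (B.emb z) :=
    (H.2.2.contMDiffAt (U.2.mem_nhds hz)).mdifferentiableAt (by simp)
  have e : (d0 (-f)).1 z w = - (d0 f).1 z w := by rw [map_neg]; rfl
  rw [hF, zero_sub, ← e, ← hH, d0_apply _ hz]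
  change (d0 H).1 (B.emb z) (di B.emb z w) = _
  rw [d0_apply H hz]
  exact mvfderiv_di hd w

/-- An element of `T(U)` whose restriction to `Z` lies over `df` belongs to the row `0`. -/
theorem exists_kk (x : TType G U) (f : Fn E' (pre B.emb U))
    (h : ∀ z ∈ pre B.emb U, B.InK z ((d0 f).1 z) (evT G U (B.emb z) x)) :
    ∃ y : B.KKType U, (∀ p, B.evK U p y = evT G U p x) ∧ ∀ z, B.evKf U z y = f.1 z := by
  obtain ⟨τ, hτ⟩ := exists_tangent_vec B.isEmb (W := pre B.emb U)
    (ξ := fun z => (x.1.1 (B.emb z)).1) (SmoothVec.comp (f := B.emb) x.1.2.1.2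
      B.emb.contMDiff.contMDiffOn fun _ hz => hz) fun z hz => ⟨_, (h z hz).choose_spec.1⟩
  refine ⟨⟨(x.1, τ, f), x.2, fun z hz => ⟨hτ z hz, fun v => ?_⟩⟩, fun p => rfl, fun z => rfl⟩
  obtain ⟨v', h1, h2⟩ := h z hz
  have : v' = τ.1 z := di_injective B.isEmb z (h1.symm.trans (hτ z hz))
  rw [← this]
  exact h2 v

theorem zetaFib_of_mem_TT {x : Sec E U} (hx : rSec B.emb x ∈ B.TT (pre B.emb U)) {z : Z}
    (hz : z ∈ pre B.emb U) : B.zetaFib x z = 0 := by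
  have h : B.qr x = 0 := (Submodule.Quotient.mk_eq_zero _).2 hx
  have hd : B.IsDelta U (B.mu _ (B.qr x)) 0 := fun s t u _ z _ v w _ _ => by
    rw [h, map_zero]
    simp [dC_zero]
  exact ((B.isDelta_iff x 0).1 hd z hz).symm

/-- `δ_l μ(q(x))` depends only on the class of `x` in the generalized normal bundle. -/
theorem zetaFib_congr_TZ {x : Sec E U} {x' : Sec E V}
    (h : ∀ z ∈ pre B.emb U, z ∈ pre B.emb V → x.1 (B.emb z) - x'.1 (B.emb z) ∈ B.TZ z) {z : Z}
    (hz : z ∈ pre B.emb U) (hz' : z ∈ pre B.emb V) : B.zetaFib x z = B.zetaFib x' z := by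
  have hm : z ∈ pre B.emb (U ⊓ V) := ⟨hz, hz'⟩
  rw [← B.zetaFib_resSec (inf_le_left : U ⊓ V ≤ U) x hm,
    ← B.zetaFib_resSec (inf_le_right : U ⊓ V ≤ V) x' hm, ← sub_eq_zero, ← B.zetaFib_sub _ _ hm]
  refine B.zetaFib_of_mem_TT (fun w => ?_) hm
  by_cases hw : w ∈ pre B.emb (U ⊓ V)
  · refine Eq.subst (motive := fun t => t ∈ B.TZ w) ?_ (h w hw.1 hw.2)
    exact (congrArg₂ (· - ·) (resSec_apply inf_le_left x hw) (resSec_apply inf_le_right x' hw)).symm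
  · rw [(rSec B.emb _).2.1 w hw]
    exact (B.TZ w).zero_mem

end
end GCBrane
end Tangential

/-! ### Comparison of the total complex with the Lie algebroid complex -/

section Comparison
variable {E : Type*} [NormedAddCommGroup E] [NormedSpace ℝ E] [FiniteDimensional ℝ E]
  {X : Type*} [TopologicalSpace X] [T2Space X] [SecondCountableTopology X] [ChartedSpace E X]
  [IsManifold 𝓘(ℝ, E) ∞ X]
  {E' : Type*} [NormedAddCommGroup E'] [NormedSpace ℝ E'] [FiniteDimensional ℝ E']
  {Z : Type*} [TopologicalSpace Z] [T2Space Z] [SecondCountableTopology Z] [ChartedSpace E' Z]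
  [IsManifold 𝓘(ℝ, E') ∞ Z]
  {G : GCStructure E X}

theorem AlmostGC.omegaAt_smul {V : Opens X} (G : AlmostGC E X) (r : ℝ) (x : Sec E V) {y : X}
    (hy : y ∈ V) : G.omegaAt (r • x) y = r • G.omegaAt x y := by
  refine LinearMap.ext₂ fun v w => ?_
  obtain ⟨a, rfl⟩ := exists_sec v V hy
  obtain ⟨b, rfl⟩ := exists_sec w V hy
  have h : G.omega (r • x) a b = r • G.omega x a b := by
    simp only [G.omega_apply, map_smul, LinearMap.smul_apply, smul_sub]
  rw [LinearMap.smul_apply, LinearMap.smul_apply, ← G.omega_val _ _ _ hy, ← G.omega_val _ _ _ hy, h]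
  rfl

namespace GCBrane
variable (B : GCBrane E' Z G) {V : Opens X} {ι : Type*} {U : ι → Opens X}

theorem zetaFib_smul (r : ℝ) (x : Sec E V) {z : Z} (hz : z ∈ pre B.emb V) :
    B.zetaFib (r • x) z = r • B.zetaFib x z := by
  refine alt_ext fun v w => ?_
  obtain ⟨a, rfl⟩ := B.exists_jl v
  obtain ⟨b, rfl⟩ := B.exists_jl w
  rw [AlternatingMap.smul_apply, B.zetaFib_jl _ hz, B.zetaFib_jl _ hz,
    G.omegaAt_smul _ _ (show B.emb z ∈ V from hz), Complex.real_smul]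
  simp only [LinearMap.smul_apply, smul_eq_mul]
  push_cast
  ring

theorem qr_surjective : Function.Surjective (B.qr (U := V)) :=
  (Submodule.mkQ_surjective _).comp (rSec_surjective B.isEmb B.closed V)

theorem glue_iff (X : ∀ a, Sec E (U a)) (a b : ι) (s : Sec E (cap U ![a, b])) :
    B.resN (pre_mono B.emb (cap_le U ![a, b] 1)) (B.qr (X b)) -
      B.resN (pre_mono B.emb (cap_le U ![a, b] 0)) (B.qr (X a)) = B.qr s ↔
    ∀ z ∈ pre B.emb (cap U ![a, b]),
      (X b).1 (B.emb z) - (X a).1 (B.emb z) - s.1 (B.emb z) ∈ B.TZ z := by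
  refine Iff.trans (Submodule.Quotient.eq (B.TT _)
    (x := resAlong B.emb (pre_mono B.emb (cap_le U ![a, b] 1)) (rSec B.emb (X b)) -
      resAlong B.emb (pre_mono B.emb (cap_le U ![a, b] 0)) (rSec B.emb (X a)))
    (y := rSec B.emb s)) ?_
  have e : ∀ z ∈ pre B.emb (cap U ![a, b]),
      (resAlong B.emb (pre_mono B.emb (cap_le U ![a, b] 1)) (rSec B.emb (X b)) -
        resAlong B.emb (pre_mono B.emb (cap_le U ![a, b] 0)) (rSec B.emb (X a)) -
          rSec B.emb s).1 z =
      (X b).1 (B.emb z) - (X a).1 (B.emb z) - s.1 (B.emb z) := fun z hz =>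
    congrArg (· - s.1 (B.emb z)) (congrArg₂ (· - ·)
      (resAlong_apply B.emb (pre_mono B.emb (cap_le U ![a, b] 1)) (rSec B.emb (X b)) hz)
      (resAlong_apply B.emb (pre_mono B.emb (cap_le U ![a, b] 0)) (rSec B.emb (X a)) hz))
  refine ⟨fun h z hz => e z hz ▸ h z, fun h z => ?_⟩
  by_cases hz : z ∈ pre B.emb (cap U ![a, b])
  · rw [e z hz]
    exact h z hz
  · refine Eq.subst (motive := fun t => t ∈ B.TZ z) ?_ (B.TZ z).zero_mem
    exact (Subtype.property (p := (· ∈ SecAlong B.emb _)) _ |>.1 z hz).symm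

variable (U) in
theorem lifts_qr_iff (c : B.Cocycle U) (X : ∀ a, Sec E (U a)) (ζ : B.Z2) :
    B.Lifts U c (fun a => B.qr (X a)) ζ ↔ c.1.1.1 = 0 ∧ (∀ α, (c.1.1.2 α).1.2.2 = 0) ∧
      (∀ a b, ∀ z ∈ pre B.emb (cap U ![a, b]), (X b).1 (B.emb z) - (X a).1 (B.emb z) -
        evT G _ (B.emb z) (c.1.2 ![a, b]) ∈ B.TZ z) ∧
      ∀ a, ∀ z ∈ pre B.emb (U a), ζ.1 z = B.zetaFib (X a) z :=
  ⟨fun h => ⟨h.ham, h.fn, fun a b => (B.glue_iff X a b _).1 (h.glue a b),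
    fun a => (B.isDelta_iff _ _).1 (h.delta a)⟩,
   fun h => ⟨h.1, h.2.1, fun a b => (B.glue_iff X a b _).2 (h.2.2.1 a b),
    fun a => (B.isDelta_iff _ _).2 (h.2.2.2 a)⟩⟩

theorem exists_eq_qr (σ : ∀ a, B.NSec (pre B.emb (U a))) :
    ∃ X : ∀ a, Sec E (U a), σ = fun a => B.qr (X a) := by
  choose X hX using fun a => B.qr_surjective (σ a)
  exact ⟨X, funext fun a => (hX a).symm⟩

variable {B}

theorem Lifts.add {c c' : B.Cocycle U} {σ σ' : ∀ a, B.NSec (pre B.emb (U a))} {ζ ζ' : B.Z2}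
    (h : B.Lifts U c σ ζ) (h' : B.Lifts U c' σ' ζ') : B.Lifts U (c + c') (σ + σ') (ζ + ζ') where
  ham := (congrArg₂ (· + ·) h.ham h'.ham).trans (add_zero _)
  fn α := (congrArg₂ (· + ·) (h.fn α) (h'.fn α)).trans (add_zero _)
  glue a b := by
    refine Eq.trans ?_ ((congrArg₂ (· + ·) (h.glue a b) (h'.glue a b)).trans (map_add B.qr _ _).symm)
    exact (congrArg₂ (· - ·) (map_add (B.resN (pre_mono B.emb (cap_le U ![a, b] 1))) (σ b) (σ' b))
      (map_add (B.resN (pre_mono B.emb (cap_le U ![a, b] 0))) (σ a) (σ' a))).trans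
        (add_sub_add_comm _ _ _ _)
  delta a := by
    obtain ⟨X, rfl⟩ := B.exists_eq_qr σ
    obtain ⟨X', rfl⟩ := B.exists_eq_qr σ'
    rw [Pi.add_apply, ← map_add]
    refine (B.isDelta_iff _ _).2 fun z hz => ?_
    rw [B.zetaFib_add _ _ hz, ← (B.isDelta_iff _ _).1 (h.delta a) z hz,
      ← (B.isDelta_iff _ _).1 (h'.delta a) z hz]
    rfl

theorem Lifts.smul {c : B.Cocycle U} {σ : ∀ a, B.NSec (pre B.emb (U a))} {ζ : B.Z2} (r : ℝ)
    (h : B.Lifts U c σ ζ) : B.Lifts U (r • c) (r • σ) (r • ζ) where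
  ham := (congrArg (r • ·) h.ham).trans (smul_zero _)
  fn α := (congrArg (r • ·) (h.fn α)).trans (smul_zero _)
  glue a b := by
    refine Eq.trans ?_ ((congrArg (r • ·) (h.glue a b)).trans (map_smul B.qr _ _).symm)
    exact (congrArg₂ (· - ·) (map_smul (B.resN (pre_mono B.emb (cap_le U ![a, b] 1))) r (σ b))
      (map_smul (B.resN (pre_mono B.emb (cap_le U ![a, b] 0))) r (σ a))).trans (smul_sub _ _ _).symm
  delta a := by
    obtain ⟨X, rfl⟩ := B.exists_eq_qr σ
    rw [Pi.smul_apply, ← map_smul]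
    refine (B.isDelta_iff _ _).2 fun z hz => ?_
    rw [B.zetaFib_smul _ _ hz, ← (B.isDelta_iff _ _).1 (h.delta a) z hz]
    rfl

theorem Lifts.sub {c c' : B.Cocycle U} {σ σ' : ∀ a, B.NSec (pre B.emb (U a))} {ζ ζ' : B.Z2}
    (h : B.Lifts U c σ ζ) (h' : B.Lifts U c' σ' ζ') : B.Lifts U (c - c') (σ - σ') (ζ - ζ') := by
  have := h.add (h'.smul (-1))
  rwa [neg_one_smul, neg_one_smul, neg_one_smul, ← sub_eq_add_neg, ← sub_eq_add_neg,
    ← sub_eq_add_neg] at this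

theorem h2TotMk_eq_zero_iff {c : B.Cocycle U} :
    B.H2TotMk U c = 0 ↔ c.1 ∈ LinearMap.range (B.totD U 0) :=
  Submodule.Quotient.mk_eq_zero _

theorem h2mk_eq_zero_iff {ζ : B.Z2} : B.H2mk ζ = 0 ↔ ζ.1 ∈ B.B2 :=
  Submodule.Quotient.mk_eq_zero _

variable (B) in
theorem exists_mem_cover (hU : ⨆ a, U a = ⊤) (z : Z) : ∃ a, z ∈ pre B.emb (U a) := by
  have h : B.emb z ∈ ⨆ a, U a := hU ▸ Opens.mem_top _
  exact (Opens.mem_iSup (x := B.emb z)).1 h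

variable (B) in
theorem exists_partition_pre (hU : ⨆ a, U a = ⊤) :
    ∃ φ : ι → Z → ℝ, IsPartition E' (⊤ : Opens Z) (fun a => pre B.emb (U a)) φ :=
  exists_isPartition _ _ fun z _ => B.exists_mem_cover hU z

end GCBrane
end Comparison

section Comparison
variable {E : Type*} [NormedAddCommGroup E] [NormedSpace ℝ E] [FiniteDimensional ℝ E]
  {X : Type*} [TopologicalSpace X] [T2Space X] [SecondCountableTopology X] [ChartedSpace E X]
  [IsManifold 𝓘(ℝ, E) ∞ X]
  {E' : Type*} [NormedAddCommGroup E'] [NormedSpace ℝ E'] [FiniteDimensional ℝ E']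
  {Z : Type*} [TopologicalSpace Z] [T2Space Z] [SecondCountableTopology Z] [ChartedSpace E' Z]
  [IsManifold 𝓘(ℝ, E') ∞ Z]
  {G : GCStructure E X}

namespace GCBrane
variable {B : GCBrane E' Z G} {ι : Type*} {U : ι → Opens X}

/-- Every class is represented by a cocycle without components in `H(X)` and in the functions on
`Z`: the function components form a Čech cocycle, which is the coboundary of some `h`, and an
extension of `h` to `X` gives elements of the row `0`. -/
theorem exists_reduced_cocycle (hU : ⨆ a, U a = ⊤) (c : B.Cocycle U) :
    ∃ c' : B.Cocycle U, B.H2TotMk U c' = B.H2TotMk U c ∧ c'.1.1.1 = 0 ∧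
      ∀ α, (c'.1.1.2 α).1.2.2 = 0 := by
  obtain ⟨φ, hφ⟩ := B.exists_partition_pre hU
  obtain ⟨t, ht, hdt⟩ := (isModuleSheaf_fun (E := E') (M := Z) (P := ℝ)).cech_two hφ
    (fun a b d z => B.evKf _ z (c.1.1.2 ![a, b, d]))
    (fun a b d => (c.1.1.2 ![a, b, d]).1.2.2.2.2.mono fun z hz => mem_cap_three.2 hz)
    (fun a b d e z hz => Cocycle.f_eq c a b d e (mem_cap_four.2 ⟨hz.1.1.1, hz.1.1.2, hz.1.2, hz.2⟩))
  have hy : ∀ α : Fin 2 → ι, ∃ y : B.KKType (cap U α), ∀ z ∈ pre B.emb (cap U α),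
      B.evKf _ z y = t (α 0) (α 1) z := fun α => by
    obtain ⟨f, hf⟩ := exists_fn_of_smooth (V := pre B.emb (cap U α))
      ((ht (α 0) (α 1)).mono fun z hz => ⟨cap_le U α 0 hz, cap_le U α 1 hz⟩)
    obtain ⟨H, hH⟩ := B.exists_exact_inK f
    obtain ⟨y, -, hy⟩ := B.exists_kk ⟨secForm (d0 H), G.exact_mem_T H⟩ f hH
    exact ⟨y, fun z hz => (hy z).trans (hf z hz)⟩
  choose y hy using hy
  let v : B.Tot U 0 := ((c.1.1.1, y), 0)
  refine ⟨c - ⟨B.totD U 0 v, totD_totD v⟩, ?_, ?_, fun α => ?_⟩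
  · rw [map_sub, sub_eq_self]
    exact h2TotMk_eq_zero_iff.2 ⟨v, rfl⟩
  · exact (congrArg (c.1.1.1 - ·) (hor0_one_fst B v.1)).trans (sub_self _)
  · obtain ⟨a, b, d, rfl⟩ : ∃ a b d, α = ![a, b, d] :=
      ⟨α 0, α 1, α 2, by ext i; fin_cases i <;> rfl⟩
    refine fn_ext fun z hz => ?_
    obtain ⟨ha, hb, hd⟩ := mem_cap_three.1 hz
    change B.evKf _ z (c.1.1.2 ![a, b, d] - (B.hor0 U 1 v.1).2 ![a, b, d]) = 0
    rw [map_sub, evKf_hor0_one B _ _ _ _ hz, hy ![b, d] z (mem_cap_two.2 ⟨hb, hd⟩),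
      hy ![a, d] z (mem_cap_two.2 ⟨ha, hd⟩), hy ![a, b] z (mem_cap_two.2 ⟨ha, hb⟩), sub_eq_zero]
    exact (hdt a b d z ⟨⟨ha, hb⟩, hd⟩).symm

/-- For a cocycle without components in `H(X)` and in the functions on `Z`, the `q(r(x_ab))` are a
Čech cocycle with values in the generalized normal bundle, so they are a coboundary. -/
theorem exists_lifts (hU : ⨆ a, U a = ⊤) (c : B.Cocycle U) (hham : c.1.1.1 = 0)
    (hfn : ∀ α, (c.1.1.2 α).1.2.2 = 0) :
    ∃ (σ : ∀ a, B.NSec (pre B.emb (U a))) (ζ : B.Z2), B.Lifts U c σ ζ := by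
  obtain ⟨φ, hφ⟩ := B.exists_partition_pre hU
  obtain ⟨t, ht, hdt⟩ := (isModuleSheaf_sec (f := B.emb) B.emb.contMDiff).cech_one hφ B.TZ
    (fun a b z => evT G _ (B.emb z) (c.1.2 ![a, b]))
    (fun a b => by
      have h : (pre B.emb (U a) ⊓ pre B.emb (U b) : Set Z) ⊆ pre B.emb (cap U ![a, b]) :=
        fun z hz => mem_cap_two.2 hz
      have := (rSec B.emb (c.1.2 ![a, b]).1).2.2
      exact ⟨ContMDiffOn.mono this.1 h, ContMDiffOn.mono this.2 h⟩)
    (fun a b d z hz => by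
      have hm : B.emb z ∈ cap U ![a, b, d] := mem_cap_three.2 ⟨hz.1.1, hz.1.2, hz.2⟩
      have hk := B.evK_inK (c.1.1.2 ![a, b, d]) hm
      rw [hfn, map_zero] at hk
      rw [Cocycle.x_eq c a b d hm, hham]
      exact (zero_sub (B.evK _ (B.emb z) (c.1.1.2 ![a, b, d]))).symm ▸
        (B.TZ z).neg_mem (B.inK_zero.1 hk))
  have hX : ∀ a, ∃ x : Sec E (U a), ∀ z ∈ pre B.emb (U a), x.1 (B.emb z) = t a z := fun a => by
    obtain ⟨s, hs⟩ := exists_secAlong_of_smooth (W := pre B.emb (U a)) (ht a).1 (ht a).2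
    obtain ⟨x, rfl⟩ := rSec_surjective B.isEmb B.closed _ s
    exact ⟨x, hs⟩
  choose X hX using hX
  have hglue : ∀ a b, ∀ z ∈ pre B.emb (cap U ![a, b]), (X b).1 (B.emb z) - (X a).1 (B.emb z) -
      evT G _ (B.emb z) (c.1.2 ![a, b]) ∈ B.TZ z := fun a b z hz => by
    obtain ⟨ha, hb⟩ := mem_cap_two.1 hz
    rw [hX a z ha, hX b z hb]
    exact hdt a b z ⟨ha, hb⟩
  -- `ζ` is computed at `z` from any `U a` that contains `z`: along `Z`, `X a` and `X b` differ by
  -- `x_ab` and an element of `T(Z, F)`, and neither of these contributes.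
  choose k hk using B.exists_mem_cover hU
  have hζ : ∀ a, ∀ z ∈ pre B.emb (U a), B.zetaFib (X (k z)) z = B.zetaFib (X a) z := by
    intro a z hz
    have ha : cap U ![k z, a] ≤ U (k z) := cap_le U ![k z, a] 0
    have hb : cap U ![k z, a] ≤ U a := cap_le U ![k z, a] 1
    have hm : z ∈ pre B.emb (cap U ![k z, a]) := mem_cap_two.2 ⟨hk z, hz⟩
    have e := B.zetaFib_congr_TZ (x := resSec hb (X a) - resSec ha (X (k z)))
      (x' := (c.1.2 ![k z, a]).1) (fun w hw _ => by
        refine Eq.subst (motive := fun s => s ∈ B.TZ w) ?_ (hglue (k z) a w hw)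
        exact congrArg (· - _) (congrArg₂ (· - ·) (resSec_apply hb (X a) hw)
          (resSec_apply ha (X (k z)) hw)).symm) hm hm
    rw [B.zetaFib_of_mem_T (c.1.2 ![k z, a]).2 hm, B.zetaFib_sub _ _ hm, B.zetaFib_resSec _ _ hm,
      B.zetaFib_resSec _ _ hm, sub_eq_zero] at e
    exact e.symm
  have hloc : B.IsLocallyDelta fun z => B.zetaFib (X (k z)) z :=
    fun z => ⟨U (k z), X (k z), hk z, fun z' hz' => hζ (k z) z' hz'⟩
  exact ⟨fun a => B.qr (X a), ⟨_, hloc.mem_Z2⟩,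
    (B.lifts_qr_iff U c X _).2 ⟨hham, hfn, hglue, hζ⟩⟩

/-- If the cocycle `c` is a coboundary, then the sections `σ_a` can be corrected by elements of
`T(U_a)`, which changes no `δ_l μ(σ_a)`, so that they glue to a global section of the generalized
normal bundle. -/
theorem Lifts.mem_B2 (hU : ⨆ a, U a = ⊤) {c : B.Cocycle U} {σ : ∀ a, B.NSec (pre B.emb (U a))}
    {ζ : B.Z2} (h : B.Lifts U c σ ζ) (hc : c.1 ∈ LinearMap.range (B.totD U 0)) : ζ.1 ∈ B.B2 := by
  obtain ⟨X, rfl⟩ := B.exists_eq_qr σ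
  obtain ⟨hham, hfn, hglue, hζ⟩ := (B.lifts_qr_iff U c X ζ).1 h
  obtain ⟨v, hv⟩ := hc
  have hv0 : v.1.1 = 0 := by
    rw [← hor0_one_fst B v.1, ← totD_fst, hv, hham]
  have hx : ∀ a b, ∀ z ∈ pre B.emb (cap U ![a, b]), evT G _ (B.emb z) (c.1.2 ![a, b]) =
      - B.evK _ (B.emb z) (v.1.2 ![a, b]) -
        (evT G _ (B.emb z) (v.2 ![b]) - evT G _ (B.emb z) (v.2 ![a])) := fun a b z hz => by
    rw [← hv, evT_totD v a b hz, hv0]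
    exact congrArg (· - _) (zero_sub _)
  obtain ⟨φ, hφ⟩ := B.exists_partition_pre hU
  obtain ⟨t, ht, hdt⟩ := (isModuleSheaf_fun (E := E') (M := Z) (P := ℝ)).cech_one hφ (fun _ => ⊥)
    (fun a b z => B.evKf _ z (v.1.2 ![a, b]))
    (fun a b => (v.1.2 ![a, b]).1.2.2.2.2.mono fun z hz => mem_cap_two.2 hz)
    (fun a b d z hz => by
      have hm : z ∈ pre B.emb (cap U ![a, b, d]) := mem_cap_three.2 ⟨hz.1.1, hz.1.2, hz.2⟩
      refine (Submodule.mem_bot ℝ).2 ?_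
      rw [← evKf_hor0_one B v.1 a b d hm, ← totD_fst, hv]
      exact congrArg (fun f : Fn E' (pre B.emb (cap U ![a, b, d])) => f.1 z) (hfn ![a, b, d]))
  have hf : ∀ a, ∃ f : Fn E' (pre B.emb (U a)), ∀ z ∈ pre B.emb (U a), f.1 z = t a z :=
    fun a => exists_fn_of_smooth (ht a)
  choose f hf using hf
  choose H hH using fun a => B.exists_exact_inK (f a)
  -- Along `Z` the sections `X_a + x'_a` differ by `y'_ab`, up to `T(Z, F)`. The function component
  -- `f'_ab` of `y'_ab` is a Čech coboundary `f_b - f_a`, and adding the exact forms `dH_a` moves the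
  -- differences into `T(Z, F)`.
  let Y : ∀ a, ∀ z, GT E (B.emb z) := fun a z =>
    (X a).1 (B.emb z) + ((v.2 ![a]).1.1 (B.emb z) + (secForm (d0 (H a))).1 (B.emb z))
  have hcap : ∀ a, cap U ![a] = U a := fun a => Opens.ext (Set.ext fun _ => mem_cap_one)
  have hYs : ∀ a, SmoothVec E' E B.emb (fun z => (Y a z).1) (pre B.emb (U a)) ∧
      SmoothForm E' E B.emb (fun z => (Y a z).2) (pre B.emb (U a)) := fun a => by
    have h1 := (rSec B.emb (X a)).2.2
    have h2 := (rSec B.emb (v.2 ![a]).1).2.2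
    have h3 := (rSec B.emb (secForm (d0 (H a)))).2.2
    have hle : (pre B.emb (U a) : Set Z) ⊆ pre B.emb (cap U ![a]) := fun z hz => mem_cap_one.2 hz
    exact ⟨h1.1.add (SmoothVec.add (ContMDiffOn.mono h2.1 hle) h3.1),
      h1.2.add (SmoothForm.add (ContMDiffOn.mono h2.2 hle) h3.2)⟩
  have hYglue : ∀ a b, ∀ z ∈ pre B.emb (U a) ⊓ pre B.emb (U b), Y b z - Y a z ∈ B.TZ z := by
    intro a b z hz
    have hm : z ∈ pre B.emb (cap U ![a, b]) := mem_cap_two.2 hz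
    have h1 := B.inK_zero.2 (hglue a b z hm)
    have h2 := B.evK_inK (v.1.2 ![a, b]) hm
    have h3 := ((h1.sub h2).add (hH b z hz.2)).sub (hH a z hz.1)
    have hd : (d0 (v.1.2 ![a, b]).1.2.2).1 z = (d0 (f b)).1 z - (d0 (f a)).1 z := by
      have e : (v.1.2 ![a, b]).1.2.2.1 =ᶠ[𝓝 z] fun z => (f b).1 z - (f a).1 z := by
        filter_upwards [(pre B.emb (U a)).2.mem_nhds hz.1, (pre B.emb (U b)).2.mem_nhds hz.2]
          with z' ha hb
        rw [hf a z' ha, hf b z' hb]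
        exact (sub_eq_zero.1 ((Submodule.mem_bot ℝ).1 (hdt a b z' ⟨ha, hb⟩))).symm
      rw [d0_apply _ hm, d0_apply _ hz.1, d0_apply _ hz.2, mvfderiv_congr e]
      exact mvfderiv_fun_sub
        (((f b).2.2.contMDiffAt ((pre B.emb (U b)).2.mem_nhds hz.2)).mdifferentiableAt (by simp))
        (((f a).2.2.contMDiffAt ((pre B.emb (U a)).2.mem_nhds hz.1)).mdifferentiableAt (by simp))
    rw [hd, hx a b z hm] at h3
    refine B.inK_zero.1 ?_
    convert h3 using 1
    · abel
    · change _ + (evT G _ (B.emb z) (v.2 ![b]) + _) - (_ + (evT G _ (B.emb z) (v.2 ![a]) + _)) = _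
      abel
  obtain ⟨T, hT, hTY⟩ := (isModuleSheaf_sec (f := B.emb) B.emb.contMDiff).cech_zero hφ B.TZ Y hYs
    hYglue
  obtain ⟨s, hs⟩ := exists_secAlong_of_smooth (W := (⊤ : Opens Z)) hT.1 hT.2
  obtain ⟨x, hxs⟩ := rSec_surjective B.isEmb B.closed ⊤ s
  have hxT : ∀ z, x.1 (B.emb z) = T z := fun z =>
    (congrArg (fun r => r.1 z) hxs).trans (hs z trivial)
  refine ⟨ζ.2.1, B.mu _ (B.qr x), B.mu_mem_C1 x, (B.isDelta_iff x ζ.1).2 fun z hz => ?_⟩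
  obtain ⟨a, ha⟩ := B.exists_mem_cover hU z
  have hm : z ∈ pre B.emb (cap U ![a]) := (hcap a).symm ▸ ha
  let Y' : Sec E (cap U ![a]) := resSec (hcap a).le (X a) + ((v.2 ![a]).1 +
    resSec (hcap a).le (secForm (d0 (H a))))
  have hY' : ∀ w ∈ pre B.emb (cap U ![a]), Y'.1 (B.emb w) = Y a w := fun w hw =>
    congrArg₂ (· + ·) (resSec_apply _ (X a) hw)
      (congrArg₂ (· + ·) rfl (resSec_apply _ (secForm (d0 (H a))) hw))
  rw [B.zetaFib_congr_TZ (x' := Y') (fun w _ hw => by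
      rw [hxT w, hY' w hw]
      exact hTY a w ((hcap a) ▸ hw)) hz hm, B.zetaFib_add _ _ hm, B.zetaFib_resSec _ _ hm,
    B.zetaFib_of_mem_T ((G.T _).add_mem (v.2 ![a]).2
      (G.resSec_mem_T _ (G.exact_mem_T (H a)))) hm, add_zero]
  exact hζ a z ha

/-- If `ζ = δ_l μ(q(x))` for a global section `x`, then the sections `σ_a - q(x)` are infinitesimal
deformations of the brane over the `U_a`, and their trivializations show that `c` is a
coboundary. -/
theorem Lifts.mem_range (hU : B.AdaptedCover U) {c : B.Cocycle U}
    {σ : ∀ a, B.NSec (pre B.emb (U a))} {ζ : B.Z2} (h : B.Lifts U c σ ζ) (hζ2 : ζ.1 ∈ B.B2) :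
    c.1 ∈ LinearMap.range (B.totD U 0) := by
  obtain ⟨X, rfl⟩ := B.exists_eq_qr σ
  obtain ⟨hham, hfn, hglue, hζ⟩ := (B.lifts_qr_iff U c X ζ).1 h
  obtain ⟨-, θ, hθ, hd⟩ := hζ2
  obtain ⟨Y, rfl⟩ := B.exists_mu_eq hθ
  have hY := (B.isDelta_iff Y ζ.1).1 hd
  have hcor := fun a => (hU.triv a).exists_correction (X a - resSec le_top Y) fun z hz => by
    rw [B.zetaFib_sub _ _ hz, B.zetaFib_resSec _ _ hz, ← hζ a z hz, ← hY z trivial, sub_self]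
  choose x' hx' τ f hK using hcor
  have hK' : ∀ a, ∀ z ∈ pre B.emb (U a), B.InK z ((d0 (f a)).1 z)
      ((x' a).1 (B.emb z) - ((X a).1 (B.emb z) - Y.1 (B.emb z))) := fun a z hz => by
    have e : (resSec le_top Y : Sec E (U a)).1 (B.emb z) = Y.1 (B.emb z) := resSec_apply _ _ hz
    rw [← e]
    exact ⟨_, hK a z hz⟩
  -- The coboundary is that of `((0, y), xi)` with `xi_a = -x'_a`, which forces
  -- `y_ab = x'_b - x'_a - x_ab`; modulo `T(Z, F)` this is the difference of the automorphisms
  -- `(τ_b, f_b)` and `(τ_a, f_a)`, so `y_ab` belongs to the row `0`.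
  let xi : V1 G U 0 := fun α => -resTT G (cap_le U α 0) ⟨x' (α 0), hx' (α 0)⟩
  have hxi : ∀ a, ∀ y ∈ U a, evT G _ y (xi ![a]) = -(x' a).1 y := fun a y hy => by
    have hm : y ∈ cap U ![a] := mem_cap_one.2 hy
    exact (map_neg _ _).trans (congrArg (- ·) (evT_resTT _ _ hm))
  have hy : ∀ α : Fin 2 → ι, ∃ y : B.KKType (cap U α),
      (∀ p ∈ cap U α, B.evK _ p y = (x' (α 1)).1 p - (x' (α 0)).1 p - evT G _ p (c.1.2 α)) ∧
      ∀ z ∈ pre B.emb (cap U α), B.evKf _ z y = (f (α 1)).1 z - (f (α 0)).1 z := by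
    intro α
    obtain ⟨a, b, rfl⟩ : ∃ a b, α = ![a, b] := ⟨α 0, α 1, by ext i; fin_cases i <;> rfl⟩
    have ha : cap U ![a, b] ≤ U a := cap_le U ![a, b] 0
    have hb : cap U ![a, b] ≤ U b := cap_le U ![a, b] 1
    let x : TType G (cap U ![a, b]) :=
      resTT G hb ⟨x' b, hx' b⟩ - resTT G ha ⟨x' a, hx' a⟩ - c.1.2 ![a, b]
    have hxe : ∀ p ∈ cap U ![a, b],
        evT G _ p x = (x' b).1 p - (x' a).1 p - evT G _ p (c.1.2 ![a, b]) := fun p hp =>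
      congrArg (· - _) (congrArg₂ (· - ·) (evT_resTT hb ⟨x' b, hx' b⟩ hp)
        (evT_resTT ha ⟨x' a, hx' a⟩ hp))
    obtain ⟨y, hy1, hy2⟩ := B.exists_kk x
      (resFn (pre_mono B.emb hb) (f b) - resFn (pre_mono B.emb ha) (f a)) fun z hz => by
        have h3 := ((B.inK_zero.2 (hglue a b z hz)).add (hK' b z (hb hz))).sub (hK' a z (ha hz))
        rw [hxe _ hz, map_sub]
        convert h3 using 1
        · rw [zero_add]
          exact congrArg₂ (· - ·) (d0_resFn _ (f b) hz) (d0_resFn _ (f a) hz)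
        · abel
    refine ⟨y, fun p hp => (hy1 p).trans (hxe p hp), fun z hz => (hy2 z).trans ?_⟩
    exact congrArg₂ (· - ·) (resFn_apply _ (f b) hz) (resFn_apply _ (f a) hz)
  choose y hy hyf using hy
  let v : B.Tot U 0 := ((0, y), xi)
  refine ⟨v, Prod.ext (Prod.ext ?_ (funext fun α => ?_)) (funext fun α => ?_)⟩
  · exact (hor0_one_fst B v.1).trans hham.symm
  · obtain ⟨a, b, d, rfl⟩ : ∃ a b d, α = ![a, b, d] :=
      ⟨α 0, α 1, α 2, by ext i; fin_cases i <;> rfl⟩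
    refine B.kktype_ext (fun p hp => ?_) fun z hz => ?_
    · obtain ⟨ha, hb, hd⟩ := mem_cap_three.1 hp
      have e := Cocycle.x_eq c a b d hp
      rw [hham] at e
      replace e : _ = - B.evK _ p (c.1.1.2 ![a, b, d]) := e.trans (zero_sub _)
      rw [totD_fst, evK_hor0_one B v.1 a b d hp, hy ![b, d] p (mem_cap_two.2 ⟨hb, hd⟩),
        hy ![a, d] p (mem_cap_two.2 ⟨ha, hd⟩), hy ![a, b] p (mem_cap_two.2 ⟨ha, hb⟩),
        ← neg_neg (B.evK _ p (c.1.1.2 ![a, b, d])), ← e]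
      change (x' d).1 p - (x' b).1 p - _ - ((x' d).1 p - (x' a).1 p - _) +
        ((x' b).1 p - (x' a).1 p - _) = _
      abel
    · obtain ⟨ha, hb, hd⟩ := mem_cap_three.1 hz
      have e : B.evKf _ z (c.1.1.2 ![a, b, d]) = 0 :=
        congrArg (fun f : Fn E' (pre B.emb (cap U ![a, b, d])) => f.1 z) (hfn ![a, b, d])
      rw [e, totD_fst, evKf_hor0_one B v.1 a b d hz, hyf ![b, d] z (mem_cap_two.2 ⟨hb, hd⟩),
        hyf ![a, d] z (mem_cap_two.2 ⟨ha, hd⟩), hyf ![a, b] z (mem_cap_two.2 ⟨ha, hb⟩)]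
      change (f d).1 z - (f b).1 z - ((f d).1 z - (f a).1 z) + ((f b).1 z - (f a).1 z) = 0
      ring
  · obtain ⟨a, b, rfl⟩ : ∃ a b, α = ![a, b] := ⟨α 0, α 1, by ext i; fin_cases i <;> rfl⟩
    refine ttype_ext fun p hp => ?_
    obtain ⟨ha, hb⟩ := mem_cap_two.1 hp
    rw [evT_totD v a b hp, hy ![a, b] p hp, hxi a p ha, hxi b p hb]
    change (0 : GT E p) - ((x' b).1 p - (x' a).1 p - _) - _ = _
    abel

/-- The comparison map: a class of the total complex is represented by a reduced cocycle, and the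
class of the 2-cochain obtained from it does not depend on choices. -/
theorem exists_comparison (hU : B.AdaptedCover U) :
    ∃ Φ : B.H2Tot U →ₗ[ℝ] B.H2, Function.Injective Φ ∧
      (∀ h : B.H2Tot U, ∃ (c : B.Cocycle U) (σ : ∀ a, B.NSec (pre B.emb (U a))) (ζ : B.Z2),
        B.Lifts U c σ ζ ∧ B.H2TotMk U c = h) ∧
      ∀ (c : B.Cocycle U) (σ : ∀ a, B.NSec (pre B.emb (U a))) (ζ : B.Z2),
        B.Lifts U c σ ζ → Φ (B.H2TotMk U c) = B.H2mk ζ := by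
  have hex : ∀ h : B.H2Tot U, ∃ (c : B.Cocycle U) (σ : ∀ a, B.NSec (pre B.emb (U a))) (ζ : B.Z2),
      B.Lifts U c σ ζ ∧ B.H2TotMk U c = h := fun h => by
    obtain ⟨c, rfl⟩ : ∃ c, B.H2TotMk U c = h := Submodule.mkQ_surjective _ h
    obtain ⟨c', hc', hham, hfn⟩ := exists_reduced_cocycle hU.cover c
    obtain ⟨σ, ζ, hL⟩ := exists_lifts hU.cover c' hham hfn
    exact ⟨c', σ, ζ, hL, hc'⟩
  have huniq : ∀ {c c' : B.Cocycle U} {σ σ' : ∀ a, B.NSec (pre B.emb (U a))} {ζ ζ' : B.Z2},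
      B.Lifts U c σ ζ → B.Lifts U c' σ' ζ' → B.H2TotMk U c = B.H2TotMk U c' →
      B.H2mk ζ = B.H2mk ζ' := fun h h' e => by
    rw [← sub_eq_zero, ← map_sub] at e ⊢
    exact h2mk_eq_zero_iff.2 ((h.sub h').mem_B2 hU.cover (h2TotMk_eq_zero_iff.1 e))
  choose c σ ζ hL hc using id hex
  refine ⟨{ toFun := fun h => B.H2mk (ζ h), map_add' := fun h h' => ?_, map_smul' := fun r h => ?_ },
    ?_, hex, fun c' σ' ζ' h => huniq (hL _) h (hc _)⟩
  · rw [← map_add]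
    exact huniq (hL _) ((hL h).add (hL h')) (by rw [map_add, hc, hc, hc])
  · rw [RingHom.id_apply, ← map_smul]
    exact huniq (hL _) ((hL h).smul r) (by rw [map_smul, hc, hc])
  · refine (injective_iff_map_eq_zero _).2 fun h e => ?_
    rw [← hc h]
    exact h2TotMk_eq_zero_iff.2 ((hL h).mem_range hU (h2mk_eq_zero_iff.1 e))

end GCBrane
end Comparison

/-! ### Adapted covers -/

section Covers
variable {E : Type*} [NormedAddCommGroup E] [NormedSpace ℝ E] [FiniteDimensional ℝ E]
  {X : Type*} [TopologicalSpace X] [ChartedSpace E X] [IsManifold 𝓘(ℝ, E) ∞ X]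
  {E' : Type*} [NormedAddCommGroup E'] [NormedSpace ℝ E'] [FiniteDimensional ℝ E']
  {Z : Type*} [TopologicalSpace Z] [ChartedSpace E' Z] [IsManifold 𝓘(ℝ, E') ∞ Z]
  {G : GCStructure E X}

theorem subsingleton_fn {W : Opens Z} (h : ∀ z, z ∉ W) : Subsingleton (Fn E' W) :=
  ⟨fun _ _ => fn_ext fun z hz => (h z hz).elim⟩

theorem subsingleton_form {W : Opens Z} (h : ∀ z, z ∉ W) : Subsingleton (Form E' W) :=
  ⟨fun a b => Subtype.ext (funext fun z => (a.2.1 z (h z)).trans (b.2.1 z (h z)).symm)⟩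

namespace GCBrane
variable (B : GCBrane E' Z G)

/-- Away from `Z` there is nothing to deform. -/
theorem trivializable_of_disjoint {U : Opens X} (h : ∀ z, z ∉ pre B.emb U) :
    B.Trivializable U := by
  intro A _ _ _ D _ _
  have h1 : ∀ I, ∀ z, z ∉ B.WU U I := fun I z hz => h z hz.1
  have h2 : ∀ I J, ∀ z, z ∉ B.WU2 U I J := fun I J z hz => h z hz.1
  have s0 := subsingleton_fn (E' := E') h
  have s1 := subsingleton_form (E' := E') h
  have t1 := fun I => subsingleton_form (E' := E') (h1 I)
  have t2 := fun I J => subsingleton_fn (E' := E') (h2 I J)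
  have r0 : Subsingleton (A ⊗[ℝ] Fn E' (pre B.emb U)) := inferInstance
  have r1 : Subsingleton (A ⊗[ℝ] Form E' (pre B.emb U)) := inferInstance
  have r2 : ∀ I, Subsingleton (A ⊗[ℝ] Form E' (B.WU U I)) := fun I => inferInstance
  have r3 : ∀ I J, Subsingleton (A ⊗[ℝ] Fn E' (B.WU2 U I J)) := fun I J => inferInstance
  exact ⟨0, Submodule.zero_mem _, 0, Submodule.zero_mem _, 0, fun I => Submodule.zero_mem _,
    LinearMap.ext fun _ => Subsingleton.elim _ _, LinearMap.ext fun _ => Subsingleton.elim _ _,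
    fun I => Subsingleton.elim _ _, fun I J => Subsingleton.elim _ _⟩

theorem LocallyTrivializable.exists_adaptedCover [SecondCountableTopology X] {B : GCBrane E' Z G}
    (hB : B.LocallyTrivializable) : ∃ (ι : Type) (U : ι → Opens X), B.AdaptedCover U := by
  have h : ∀ x : X, ∃ U : Opens X, x ∈ U ∧ B.Trivializable U := fun x => by
    by_cases hx : x ∈ Set.range B.emb
    · obtain ⟨z, rfl⟩ := hx
      exact hB z
    · exact ⟨⟨_, B.closed.isOpen_compl⟩, hx, B.trivializable_of_disjoint fun z hz => hz ⟨z, rfl⟩⟩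
  choose O hO hT using h
  obtain ⟨s, hs, hcov⟩ := TopologicalSpace.countable_cover_nhds fun x => (O x).2.mem_nhds (hO x)
  -- A countable set of indices can be moved to the lowest universe.
  have : Countable s := hs
  obtain ⟨ι, ⟨e⟩⟩ := (Countable.toSmall.{0} s).equiv_small
  refine ⟨ι, fun a => O (e.symm a), ?_, fun a => hT _⟩
  refine top_unique fun x _ => ?_
  obtain ⟨y, hy, hxy⟩ := Set.mem_iUnion₂.1 (hcov.symm ▸ Set.mem_univ x : x ∈ ⋃ y ∈ s, (O y : Set X))
  exact Opens.mem_iSup.2 ⟨e ⟨y, hy⟩, by simpa using hxy⟩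

end GCBrane
end Covers

end GCB

end

theorem mainTheorem6 {E : Type*} [NormedAddCommGroup E] [NormedSpace ℝ E] [FiniteDimensional ℝ E]
    {X : Type*} [TopologicalSpace X] [T2Space X] [SecondCountableTopology X] [ChartedSpace E X]
    [IsManifold 𝓘(ℝ, E) ∞ X]
    {E' : Type*} [NormedAddCommGroup E'] [NormedSpace ℝ E'] [FiniteDimensional ℝ E']
    {Z : Type*} [TopologicalSpace Z] [ChartedSpace E' Z] [IsManifold 𝓘(ℝ, E') ∞ Z]
    (G : GCB.GCStructure E X) (B : GCB.GCBrane E' Z G) (hB : B.LocallyTrivializable) :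
    (∃ (ι : Type) (U : ι → Opens X), B.AdaptedCover U) ∧
    ∀ {ι : Type*} (U : ι → Opens X), B.AdaptedCover U →
      ∃ Φ : B.H2Tot U →ₗ[ℝ] B.H2, Function.Injective Φ ∧
        (∀ h : B.H2Tot U, ∃ (c : B.Cocycle U) (σ : ∀ a, B.NSec (GCB.pre B.emb (U a))) (ζ : B.Z2),
          B.Lifts U c σ ζ ∧ B.H2TotMk U c = h) ∧
        ∀ (c : B.Cocycle U) (σ : ∀ a, B.NSec (GCB.pre B.emb (U a))) (ζ : B.Z2),
          B.Lifts U c σ ζ → Φ (B.H2TotMk U c) = B.H2mk ζ := by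
  have : T2Space Z := B.isEmb.isEmbedding.t2Space
  have : SecondCountableTopology Z := B.isEmb.isEmbedding.secondCountableTopology
  exact ⟨hB.exists_adaptedCover, fun _ hU => GCB.GCBrane.exists_comparison hU⟩
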